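/- Let $K\ge 0$ and let $S_K$ be the complete simply connected surface of constant curvature $K$ (the Euclidean plane if $K=0$, the round sphere of radius $1/\sqrt K$ if $K>0$) with its intrinsic distance $|pq|$. For $\kappa\ge 0$ a $\kappa$-circle is a circle in $S_K$ of constant geodesic curvature $\kappa$ (a straight line if $K=\kappa=0$), and a $\kappa$-arc is an arc of a $\kappa$-circle that does not overlap itself. Let $\sigma$ be a closed convex curve in $S_K$, that is, a simple closed curve that bounds a geodesically convex region; $\sigma$ has finite length, and "almost all $q\in\sigma$" refers to arc length. For distinct $p,q,m\in S_K$ let $\chi_K(p,q,m)$ be the unique $\kappa\ge 0$ such that a triangle in $S_K$ with the side lengths $|pq|,|qm|,|mp|$ has its three vertices on a $\kappa$-circle. The osculating curvature of $\sigma$ at $q$ is $\chi_\sigma(q)=\lim\chi_K(p,q,m)$, where $p,m\to q$ along $\sigma$ from opposite sides of $q$, if the limit exists. For a nondegenerate subarc $I$ of $\sigma$ with endpoints $p,q$ and length $|I|$, where $|I|+|pq|\le 2\pi/\sqrt K$ if $K>0$, let $\kappa_K(I)$ be the unique $\kappa\ge 0$ such that there is a $\kappa$-arc in $S_K$ of length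 $|I|$ whose endpoints are at distance $|pq|$. The arc/chord curvature of $\sigma$ at $q$ is $\kappa_\sigma(q)=\lim\kappa_K(I)$, over subarcs $I$ of $\sigma$ containing $q$ with $|I|\to 0$, if the limit exists. Let $\kappa\in[0,\infty)$. Then the following are equivalent: (a) for almost all $q\in\sigma$, $\kappa_\sigma(q)$ exists and $\kappa_\sigma(q)\ge\kappa$; (b) for almost all $q\in\sigma$, $\chi_\sigma(q)$ exists and $\chi_\sigma(q)\ge\kappa$; (c) $\kappa_K(I)\ge\kappa$ for every nondegenerate subarc $I$ of $\sigma$ (the whole curve, with equal endpoints, included) with endpoints $p,q$ such that $|I|+|pq|\le 2\pi/\sqrt K$ if $K>0$; (d) $\chi_K(p,q,m)\ge\kappa$ for any three distinct points $p,q,m\in\sigma$ such that $|pq|+|qm|+|mp|\le 2\pi/\sqrt K$ if $K>0$. -/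

import Mathlib

open Set Filter Topology MeasureTheory

noncomputable section

/-- The two-dimensional model space `S_K` of constant curvature `K ≥ 0`, realised in `ℝ³`:
the plane `x₂ = 0` if `K = 0`, and the round sphere of radius `1 / √K` about `0` if `K > 0`. -/
def ModelPlane (K : ℝ) : Type :=
  {x : EuclideanSpace ℝ (Fin 3) // if K = 0 then x 2 = 0 else ‖x‖ = 1 / √K}

namespace ModelPlane

/-- The point of `ℝ³` underlying a point of the model space. -/
def coords {K : ℝ} (x : ModelPlane K) : EuclideanSpace ℝ (Fin 3) := x.1

/-- The intrinsic distance of `S_K`: Euclidean distance in the plane, and great-circle distance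
(angle at the centre times the radius) on the sphere. -/
instance instDist (K : ℝ) : Dist (ModelPlane K) where
  dist x y := if K = 0 then ‖x.coords - y.coords‖
    else InnerProductGeometry.angle x.coords y.coords / √K

theorem dist_def {K : ℝ} (x y : ModelPlane K) :
    dist x y = if K = 0 then ‖x.coords - y.coords‖
      else InnerProductGeometry.angle x.coords y.coords / √K := rfl

theorem norm_coords {K : ℝ} (hK : K ≠ 0) (x : ModelPlane K) : ‖x.coords‖ = 1 / √K := by
  have h := x.2
  rw [if_neg hK] at h
  exact h

instance instMetricSpace (K : ℝ) : MetricSpace (ModelPlane K) where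
  dist_self x := by
    rw [dist_def]
    split_ifs with hK
    · simp
    · rcases le_or_gt K 0 with h0 | h0
      · simp [Real.sqrt_eq_zero_of_nonpos h0]
      · have hx : x.coords ≠ 0 := by
          rw [← norm_pos_iff, norm_coords hK]
          positivity
        rw [InnerProductGeometry.angle_self hx, zero_div]
  dist_comm x y := by
    rw [dist_def, dist_def, norm_sub_rev, InnerProductGeometry.angle_comm]
  dist_triangle x y z := by
    rw [dist_def, dist_def, dist_def]
    split_ifs with hK
    · exact norm_sub_le_norm_sub_add_norm_sub _ _ _
    · rw [← add_div]
      exact div_le_div_of_nonneg_right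
        (InnerProductGeometry.angle_le_angle_add_angle _ _ _) (Real.sqrt_nonneg K)
  eq_of_dist_eq_zero {x y} h := by
    rw [dist_def] at h
    split_ifs at h with hK
    · exact Subtype.ext (sub_eq_zero.mp (norm_eq_zero.mp h))
    · rcases le_or_gt K 0 with h0 | h0
      · have hx := norm_coords hK x
        have hy := norm_coords hK y
        rw [Real.sqrt_eq_zero_of_nonpos h0, div_zero, norm_eq_zero] at hx hy
        exact Subtype.ext (hx.trans hy.symm)
      · have hs : √K ≠ 0 := (Real.sqrt_pos.mpr h0).ne'
        have ha : InnerProductGeometry.angle x.coords y.coords = 0 := by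
          rcases div_eq_zero_iff.mp h with h | h
          · exact h
          · exact absurd h hs
        have hn : ‖x.coords‖ = ‖y.coords‖ := (norm_coords hK x).trans (norm_coords hK y).symm
        refine Subtype.ext ?_
        have hi := InnerProductGeometry.inner_eq_mul_norm_of_angle_eq_zero ha
        have h2 : ‖x.coords - y.coords‖ ^ 2 = 0 := by
          rw [norm_sub_sq_real, hi, hn]
          ring
        exact sub_eq_zero.mp (norm_eq_zero.mp (pow_eq_zero_iff two_ne_zero |>.mp h2))

end ModelPlane

/-- A unit-speed parametrized straight line or round circle (of any radius `R > 0`) in `ℝ³`. -/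
def IsLineOrCircle (α : ℝ → EuclideanSpace ℝ (Fin 3)) : Prop :=
  (∃ o u : EuclideanSpace ℝ (Fin 3), ‖u‖ = 1 ∧ ∀ t, α t = o + t • u) ∨
  (∃ (R : ℝ) (o u v : EuclideanSpace ℝ (Fin 3)), 0 < R ∧ ‖u‖ = 1 ∧ ‖v‖ = 1 ∧ inner ℝ u v = 0 ∧
    ∀ t, α t = o + (R * Real.cos (t / R)) • u + (R * Real.sin (t / R)) • v)

/-- The (absolute) geodesic curvature in `S_K` of a unit-speed curve `α` lying in `S_K`: the norm
of the component of `α''` tangent to `S_K`. For `K = 0` this component is `α''` itself; for `K > 0`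
the component normal to the sphere is `-K α`, because `⟪α'', α⟫ = -1` and `‖α‖ ^ 2 = 1 / K`. -/
def geodesicCurvature (K : ℝ) (α : ℝ → EuclideanSpace ℝ (Fin 3)) (t : ℝ) : ℝ :=
  ‖deriv (deriv α) t + K • α t‖

/-- `c` is a unit-speed parametrization of a `κ`-circle of `S_K`, a circle in `S_K` of constant
geodesic curvature `κ`. Straight lines (`K = κ = 0`) are included. -/
def IsKappaCircle (K κ : ℝ) (c : ℝ → ModelPlane K) : Prop :=
  IsLineOrCircle (fun t => (c t).coords) ∧
    ∀ t, geodesicCurvature K (fun s => (c s).coords) t = κ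

section Curvature

variable {X : Type*} [MetricSpace X]

/-- `χ_K(p, q, m)`: the `κ` such that a comparison triangle of `p, q, m` in `S_K` lies on a
`κ`-circle. For distinct points that have a comparison triangle the set is a singleton. -/
def oscCurvature (K : ℝ) (p q m : X) : ℝ :=
  sInf {κ : ℝ | ∃ p' q' m' : ModelPlane K,
    dist p' q' = dist p q ∧ dist q' m' = dist q m ∧ dist m' p' = dist m p ∧
    ∃ c : ℝ → ModelPlane K, IsKappaCircle K κ c ∧ p' ∈ range c ∧ q' ∈ range c ∧ m' ∈ range c}

/-- The `κ` such that there is a `κ`-arc in `S_K` of length `ℓ` whose endpoints are at distance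
`r`. A `κ`-arc of length `ℓ` is a `κ`-circle, parametrized by arc length, restricted to `[0, ℓ]`,
and not overlapping itself. For `0 < ℓ`, `0 ≤ r ≤ ℓ` (and `ℓ + r ≤ 2π / √K` if `K > 0`)
the set is a singleton. -/
def arcChordValue (K ℓ r : ℝ) : ℝ :=
  sInf {κ : ℝ | ∃ c : ℝ → ModelPlane K, IsKappaCircle K κ c ∧ InjOn c (Ico 0 ℓ) ∧
    dist (c 0) (c ℓ) = r}

/-- The length of the subarc `γ|[a, b]`. -/
def arcLength (γ : ℝ → X) (a b : ℝ) : ℝ := (eVariationOn γ (Icc a b)).toReal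

/-- `κ_K` of the subarc `γ|[a, b]`. -/
def arcChordCurvature (K : ℝ) (γ : ℝ → X) (a b : ℝ) : ℝ :=
  arcChordValue K (arcLength γ a b) (dist (γ a) (γ b))

/-- The filter of pairs `(s₁, s₂)` with `s₁ < t < s₂` and `s₁, s₂ → t`. -/
def oppositeSides (t : ℝ) : Filter (ℝ × ℝ) := 𝓝[<] t ×ˢ 𝓝[>] t

/-- The lower osculating curvature of `γ` at `γ t`. -/
def lowerOscCurvature (K : ℝ) (γ : ℝ → X) (t : ℝ) : EReal :=
  liminf (fun s : ℝ × ℝ => (oscCurvature K (γ s.1) (γ t) (γ s.2) : EReal)) (oppositeSides t)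

/-- The upper osculating curvature of `γ` at `γ t`. -/
def upperOscCurvature (K : ℝ) (γ : ℝ → X) (t : ℝ) : EReal :=
  limsup (fun s : ℝ × ℝ => (oscCurvature K (γ s.1) (γ t) (γ s.2) : EReal)) (oppositeSides t)

/-- Nondegenerate subarcs `γ|[a, b]` of a closed curve `γ` of period `1` that contain `γ t`, as
their length tends to `0`. -/
def shrinkingArcs (γ : ℝ → X) (t : ℝ) : Filter (ℝ × ℝ) :=
  comap (fun I : ℝ × ℝ => eVariationOn γ (Icc I.1 I.2)) (𝓝 0) ⊓
    𝓟 {I : ℝ × ℝ | I.1 < I.2 ∧ I.2 ≤ I.1 + 1 ∧ I.1 ≤ t ∧ t ≤ I.2}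

/-- The lower arc/chord curvature of the closed curve `γ` at `γ t`. -/
def lowerArcChordCurvature (K : ℝ) (γ : ℝ → X) (t : ℝ) : EReal :=
  liminf (fun I : ℝ × ℝ => (arcChordCurvature K γ I.1 I.2 : EReal)) (shrinkingArcs γ t)

/-- The upper arc/chord curvature of the closed curve `γ` at `γ t`. -/
def upperArcChordCurvature (K : ℝ) (γ : ℝ → X) (t : ℝ) : EReal :=
  limsup (fun I : ℝ × ℝ => (arcChordCurvature K γ I.1 I.2 : EReal)) (shrinkingArcs γ t)

/-- A property of the points `γ t` of a closed curve of period `1` holds at almost all of them,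
with respect to arc length: the points where it fails have a null set of arc-length parameters. -/
def AlmostEverywhereOnCurve (γ : ℝ → X) (P : ℝ → Prop) : Prop :=
  volume (arcLength γ 0 '' {t : ℝ | t ∈ Icc (0 : ℝ) 1 ∧ ¬ P t}) = 0

/-- The arc/chord curvature of `γ` at `γ t` exists and is at least `κ`. -/
def ArcChordCurvatureGEAt (K : ℝ) (γ : ℝ → X) (κ t : ℝ) : Prop :=
  lowerArcChordCurvature K γ t = upperArcChordCurvature K γ t ∧
    (κ : EReal) ≤ lowerArcChordCurvature K γ t

/-- The osculating curvature of `γ` at `γ t` exists and is at least `κ`. -/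
def OscCurvatureGEAt (K : ℝ) (γ : ℝ → X) (κ t : ℝ) : Prop :=
  lowerOscCurvature K γ t = upperOscCurvature K γ t ∧
    (κ : EReal) ≤ lowerOscCurvature K γ t

/-- `κ_{γ,K} ≥ κ` globally, for a closed curve `γ` of period `1`. -/
def GlobalArcChordGE (K : ℝ) (γ : ℝ → X) (κ : ℝ) : Prop :=
  ∀ a b : ℝ, a < b → b ≤ a + 1 →
    (0 < K → arcLength γ a b + dist (γ a) (γ b) ≤ 2 * Real.pi / √K) →
    κ ≤ arcChordCurvature K γ a b

/-- `χ_{γ,K} ≥ κ` globally. -/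
def GlobalOscGE (K : ℝ) (γ : ℝ → X) (κ : ℝ) : Prop :=
  ∀ p ∈ range γ, ∀ q ∈ range γ, ∀ m ∈ range γ, p ≠ q → q ≠ m → m ≠ p →
    (0 < K → dist p q + dist q m + dist m p ≤ 2 * Real.pi / √K) →
    κ ≤ oscCurvature K p q m

/-- Any two points of `A` are joined by a shortest path (parametrized by arc length) inside `A`. -/
def IsGeodesicallyConvex (A : Set X) : Prop :=
  ∀ p ∈ A, ∀ q ∈ A, ∃ g : ℝ → X, g 0 = p ∧ g (dist p q) = q ∧
    (∀ s ∈ Icc 0 (dist p q), ∀ t ∈ Icc 0 (dist p q), dist (g s) (g t) = |s - t|) ∧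
    ∀ t ∈ Icc 0 (dist p q), g t ∈ A

/-- `γ` is a simple closed curve, parametrized as a continuous map of period `1`, that bounds a
geodesically convex region. -/
structure IsClosedConvexCurve (γ : ℝ → X) : Prop where
  continuous : Continuous γ
  periodic : Function.Periodic γ 1
  simple : InjOn γ (Ico 0 1)
  bounds : ∃ Ω : Set X, IsOpen Ω ∧ Ω.Nonempty ∧ IsGeodesicallyConvex Ω ∧ frontier Ω = range γ

end Curvature

end

/-! Polar coordinates. Take a point `o` of the convex region and the cone over the region in
homogeneous coordinates around `o`. Geodesic convexity makes this cone convex, so its boundary is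
the graph of a sublinear function. On the unit circle of directions that function is the radial
function `G` of the curve: `1 / r` in the plane and `√K cot (√K r)` on the sphere, where `r` is the
distance from `o` to the curve. By Hahn–Banach, `G` is supported from below at every angle by a
solution of `y'' + y = 0`; its derivative there is a slope `p` (`IsSlope`). Up to a linear term
slopes are increasing. Hence `p` is differentiable almost everywhere, its jumps and singular part go
upwards only, and at a point of differentiability the geodesic curvature is `(G + p') W³ / Z³`
(`radCurvature`) with `W² = K + G²` and `Z² = W² + p²`. All four statements are compared with one
condition, `CurvatureGE`: this quantity is at least `κ` at almost every angle. Integration of such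
almost everywhere bounds uses `le_of_oneSidedLipschitz_of_ae_deriv_nonpos`: a function whose
increments are bounded above linearly is controlled by its almost everywhere derivative, because the
singular part can only decrease it.

Local part. Where `p` is differentiable the curve has a second order expansion in space. Both the
circumcircle of three nearby points and the third order defect between length and chord of a short
arc then yield `K + radCurvature²`, the squared curvature in space. So both local curvatures exist
almost everywhere and agree; (a) and (b) are each equivalent to `CurvatureGE`, and (c) and (d),
applied to small arcs and triples, imply it.

Global part: a rolling argument in the manner of Blaschke. For a chord from the point at angle `t`
to a fixed point `u`, let the excess be its component along the inner normal minus `κ / 2` times its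
squared length. It is nonnegative exactly when `u` lies in the disc of curvature `κ` that touches
the curve at `t` from inside. As `t` moves, the derivative of the excess is minus the tangential
component of the chord times curvature minus `κ` times speed. So the excess decreases while `u` is
ahead, and `t` can be moved until the chord is normal. There the excess is nonnegative by a bound on
the diameter, which is proved by the same rolling. Thus the whole curve lies in each touching disc
(`PolarFrame.excess_nonneg`).

Consequences. In space each point of the curve is touched by a ball of radius `1 / β`, `β = √(K +
κ²)`, that contains the curve. The ball at the vertex opposite the longest side of a triangle bounds
its circumradius, which is (d). For (c) the touching discs give a differential inequality for the
chord as a function of length, whose solution is the chord of a `κ`-arc as long as `β ℓ ≤ π`. Longer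
arcs have the same chord as their complement, so it remains to bound the total length by `2π / β`.
In the plane this holds because the tangent turns by `2π` in total. On the sphere the centre is
changed to the direction of the point of the closed convex hull of the curve nearest to the origin
of space. The touching balls show that this direction lies in the region and that the curve lies in
the disc of curvature `κ` about it; a calibration then shows that a convex curve inside a disc is
not longer than its boundary. -/

set_option linter.unusedSimpArgs false

local notation "E3" => EuclideanSpace ℝ (Fin 3)
local notation "⟪" x ", " y "⟫" => inner ℝ x y

/-! ### One-sided Lipschitz functions and their almost everywhere derivative -/

/-- A function whose increments are bounded above by `C` times the increment of the variable and
whose derivative is almost everywhere nonpositive does not increase. -/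
theorem le_of_oneSidedLipschitz_of_ae_deriv_nonpos {f : ℝ → ℝ} {a b C : ℝ} (hab : a ≤ b)
    (hC : ∀ x ∈ Icc a b, ∀ y ∈ Icc a b, x ≤ y → f y - f x ≤ C * (y - x))
    (hd : ∀ᵐ x, x ∈ Ioo a b → ∃ d, HasDerivAt f d x ∧ d ≤ 0) : f b ≤ f a := by
  -- The function `C x - f x` increases, and the increment of a monotone function is at least the
  -- integral of its almost everywhere derivative, here at least `C`. A singular part only helps, so
  -- no absolute continuity is needed.
  have hm : MonotoneOn (fun x => C * x - f x) (uIcc a b) := by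
    rw [uIcc_of_le hab]
    intro x hx y hy hxy
    have := hC x hx y hy hxy
    linarith
  have h1 := hm.intervalIntegral_deriv_mem_uIcc
  have h2 := hm.intervalIntegrable_deriv
  have hle : (C * a - f a) ≤ C * b - f b := hm (by simp) (by simp) hab
  rw [uIcc_of_le (by linarith)] at h1
  have h3 : ∫ _x in a..b, C ≤ ∫ x in a..b, deriv (fun x => C * x - f x) x := by
    apply intervalIntegral.integral_mono_ae_restrict hab intervalIntegrable_const h2
    rw [← restrict_Ioo_eq_restrict_Icc]
    rw [Filter.EventuallyLE, ae_restrict_iff' measurableSet_Ioo]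
    filter_upwards [hd] with x hx hxm
    obtain ⟨d, hd1, hd2⟩ := hx hxm
    have : HasDerivAt (fun x => C * x - f x) (C * 1 - d) x :=
      ((hasDerivAt_id x).const_mul C).sub hd1
    rw [this.deriv]
    linarith
  rw [intervalIntegral.integral_const, smul_eq_mul] at h3
  have := h1.2
  nlinarith

/-- Increments of a Lipschitz function are bounded by an almost everywhere bound of its
derivative. -/
theorem sub_le_mul_of_ae_deriv_le {f : ℝ → ℝ} {a b C M : ℝ} (hab : a ≤ b)
    (hC : ∀ x ∈ Icc a b, ∀ y ∈ Icc a b, x ≤ y → f y - f x ≤ C * (y - x))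
    (hd : ∀ᵐ x, x ∈ Ioo a b → ∃ d, HasDerivAt f d x ∧ d ≤ M) : f b - f a ≤ M * (b - a) := by
  have := le_of_oneSidedLipschitz_of_ae_deriv_nonpos (f := fun x => f x - M * x) (C := C - M) hab
    (fun x hx y hy hxy => by have := hC x hx y hy hxy; linarith) (by
      filter_upwards [hd] with x hx hxm
      obtain ⟨d, hd1, hd2⟩ := hx hxm
      exact ⟨d - M * 1, hd1.sub ((hasDerivAt_id x).const_mul M), by linarith⟩)
  linarith

/-! ### The cardinal sine -/

/-- Chords of arcs are written with `sinc`. Strict monotonicity says that the chord of an arc of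
fixed length shrinks as the curvature grows, so length and chord determine the curvature. -/
theorem Real.strictAntiOn_sinc : StrictAntiOn Real.sinc (Icc 0 Real.pi) := by
  apply strictAntiOn_of_deriv_neg (convex_Icc _ _) Real.continuous_sinc.continuousOn
  intro x hx
  rw [interior_Icc] at hx
  have hx0 : x ≠ 0 := hx.1.ne'
  have heq : Real.sinc =ᶠ[𝓝 x] fun y => Real.sin y / y := by
    filter_upwards [isOpen_ne.mem_nhds hx0] with y hy
    exact Real.sinc_of_ne_zero hy
  rw [heq.deriv_eq]
  have : HasDerivAt (fun y => Real.sin y / y) ((Real.cos x * x - Real.sin x * 1) / x ^ 2) x :=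
    (Real.hasDerivAt_sin x).div (hasDerivAt_id x) hx0
  rw [this.deriv]
  apply div_neg_of_neg_of_pos _ (by have := hx.1; positivity)
  rw [mul_one, sub_neg]
  have hanti : StrictMonoOn (fun y => Real.sin y - Real.cos y * y) (Icc 0 Real.pi) := by
    apply strictMonoOn_of_deriv_pos (convex_Icc _ _) (by fun_prop)
    intro y hy
    rw [interior_Icc] at hy
    have h : HasDerivAt (fun y => Real.sin y - Real.cos y * y)
        (Real.cos y - (-Real.sin y * y + Real.cos y * 1)) y :=
      (Real.hasDerivAt_sin y).sub ((Real.hasDerivAt_cos y).mul (hasDerivAt_id y))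
    rw [h.deriv]
    have := mul_pos (Real.sin_pos_of_pos_of_lt_pi hy.1 hy.2) hy.1
    linarith
  have := hanti (left_mem_Icc.2 Real.pi_pos.le) ⟨hx.1.le, hx.2.le⟩ hx.1
  simp at this
  linarith

theorem Real.mul_sinc (x : ℝ) : x * Real.sinc x = Real.sin x := by
  by_cases hx : x = 0
  · simp [hx]
  · rw [Real.sinc_of_ne_zero hx]; field_simp

theorem Real.sinc_pi : Real.sinc Real.pi = 0 := by
  rw [Real.sinc_of_ne_zero Real.pi_ne_zero]; simp

/-- Second order expansion of the cardinal sine at `0`. -/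
theorem Real.abs_sinc_sub_le {x : ℝ} (hx0 : 0 ≤ x) (hx1 : x ≤ 1) :
    |Real.sinc x - (1 - x ^ 2 / 6)| ≤ x ^ 4 := by
  rcases hx0.eq_or_lt with rfl | hx
  · simp
  rw [Real.sinc_of_ne_zero hx.ne']
  have h := Real.sin_bound (x := x) (by rwa [abs_of_nonneg hx0])
  rw [abs_of_nonneg hx0] at h
  have e : Real.sin x / x - (1 - x ^ 2 / 6) = (Real.sin x - (x - x ^ 3 / 6)) / x := by
    field_simp
  rw [e, abs_div, abs_of_pos hx, div_le_iff₀ hx]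
  calc _ ≤ _ := h
    _ ≤ x ^ 5 := by have := pow_pos hx 5; linarith
    _ = _ := by ring

/-! ### Radial functions of convex regions -/

/-- `p` is a slope of `G` at `t`: the trigonometric function with value `G t` and derivative `p`
at `t` lies below `G`. -/
def IsSlope (G : ℝ → ℝ) (t p : ℝ) : Prop :=
  ∀ u, G t * Real.cos (u - t) + p * Real.sin (u - t) ≤ G u

/-- `G` is the cotangent-type radial function of a convex region of the model plane, seen from an
interior point. -/
structure ConvexRadial (K : ℝ) (G : ℝ → ℝ) : Prop where
  nonneg : 0 ≤ K
  periodic : Function.Periodic G (2 * Real.pi)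
  pos : K = 0 → ∀ t, 0 < G t
  bdd : ∃ B, ∀ t, G t ≤ B
  slope : ∀ t, ∃ p, IsSlope G t p

namespace ConvexRadial

variable {K : ℝ} {G : ℝ → ℝ}

theorem pos_add (h : ConvexRadial K G) (t : ℝ) : 0 < K + G t ^ 2 := by
  rcases h.nonneg.eq_or_lt with h0 | h0
  · have := h.pos h0.symm t
    rw [← h0]; positivity
  · positivity

theorem exists_bound (h : ConvexRadial K G) :
    ∃ B, 0 < B ∧ (∀ t, |G t| ≤ B) ∧ ∀ t p, IsSlope G t p → |p| ≤ B := by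
  obtain ⟨B, hB⟩ := h.bdd
  have h1 : ∀ t, -B ≤ G t := by
    intro t
    obtain ⟨p, hp⟩ := h.slope t
    have := hp (t + Real.pi)
    rw [add_sub_cancel_left, Real.cos_pi, Real.sin_pi] at this
    linarith [hB (t + Real.pi)]
  refine ⟨|B| + 1, by positivity, fun t => ?_, fun t p hp => ?_⟩
  · have := abs_le.2 ⟨h1 t, hB t⟩
    linarith [le_abs_self B]
  · have h2 := hp (t + Real.pi / 2)
    have h3 := hp (t - Real.pi / 2)
    rw [add_sub_cancel_left, Real.cos_pi_div_two, Real.sin_pi_div_two] at h2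
    rw [sub_sub_cancel_left, Real.cos_neg, Real.sin_neg, Real.cos_pi_div_two,
      Real.sin_pi_div_two] at h3
    have : |p| ≤ B :=
      abs_le.2 ⟨by linarith [hB (t - Real.pi / 2)], by linarith [hB (t + Real.pi / 2)]⟩
    linarith [le_abs_self B]

theorem reflect (h : ConvexRadial K G) : ConvexRadial K (fun t => G (-t)) where
  nonneg := h.nonneg
  periodic t := by
    simp only
    rw [neg_add, ← sub_eq_add_neg]
    exact h.periodic.sub_eq (-t)
  pos hK t := h.pos hK _
  bdd := let ⟨B, hB⟩ := h.bdd; ⟨B, fun t => hB _⟩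
  slope t := by
    obtain ⟨p, hp⟩ := h.slope (-t)
    refine ⟨-p, fun u => ?_⟩
    have := hp (-u)
    rw [show -u - -t = -(u - t) by ring, Real.cos_neg, Real.sin_neg] at this
    linarith

end ConvexRadial

theorem IsSlope.reflect {G : ℝ → ℝ} {t p : ℝ} (h : IsSlope G t p) :
    IsSlope (fun t => G (-t)) (-t) (-p) := by
  intro u
  have := h (-u)
  rw [show -u - t = -(u - -t) by ring, Real.cos_neg, Real.sin_neg] at this
  simp only [neg_neg]
  linarith

theorem IsSlope.add_period {G : ℝ → ℝ} {t p : ℝ} (hG : Function.Periodic G (2 * Real.pi))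
    (h : IsSlope G t p) : IsSlope G (t + 2 * Real.pi) p := by
  intro u
  have := h u
  rw [hG t, ← sub_sub, Real.cos_sub_two_pi, Real.sin_sub_two_pi]
  exact this

theorem IsSlope.sub_period {G : ℝ → ℝ} {t p : ℝ} (hG : Function.Periodic G (2 * Real.pi))
    (h : IsSlope G t p) : IsSlope G (t - 2 * Real.pi) p := by
  intro u
  have := h u
  rw [hG.sub_eq t, sub_sub_eq_add_sub, add_sub_right_comm, Real.cos_add_two_pi,
    Real.sin_add_two_pi]
  exact this

/-- Slopes increase, up to a linear error. -/
theorem IsSlope.sub_le {G : ℝ → ℝ} {B s t p q : ℝ} (hB : ∀ t, |G t| ≤ B) (hs : IsSlope G s p)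
    (ht : IsSlope G t q) (hst : s < t) (hst' : t < s + Real.pi) :
    p - q ≤ 2 * B * Real.tan ((t - s) / 2) := by
  have h1 := hs t
  have h2 := ht s
  rw [← neg_sub t s, Real.cos_neg, Real.sin_neg] at h2
  -- In the half angle `d` the sum of the two support inequalities becomes `(p - q) cos d sin d ≤ (G
  -- s + G t) sin² d`, from which one factor `sin d` cancels.
  set d := (t - s) / 2 with hd
  have hts : t - s = 2 * d := by rw [hd]; ring
  rw [hts, Real.cos_two_mul, Real.sin_two_mul] at h1 h2
  have hd0 : 0 < d := by rw [hd]; linarith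
  have hd1 : d < Real.pi / 2 := by rw [hd]; linarith
  have hsin : 0 < Real.sin d := Real.sin_pos_of_pos_of_lt_pi hd0 (by linarith)
  have hcos : 0 < Real.cos d := Real.cos_pos_of_mem_Ioo ⟨by linarith, hd1⟩
  have hsc := Real.sin_sq_add_cos_sq d
  rw [Real.tan_eq_sin_div_cos, ← mul_div_assoc, le_div_iff₀ hcos]
  have hGs := (abs_le.1 (hB s)).2
  have hGt := (abs_le.1 (hB t)).2
  have hc2 : Real.cos d ^ 2 = 1 - Real.sin d ^ 2 := by linarith
  rw [hc2] at h1 h2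
  have h3 : (p - q) * Real.cos d * Real.sin d ≤ (G s + G t) * Real.sin d * Real.sin d := by
    nlinarith
  have h4 := le_of_mul_le_mul_right h3 hsin
  nlinarith

theorem IsSlope.le_add {G : ℝ → ℝ} {B s t p q : ℝ} (hB : ∀ t, |G t| ≤ B) (hs : IsSlope G s p)
    (ht : IsSlope G t q) (hst : s < t) (hst' : t ≤ s + 1) : p ≤ q + 2 * B * (t - s) := by
  have h1 := IsSlope.sub_le hB hs ht hst (by linarith [Real.pi_gt_three])
  have hB0 : 0 ≤ B := (abs_nonneg _).trans (hB 0)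
  have h2 : Real.tan ((t - s) / 2) ≤ t - s := by
    set d := (t - s) / 2 with hd
    have hd0 : 0 < d := by rw [hd]; linarith
    have hd1 : d ≤ 1 / 2 := by rw [hd]; linarith
    have hcos : 1 / 2 ≤ Real.cos d := by
      have := Real.one_sub_sq_div_two_le_cos (x := d)
      nlinarith
    have hsin := Real.sin_le hd0.le
    rw [Real.tan_eq_sin_div_cos, div_le_iff₀ (by linarith), show t - s = 2 * d by rw [hd]; ring]
    nlinarith
  nlinarith

/-- Slopes are one-sided Lipschitz on the whole line. -/
theorem IsSlope.le_add_of_le {G p : ℝ → ℝ} {B : ℝ}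
    (hB : ∀ t, |G t| ≤ B) (hp : ∀ t, IsSlope G t (p t)) {s t : ℝ} (hst : s ≤ t) :
    p s ≤ p t + 2 * B * (t - s) := by
  have key : ∀ n : ℕ, ∀ s t : ℝ, s ≤ t → t ≤ s + n → p s ≤ p t + 2 * B * (t - s) := by
    intro n
    induction n with
    | zero =>
      intro s t h1 h2
      have : s = t := by push_cast at h2; linarith
      subst this; simp
    | succ n ih =>
      intro s t h1 h2
      rcases h1.eq_or_lt with rfl | h1
      · simp
      by_cases h3 : t ≤ s + 1
      · exact IsSlope.le_add hB (hp s) (hp t) h1 h3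
      · push_cast at h2
        have h4 := IsSlope.le_add hB (hp s) (hp (s + 1)) (by linarith) le_rfl
        have h5 := ih (s + 1) t (by linarith) (by linarith)
        linarith
  obtain ⟨n, hn⟩ := exists_nat_gt (t - s)
  exact key n s t hst (by linarith)

/-- Adding `2 B t` makes the slopes monotone, and Lebesgue's theorem on monotone functions applies.
-/
theorem ConvexRadial.ae_differentiableAt_slope {K : ℝ} {G p : ℝ → ℝ} (h : ConvexRadial K G)
    (hp : ∀ t, IsSlope G t (p t)) : ∀ᵐ t, DifferentiableAt ℝ p t := by
  obtain ⟨B, -, hB, -⟩ := h.exists_bound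
  have hm : Monotone (fun t => p t + 2 * B * t) := by
    intro s t hst
    have := IsSlope.le_add_of_le hB hp hst
    simp only
    linarith
  filter_upwards [hm.ae_differentiableAt] with t ht
  have h2 : DifferentiableAt ℝ (fun t => 2 * B * t) t := by fun_prop
  have := ht.sub h2
  refine this.congr_of_eventuallyEq (Eventually.of_forall fun x => ?_)
  simp

theorem ConvexRadial.abs_sub_le {K : ℝ} {G : ℝ → ℝ} (h : ConvexRadial K G) {B : ℝ}
    (hB : ∀ t, |G t| ≤ B) (hBp : ∀ t p, IsSlope G t p → |p| ≤ B) (s t : ℝ) :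
    |G t - G s| ≤ 2 * B * |t - s| := by
  have key : ∀ s t : ℝ, G s - G t ≤ 2 * B * |t - s| := by
    intro s t
    obtain ⟨p, hp⟩ := h.slope s
    have h1 := hp t
    have hpB := hBp s p hp
    have hs : |Real.sin (t - s)| ≤ |t - s| := Real.abs_sin_le_abs
    have hc : 1 - Real.cos (t - s) ≤ |t - s| := by
      by_cases hx : |t - s| ≤ 1
      · have := Real.one_sub_sq_div_two_le_cos (x := t - s)
        have h3 : (t - s) ^ 2 = |t - s| ^ 2 := (sq_abs _).symm
        nlinarith [abs_nonneg (t - s)]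
      · have : |t - s| ≤ 2 → 1 - Real.cos (t - s) ≤ |t - s| := by
          intro hx2
          have := Real.one_sub_sq_div_two_le_cos (x := t - s)
          have h3 : (t - s) ^ 2 = |t - s| ^ 2 := (sq_abs _).symm
          nlinarith [abs_nonneg (t - s)]
        by_cases hx2 : |t - s| ≤ 2
        · exact this hx2
        · linarith [Real.neg_one_le_cos (t - s)]
    have hc0 : 0 ≤ 1 - Real.cos (t - s) := by linarith [Real.cos_le_one (t - s)]
    have hGs := abs_le.1 (hB s)
    have h4 : G s * (1 - Real.cos (t - s)) ≤ B * |t - s| := by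
      have hB0 : 0 ≤ B := (abs_nonneg _).trans (hB 0)
      calc _ ≤ B * (1 - Real.cos (t - s)) := by gcongr; exact hGs.2
        _ ≤ _ := by gcongr
    have h5 : -(p * Real.sin (t - s)) ≤ B * |t - s| := by
      calc _ ≤ |p * Real.sin (t - s)| := neg_le_abs _
        _ = |p| * |Real.sin (t - s)| := abs_mul _ _
        _ ≤ _ := by gcongr; exact (abs_nonneg _).trans hpB
    nlinarith
  rw [abs_le]
  constructor
  · linarith [key s t]
  · have := key t s
    rw [abs_sub_comm] at this
    exact this

theorem ConvexRadial.continuous {K : ℝ} {G : ℝ → ℝ} (h : ConvexRadial K G) : Continuous G := by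
  obtain ⟨B, hB0, hB, hBp⟩ := h.exists_bound
  have : LipschitzWith (2 * B).toNNReal G := by
    apply LipschitzWith.of_dist_le_mul
    intro x y
    rw [Real.dist_eq, Real.dist_eq, Real.coe_toNNReal _ (by positivity)]
    exact h.abs_sub_le hB hBp y x
  exact this.continuous

/-- `G` is differentiable wherever a choice of slopes is continuous. -/
theorem ConvexRadial.hasDerivAt {K : ℝ} {G p : ℝ → ℝ} (h : ConvexRadial K G)
    (hp : ∀ t, IsSlope G t (p t)) {t : ℝ} (hc : ContinuousAt p t) : HasDerivAt G (p t) t := by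
  have h1 : HasDerivAt (fun u => G t * Real.cos (u - t) + p t * Real.sin (u - t)) (p t) t := by
    have hc : HasDerivAt (fun u => Real.cos (u - t)) (-Real.sin (t - t) * 1) t :=
      (Real.hasDerivAt_cos _).comp t ((hasDerivAt_id t).sub_const t)
    have hs : HasDerivAt (fun u => Real.sin (u - t)) (Real.cos (t - t) * 1) t :=
      (Real.hasDerivAt_sin _).comp t ((hasDerivAt_id t).sub_const t)
    have := (hc.const_mul (G t)).fun_add (hs.const_mul (p t))
    simpa using this
  rw [hasDerivAt_iff_isLittleO] at h1 ⊢
  obtain ⟨B, hB0, hB, hBp⟩ := h.exists_bound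
  -- The difference is squeezed between `0` and a small multiple of `u - t`.
  have h2 : (fun u => G u - (G t * Real.cos (u - t) + p t * Real.sin (u - t)))
      =o[𝓝 t] fun u => u - t := by
    rw [Asymptotics.isLittleO_iff]
    intro ε hε
    have e1 : ∀ᶠ u in 𝓝 t, |p u - p t| < ε / 2 := by
      have := Metric.continuousAt_iff'.1 hc (ε / 2) (by positivity)
      simpa [Real.dist_eq] using this
    have e2 : ∀ᶠ u in 𝓝 t, |u - t| < min (ε / (4 * B)) 1 := by
      have := Metric.ball_mem_nhds t (show 0 < min (ε / (4 * B)) 1 by positivity)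
      filter_upwards [this] with u hu
      simpa [Real.dist_eq] using hu
    filter_upwards [e1, e2] with u hu1 hu2
    rw [Real.norm_eq_abs, Real.norm_eq_abs]
    have h3 := hp u t
    have h4 := hp t u
    rw [← neg_sub u t, Real.cos_neg, Real.sin_neg] at h3
    set d := u - t with hd
    rw [abs_of_nonneg (by linarith)]
    have hsin : |Real.sin d| ≤ |d| := Real.abs_sin_le_abs
    have hcos : 1 - Real.cos d ≤ |d| * |d| / 2 := by
      have := Real.one_sub_sq_div_two_le_cos (x := d)
      rw [← pow_two, sq_abs]; linarith
    have hcos0 : 0 ≤ 1 - Real.cos d := by linarith [Real.cos_le_one d]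
    have h5 : (p u - p t) * Real.sin d ≤ ε / 2 * |d| := by
      calc _ ≤ |(p u - p t) * Real.sin d| := le_abs_self _
        _ = |p u - p t| * |Real.sin d| := abs_mul _ _
        _ ≤ _ := by gcongr
    have h6 : (G u + G t) * (1 - Real.cos d) ≤ ε / 2 * |d| := by
      have hu3 : |d| ≤ ε / (4 * B) := hu2.le.trans (min_le_left _ _)
      have hGG : G u + G t ≤ 2 * B := by
        linarith [(abs_le.1 (hB u)).2, (abs_le.1 (hB t)).2]
      calc _ ≤ 2 * B * (1 - Real.cos d) := by gcongr
        _ ≤ 2 * B * (|d| * |d| / 2) := by gcongr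
        _ = B * |d| * |d| := by ring
        _ ≤ B * (ε / (4 * B)) * |d| := by gcongr
        _ ≤ _ := by
          have : B * (ε / (4 * B)) = ε / 4 := by field_simp
          rw [this]; gcongr; norm_num
    nlinarith
  have h3 := h1.add h2
  refine h3.congr_left fun u => ?_
  simp only [sub_self, Real.cos_zero, Real.sin_zero, smul_eq_mul]
  ring

/-- At a corner there is a whole interval of slopes and `p` may jump. Closedness of the set of pairs
(angle, slope) provides the compactness for the stopping arguments below. -/
theorem isClosed_slopes {G : ℝ → ℝ} (hG : Continuous G) :
    IsClosed {x : ℝ × ℝ | IsSlope G x.1 x.2} := by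
  simp only [IsSlope, ofPred_forall]
  refine isClosed_iInter fun u => isClosed_le ?_ continuous_const
  fun_prop

/-! ### Moving frames in `ℝ³` -/

/-- Polar coordinates on the model plane: `a`, `b` is an orthonormal basis of the tangent space at
the origin of the coordinates, which is `c` if `K = 0` and `O` if `K ≠ 0`. -/
structure PolarFrame (K : ℝ) where
  c : EuclideanSpace ℝ (Fin 3)
  O : EuclideanSpace ℝ (Fin 3)
  a : EuclideanSpace ℝ (Fin 3)
  b : EuclideanSpace ℝ (Fin 3)
  aa : inner ℝ a a = 1
  bb : inner ℝ b b = 1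
  ab : inner ℝ a b = 0
  Oa : inner ℝ O a = 0
  Ob : inner ℝ O b = 0
  origin : K = 0 ∧ O = 0 ∨ K ≠ 0 ∧ c = 0 ∧ K * inner ℝ O O = 1

/-- `√(K + g²)`. -/
noncomputable def radW (K g : ℝ) : ℝ := √(K + g ^ 2)

/-- `√(K + g² + p²)`. -/
noncomputable def radZ (K g p : ℝ) : ℝ := √(K + g ^ 2 + p ^ 2)

section
variable {K g p : ℝ}

theorem radW_pos (h : 0 < K + g ^ 2) : 0 < radW K g := Real.sqrt_pos.2 h
theorem radW_sq (h : 0 < K + g ^ 2) : radW K g ^ 2 = K + g ^ 2 := Real.sq_sqrt h.le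
theorem radZ_pos (h : 0 < K + g ^ 2) : 0 < radZ K g p := Real.sqrt_pos.2 (by positivity)
theorem radZ_sq (h : 0 < K + g ^ 2) : radZ K g p ^ 2 = K + g ^ 2 + p ^ 2 :=
  Real.sq_sqrt (by positivity)
theorem radW_zero (h : 0 < g) : radW 0 g = g := by
  rw [radW, zero_add, Real.sqrt_sq h.le]
theorem radZ_sq_eq (h : 0 < K + g ^ 2) : radZ K g p ^ 2 = radW K g ^ 2 + p ^ 2 := by
  rw [radZ_sq h, radW_sq h]
theorem radW_le_radZ : radW K g ≤ radZ K g p := Real.sqrt_le_sqrt (by nlinarith [sq_nonneg p])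

theorem continuous_radW : Continuous (radW K) := by unfold radW; fun_prop
theorem continuous_radZ : Continuous (fun x : ℝ × ℝ => radZ K x.1 x.2) := by unfold radZ; fun_prop

end

namespace PolarFrame

variable {K : ℝ} (F : PolarFrame K) {G : ℝ → ℝ}

/-- The radial direction at angle `t`. -/
noncomputable def e (t : ℝ) : E3 := Real.cos t • F.a + Real.sin t • F.b

/-- The angular direction at angle `t`. -/
noncomputable def e' (t : ℝ) : E3 := -Real.sin t • F.a + Real.cos t • F.b

/-- The curve with radial function `G`. -/
noncomputable def curve (G : ℝ → ℝ) (t : ℝ) : E3 :=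
  F.c + (radW K (G t))⁻¹ • (F.e t + G t • F.O)

/-- A positive multiple of the velocity of a curve through a point with radial coordinate `g` and
slope `p`. -/
noncomputable def tangent (t g p : ℝ) : E3 := radW K g ^ 2 • F.e' t - p • (g • F.e t - K • F.O)

/-- A positive multiple of the inner normal of a curve through a point with radial coordinate `g`
and slope `p`. -/
noncomputable def normal (t g p : ℝ) : E3 := K • F.O - g • F.e t - p • F.e' t

theorem ba : ⟪F.b, F.a⟫ = 0 := by rw [real_inner_comm, F.ab]
theorem aO : ⟪F.a, F.O⟫ = 0 := by rw [real_inner_comm, F.Oa]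
theorem bO : ⟪F.b, F.O⟫ = 0 := by rw [real_inner_comm, F.Ob]

theorem inner_e_e (s t : ℝ) : ⟪F.e s, F.e t⟫ = Real.cos (s - t) := by
  simp only [e, inner_add_left, inner_add_right, real_inner_smul_left, real_inner_smul_right,
    F.aa, F.bb, F.ab, F.ba, Real.cos_sub]
  ring

theorem inner_e_e' (s t : ℝ) : ⟪F.e s, F.e' t⟫ = Real.sin (s - t) := by
  simp only [e, e', inner_add_left, inner_add_right, real_inner_smul_left, real_inner_smul_right,
    F.aa, F.bb, F.ab, F.ba, Real.sin_sub]
  ring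

theorem inner_e'_e (s t : ℝ) : ⟪F.e' s, F.e t⟫ = -Real.sin (s - t) := by
  rw [real_inner_comm, inner_e_e', ← Real.sin_neg, neg_sub]

theorem inner_e'_e' (s t : ℝ) : ⟪F.e' s, F.e' t⟫ = Real.cos (s - t) := by
  simp only [e', inner_add_left, inner_add_right, real_inner_smul_left, real_inner_smul_right,
    F.aa, F.bb, F.ab, F.ba, Real.cos_sub]
  ring

theorem inner_e_O (t : ℝ) : ⟪F.e t, F.O⟫ = 0 := by
  simp only [e, inner_add_left, real_inner_smul_left, F.aO, F.bO]; ring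

theorem inner_e'_O (t : ℝ) : ⟪F.e' t, F.O⟫ = 0 := by
  simp only [e', inner_add_left, real_inner_smul_left, F.aO, F.bO]; ring

theorem inner_O_e (t : ℝ) : ⟪F.O, F.e t⟫ = 0 := by rw [real_inner_comm, inner_e_O]
theorem inner_O_e' (t : ℝ) : ⟪F.O, F.e' t⟫ = 0 := by rw [real_inner_comm, inner_e'_O]

/-- The relation `K |O|² = 1` fails in the plane. Multiplied by `K` it holds in both geometries and
spares a case distinction in the identities that follow. -/
theorem K_mul_K_mul_inner : K * (K * ⟪F.O, F.O⟫) = K := by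
  rcases F.origin with ⟨h, -⟩ | ⟨-, -, h⟩
  · linear_combination (K * ⟪F.O, F.O⟫ - 1) * h
  · rw [h]; ring

theorem inner_normal_normal {t g p : ℝ} (h : 0 < K + g ^ 2) :
    ⟪F.normal t g p, F.normal t g p⟫ = radZ K g p ^ 2 := by
  rw [radZ_sq h]
  simp only [normal, inner_sub_left, inner_sub_right, real_inner_smul_left, real_inner_smul_right,
    inner_e_e, inner_e'_e', inner_e_e', inner_e'_e, inner_e_O, inner_e'_O, inner_O_e, inner_O_e',
    sub_self, Real.cos_zero, Real.sin_zero]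
  linear_combination F.K_mul_K_mul_inner

theorem inner_tangent_tangent {t g p : ℝ} (h : 0 < K + g ^ 2) :
    ⟪F.tangent t g p, F.tangent t g p⟫ = radW K g ^ 2 * radZ K g p ^ 2 := by
  rw [radZ_sq_eq h]
  simp only [tangent, inner_sub_left, inner_sub_right, real_inner_smul_left,
    real_inner_smul_right,
    inner_e_e, inner_e'_e', inner_e_e', inner_e'_e, inner_e_O, inner_e'_O, inner_O_e, inner_O_e',
    sub_self, Real.cos_zero, Real.sin_zero]
  linear_combination p ^ 2 * F.K_mul_K_mul_inner - p ^ 2 * radW_sq h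

end PolarFrame

/-- The gap between `G u` and the trigonometric function with value `G t` and derivative `p` at
`t`. -/
noncomputable def gap (G : ℝ → ℝ) (t p u : ℝ) : ℝ :=
  G u - G t * Real.cos (u - t) - p * Real.sin (u - t)

theorem IsSlope.gap_nonneg {G : ℝ → ℝ} {t p : ℝ} (h : IsSlope G t p) (u : ℝ) :
    0 ≤ gap G t p u := by
  have := h u
  unfold gap; linarith

/-- The tangential component of the chord from `t` to `u`. -/
noncomputable def tanComp (K : ℝ) (G : ℝ → ℝ) (t p u : ℝ) : ℝ :=
  (radZ K (G t) p ^ 2 * Real.sin (u - t) + p * gap G t p u) /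
    (radW K (G u) * radW K (G t) * radZ K (G t) p)

/-- The normal component of the chord from `t` to `u`. -/
noncomputable def norComp (K : ℝ) (G : ℝ → ℝ) (t p u : ℝ) : ℝ :=
  gap G t p u / (radW K (G u) * radZ K (G t) p)

namespace PolarFrame
variable {K : ℝ} (F : PolarFrame K) {G : ℝ → ℝ}

/-- This is the geometric meaning of a slope: the support inequality says that the curve stays on
the inner side of the tangent geodesic determined by the slope. -/
theorem inner_sub_normal (hG : ConvexRadial K G) (t p u : ℝ) :
    ⟪F.curve G u - F.curve G t, F.normal t (G t) p⟫ = gap G t p u / radW K (G u) := by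
  have hu := radW_pos (hG.pos_add u)
  have ht := radW_pos (hG.pos_add t)
  simp only [curve, normal, gap, inner_sub_left, inner_sub_right, inner_add_left, inner_add_right,
    real_inner_smul_left, real_inner_smul_right,
    inner_e_e, inner_e'_e', inner_e_e', inner_e'_e, inner_e_O, inner_e'_O, inner_O_e, inner_O_e',
    sub_self, Real.cos_zero, Real.sin_zero]
  rcases F.origin with ⟨hK, h⟩ | ⟨-, -, h⟩
  · subst hK
    rw [h, radW_zero (hG.pos rfl u), radW_zero (hG.pos rfl t)]
    have h1 := hG.pos rfl u
    have h2 := hG.pos rfl t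
    simp only [inner_zero_left]
    field_simp
    ring
  · field_simp
    linear_combination (G u * radW K (G t) - G t * radW K (G u)) * h

theorem inner_sub_tangent (hG : ConvexRadial K G) (t p u : ℝ) :
    ⟪F.curve G u - F.curve G t, F.tangent t (G t) p⟫ =
      (radZ K (G t) p ^ 2 * Real.sin (u - t) + p * gap G t p u) / radW K (G u) := by
  have hu := radW_pos (hG.pos_add u)
  have ht := radW_pos (hG.pos_add t)
  rw [radZ_sq_eq (hG.pos_add t)]
  simp only [curve, tangent, gap, inner_sub_left, inner_sub_right, inner_add_left, inner_add_right,
    real_inner_smul_left, real_inner_smul_right,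
    inner_e_e, inner_e'_e', inner_e_e', inner_e'_e, inner_e_O, inner_e'_O, inner_O_e, inner_O_e',
    sub_self, Real.cos_zero, Real.sin_zero]
  rcases F.origin with ⟨hK, h⟩ | ⟨-, -, h⟩
  · subst hK
    rw [h, radW_zero (hG.pos rfl u), radW_zero (hG.pos rfl t)]
    have h1 := hG.pos rfl u
    have h2 := hG.pos rfl t
    simp only [inner_zero_left]
    field_simp
    ring
  · field_simp
    linear_combination p * (G u * radW K (G t) - G t * radW K (G u)) * h

/-- The square of the chord between `t` and `u`. -/
noncomputable def chordSq (G : ℝ → ℝ) (t u : ℝ) : ℝ := ‖F.curve G u - F.curve G t‖ ^ 2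

theorem inner_sub_tangent' (hG : ConvexRadial K G) (t p u : ℝ) :
    ⟪F.curve G u - F.curve G t, F.tangent t (G t) p⟫ =
      tanComp K G t p u * (radW K (G t) * radZ K (G t) p) := by
  have hu := radW_pos (hG.pos_add u)
  have ht := radW_pos (hG.pos_add t)
  have hz := radZ_pos (p := p) (hG.pos_add t)
  rw [inner_sub_tangent F hG, tanComp]
  field_simp

theorem inner_sub_normal' (hG : ConvexRadial K G) (t p u : ℝ) :
    ⟪F.curve G u - F.curve G t, F.normal t (G t) p⟫ =
      norComp K G t p u * radZ K (G t) p := by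
  have hu := radW_pos (hG.pos_add u)
  have hz := radZ_pos (p := p) (hG.pos_add t)
  rw [inner_sub_normal F hG, norComp]
  field_simp

/-- With `X` the squared chord, its component normal to the sphere is `√K X / 2` in absolute value.
So `X - K X² / 4` is the squared length of the projection of the chord to the tangent plane at `t`.
-/
theorem chordSq_sub (hG : ConvexRadial K G) (t u : ℝ) :
    F.chordSq G t u - K / 4 * F.chordSq G t u ^ 2 =
      (radW K (G t) ^ 2 * Real.sin (u - t) ^ 2 + (G u - G t * Real.cos (u - t)) ^ 2) /
        (radW K (G t) * radW K (G u)) ^ 2 := by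
  have hu := radW_pos (hG.pos_add u)
  have ht := radW_pos (hG.pos_add t)
  have hu2 := radW_sq (hG.pos_add u)
  have ht2 := radW_sq (hG.pos_add t)
  have hsc := Real.sin_sq_add_cos_sq (u - t)
  have e1 : F.chordSq G t u = ⟪F.curve G u - F.curve G t, F.curve G u - F.curve G t⟫ := by
    rw [chordSq, real_inner_self_eq_norm_sq]
  have hcos : Real.cos (t - u) = Real.cos (u - t) := by rw [← Real.cos_neg, neg_sub]
  rcases F.origin with ⟨hK, h⟩ | ⟨hK, hc, h⟩
  · subst hK
    have h1 := hG.pos rfl u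
    have h2 := hG.pos rfl t
    simp only [curve, h, radW_zero h1, radW_zero h2, inner_sub_left, inner_sub_right,
      inner_add_left, inner_add_right, real_inner_smul_left, real_inner_smul_right, inner_e_e,
      smul_zero, add_zero, sub_self, Real.cos_zero, hcos, real_inner_comm F.c (F.e _)] at e1
    rw [e1, radW_zero h1, radW_zero h2]
    field_simp
    linear_combination (-4 * G t ^ 4 * G u ^ 2) * hsc
  · have e2 : F.chordSq G t u = 2 / K *
        (1 - (K * Real.cos (u - t) + G t * G u) / (radW K (G t) * radW K (G u))) := by
      rw [e1]
      simp only [curve, hc, zero_add, inner_sub_left, inner_sub_right, inner_add_left,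
        inner_add_right, real_inner_smul_left, real_inner_smul_right, inner_e_e, inner_e_O,
        inner_O_e, sub_self, Real.cos_zero, hcos]
      field_simp
      have h' : ⟪F.O, F.O⟫ = 1 / K := by field_simp; linarith
      rw [h']
      field_simp
      linear_combination (-radW K (G t) ^ 2) * hu2 - radW K (G u) ^ 2 * ht2
    rw [e2]
    field_simp
    linear_combination 4 * radW K (G t) ^ 2 * hu2 + 4 * (K + G u ^ 2) * ht2
      - 4 * K * Real.sin (u - t) ^ 2 * ht2 - 4 * K * (K + G t ^ 2) * hsc

/-- Pythagoras for the tangential component, the component along the inner normal within the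
surface, and the component normal to the surface. -/
theorem chordSq_eq (hG : ConvexRadial K G) (t p u : ℝ) :
    F.chordSq G t u = tanComp K G t p u ^ 2 + norComp K G t p u ^ 2
      + K / 4 * F.chordSq G t u ^ 2 := by
  rw [← sub_eq_iff_eq_add, chordSq_sub F hG]
  have hu := radW_pos (hG.pos_add u)
  have ht := radW_pos (hG.pos_add t)
  have hz := radZ_pos (p := p) (hG.pos_add t)
  have hz2 := radZ_sq_eq (p := p) (hG.pos_add t)
  have hsc := Real.sin_sq_add_cos_sq (u - t)
  have e : G u - G t * Real.cos (u - t) = gap G t p u + p * Real.sin (u - t) := by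
    unfold gap; ring
  rw [e, tanComp, norComp]
  generalize gap G t p u = β
  generalize Real.sin (u - t) = s
  field_simp
  linear_combination (β ^ 2 - radZ K (G t) p ^ 2 * s ^ 2) * hz2

theorem hasDerivAt_e (t : ℝ) : HasDerivAt F.e (F.e' t) t := by
  exact ((Real.hasDerivAt_cos t).smul_const F.a).fun_add ((Real.hasDerivAt_sin t).smul_const F.b)

theorem hasDerivAt_e' (t : ℝ) : HasDerivAt F.e' (-F.e t) t := by
  have := ((Real.hasDerivAt_sin t).neg.smul_const F.a).fun_add
    ((Real.hasDerivAt_cos t).smul_const F.b)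
  refine this.congr_deriv ?_
  simp only [e]
  module

theorem hasDerivAt_radW {K : ℝ} {g : ℝ → ℝ} {g' t : ℝ} (h : 0 < K + g t ^ 2)
    (hg : HasDerivAt g g' t) :
    HasDerivAt (fun s => radW K (g s)) (g t * g' / radW K (g t)) t := by
  have h1 : HasDerivAt (fun s => K + g s ^ 2) (2 * g t * g') t := by
    simpa using (hg.fun_pow 2).const_add K
  refine (h1.sqrt h.ne').congr_deriv ?_
  rw [radW]; ring

/-- The velocity of the curve at angle `t`, if its slope is `p`. -/
noncomputable def velocity (t g p : ℝ) : E3 := (radW K g ^ 3)⁻¹ • F.tangent t g p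

theorem hasDerivAt_curve (hG : ConvexRadial K G) {t p : ℝ} (hp : HasDerivAt G p t) :
    HasDerivAt (F.curve G) (F.velocity t (G t) p) t := by
  have ht := radW_pos (hG.pos_add t)
  have ht2 := radW_sq (hG.pos_add t)
  have h1 := (hasDerivAt_radW (hG.pos_add t) hp).fun_inv ht.ne'
  have h2 := (F.hasDerivAt_e t).fun_add (hp.smul_const F.O)
  have h3 := (h1.fun_smul h2).const_add F.c
  refine h3.congr_deriv ?_
  have hcoe : F.velocity t (G t) p = (radW K (G t))⁻¹ • F.e' t
      - (p * G t / radW K (G t) ^ 3) • F.e t + (p * K / radW K (G t) ^ 3) • F.O := by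
    rw [velocity, tangent]
    simp only [smul_sub, smul_smul]
    have a1 : (radW K (G t) ^ 3)⁻¹ * radW K (G t) ^ 2 = (radW K (G t))⁻¹ := by field_simp
    have a2 : (radW K (G t) ^ 3)⁻¹ * (p * G t) = p * G t / radW K (G t) ^ 3 := by ring
    have a3 : (radW K (G t) ^ 3)⁻¹ * (p * K) = p * K / radW K (G t) ^ 3 := by ring
    rw [a1, a2, a3]
    abel
  rw [hcoe]
  have b1 : p * K / radW K (G t) ^ 3 = (radW K (G t))⁻¹ * p
      + -(G t * p / radW K (G t)) / radW K (G t) ^ 2 * G t := by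
    field_simp
    linear_combination (-p) * ht2
  have b2 : p * G t / radW K (G t) ^ 3 = -(-(G t * p / radW K (G t)) / radW K (G t) ^ 2) := by
    field_simp
  rw [b1, b2]
  simp only [smul_add, smul_smul, add_smul, neg_smul]
  abel

end PolarFrame

/-! ### Uniform bounds, and how the components of a chord vary -/

section

variable {K : ℝ} {G : ℝ → ℝ}

/-- Uniform bounds for a radial function and its slopes. -/
structure RadialBounds (K : ℝ) (G : ℝ → ℝ) (m M B w : ℝ) : Prop where
  mem : ∀ t, G t ∈ Icc m M
  B_pos : 0 < B
  abs_le : ∀ t, |G t| ≤ B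
  slope : ∀ t p, IsSlope G t p → p ∈ Icc (-B) B
  lip : ∀ s t, |G t - G s| ≤ 2 * B * |t - s|
  w_pos : 0 < w
  w_le : ∀ g ∈ Icc m M, w ≤ radW K g
  pos : ∀ g ∈ Icc m M, 0 < K + g ^ 2

theorem ConvexRadial.exists_bounds (h : ConvexRadial K G) :
    ∃ m M B w, RadialBounds K G m M B w := by
  obtain ⟨B, hB0, hB, hBp⟩ := h.exists_bound
  have hpos : ∃ m, ∀ t, G t ∈ Icc m B ∧ ∀ g ∈ Icc m B, 0 < K + g ^ 2 := by
    rcases h.nonneg.eq_or_lt with h0 | h0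
    · obtain ⟨t0, -, ht0⟩ := isCompact_Icc.exists_isMinOn
        (nonempty_Icc.2 (show (0 : ℝ) ≤ 2 * Real.pi by positivity)) h.continuous.continuousOn
      have hm := h.pos h0.symm t0
      refine ⟨G t0, fun t => ⟨⟨?_, (_root_.abs_le.1 (hB t)).2⟩, ?_⟩⟩
      · obtain ⟨y, hy, hy2⟩ := h.periodic.exists_mem_Ico₀ (by positivity) t
        rw [hy2]
        exact ht0 ⟨hy.1, hy.2.le⟩
      · intro g hg
        have : 0 < g := hm.trans_le hg.1
        rw [← h0]; positivity
    · exact ⟨-B, fun t => ⟨_root_.abs_le.1 (hB t), fun g _ => by positivity⟩⟩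
  obtain ⟨m, hm⟩ := hpos
  have hne : (Icc m B).Nonempty := ⟨G 0, (hm 0).1⟩
  obtain ⟨g0, hg0, hg⟩ := isCompact_Icc.exists_isMinOn hne (continuous_radW (K := K)).continuousOn
  exact ⟨m, B, B, radW K g0, fun t => (hm t).1, hB0, hB, fun t p hp => _root_.abs_le.1 (hBp t p hp),
    fun s t => h.abs_sub_le hB hBp s t, radW_pos ((hm 0).2 g0 hg0), fun g hg' => hg hg', (hm 0).2⟩

/-- Smooth functions of the angle, the radial function and the slope are Lipschitz. -/
theorem RadialBounds.exists_lipschitz {E : Type*} [NormedAddCommGroup E] [NormedSpace ℝ E]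
    {m M B w : ℝ} (_ : RadialBounds K G m M B w) {Φ : ℝ × ℝ × ℝ → E}
    (hΦ : ∀ x : ℝ × ℝ × ℝ, 0 < K + x.2.1 ^ 2 → ContDiffAt ℝ 1 Φ x) (hpos : ∀ g ∈ Icc m M, 0 < K + g ^ 2) (s t : ℝ) :
    ∃ L : ℝ, 0 ≤ L ∧ ∀ x ∈ Icc s t ×ˢ Icc m M ×ˢ Icc (-B) B, ∀ y ∈ Icc s t ×ˢ Icc m M ×ˢ Icc (-B) B,
      ‖Φ x - Φ y‖ ≤ L * (|x.1 - y.1| + |x.2.1 - y.2.1| + |x.2.2 - y.2.2|) := by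
  have hc : ContDiffOn ℝ 1 Φ (Icc s t ×ˢ Icc m M ×ˢ Icc (-B) B) :=
    fun x hx => (hΦ x (hpos _ hx.2.1)).contDiffWithinAt
  obtain ⟨L, hL⟩ := hc.exists_lipschitzOnWith one_ne_zero
    ((convex_Icc _ _).prod ((convex_Icc _ _).prod (convex_Icc _ _)))
    (isCompact_Icc.prod (isCompact_Icc.prod isCompact_Icc))
  refine ⟨L, L.2, fun x hx y hy => ?_⟩
  have h1 := hL.dist_le_mul x hx y hy
  rw [dist_eq_norm] at h1
  refine h1.trans ?_
  gcongr
  rw [Prod.dist_eq, Prod.dist_eq, Real.dist_eq, Real.dist_eq, Real.dist_eq]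
  have a1 := abs_nonneg (x.1 - y.1)
  have a2 := abs_nonneg (x.2.1 - y.2.1)
  have a3 := abs_nonneg (x.2.2 - y.2.2)
  refine max_le (by linarith) (max_le (by linarith) (by linarith))

theorem contDiffAt_radW {x : ℝ × ℝ × ℝ} (h : 0 < K + x.2.1 ^ 2) :
    ContDiffAt ℝ 1 (fun x : ℝ × ℝ × ℝ => radW K x.2.1) x := by
  unfold radW
  exact ContDiffAt.sqrt (by fun_prop) h.ne'

theorem contDiffAt_radZ {x : ℝ × ℝ × ℝ} (h : 0 < K + x.2.1 ^ 2) :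
    ContDiffAt ℝ 1 (fun x : ℝ × ℝ × ℝ => radZ K x.2.1 x.2.2) x := by
  unfold radZ
  exact ContDiffAt.sqrt (by fun_prop) (by positivity)

theorem PolarFrame.contDiffAt_point (F : PolarFrame K) {x : ℝ × ℝ × ℝ} (h : 0 < K + x.2.1 ^ 2) :
    ContDiffAt ℝ 1 (fun x : ℝ × ℝ × ℝ =>
      F.c + (radW K x.2.1)⁻¹ • (F.e x.1 + x.2.1 • F.O)) x := by
  unfold PolarFrame.e
  have := contDiffAt_radW h
  have h2 := this.inv (radW_pos h).ne'
  have h3 : ContDiffAt ℝ 1 (fun x : ℝ × ℝ × ℝ => (radW K x.2.1)⁻¹ • 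
    (Real.cos x.1 • F.a + Real.sin x.1 • F.b + x.2.1 • F.O)) x := h2.smul (by fun_prop)
  exact contDiffAt_const.add h3

theorem PolarFrame.exists_lipschitz_curve (F : PolarFrame K) (hG : ConvexRadial K G) (s t : ℝ) :
    ∃ L, 0 ≤ L ∧ ∀ x ∈ Icc s t, ∀ y ∈ Icc s t, ‖F.curve G x - F.curve G y‖ ≤ L * |x - y| := by
  obtain ⟨m, M, B, w, hb⟩ := hG.exists_bounds
  obtain ⟨L, hL0, hL⟩ := hb.exists_lipschitz (fun x hx => F.contDiffAt_point hx) hb.pos s t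
  refine ⟨L * (1 + 2 * B), by have := hb.B_pos; positivity, fun x hx y hy => ?_⟩
  have hB := hb.B_pos
  have := hL (x, G x, 0) ⟨hx, hb.mem x, by constructor <;> simp [hB.le]⟩
    (y, G y, 0) ⟨hy, hb.mem y, by constructor <;> simp [hB.le]⟩
  simp only [sub_self, abs_zero, add_zero] at this
  refine this.trans ?_
  rw [mul_assoc]
  gcongr
  have := hb.lip y x
  linarith

theorem PolarFrame.continuous_curve (F : PolarFrame K) (hG : ConvexRadial K G) :
    Continuous (F.curve G) := by
  unfold PolarFrame.curve PolarFrame.e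
  have h1 := hG.continuous
  have h2 : Continuous fun t => (radW K (G t))⁻¹ :=
    (continuous_radW.comp h1).inv₀ fun t => (radW_pos (hG.pos_add t)).ne'
  fun_prop

/-- The excess of the normal component of a chord over that of a circle of curvature `κ`. -/
noncomputable def PolarFrame.excess (F : PolarFrame K) (G : ℝ → ℝ) (κ t p u : ℝ) : ℝ :=
  norComp K G t p u - κ / 2 * F.chordSq G t u

/-- The terms in `p²` cancel. The sign is therefore that of an expression affine in the slope, which
on an interval of slopes is controlled by its two ends. -/
theorem tanComp_nonneg_iff (hG : ConvexRadial K G) {t p u : ℝ} :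
    0 ≤ tanComp K G t p u ↔
      0 ≤ (K + G t ^ 2) * Real.sin (u - t) + p * (G u - G t * Real.cos (u - t)) := by
  have hu := radW_pos (hG.pos_add u)
  have ht := radW_pos (hG.pos_add t)
  have hz := radZ_pos (p := p) (hG.pos_add t)
  rw [tanComp, le_div_iff₀ (by positivity), zero_mul, radZ_sq (hG.pos_add t), gap]
  ring_nf

/-- A Frenet equation: the unit normal turns at the rate curvature times speed, `(G + p') W / Z²`,
and the motion of the base point, being tangential, does not contribute. -/
theorem hasDerivAt_norComp (hG : ConvexRadial K G) {p : ℝ → ℝ} (hp : ∀ t, IsSlope G t (p t))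
    {t d : ℝ} (hd : HasDerivAt p d t) (u : ℝ) :
    HasDerivAt (fun t => norComp K G t (p t) u)
      (-(G t + d) * tanComp K G t (p t) u * radW K (G t) / radZ K (G t) (p t) ^ 2) t := by
  have hGd := hG.hasDerivAt hp hd.continuousAt
  have hu := radW_pos (hG.pos_add u)
  have ht := radW_pos (hG.pos_add t)
  have hz := radZ_pos (p := p t) (hG.pos_add t)
  have hc : HasDerivAt (fun s => Real.cos (u - s)) (-Real.sin (u - t) * -1) t :=
    (Real.hasDerivAt_cos _).comp t ((hasDerivAt_id t).const_sub u)
  have hs : HasDerivAt (fun s => Real.sin (u - s)) (Real.cos (u - t) * -1) t :=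
    (Real.hasDerivAt_sin _).comp t ((hasDerivAt_id t).const_sub u)
  have h1 : HasDerivAt (fun s => gap G s (p s) u) (-(G t + d) * Real.sin (u - t)) t := by
    have := ((hGd.fun_mul hc).const_sub (G u)).fun_sub (hd.fun_mul hs)
    refine this.congr_deriv ?_
    ring
  have h2 : HasDerivAt (fun s => radZ K (G s) (p s))
      (p t * (G t + d) / radZ K (G t) (p t)) t := by
    have h3 : HasDerivAt (fun s => K + G s ^ 2 + p s ^ 2) (2 * G t * p t + 2 * p t * d) t := by
      simpa using ((hGd.fun_pow 2).const_add K).fun_add (hd.fun_pow 2)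
    have hne : K + G t ^ 2 + p t ^ 2 ≠ 0 := by have := hG.pos_add t; positivity
    refine (h3.sqrt hne).congr_deriv ?_
    rw [radZ]; ring
  have h3 := h1.fun_div (h2.const_mul (radW K (G u))) (by positivity)
  refine h3.congr_deriv ?_
  rw [tanComp]
  field_simp
  ring

theorem PolarFrame.hasDerivAt_chordSq (F : PolarFrame K) (hG : ConvexRadial K G) {t p : ℝ}
    (hp : HasDerivAt G p t) (u : ℝ) :
    HasDerivAt (fun t => F.chordSq G t u)
      (-2 * tanComp K G t p u * radZ K (G t) p / radW K (G t) ^ 2) t := by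
  have ht := radW_pos (hG.pos_add t)
  have h1 := (F.hasDerivAt_curve hG hp).const_sub (F.curve G u)
  have h2 := h1.norm_sq
  refine h2.congr_deriv ?_
  rw [inner_neg_right, velocity, real_inner_smul_right, F.inner_sub_tangent' hG]
  field_simp

/-- What happens at a corner, where only the slope turns: the derivative of the normal component is
a negative multiple of the sign expression of the tangential component. -/
theorem hasDerivAt_norComp_slope {g : ℝ} (hpos : 0 < K + g ^ 2) (W c s q : ℝ) (hW : 0 < W) :
    HasDerivAt (fun q => (c - q * s) / (W * radZ K g q))
      (-((K + g ^ 2) * s + q * c) / (W * radZ K g q ^ 3)) q := by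
  have hz := radZ_pos (p := q) hpos
  have hz2 := radZ_sq (p := q) hpos
  have h2 : HasDerivAt (fun q => radZ K g q) (q / radZ K g q) q := by
    have h3 : HasDerivAt (fun q => K + g ^ 2 + q ^ 2) (2 * q) q := by
      simpa using ((hasDerivAt_id q).fun_pow 2).const_add (K + g ^ 2)
    have hne : K + g ^ 2 + q ^ 2 ≠ 0 := by positivity
    refine (h3.sqrt hne).congr_deriv ?_
    rw [radZ]; ring
  have h1 : HasDerivAt (fun q => c - q * s) (-(1 * s)) q :=
    ((hasDerivAt_id q).mul_const s).const_sub c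
  refine (h1.fun_div (h2.const_mul W) (by positivity)).congr_deriv ?_
  field_simp
  linear_combination (-s) * hz2

/-- A choice of slopes along which the curvature is at least `κ` almost everywhere. -/
structure CurvatureGE (K : ℝ) (G p : ℝ → ℝ) (κ : ℝ) : Prop where
  slope : ∀ t, IsSlope G t (p t)
  ae_le : ∀ᵐ t, ∀ d, HasDerivAt p d t → κ * radZ K (G t) (p t) ^ 3 ≤ (G t + d) * radW K (G t) ^ 3

/-- The curvature condition ignores single points. Hence results for one choice of slopes extend to
every slope at a corner. -/
theorem CurvatureGE.update {p : ℝ → ℝ} {κ : ℝ} (h : CurvatureGE K G p κ) {x q : ℝ}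
    (hq : IsSlope G x q) : CurvatureGE K G (Function.update p x q) κ where
  slope t := by
    by_cases ht : t = x
    · subst ht; simpa using hq
    · simpa [Function.update_of_ne ht] using h.slope t
  ae_le := by
    filter_upwards [h.ae_le, Measure.ae_ne volume x] with t ht hne d hd
    rw [Function.update_of_ne hne]
    refine ht d (hd.congr_of_eventuallyEq ?_)
    filter_upwards [isOpen_ne.mem_nhds hne] with y hy
    rw [Function.update_of_ne hy]

/-- The one-sided bound that allows the derivative of the excess to be integrated across jumps of
`p`. A fall of the slope is at most linear in `y - x`. A rise may be a jump, but turning the slope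
upwards does not increase the normal component while the tangential one is nonnegative, up to an
error linear in `y - x`. -/
theorem exists_norComp_le (hG : ConvexRadial K G) {p : ℝ → ℝ} (hp : ∀ t, IsSlope G t (p t))
    {s t u : ℝ} (hτ : ∀ v ∈ Icc s t, 0 ≤ tanComp K G v (p v) u) :
    ∃ C, ∀ x ∈ Icc s t, ∀ y ∈ Icc s t, x ≤ y →
      norComp K G y (p y) u - norComp K G x (p x) u ≤ C * (y - x) := by
  obtain ⟨m, M, B, w, hb⟩ := hG.exists_bounds
  have hB := hb.B_pos
  have hu := radW_pos (hG.pos_add u)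
  obtain ⟨L, hL0, hL⟩ := hb.exists_lipschitz (Φ := fun x : ℝ × ℝ × ℝ =>
    (G u - x.2.1 * Real.cos (u - x.1) - x.2.2 * Real.sin (u - x.1)) /
      (radW K (G u) * radZ K x.2.1 x.2.2)) (fun x hx => by
      have h1 := contDiffAt_radZ hx
      refine ContDiffAt.div (by fun_prop) (contDiffAt_const.mul h1) ?_
      have := radZ_pos (p := x.2.2) hx
      positivity) hb.pos s t
  obtain ⟨L', hL0', hL'⟩ := hb.exists_lipschitz (Φ := fun x : ℝ × ℝ × ℝ =>
    (K + x.2.1 ^ 2) * Real.sin (u - x.1) + x.2.2 * (G u - x.2.1 * Real.cos (u - x.1)))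
    (fun x hx => by fun_prop) hb.pos s t
  have hpm : ∀ v, p v ∈ Icc (-B) B := fun v => hb.slope v _ (hp v)
  set D := L' * (1 + 2 * B) with hD
  refine ⟨L * (1 + 4 * B) + D / (radW K (G u) * w ^ 3) * (2 * B), fun x hx y hy hxy => ?_⟩
  have hw := hb.w_pos
  have hD0 : 0 ≤ D := by positivity
  have hlip : |G y - G x| ≤ 2 * B * (y - x) := by
    simpa [abs_of_nonneg (sub_nonneg.2 hxy)] using hb.lip x y
  have hyx : |y - x| = y - x := abs_of_nonneg (sub_nonneg.2 hxy)
  have hx0 := sub_nonneg.2 hxy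
  rcases le_total (p y) (p x) with h | h
  · have h1 := hL (y, G y, p y) ⟨hy, hb.mem y, hpm y⟩ (x, G x, p x) ⟨hx, hb.mem x, hpm x⟩
    have h2 : |p y - p x| ≤ 2 * B * (y - x) := by
      rw [abs_of_nonpos (by linarith)]
      linarith [IsSlope.le_add_of_le hb.abs_le hp hxy]
    rw [Real.norm_eq_abs] at h1
    have h3 := (le_abs_self _).trans h1
    simp only [hyx] at h3
    rw [norComp, norComp, gap, gap]
    refine h3.trans ?_
    have : L * (y - x + |G y - G x| + |p y - p x|) ≤ L * (1 + 4 * B) * (y - x) := by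
      rw [mul_assoc]; gcongr; linarith
    have : 0 ≤ D / (radW K (G u) * w ^ 3) * (2 * B) * (y - x) := by positivity
    linarith
  · have h1 := hL (y, G y, p y) ⟨hy, hb.mem y, hpm y⟩ (x, G x, p y) ⟨hx, hb.mem x, hpm y⟩
    rw [Real.norm_eq_abs] at h1
    have h3 := (le_abs_self _).trans h1
    simp only [hyx, sub_self, abs_zero, add_zero] at h3
    have h4 := hL' (y, G y, p y) ⟨hy, hb.mem y, hpm y⟩ (x, G x, p y) ⟨hx, hb.mem x, hpm y⟩
    rw [Real.norm_eq_abs] at h4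
    have h5 := (le_abs_self _).trans h4
    simp only [hyx, sub_self, abs_zero, add_zero] at h5
    have t1 := (tanComp_nonneg_iff hG).1 (hτ x hx)
    have t2 := (tanComp_nonneg_iff hG).1 (hτ y hy)
    have e5 : L' * (y - x + |G y - G x|) ≤ D * (y - x) := by
      rw [hD, mul_assoc]; gcongr; linarith
    have e3 : L * (y - x + |G y - G x|) ≤ L * (1 + 4 * B) * (y - x) := by
      rw [mul_assoc]; gcongr; nlinarith
    set A := (K + G x ^ 2) * Real.sin (u - x) with hA
    set c := G u - G x * Real.cos (u - x) with hc
    -- `A + q c` is the sign expression at `x` with slope `q`. It is nonnegative for `p x`, and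
    -- almost so for `p y` by comparison with the point `y`; being affine in `q`, it is almost
    -- nonnegative in between.
    have key : ∀ q ∈ Icc (p x) (p y), -(D * (y - x)) ≤ A + q * c := by
      intro q hq
      have t3 : -(D * (y - x)) ≤ A + p y * c := by linarith
      have t4 : -(D * (y - x)) ≤ A + p x * c := by
        have : 0 ≤ D * (y - x) := by positivity
        linarith
      rcases le_total 0 c with h0 | h0
      · nlinarith [mul_le_mul_of_nonneg_right hq.1 h0]
      · nlinarith [mul_le_mul_of_nonpos_right hq.2 h0]
    have hder := fun q => hasDerivAt_norComp_slope (hG.pos_add x) (radW K (G u)) c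
      (Real.sin (u - x)) q hu
    have mvt := Convex.image_sub_le_mul_sub_of_deriv_le (convex_Icc (p x) (p y))
      (f := fun q => (c - q * Real.sin (u - x)) / (radW K (G u) * radZ K (G x) q))
      (C := D * (y - x) / (radW K (G u) * w ^ 3))
      (fun q _ => (hder q).continuousAt.continuousWithinAt)
      (fun q _ => (hder q).differentiableAt.differentiableWithinAt)
      (fun q hq => by
        rw [(hder q).deriv]
        rw [interior_Icc] at hq
        have hk := key q ⟨hq.1.le, hq.2.le⟩
        have hz : w ≤ radZ K (G x) q := (hb.w_le _ (hb.mem x)).trans radW_le_radZ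
        calc _ ≤ D * (y - x) / (radW K (G u) * radZ K (G x) q ^ 3) := by
              have := radZ_pos (p := q) (hG.pos_add x)
              gcongr; linarith
          _ ≤ _ := by gcongr)
      (p x) (left_mem_Icc.2 h) (p y) (right_mem_Icc.2 h) h
    have e6 : D * (y - x) / (radW K (G u) * w ^ 3) * (p y - p x) ≤
        D / (radW K (G u) * w ^ 3) * (2 * B) * (y - x) := by
      calc _ ≤ D * (y - x) / (radW K (G u) * w ^ 3) * (2 * B) := by
            gcongr; linarith [(hpm y).2, (hpm x).1]
        _ = _ := by ring
    rw [norComp, norComp, gap, gap]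
    have := h3.trans e3
    linarith

theorem PolarFrame.exists_lipschitz_chordSq (F : PolarFrame K) (hG : ConvexRadial K G)
    (s t u : ℝ) : ∃ C, 0 ≤ C ∧ ∀ x ∈ Icc s t, ∀ y ∈ Icc s t,
      |F.chordSq G x u - F.chordSq G y u| ≤ C * |x - y| := by
  obtain ⟨L, hL0, hL⟩ := F.exists_lipschitz_curve hG s t
  obtain ⟨R, hR⟩ := (isCompact_Icc (a := s) (b := t)).exists_bound_of_continuousOn
    (f := fun v => F.curve G u - F.curve G v)
    (continuous_const.sub (F.continuous_curve hG)).continuousOn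
  refine ⟨2 * |R| * L, by positivity, fun x hx y hy => ?_⟩
  rw [PolarFrame.chordSq, PolarFrame.chordSq, sq_sub_sq, abs_mul]
  have a1 := (hR x hx).trans (le_abs_self R)
  have a2 := (hR y hy).trans (le_abs_self R)
  have a3 := hL x hx y hy
  rw [norm_sub_rev] at a3
  have a4 := abs_norm_sub_norm_le (F.curve G u - F.curve G x) (F.curve G u - F.curve G y)
  rw [sub_sub_sub_cancel_left] at a4
  rw [abs_of_nonneg (by positivity : 0 ≤ ‖F.curve G u - F.curve G x‖
    + ‖F.curve G u - F.curve G y‖)]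
  calc _ ≤ (2 * |R|) * (L * |x - y|) := by
        gcongr
        · linarith
        · exact a4.trans a3
    _ = _ := by ring

/-- While the point `u` is ahead, the excess decreases. -/
theorem PolarFrame.excess_le (F : PolarFrame K) (hG : ConvexRadial K G) {p : ℝ → ℝ} {κ : ℝ}
    (hp : CurvatureGE K G p κ) {s t u : ℝ} (hst : s ≤ t)
    (hτ : ∀ v ∈ Icc s t, 0 ≤ tanComp K G v (p v) u) :
    F.excess G κ t (p t) u ≤ F.excess G κ s (p s) u := by
  obtain ⟨C, hC⟩ := exists_norComp_le hG hp.slope hτ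
  obtain ⟨L, hL0, hL⟩ := F.exists_lipschitz_chordSq hG s t u
  refine le_of_oneSidedLipschitz_of_ae_deriv_nonpos (f := fun v => F.excess G κ v (p v) u)
    (C := C + |κ| / 2 * L) hst ?_ ?_
  · intro x hx y hy hxy
    have h1 := hC x hx y hy hxy
    have h2 := hL x hx y hy
    rw [abs_sub_comm x, abs_of_nonneg (sub_nonneg.2 hxy)] at h2
    have h3 : κ / 2 * (F.chordSq G x u - F.chordSq G y u) ≤ |κ| / 2 * (L * (y - x)) := by
      calc _ ≤ |κ / 2 * (F.chordSq G x u - F.chordSq G y u)| := le_abs_self _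
        _ = |κ| / 2 * |F.chordSq G x u - F.chordSq G y u| := by
          rw [abs_mul, abs_div, abs_two]
        _ ≤ _ := by gcongr
    unfold PolarFrame.excess
    linarith
  · filter_upwards [hp.ae_le, hG.ae_differentiableAt_slope hp.slope] with v hv hd hm
    have hd' := hd.hasDerivAt
    have h1 := (hasDerivAt_norComp hG hp.slope hd' u).fun_sub
      ((F.hasDerivAt_chordSq hG (hG.hasDerivAt hp.slope hd.continuousAt) u).const_mul (κ / 2))
    refine ⟨_, h1, ?_⟩
    have hk := hv _ hd'
    have ht := radW_pos (hG.pos_add v)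
    have hz := radZ_pos (p := p v) (hG.pos_add v)
    have hτv := hτ v ⟨hm.1.le, hm.2.le⟩
    -- Minus the tangential component times (curvature minus `κ`) times the speed `Z / W²`, brought
    -- to a common denominator.
    have e : -(G v + deriv p v) * tanComp K G v (p v) u * radW K (G v) / radZ K (G v) (p v) ^ 2
        - κ / 2 * (-2 * tanComp K G v (p v) u * radZ K (G v) (p v) / radW K (G v) ^ 2) =
        -(tanComp K G v (p v) u * ((G v + deriv p v) * radW K (G v) ^ 3
          - κ * radZ K (G v) (p v) ^ 3) / (radZ K (G v) (p v) ^ 2 * radW K (G v) ^ 2)) := by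
      field_simp
      ring
    rw [e, neg_nonpos]
    have := sub_nonneg.2 hk
    positivity

end

section

variable {K : ℝ} {G : ℝ → ℝ}

/-! ### Rolling a circle along a curve of larger curvature -/

theorem PolarFrame.chordSq_le_of_tanComp_nonneg (F : PolarFrame K) (hG : ConvexRadial K G)
    {p : ℝ → ℝ} (hp : ∀ t, IsSlope G t (p t)) {s t u : ℝ} (hst : s ≤ t)
    (hτ : ∀ v ∈ Icc s t, 0 ≤ tanComp K G v (p v) u) : F.chordSq G t u ≤ F.chordSq G s u := by
  obtain ⟨L, hL0, hL⟩ := F.exists_lipschitz_chordSq hG s t u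
  refine le_of_oneSidedLipschitz_of_ae_deriv_nonpos (f := fun v => F.chordSq G v u)
    (C := L) hst ?_ ?_
  · intro x hx y hy hxy
    have h2 := (le_abs_self _).trans (hL y hy x hx)
    rwa [abs_of_nonneg (sub_nonneg.2 hxy)] at h2
  · filter_upwards [hG.ae_differentiableAt_slope hp] with v hd hv
    refine ⟨_, F.hasDerivAt_chordSq hG (hG.hasDerivAt hp hd.continuousAt) u, ?_⟩
    have ht := radW_pos (hG.pos_add v)
    have hz := radZ_pos (p := p v) (hG.pos_add v)
    have := hτ v ⟨hv.1.le, hv.2.le⟩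
    have : 0 ≤ tanComp K G v (p v) u * radZ K (G v) (p v) / radW K (G v) ^ 2 := by positivity
    calc _ = -(2 * (tanComp K G v (p v) u * radZ K (G v) (p v) / radW K (G v) ^ 2)) := by ring
      _ ≤ 0 := by linarith

theorem PolarFrame.chordSq_le_of_tanComp_nonpos (F : PolarFrame K) (hG : ConvexRadial K G)
    {p : ℝ → ℝ} (hp : ∀ t, IsSlope G t (p t)) {s t u : ℝ} (hst : s ≤ t)
    (hτ : ∀ v ∈ Ioo s t, tanComp K G v (p v) u ≤ 0) : F.chordSq G s u ≤ F.chordSq G t u := by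
  obtain ⟨L, hL0, hL⟩ := F.exists_lipschitz_chordSq hG s t u
  have := le_of_oneSidedLipschitz_of_ae_deriv_nonpos (f := fun v => -F.chordSq G v u)
    (C := L) hst ?_ ?_
  · linarith
  · intro x hx y hy hxy
    have h2 := (le_abs_self _).trans (hL x hx y hy)
    rw [abs_sub_comm x, abs_of_nonneg (sub_nonneg.2 hxy)] at h2
    linarith
  · filter_upwards [hG.ae_differentiableAt_slope hp] with v hd hv
    refine ⟨_, (F.hasDerivAt_chordSq hG (hG.hasDerivAt hp hd.continuousAt) u).fun_neg, ?_⟩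
    have ht := radW_pos (hG.pos_add v)
    have hz := radZ_pos (p := p v) (hG.pos_add v)
    have := hτ v hv
    have : 0 ≤ -tanComp K G v (p v) u * radZ K (G v) (p v) / radW K (G v) ^ 2 := by
      have : 0 ≤ -tanComp K G v (p v) u := by linarith
      positivity
    calc _ = -(2 * (-tanComp K G v (p v) u * radZ K (G v) (p v) / radW K (G v) ^ 2)) := by ring
      _ ≤ 0 := by linarith

/-- The sign of the tangential component is that of `tanSign`. -/
noncomputable def tanSign (K : ℝ) (G : ℝ → ℝ) (t p u : ℝ) : ℝ :=
  (K + G t ^ 2) * Real.sin (u - t) + p * (G u - G t * Real.cos (u - t))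

theorem tanComp_eq (hG : ConvexRadial K G) (t p u : ℝ) :
    tanComp K G t p u = tanSign K G t p u / (radW K (G u) * radW K (G t) * radZ K (G t) p) := by
  rw [tanComp, radZ_sq (hG.pos_add t), gap, tanSign]
  ring_nf

theorem tanSign_self (t p : ℝ) : tanSign K G t p t = 0 := by simp [tanSign]

/-- The sign of the tangential component increases with the slope. -/
theorem IsSlope.tanSign_nonneg {t u p q : ℝ} (hpos : 0 < K + G t ^ 2)
    (hq : IsSlope G t q) (hpq : p ≤ q) (h : 0 ≤ tanSign K G t p u) (hp : IsSlope G t p) :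
    0 ≤ tanSign K G t q u := by
  have h1 := hp.gap_nonneg u
  have h2 := hq.gap_nonneg u
  unfold gap at h1 h2
  unfold tanSign at h ⊢
  set c := G u - G t * Real.cos (u - t)
  set s := Real.sin (u - t)
  -- The expression is affine in the slope with coefficient `c`. If `c < 0` it need not increase,
  -- but then the nonnegative gap at `q` forces `q ≤ 0` when `s ≥ 0`, and both terms are
  -- nonnegative; `s < 0` is incompatible with the hypothesis at `p`.
  rcases le_or_gt 0 c with hc | hc
  · nlinarith
  · rcases le_or_gt 0 s with hs | hs
    · have : q * s ≤ c := by linarith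
      have hq0 : q ≤ 0 := by
        by_contra! hq0
        have := mul_nonneg hq0.le hs
        linarith
      have := mul_nonneg_of_nonpos_of_nonpos hq0 hc.le
      have := mul_nonneg hpos.le hs
      linarith
    · exfalso
      have hp0 : 0 ≤ p := by
        by_contra! hp0
        have := mul_nonneg_of_nonpos_of_nonpos hp0.le hs.le
        linarith
      have := mul_neg_of_pos_of_neg hpos hs
      have := mul_nonpos_of_nonneg_of_nonpos hp0 hc.le
      linarith

theorem IsSlope.tanSign_pos {t u p q : ℝ} (hpos : 0 < K + G t ^ 2)
    (hq : IsSlope G t q) (hpq : p ≤ q) (h : 0 < tanSign K G t p u) (hp : IsSlope G t p) :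
    0 < tanSign K G t q u := by
  have h0 := IsSlope.tanSign_nonneg hpos hq hpq h.le hp
  refine lt_of_le_of_ne h0 fun h3 => ?_
  have h1 := hp.gap_nonneg u
  have h2 := hq.gap_nonneg u
  unfold gap at h1 h2
  unfold tanSign at h h3
  set c := G u - G t * Real.cos (u - t)
  set s := Real.sin (u - t)
  rcases le_or_gt 0 c with hc | hc
  · nlinarith
  · have hs : 0 ≤ s := by
      by_contra! hs
      have hp0 : 0 ≤ p := by
        by_contra! hp0
        have := mul_nonneg_of_nonpos_of_nonpos hp0.le hs.le
        linarith
      have := mul_neg_of_pos_of_neg hpos hs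
      have := mul_nonpos_of_nonneg_of_nonpos hp0 hc.le
      linarith
    have hq0 : q < 0 := by
      by_contra! hq0
      have := mul_nonneg hq0 hs
      linarith
    have := mul_pos_of_neg_of_neg hq0 hc
    have := mul_nonneg hpos.le hs
    linarith

theorem continuous_tanSign (hG : ConvexRadial K G) (u : ℝ) :
    Continuous fun x : ℝ × ℝ => tanSign K G x.1 x.2 u := by
  have := hG.continuous
  unfold tanSign
  fun_prop

/-- Rolling forward until the tangential component vanishes. -/
theorem PolarFrame.exists_tanSign_eq_zero (F : PolarFrame K) (hG : ConvexRadial K G) {p : ℝ → ℝ}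
    {κ : ℝ} (hp : CurvatureGE K G p κ) {t u q : ℝ} (htu : t < u) (hq : IsSlope G t q)
    (hτ : 0 < tanSign K G t q u) :
    ∃ v r, IsSlope G v r ∧ tanSign K G v r u = 0 ∧ F.excess G κ v r u ≤ F.excess G κ t q u ∧
      F.chordSq G v u ≤ F.chordSq G t u := by
  obtain ⟨B, hB0, hB, hBp⟩ := hG.exists_bound
  have hcτ := continuous_tanSign hG u
  have hcl := isClosed_slopes hG.continuous
  have hbox : IsCompact (Icc t u ×ˢ Icc (-B) B) := isCompact_Icc.prod isCompact_Icc
  -- the first point with a slope whose tangential component is not positive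
  set S := (Icc t u ×ˢ Icc (-B) B) ∩ ({x : ℝ × ℝ | IsSlope G x.1 x.2} ∩
    ({x : ℝ × ℝ | q - 2 * B * (x.1 - t) ≤ x.2} ∩ {x : ℝ × ℝ | tanSign K G x.1 x.2 u ≤ 0})) with hS
  have hSc : IsCompact S := hbox.inter_right (hcl.inter
    ((isClosed_le (by fun_prop) (by fun_prop)).inter (isClosed_le hcτ continuous_const)))
  -- Beyond `t` the lower bound in `S` holds for all slopes. At `t` itself it leaves only slopes at
  -- least `q`, for which the sign is still positive; this keeps the first point of `S` away from
  -- `t`.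
  have hlow : ∀ v r, t < v → IsSlope G v r → q - 2 * B * (v - t) ≤ r := by
    intro v r hv hr
    have h1 := IsSlope.le_add_of_le hB (hp.update hq |>.update hr).slope hv.le
    rw [Function.update_of_ne hv.ne, Function.update_self, Function.update_self] at h1
    linarith
  have hSne : S.Nonempty := by
    refine ⟨(u, p u), ⟨⟨htu.le, le_rfl⟩, abs_le.1 (hBp _ _ (hp.slope u))⟩, hp.slope u,
      hlow u _ htu (hp.slope u), ?_⟩
    simp [tanSign_self]
  obtain ⟨⟨v, r⟩, hvr, hmin⟩ := hSc.exists_isMinOn hSne continuous_fst.continuousOn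
  obtain ⟨⟨hvI, hrI⟩, hr : IsSlope G v r, hrq, hrτ⟩ := hvr
  simp only at hvI hrI hrq hrτ
  have hbefore : ∀ x y, t < x → x < v → IsSlope G x y → 0 < tanSign K G x y u := by
    intro x y hx hxv hy
    by_contra! hcon
    have : v ≤ x := hmin (a := (x, y)) ⟨⟨⟨hx.le, hxv.le.trans hvI.2⟩, abs_le.1 (hBp _ _ hy)⟩, hy,
      hlow x y hx hy, hcon⟩
    linarith
  have htv : t < v := by
    refine lt_of_le_of_ne hvI.1 ?_
    rintro rfl
    have : q ≤ r := by simpa using hrq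
    have := IsSlope.tanSign_pos (hG.pos_add _) hr this hτ hq
    exact absurd hrτ (not_le.2 this)
  -- Before `v` the sign is positive. By compactness some limit of slopes from the left is a slope
  -- `r' ≤ r` at `v` with nonnegative sign, and monotonicity in the slope carries this over to `r`.
  have hzero : tanSign K G v r u = 0 := by
    refine le_antisymm hrτ ?_
    set T := (Icc t v ×ˢ Icc (-B) B) ∩ ({x : ℝ × ℝ | IsSlope G x.1 x.2} ∩
      ({x : ℝ × ℝ | x.2 ≤ r + 2 * B * (v - x.1)} ∩ {x : ℝ × ℝ | 0 ≤ tanSign K G x.1 x.2 u}))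
    have hTc : IsCompact T := (isCompact_Icc.prod isCompact_Icc).inter_right (hcl.inter
      ((isClosed_le (by fun_prop) (by fun_prop)).inter (isClosed_le continuous_const hcτ)))
    have hT1 : IsClosed (Prod.fst '' T) := (hTc.image continuous_fst).isClosed
    have hT2 : Ioo t v ⊆ Prod.fst '' T := by
      intro x hx
      refine ⟨(x, p x), ⟨⟨⟨hx.1.le, hx.2.le⟩, abs_le.1 (hBp _ _ (hp.slope x))⟩, hp.slope x, ?_,
        (hbefore x _ hx.1 hx.2 (hp.slope x)).le⟩, rfl⟩
      have h1 := IsSlope.le_add_of_le hB (hp.update hr).slope hx.2.le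
      rw [Function.update_of_ne hx.2.ne, Function.update_self] at h1
      exact h1
    have hT3 := hT1.closure_subset_iff.2 hT2
    rw [closure_Ioo htv.ne] at hT3
    obtain ⟨⟨v', r'⟩, ⟨-, h1, h2, h3⟩, h4⟩ := hT3 (right_mem_Icc.2 htv.le)
    simp only at h4
    subst h4
    have : r' ≤ r := by simpa using h2
    exact IsSlope.tanSign_nonneg (hG.pos_add _) hr this h3 h1
  have hp' := (hp.update hq).update hr
  have hτ' : ∀ x ∈ Icc t v, 0 ≤ tanComp K G x
      (Function.update (Function.update p t q) v r x) u := by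
    intro x hx
    rw [tanComp_nonneg_iff hG]
    change 0 ≤ tanSign K G x _ u
    rcases hx.2.eq_or_lt with rfl | hxv
    · rw [Function.update_self, hzero]
    rw [Function.update_of_ne hxv.ne]
    rcases hx.1.eq_or_lt with rfl | hxt
    · rw [Function.update_self]; exact hτ.le
    rw [Function.update_of_ne hxt.ne']
    exact (hbefore x _ hxt hxv (hp.slope x)).le
  refine ⟨v, r, hr, hzero, ?_, F.chordSq_le_of_tanComp_nonneg hG hp'.slope htv.le hτ'⟩
  have := F.excess_le hG hp' htv.le hτ'
  rwa [Function.update_self, Function.update_of_ne htv.ne, Function.update_self] at this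

theorem IsSlope.norComp_nonneg (hG : ConvexRadial K G) {t q : ℝ} (hq : IsSlope G t q) (u : ℝ) :
    0 ≤ norComp K G t q u := by
  have hu := radW_pos (hG.pos_add u)
  have hz := radZ_pos (p := q) (hG.pos_add t)
  have := hq.gap_nonneg u
  rw [norComp]
  positivity

/-- The diameter is bounded by that of the circle of curvature `κ`. -/
theorem PolarFrame.chordSq_le (F : PolarFrame K) (hG : ConvexRadial K G) {p : ℝ → ℝ} {κ : ℝ}
    (hκ : 0 < κ) (hp : CurvatureGE K G p κ) {t u : ℝ} (htu : t ≤ u) :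
    (K + κ ^ 2) * F.chordSq G t u ≤ 4 := by
  have hK := hG.nonneg
  -- A chord that is too long cannot point forwards: rolling to a normal chord would not increase
  -- the excess, whereas the comparison below shows that it has to.
  have key : ∀ v q, v < u → IsSlope G v q → 4 < (K + κ ^ 2) * F.chordSq G v u →
      tanSign K G v q u ≤ 0 := by
    intro v q hvu hq hv
    by_contra! hτ
    obtain ⟨x, r, hr, h0, hF, hX⟩ := F.exists_tanSign_eq_zero hG hp hvu hq hτ
    have hN := hq.norComp_nonneg hG u
    have hN1 := hr.norComp_nonneg hG u
    have e := F.chordSq_eq hG v q u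
    have e1 := F.chordSq_eq hG x r u
    have hτ1 : 0 < tanComp K G v q u := by
      rw [tanComp_eq hG]
      have hu := radW_pos (hG.pos_add u)
      have ht := radW_pos (hG.pos_add v)
      have hz := radZ_pos (p := q) (hG.pos_add v)
      positivity
    rw [tanComp_eq hG, h0, zero_div] at e1
    unfold PolarFrame.excess at hF
    have hX10 : 0 ≤ F.chordSq G x u := sq_nonneg _
    set X := F.chordSq G v u
    set X1 := F.chordSq G x u
    set N := norComp K G v q u
    set N1 := norComp K G x r u
    set τ := tanComp K G v q u
    have hX0 : 0 < X := by
      by_contra! h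
      have : 0 < K + κ ^ 2 := by positivity
      nlinarith
    have hNX : N < κ * X / 2 := by
      refine lt_of_pow_lt_pow_left₀ 2 (by positivity) ?_
      nlinarith [mul_pos hX0 (sub_pos.2 hv), sq_pos_of_pos hτ1]
    have hN1X : N1 < κ * X1 / 2 := by linarith
    have hX1 : 0 < X1 := by
      rcases hX10.eq_or_lt with h | h
      · rw [← h] at hN1X; linarith
      · exact h
    -- So `N / X < N1 / X1 < κ / 2` while `X1 ≤ X`. Hence `N - κ X / 2 < N1 - κ X1 / 2`, contrary to
    -- the monotonicity `hF` of the excess.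
    have h5 : N * X1 < N1 * X := by
      refine lt_of_pow_lt_pow_left₀ 2 (by positivity) ?_
      have a1 : N ^ 2 < X - K / 4 * X ^ 2 := by nlinarith [sq_pos_of_pos hτ1]
      have a2 : N1 ^ 2 = X1 - K / 4 * X1 ^ 2 := by linarith
      rw [mul_pow, mul_pow, a2]
      have a3 : N ^ 2 * X1 ^ 2 < (X - K / 4 * X ^ 2) * X1 ^ 2 := by gcongr
      have a4 : 0 ≤ X * X1 * (X - X1) :=
        mul_nonneg (mul_nonneg hX0.le hX1.le) (sub_nonneg.2 hX)
      nlinarith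
    nlinarith
  by_contra! hcon
  -- Let `b` be the first angle from `t` on where the bound holds; `u` itself qualifies. Before `b`
  -- the bound fails, so the chord never points forwards and its length does not decrease on the way
  -- to `b`. Hence the bound at `b` gives the bound at `t`.
  set S := {v | (K + κ ^ 2) * F.chordSq G v u ≤ 4} ∩ Icc t u
  have hcont : Continuous fun v => F.chordSq G v u := by
    have := F.continuous_curve hG
    unfold PolarFrame.chordSq
    fun_prop
  have hSc : IsCompact S := isCompact_Icc.inter_left
    (isClosed_le (continuous_const.mul hcont) continuous_const)
  have hSne : S.Nonempty := ⟨u, by simp [PolarFrame.chordSq], htu, le_rfl⟩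
  obtain ⟨b, hb, hmin⟩ := hSc.exists_isMinOn hSne continuousOn_id
  have h1 := F.chordSq_le_of_tanComp_nonpos hG hp.slope (s := t) (t := b) (u := u) hb.2.1 ?_
  · have hb1 := hb.1
    simp only [Set.mem_ofPred_eq] at hb1
    have : (K + κ ^ 2) * F.chordSq G t u ≤ (K + κ ^ 2) * F.chordSq G b u := by gcongr
    linarith
  · intro v hv
    rw [tanComp_eq hG]
    refine div_nonpos_of_nonpos_of_nonneg (key v _ (hv.2.trans_le hb.2.2) (hp.slope v) ?_) ?_
    · by_contra! h
      have : b ≤ v := hmin ⟨h, hv.1.le, hv.2.le.trans hb.2.2⟩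
      linarith [hv.2]
    · have hu := radW_pos (hG.pos_add u)
      have ht := radW_pos (hG.pos_add v)
      have hz := radZ_pos (p := p v) (hG.pos_add v)
      positivity

/-- For a normal chord `N² = X - K X² / 4`, so `N² - (κ X / 2)²` equals `X (1 - (K + κ²) X / 4)`,
and the diameter bound is exactly what is needed. -/
theorem PolarFrame.excess_nonneg_of_tanSign_eq_zero (F : PolarFrame K) (hG : ConvexRadial K G)
    {κ : ℝ} {t u q : ℝ} (hq : IsSlope G t q)
    (hX : (K + κ ^ 2) * F.chordSq G t u ≤ 4) (h0 : tanSign K G t q u = 0) :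
    0 ≤ F.excess G κ t q u := by
  have e := F.chordSq_eq hG t q u
  rw [tanComp_eq hG, h0, zero_div] at e
  have hN := hq.norComp_nonneg hG u
  unfold PolarFrame.excess
  have hX10 : 0 ≤ F.chordSq G t u := sq_nonneg _
  have : κ / 2 * F.chordSq G t u ≤ norComp K G t q u := by
    refine le_of_sq_le_sq ?_ hN
    nlinarith
  linarith

theorem CurvatureGE.reflect {p : ℝ → ℝ} {κ : ℝ} (h : CurvatureGE K G p κ) :
    CurvatureGE K (fun t => G (-t)) (fun t => -p (-t)) κ where
  slope t := by
    have := (h.slope (-t)).reflect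
    rwa [neg_neg] at this
  ae_le := by
    have h1 := (Measure.measurePreserving_neg (volume : Measure ℝ)).quasiMeasurePreserving.ae h.ae_le
    filter_upwards [h1] with t ht d hd
    have h2 : HasDerivAt p d (-t) := by
      have h3 : HasDerivAt (fun s => -p (-s)) d (- -t) := by rwa [neg_neg]
      have h4 := (h3.scomp (-t) (hasDerivAt_neg (-t))).neg
      refine (h4.congr_deriv (by simp)).congr_of_eventuallyEq (Eventually.of_forall fun s => ?_)
      simp
    have := ht d h2
    rw [radZ, neg_sq]
    exact this

/-- The polar frame with the opposite orientation. -/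
def PolarFrame.reflect (F : PolarFrame K) : PolarFrame K where
  c := F.c
  O := F.O
  a := F.a
  b := -F.b
  aa := F.aa
  bb := by rw [inner_neg_neg, F.bb]
  ab := by rw [inner_neg_right, F.ab, neg_zero]
  Oa := F.Oa
  Ob := by rw [inner_neg_right, F.Ob, neg_zero]
  origin := F.origin

theorem PolarFrame.reflect_curve (F : PolarFrame K) (t : ℝ) :
    F.reflect.curve (fun s => G (-s)) t = F.curve G (-t) := by
  simp [PolarFrame.curve, PolarFrame.reflect, PolarFrame.e]

theorem PolarFrame.reflect_chordSq (F : PolarFrame K) (t u : ℝ) :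
    F.reflect.chordSq (fun s => G (-s)) t u = F.chordSq G (-t) (-u) := by
  simp only [PolarFrame.chordSq, PolarFrame.reflect_curve]

theorem PolarFrame.reflect_excess (F : PolarFrame K) (κ t q u : ℝ) :
    F.reflect.excess (fun s => G (-s)) κ t q u = F.excess G κ (-t) (-q) (-u) := by
  rw [PolarFrame.excess, PolarFrame.excess, F.reflect_chordSq, norComp, norComp, gap, gap, radZ,
    radZ, neg_sq, ← neg_sub' u t, Real.cos_neg, Real.sin_neg, neg_mul_neg]

theorem tanSign_reflect (t q u : ℝ) :
    tanSign K (fun s => G (-s)) t q u = -tanSign K G (-t) (-q) (-u) := by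
  rw [tanSign, tanSign, ← neg_sub' u t, Real.cos_neg, Real.sin_neg]
  ring

theorem PolarFrame.e_add_two_pi_mul (F : PolarFrame K) (t : ℝ) (n : ℤ) :
    F.e (t + n * (2 * Real.pi)) = F.e t := by
  simp [PolarFrame.e]

theorem PolarFrame.curve_add_two_pi_mul (F : PolarFrame K) (hG : ConvexRadial K G) (t : ℝ)
    (n : ℤ) : F.curve G (t + n * (2 * Real.pi)) = F.curve G t := by
  rw [PolarFrame.curve, PolarFrame.curve, F.e_add_two_pi_mul, hG.periodic.int_mul n t]

theorem PolarFrame.excess_add_two_pi_mul (F : PolarFrame K) (hG : ConvexRadial K G)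
    (κ t q u : ℝ) (n : ℤ) :
    F.excess G κ t q (u + n * (2 * Real.pi)) = F.excess G κ t q u := by
  rw [PolarFrame.excess, PolarFrame.excess, PolarFrame.chordSq, PolarFrame.chordSq,
    F.curve_add_two_pi_mul hG, norComp, norComp, gap, gap, hG.periodic.int_mul n u,
    add_sub_right_comm, Real.cos_add_int_mul_two_pi, Real.sin_add_int_mul_two_pi]

theorem exists_int_lt_add (t u : ℝ) : ∃ n : ℤ, t < u + n * (2 * Real.pi) := by
  obtain ⟨n, hn⟩ := exists_nat_gt ((t - u) / (2 * Real.pi))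
  refine ⟨n, ?_⟩
  rw [div_lt_iff₀ Real.two_pi_pos] at hn
  push_cast
  linarith

/-- The diameter is bounded by that of the circle of curvature `κ`. -/
theorem PolarFrame.chordSq_le' (F : PolarFrame K) (hG : ConvexRadial K G) {p : ℝ → ℝ} {κ : ℝ}
    (hκ : 0 < κ) (hp : CurvatureGE K G p κ) (t u : ℝ) :
    (K + κ ^ 2) * F.chordSq G t u ≤ 4 := by
  obtain ⟨n, hn⟩ := exists_int_lt_add t u
  have := F.chordSq_le hG hκ hp hn.le
  rwa [PolarFrame.chordSq, F.curve_add_two_pi_mul hG] at this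

/-- By periodicity `u` may be assumed to come after `t`. Rolling forward to a normal chord does not
increase the excess, and it ends nonnegative. -/
theorem PolarFrame.excess_nonneg_of_tanSign_pos (F : PolarFrame K) (hG : ConvexRadial K G)
    {p : ℝ → ℝ} {κ : ℝ} (hκ : 0 < κ) (hp : CurvatureGE K G p κ) {t q u : ℝ} (hq : IsSlope G t q)
    (hτ : 0 < tanSign K G t q u) : 0 ≤ F.excess G κ t q u := by
  obtain ⟨n, hn⟩ := exists_int_lt_add t u
  rw [← F.excess_add_two_pi_mul hG _ _ _ _ n]
  have e : tanSign K G t q (u + n * (2 * Real.pi)) = tanSign K G t q u := by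
    rw [tanSign, tanSign, hG.periodic.int_mul n u, add_sub_right_comm,
      Real.cos_add_int_mul_two_pi, Real.sin_add_int_mul_two_pi]
  obtain ⟨v, r, hr, h0, hF, -⟩ := F.exists_tanSign_eq_zero hG hp hn hq (e.symm ▸ hτ)
  exact (F.excess_nonneg_of_tanSign_eq_zero hG hr (F.chordSq_le' hG hκ hp _ _) h0).trans hF

/-- A closed convex curve of curvature at least `κ` lies in the disc of curvature `κ` that
touches it from inside at any of its points. -/
theorem PolarFrame.excess_nonneg (F : PolarFrame K) (hG : ConvexRadial K G)
    {p : ℝ → ℝ} {κ : ℝ} (hκ : 0 < κ) (hp : CurvatureGE K G p κ) {t q : ℝ} (hq : IsSlope G t q)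
    (u : ℝ) : 0 ≤ F.excess G κ t q u := by
  rcases lt_trichotomy (tanSign K G t q u) 0 with h | h | h
  · have h1 := F.reflect.excess_nonneg_of_tanSign_pos hG.reflect hκ hp.reflect hq.reflect (u := -u)
      (by rw [tanSign_reflect]; simpa using h)
    rw [F.reflect_excess] at h1
    simpa using h1
  · exact F.excess_nonneg_of_tanSign_eq_zero hG hq (F.chordSq_le' hG hκ hp _ _) h
  · exact F.excess_nonneg_of_tanSign_pos hG hκ hp hq h

end

section

/-! ### Chords and circles in the model plane -/

namespace ModelPlane

variable {K : ℝ}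

theorem K_mul_inner_self (hK : 0 < K) (x : ModelPlane K) : K * ⟪x.coords, x.coords⟫ = 1 := by
  rw [real_inner_self_eq_norm_sq, norm_coords hK.ne', div_pow, Real.sq_sqrt hK.le]
  field_simp

theorem sqrt_mul_dist_le_pi (hK : 0 ≤ K) (x y : ModelPlane K) : √K * dist x y ≤ Real.pi := by
  rcases hK.eq_or_lt with rfl | hK
  · simp [Real.pi_pos.le]
  · rw [dist_def, if_neg hK.ne', mul_div_cancel₀ _ (Real.sqrt_pos.2 hK).ne']
    exact InnerProductGeometry.angle_le_pi _ _

/-- On the sphere the chord is `(2 / √K) sin (√K d / 2)`. Written with `sinc` the formula includes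
the plane, where `sinc 0 = 1`. -/
theorem norm_coords_sub (hK : 0 ≤ K) (x y : ModelPlane K) :
    ‖x.coords - y.coords‖ = dist x y * Real.sinc (√K * dist x y / 2) := by
  rcases hK.eq_or_lt with rfl | hK
  · rw [dist_def, if_pos rfl]; simp
  · have hs := Real.sqrt_pos.2 hK
    have hs2 := Real.sq_sqrt hK.le
    have h1 := mul_comm (Real.sinc (√K * dist x y / 2)) (√K * dist x y / 2)
    have hθ : √K * dist x y = InnerProductGeometry.angle x.coords y.coords := by
      rw [dist_def, if_neg hK.ne', mul_div_cancel₀ _ hs.ne']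
    have h2 : √K * ‖x.coords - y.coords‖ / 2 =
        Real.sin (InnerProductGeometry.angle x.coords y.coords / 2) := by
      have h0 : 0 ≤ Real.sin (InnerProductGeometry.angle x.coords y.coords / 2) :=
        Real.sin_nonneg_of_nonneg_of_le_pi
          (by linarith [InnerProductGeometry.angle_nonneg x.coords y.coords])
          (by linarith [InnerProductGeometry.angle_le_pi x.coords y.coords, Real.pi_pos])
      rw [← sq_eq_sq₀ (by positivity) h0, Real.sin_sq, Real.cos_sq]
      have h3 := InnerProductGeometry.cos_angle_mul_norm_mul_norm x.coords y.coords
      have hx := K_mul_inner_self hK x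
      have hy := K_mul_inner_self hK y
      rw [norm_coords hK.ne', norm_coords hK.ne'] at h3
      have h4 : Real.cos (InnerProductGeometry.angle x.coords y.coords) =
          K * ⟪x.coords, y.coords⟫ := by
        rw [← h3]; field_simp; rw [hs2]; 
      rw [mul_div_cancel₀ _ (two_ne_zero), h4, div_pow, mul_pow, hs2, norm_sub_sq_real,
        ← real_inner_self_eq_norm_sq, ← real_inner_self_eq_norm_sq]
      linear_combination (hx + hy) / 4
    rw [← hθ] at h2
    have h3 := Real.mul_sinc (√K * dist x y / 2)
    rw [← h2] at h3
    have : √K / 2 * (dist x y * Real.sinc (√K * dist x y / 2)) =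
        √K / 2 * ‖x.coords - y.coords‖ := by linear_combination h3
    exact (mul_left_cancel₀ (by positivity) this).symm

theorem norm_coords_sub_eq_of_dist_eq (hK : 0 ≤ K) {x y x' y' : ModelPlane K}
    (h : dist x y = dist x' y') : ‖x.coords - y.coords‖ = ‖x'.coords - y'.coords‖ := by
  rw [norm_coords_sub hK, norm_coords_sub hK, h]

theorem dist_eq_of_norm_coords_sub_eq (hK : 0 ≤ K) {x y x' y' : ModelPlane K}
    (h : ‖x.coords - y.coords‖ = ‖x'.coords - y'.coords‖) : dist x y = dist x' y' := by
  rcases hK.eq_or_lt with rfl | hK'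
  · rw [dist_def, dist_def, if_pos rfl, if_pos rfl, h]
  · have hs := Real.sqrt_pos.2 hK'
    have e : ∀ x y : ModelPlane K, Real.sin (√K * dist x y / 2) =
        √K / 2 * ‖x.coords - y.coords‖ := by
      intro x y
      rw [norm_coords_sub hK, ← Real.mul_sinc]; ring
    have m : ∀ x y : ModelPlane K, √K * dist x y / 2 ∈ Icc (-(Real.pi / 2)) (Real.pi / 2) := by
      intro x y
      have := sqrt_mul_dist_le_pi hK x y
      have h0 : 0 ≤ √K * dist x y := by positivity
      constructor <;> linarith [Real.pi_pos]
    have := Real.injOn_sin (m x y) (m x' y') (by rw [e, e, h])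
    have : √K * dist x y = √K * dist x' y' := by linarith
    exact mul_left_cancel₀ hs.ne' this

theorem norm_coords_sub_le_dist (hK : 0 ≤ K) (x y : ModelPlane K) :
    ‖x.coords - y.coords‖ ≤ dist x y := by
  rw [norm_coords_sub hK]
  exact mul_le_of_le_one_right dist_nonneg (Real.sinc_le_one _)

theorem coords_injective : Function.Injective (coords (K := K)) := Subtype.val_injective

theorem norm_coords_sub_pos {x y : ModelPlane K} (h : x ≠ y) : 0 < ‖x.coords - y.coords‖ :=
  norm_pos_iff.2 (sub_ne_zero.2 fun h' => h (coords_injective h'))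

end ModelPlane

open ModelPlane

variable {K κ : ℝ}

/-- A round circle in space. -/
noncomputable def circlePoint (R : ℝ) (o u v : E3) (t : ℝ) : E3 :=
  o + (R * Real.cos (t / R)) • u + (R * Real.sin (t / R)) • v

theorem hasDerivAt_circlePoint {R : ℝ} (hR : 0 < R) (o u v : E3) (t : ℝ) :
    HasDerivAt (circlePoint R o u v) ((-Real.sin (t / R)) • u + (Real.cos (t / R)) • v) t := by
  have h1 : HasDerivAt (fun t : ℝ => t / R) (1 / R) t := (hasDerivAt_id t).div_const R
  have hc := ((Real.hasDerivAt_cos (t / R)).comp t h1).const_mul R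
  have hs := ((Real.hasDerivAt_sin (t / R)).comp t h1).const_mul R
  refine (((hc.smul_const u).const_add o).fun_add (hs.smul_const v)).congr_deriv ?_
  congr 2 <;> field_simp

theorem hasDerivAt_circlePoint' {R : ℝ} (u v : E3) (t : ℝ) :
    HasDerivAt (fun t : ℝ => (-Real.sin (t / R)) • u + (Real.cos (t / R)) • v)
      (-(R⁻¹ • (Real.cos (t / R) • u + Real.sin (t / R) • v))) t := by
  have h1 : HasDerivAt (fun t : ℝ => t / R) (1 / R) t := (hasDerivAt_id t).div_const R
  have hc := ((Real.hasDerivAt_cos (t / R)).comp t h1)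
  have hs := ((Real.hasDerivAt_sin (t / R)).comp t h1).fun_neg
  refine ((hs.smul_const u).fun_add (hc.smul_const v)).congr_deriv ?_
  rw [smul_add, smul_smul, smul_smul, neg_add, ← neg_smul, ← neg_smul]
  congr 2 <;> ring

theorem deriv_deriv_circlePoint {R : ℝ} (hR : 0 < R) (o u v : E3) (t : ℝ) :
    deriv (deriv (circlePoint R o u v)) t =
      -(R⁻¹ • (Real.cos (t / R) • u + Real.sin (t / R) • v)) := by
  have : deriv (circlePoint R o u v) =
      fun t : ℝ => (-Real.sin (t / R)) • u + (Real.cos (t / R)) • v :=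
    funext fun t => (hasDerivAt_circlePoint hR o u v t).deriv
  rw [this, (hasDerivAt_circlePoint' u v t).deriv]

theorem norm_circlePoint_sub {R : ℝ} (_hR : 0 < R) {o u v : E3} (hu : ‖u‖ = 1) (hv : ‖v‖ = 1)
    (huv : ⟪u, v⟫ = 0) (s t : ℝ) :
    ‖circlePoint R o u v s - circlePoint R o u v t‖ ^ 2 =
      4 * R ^ 2 * Real.sin ((s - t) / (2 * R)) ^ 2 := by
  have e : circlePoint R o u v s - circlePoint R o u v t =
      (R * (Real.cos (s / R) - Real.cos (t / R))) • u +
        (R * (Real.sin (s / R) - Real.sin (t / R))) • v := by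
    unfold circlePoint
    module
  have h2 : Real.sin ((s - t) / (2 * R)) ^ 2 = (1 - Real.cos (s / R - t / R)) / 2 := by
    rw [Real.sin_sq, Real.cos_sq]
    have : 2 * ((s - t) / (2 * R)) = s / R - t / R := by field_simp
    rw [this]; ring
  rw [e, h2, Real.cos_sub, norm_add_sq_real, norm_smul, norm_smul, hu, hv, real_inner_smul_left,
    real_inner_smul_right, huv, mul_pow, mul_pow, Real.norm_eq_abs, Real.norm_eq_abs, sq_abs,
    sq_abs]
  linear_combination R ^ 2 * (Real.sin_sq_add_cos_sq (s / R) + Real.sin_sq_add_cos_sq (t / R))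

/-- The geodesic curvature of a circle of radius `R` in the model plane. -/
theorem geodesicCurvature_circlePoint (hK : 0 ≤ K) {R : ℝ} (hR : 0 < R) {o u v : E3}
    (hu : ‖u‖ = 1) (hv : ‖v‖ = 1) (huv : ⟪u, v⟫ = 0)
    (h : K ≠ 0 → ∀ t, K * ‖circlePoint R o u v t‖ ^ 2 = 1) (t : ℝ) :
    geodesicCurvature K (circlePoint R o u v) t ^ 2 = R⁻¹ ^ 2 - K := by
  rw [geodesicCurvature, deriv_deriv_circlePoint hR]
  have hn : ‖Real.cos (t / R) • u + Real.sin (t / R) • v‖ ^ 2 = 1 := by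
    rw [norm_add_sq_real, norm_smul, norm_smul, hu, hv, real_inner_smul_left,
      real_inner_smul_right, huv, Real.norm_eq_abs, Real.norm_eq_abs, mul_one, mul_one, sq_abs,
      sq_abs]
    linear_combination Real.sin_sq_add_cos_sq (t / R)
  have hn2 : ‖-(R⁻¹ • (Real.cos (t / R) • u + Real.sin (t / R) • v))‖ ^ 2 = R⁻¹ ^ 2 := by
    rw [norm_neg, norm_smul, mul_pow, hn, Real.norm_eq_abs, sq_abs, mul_one]
  rcases hK.eq_or_lt with rfl | hK
  · rw [zero_smul, add_zero, hn2, sub_zero]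
  have h0 := h hK.ne'
  -- the centre is orthogonal to the plane of the circle
  have ho : ⟪o, Real.cos (t / R) • u + Real.sin (t / R) • v⟫ = 0 := by
    have e : ∀ s : ℝ, ‖circlePoint R o u v s‖ ^ 2 = ‖o‖ ^ 2 +
        2 * R * (Real.cos (s / R) * ⟪o, u⟫ + Real.sin (s / R) * ⟪o, v⟫) + R ^ 2 := by
      intro s
      rw [circlePoint, ← real_inner_self_eq_norm_sq, ← real_inner_self_eq_norm_sq]
      simp only [inner_add_left, inner_add_right, real_inner_smul_left, real_inner_smul_right]
      rw [real_inner_comm o u, real_inner_comm o v, real_inner_comm u v, huv,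
        real_inner_self_eq_norm_sq u, real_inner_self_eq_norm_sq v, hu, hv]
      linear_combination R ^ 2 * Real.sin_sq_add_cos_sq (s / R)
    have h1 := h0 t
    have h2 := h0 (t + Real.pi * R)
    have e2 : (t + Real.pi * R) / R = t / R + Real.pi := by field_simp
    rw [e] at h1 h2
    rw [e2, Real.cos_add_pi, Real.sin_add_pi] at h2
    rw [inner_add_right, real_inner_smul_right, real_inner_smul_right]
    have : 4 * K * R * (Real.cos (t / R) * ⟪o, u⟫ + Real.sin (t / R) * ⟪o, v⟫) = 0 := by
      linear_combination h1 - h2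
    exact (mul_eq_zero.1 this).resolve_left (by positivity)
  have e : circlePoint R o u v t = o + R • (Real.cos (t / R) • u + Real.sin (t / R) • v) := by
    unfold circlePoint; module
  have h1 := h0 t
  rw [norm_add_sq_real, hn2, inner_neg_left, real_inner_smul_left, real_inner_smul_right, norm_smul,
    mul_pow, Real.norm_eq_abs, sq_abs]
  have h3 : ⟪Real.cos (t / R) • u + Real.sin (t / R) • v, circlePoint R o u v t⟫ = R := by
    rw [e, inner_add_right, real_inner_smul_right, real_inner_self_eq_norm_sq, hn,
      real_inner_comm, ho]; ring
  rw [h3]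
  field_simp
  linear_combination K * R ^ 2 * h1

theorem norm_sq_mul_eq_one {K : ℝ} (hK : 0 ≤ K) (c : ℝ → ModelPlane K) (h0 : K ≠ 0) (t : ℝ) :
    K * ‖(c t).coords‖ ^ 2 = 1 := by
  rw [← real_inner_self_eq_norm_sq, K_mul_inner_self (hK.lt_of_ne' h0)]

theorem IsKappaCircle.nonneg {c : ℝ → ModelPlane K} (h : IsKappaCircle K κ c) : 0 ≤ κ := by
  rw [← h.2 0]; exact norm_nonneg _

/-- The chords of a circle of the model plane. -/
theorem IsKappaCircle.chord (hK : 0 ≤ K) {c : ℝ → ModelPlane K} (h : IsKappaCircle K κ c) :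
    (∃ R, 0 < R ∧ R⁻¹ ^ 2 = K + κ ^ 2 ∧ ∀ s t, ‖(c s).coords - (c t).coords‖ ^ 2 =
      4 * R ^ 2 * Real.sin ((s - t) / (2 * R)) ^ 2) ∨
    (K = 0 ∧ κ = 0 ∧ ∀ s t, ‖(c s).coords - (c t).coords‖ = |s - t|) := by
  obtain ⟨⟨o, u, hu, hc⟩ | ⟨R, o, u, v, hR, hu, hv, huv, hc⟩, hg⟩ := h
  · have hc' : ∀ t, (c t).coords = o + t • u := hc
    have hK0 : K = 0 := by
      by_contra h0
      have e := fun t => norm_sq_mul_eq_one hK c h0 t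
      simp only [hc, norm_add_sq_real, norm_smul, hu, real_inner_smul_right, mul_one, Real.norm_eq_abs,
        sq_abs] at e
      -- The squared norm along a line is a quadratic polynomial with leading coefficient one, so it
      -- cannot take the value `1 / K` at three parameters.
      have h1 := e 0
      have h2 := e 1
      have h3 := e (-1)
      apply h0
      linarith
    refine Or.inr ⟨hK0, ?_, fun s t => ?_⟩
    · have h1 := hg 0
      have e : (fun s => (c s).coords) = fun t : ℝ => o + t • u := funext hc
      have e1 : deriv (fun t : ℝ => o + t • u) = fun _ => u := by
        funext t
        have := ((hasDerivAt_id t).smul_const u).const_add o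
        simpa using this.deriv
      rw [geodesicCurvature, e, e1] at h1
      simpa [hK0] using h1.symm
    · rw [hc', hc', add_sub_add_left_eq_sub, ← sub_smul, norm_smul, hu, mul_one, Real.norm_eq_abs]
  · have e : (fun s => (c s).coords) = circlePoint R o u v := funext hc
    refine Or.inl ⟨R, hR, ?_, fun s t => ?_⟩
    · have h1 := hg 0
      rw [e] at h1
      have h2 := geodesicCurvature_circlePoint hK hR hu hv huv (fun h0 t => by
        have := norm_sq_mul_eq_one hK c h0 t
        rwa [congrFun e t] at this) 0
      rw [h1] at h2
      linarith
    · have := norm_circlePoint_sub hR (o := o) hu hv huv s t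
      rwa [← congrFun e s, ← congrFun e t] at this

/-- A circle of space that lies in the model plane. -/
theorem isKappaCircle_of_circlePoint (hK : 0 ≤ K) (hκ : 0 ≤ κ) {R : ℝ} (hR : 0 < R)
    (hRκ : R⁻¹ ^ 2 = K + κ ^ 2) {o u v : E3} (hu : ‖u‖ = 1) (hv : ‖v‖ = 1) (huv : ⟪u, v⟫ = 0)
    {c : ℝ → ModelPlane K} (hc : ∀ t, (c t).coords = circlePoint R o u v t) :
    IsKappaCircle K κ c := by
  refine ⟨Or.inr ⟨R, o, u, v, hR, hu, hv, huv, hc⟩, fun t => ?_⟩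
  have e : (fun s => (c s).coords) = circlePoint R o u v := funext hc
  rw [e]
  have h2 := geodesicCurvature_circlePoint hK hR hu hv huv (fun h0 t => by
    have := norm_sq_mul_eq_one hK c h0 t
    rwa [congrFun e t] at this) t
  rw [hRκ, add_sub_cancel_left] at h2
  exact (sq_eq_sq₀ (norm_nonneg _) hκ).1 h2

theorem isKappaCircle_of_line {o u : E3} (hu : ‖u‖ = 1) {c : ℝ → ModelPlane 0}
    (hc : ∀ t, (c t).coords = o + t • u) : IsKappaCircle 0 0 c := by
  refine ⟨Or.inl ⟨o, u, hu, hc⟩, fun t => ?_⟩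
  have e : (fun s => (c s).coords) = fun t : ℝ => o + t • u := funext hc
  have e1 : deriv (fun t : ℝ => o + t • u) = fun _ => u := by
    funext t
    have := ((hasDerivAt_id t).smul_const u).const_add o
    simpa using this.deriv
  rw [geodesicCurvature, e, e1]
  simp

/-- The relation between the squared sides of a triangle and `λ = 1 / R²`, where `R` is the
circumradius. -/
def CircumEq (x y z l : ℝ) : Prop := l * (x * y * z) = 4 * x * y - (x + y - z) ^ 2

theorem IsKappaCircle.circumEq (hK : 0 ≤ K) {c : ℝ → ModelPlane K} (h : IsKappaCircle K κ c)
    (r s t : ℝ) : CircumEq (‖(c r).coords - (c s).coords‖ ^ 2) (‖(c s).coords - (c t).coords‖ ^ 2)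
      (‖(c t).coords - (c r).coords‖ ^ 2) (K + κ ^ 2) := by
  unfold CircumEq
  rcases h.chord hK with ⟨R, hR, e, hc⟩ | ⟨rfl, rfl, hc⟩
  · rw [hc, hc, hc, ← e]
    have e1 : (t - r) / (2 * R) = -((r - s) / (2 * R) + (s - t) / (2 * R)) := by ring
    rw [e1, Real.sin_neg, Real.sin_add]
    have h1 := Real.sin_sq_add_cos_sq ((r - s) / (2 * R))
    have h2 := Real.sin_sq_add_cos_sq ((s - t) / (2 * R))
    generalize Real.sin ((r - s) / (2 * R)) = p at *
    generalize Real.sin ((s - t) / (2 * R)) = q at *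
    generalize Real.cos ((r - s) / (2 * R)) = p' at *
    generalize Real.cos ((s - t) / (2 * R)) = q' at *
    have h1' : p' ^ 2 = 1 - p ^ 2 := by linarith
    have h2' : q' ^ 2 = 1 - q ^ 2 := by linarith
    have e3 : (-(p * q' + p' * q)) ^ 2 = p ^ 2 * (1 - q ^ 2) + (1 - p ^ 2) * q ^ 2
        + 2 * p * q * (p' * q') := by
      rw [← h1', ← h2']; ring
    have e4 : (p' * q') ^ 2 = (1 - p ^ 2) * (1 - q ^ 2) := by rw [← h1', ← h2']; ring
    rw [e3]
    generalize p' * q' = m at *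
    field_simp
    linear_combination (4 * p ^ 2 * q ^ 2) * e4
  · rw [hc, hc, hc, sq_abs, sq_abs, sq_abs]
    ring

theorem ModelPlane.exists_coords_eq {K : ℝ} {x : E3} (h : if K = 0 then x 2 = 0 else ‖x‖ = 1 / √K) :
    ∃ y : ModelPlane K, y.coords = x := ⟨⟨x, h⟩, rfl⟩

theorem ModelPlane.exists_curve_eq {K : ℝ} {f : ℝ → E3}
    (h : ∀ t, if K = 0 then f t 2 = 0 else ‖f t‖ = 1 / √K) :
    ∃ c : ℝ → ModelPlane K, ∀ t, (c t).coords = f t := ⟨fun t => ⟨f t, h t⟩, fun _ => rfl⟩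

/-- There are circles of every curvature. -/
theorem exists_isKappaCircle (hK : 0 ≤ K) (hκ : 0 ≤ κ) :
    ∃ c : ℝ → ModelPlane K, IsKappaCircle K κ c := by
  have n0 : ‖(EuclideanSpace.single 0 1 : E3)‖ = 1 := by simp
  have n1 : ‖(EuclideanSpace.single 1 1 : E3)‖ = 1 := by simp
  have n01 : ⟪(EuclideanSpace.single 0 1 : E3), EuclideanSpace.single 1 1⟫ = 0 := by
    simp [EuclideanSpace.inner_single_left]
  have i2 : ∀ a b h : ℝ, ‖h • (EuclideanSpace.single 2 1 : E3) + a • EuclideanSpace.single 0 1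
      + b • EuclideanSpace.single 1 1‖ ^ 2 = h ^ 2 + a ^ 2 + b ^ 2 := by
    intro a b h
    rw [EuclideanSpace.norm_sq_eq, Fin.sum_univ_three]
    simp
    ring
  rcases (show 0 ≤ K + κ ^ 2 by positivity).eq_or_lt with h | h
  · have hK0 : K = 0 := by nlinarith [sq_nonneg κ]
    have hκ0 : κ = 0 := by
      rw [hK0, zero_add] at h
      exact pow_eq_zero_iff two_ne_zero |>.1 h.symm
    subst hK0 hκ0
    obtain ⟨c, hc⟩ := ModelPlane.exists_curve_eq (K := 0)
      (f := fun t => (0 : E3) + t • EuclideanSpace.single 0 1) (by simp)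
    exact ⟨c, isKappaCircle_of_line n0 hc⟩
  · set R := (√(K + κ ^ 2))⁻¹ with hR
    have hR0 : 0 < R := inv_pos.2 (Real.sqrt_pos.2 h)
    have hRs : R⁻¹ ^ 2 = K + κ ^ 2 := by rw [hR, inv_inv, Real.sq_sqrt h.le]
    -- A horizontal circle at height `√(1 / K - R²)`. For `K = 0` the conventions `0⁻¹ = 0` and `√x
    -- = 0` for negative `x` make the height zero, so the circle lies in the plane.
    obtain ⟨c, hc⟩ := ModelPlane.exists_curve_eq (K := K)
      (f := circlePoint R (√(K⁻¹ - R ^ 2) • EuclideanSpace.single 2 1) (EuclideanSpace.single 0 1)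
        (EuclideanSpace.single 1 1)) (by
        intro t
        split_ifs with hK0
        · subst hK0
          have : √(0⁻¹ - R ^ 2) = 0 := Real.sqrt_eq_zero_of_nonpos (by simp; positivity)
          rw [circlePoint, this]
          simp
        · have hK' := hK.lt_of_ne' hK0
          have hs : 0 ≤ K⁻¹ - R ^ 2 := by
            rw [hR, inv_pow, Real.sq_sqrt h.le, sub_nonneg]
            apply inv_anti₀ hK'
            nlinarith
          rw [← sq_eq_sq₀ (norm_nonneg _) (by positivity), circlePoint, i2, Real.sq_sqrt hs,
            div_pow, Real.sq_sqrt hK]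
          linear_combination R ^ 2 * Real.sin_sq_add_cos_sq (t / R))
    exact ⟨c, isKappaCircle_of_circlePoint hK hκ hR0 hRs n0 n1 n01 hc⟩

theorem exists_circlePoint_eq {R a b : ℝ} (hR : 0 < R) (h : a ^ 2 + b ^ 2 = R ^ 2) (o u v : E3) :
    ∃ t, circlePoint R o u v t = o + a • u + b • v := by
  set z : ℂ := ⟨a, b⟩
  have hz : ‖z‖ = R := by
    rw [Complex.norm_def, Complex.normSq_mk, ← pow_two, ← pow_two, h, Real.sqrt_sq hR.le]
  have h1 := Complex.norm_mul_cos_arg z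
  have h2 := Complex.norm_mul_sin_arg z
  rw [hz] at h1 h2
  refine ⟨R * z.arg, ?_⟩
  rw [circlePoint, mul_div_cancel_left₀ _ hR.ne', h1, h2]

theorem norm_circlePoint_sq {R : ℝ} {o u v : E3} (hu : ‖u‖ = 1) (hv : ‖v‖ = 1)
    (huv : ⟪u, v⟫ = 0) (hou : ⟪o, u⟫ = 0) (hov : ⟪o, v⟫ = 0) (t : ℝ) :
    ‖circlePoint R o u v t‖ ^ 2 = ‖o‖ ^ 2 + R ^ 2 := by
  rw [circlePoint, ← real_inner_self_eq_norm_sq, ← real_inner_self_eq_norm_sq]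
  simp only [inner_add_left, inner_add_right, real_inner_smul_left, real_inner_smul_right]
  rw [real_inner_comm o u, real_inner_comm o v, real_inner_comm u v, huv, hou, hov,
    real_inner_self_eq_norm_sq u, real_inner_self_eq_norm_sq v, hu, hv]
  linear_combination R ^ 2 * Real.sin_sq_add_cos_sq (t / R)

/-- Three distinct points of the model plane lie on a circle. -/
theorem exists_isKappaCircle_through (hK : 0 ≤ K) {p q m : ModelPlane K} (hpq : p ≠ q)
    (hqm : q ≠ m) (hmp : m ≠ p) : ∃ κ c, IsKappaCircle K κ c ∧ p ∈ range c ∧ q ∈ range c ∧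
      m ∈ range c := by
  have ha := norm_coords_sub_pos hpq.symm
  set u := q.coords - p.coords with hu
  set v := m.coords - p.coords with hv
  set a := ‖u‖ with had
  have hq : q.coords = p.coords + u := by rw [hu]; abel
  have hm : m.coords = p.coords + v := by rw [hv]; abel
  set e₁ := a⁻¹ • u with he₁
  have ne₁ : ‖e₁‖ = 1 := by
    rw [he₁, norm_smul, norm_inv, Real.norm_eq_abs, abs_of_pos ha, inv_mul_cancel₀ ha.ne']
  have hue : u = a • e₁ := by rw [he₁, smul_smul, mul_inv_cancel₀ ha.ne', one_smul]
  set x := ⟪e₁, v⟫ with hx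
  set w := v - x • e₁ with hw
  have hew : ⟪e₁, w⟫ = 0 := by
    rw [hw, inner_sub_right, real_inner_smul_right, real_inner_self_eq_norm_sq, ne₁, ← hx]; ring
  have hplane : K = 0 → p.coords 2 = 0 ∧ q.coords 2 = 0 ∧ m.coords 2 = 0 := by
    intro h0
    have hp2 := p.2
    have hq2 := q.2
    have hm2 := m.2
    rw [if_pos h0] at hp2 hq2 hm2
    exact ⟨hp2, hq2, hm2⟩
  -- `w` is the part of `m - p` orthogonal to `q - p`; it vanishes when the points are collinear in
  -- space. On the sphere this cannot occur, since a line meets it in at most two points.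
  by_cases hw0 : w = 0
  · have hve : v = x • e₁ := by rw [← sub_eq_zero, ← hw, hw0]
    rcases hK.eq_or_lt with rfl | hK'
    · obtain ⟨h2, h3, -⟩ := hplane rfl
      obtain ⟨c, hc⟩ := ModelPlane.exists_curve_eq (K := 0)
        (f := fun t => p.coords + t • e₁) (by
          intro t
          rw [if_pos rfl, he₁, hu]
          simp [h2, h3])
      refine ⟨0, c, isKappaCircle_of_line ne₁ hc, ⟨0, coords_injective ?_⟩,
        ⟨a, coords_injective ?_⟩, ⟨x, coords_injective ?_⟩⟩
      · rw [hc]; simp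
      · rw [hc, hq, hue]
      · rw [hc, hm, hve]
    · exfalso
      have e1 := K_mul_inner_self hK' p
      have e2 := K_mul_inner_self hK' q
      have e3 := K_mul_inner_self hK' m
      rw [hq, hue] at e2
      rw [hm, hve] at e3
      simp only [inner_add_left, inner_add_right, real_inner_smul_left, real_inner_smul_right] at e2 e3
      rw [real_inner_self_eq_norm_sq e₁, ne₁, real_inner_comm p.coords] at e2 e3
      have e4 : K * (x * (x - a)) * a = 0 := by linear_combination a * (e3 - e1) - x * (e2 - e1)
      have e5 : x * (x - a) = 0 := by
        simpa [ha.ne', hK'.ne'] using e4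
      rcases mul_eq_zero.1 e5 with h | h
      · apply hmp
        apply coords_injective
        rw [hm, hve, h]; simp
      · apply hqm
        apply coords_injective
        rw [hq, hm, hue, hve, sub_eq_zero.1 h]
  · have hy : 0 < ‖w‖ := norm_pos_iff.2 hw0
    set y := ‖w‖ with hyd
    set e₂ := y⁻¹ • w with he₂
    have ne₂ : ‖e₂‖ = 1 := by
      rw [he₂, norm_smul, norm_inv, Real.norm_eq_abs, abs_of_pos hy, inv_mul_cancel₀ hy.ne']
    have hwe : w = y • e₂ := by rw [he₂, smul_smul, mul_inv_cancel₀ hy.ne', one_smul]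
    have hve : v = x • e₁ + y • e₂ := by rw [← hwe, hw]; abel
    have h12 : ⟪e₁, e₂⟫ = 0 := by rw [he₂, real_inner_smul_right, hew, mul_zero]
    -- In the frame `e₁, e₂` at `p` the other vertices are `(a, 0)` and `(x, y)`, and the
    -- circumcentre is `(a / 2, η)`.
    set η := (x ^ 2 + y ^ 2 - a * x) / (2 * y) with hη
    have hη' : 2 * y * η = x ^ 2 + y ^ 2 - a * x := by rw [hη]; field_simp
    set R := √(a ^ 2 / 4 + η ^ 2) with hR
    have hR2 : R ^ 2 = a ^ 2 / 4 + η ^ 2 := Real.sq_sqrt (by positivity)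
    have hR0 : 0 < R := Real.sqrt_pos.2 (by positivity)
    set o := p.coords + (a / 2) • e₁ + η • e₂ with ho
    have hoo : K ≠ 0 → ⟪o, e₁⟫ = 0 ∧ ⟪o, e₂⟫ = 0 ∧ K * (‖o‖ ^ 2 + R ^ 2) = 1 := by
      intro h0
      have hK' := hK.lt_of_ne' h0
      have e1 := K_mul_inner_self hK' p
      have e2 := K_mul_inner_self hK' q
      have e3 := K_mul_inner_self hK' m
      rw [hq, hue] at e2
      rw [hm, hve] at e3
      have h21 : ⟪e₂, e₁⟫ = 0 := by rw [real_inner_comm, h12]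
      simp only [inner_add_left, inner_add_right, real_inner_smul_left, real_inner_smul_right,
        real_inner_self_eq_norm_sq e₁, ne₁, real_inner_self_eq_norm_sq e₂, ne₂, h12, h21,
        real_inner_comm p.coords] at e2 e3
      rw [← real_inner_self_eq_norm_sq, hR2, ho]
      simp only [inner_add_left, inner_add_right, real_inner_smul_left, real_inner_smul_right,
        real_inner_self_eq_norm_sq e₁, ne₁, real_inner_self_eq_norm_sq e₂, ne₂, h12, h21,
        real_inner_comm p.coords]
      have i1 : ⟪p.coords, e₁⟫ = -(a / 2) := by
        have : K * a * 2 * (⟪p.coords, e₁⟫ + a / 2) = 0 := by linear_combination e2 - e1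
        have := (mul_eq_zero.1 this).resolve_left (by positivity)
        linarith
      have i2 : ⟪p.coords, e₂⟫ = -η := by
        rw [i1] at e3
        have : K * y * 2 * (⟪p.coords, e₂⟫ + η) = 0 := by
          linear_combination e3 - e1 + K * hη'
        have := (mul_eq_zero.1 this).resolve_left (by positivity)
        linarith
      rw [i1, i2]
      refine ⟨by ring, by ring, ?_⟩
      linear_combination e1
    have hRK : K ≤ R⁻¹ ^ 2 := by
      rcases hK.eq_or_lt with rfl | hK'
      · positivity
      · have := (hoo hK'.ne').2.2
        rw [inv_pow, ← one_div, le_div_iff₀ (by positivity)]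
        have : 0 ≤ K * ‖o‖ ^ 2 := by positivity
        linarith
    obtain ⟨c, hc⟩ := ModelPlane.exists_curve_eq (K := K) (f := circlePoint R o e₁ e₂) (by
      intro t
      split_ifs with h0
      · obtain ⟨h2, h3, h4⟩ := hplane h0
        have a1 : e₁ 2 = 0 := by rw [he₁, hu]; simp [h2, h3]
        have a2 : e₂ 2 = 0 := by rw [he₂, hw, hv]; simp [h2, h4, a1]
        rw [circlePoint, ho]
        simp [a1, a2, h2]
      · obtain ⟨h1, h2, h3⟩ := hoo h0
        have hK' := hK.lt_of_ne' h0
        rw [← sq_eq_sq₀ (norm_nonneg _) (by positivity), norm_circlePoint_sq ne₁ ne₂ h12 h1 h2,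
          div_pow, Real.sq_sqrt hK]
        field_simp
        linarith)
    obtain ⟨t1, ht1⟩ := exists_circlePoint_eq (a := -(a / 2)) (b := -η) hR0
      (by rw [hR2]; ring) o e₁ e₂
    obtain ⟨t2, ht2⟩ := exists_circlePoint_eq (a := a / 2) (b := -η) hR0
      (by rw [hR2]; ring) o e₁ e₂
    obtain ⟨t3, ht3⟩ := exists_circlePoint_eq (a := x - a / 2) (b := y - η) hR0
      (by rw [hR2]; linear_combination -hη') o e₁ e₂
    refine ⟨√(R⁻¹ ^ 2 - K), c, isKappaCircle_of_circlePoint hK (Real.sqrt_nonneg _) hR0 ?_ ne₁ ne₂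
      h12 hc, ⟨t1, coords_injective ?_⟩, ⟨t2, coords_injective ?_⟩, ⟨t3, coords_injective ?_⟩⟩
    · rw [Real.sq_sqrt (by linarith)]; ring
    · rw [hc, ht1, ho]; module
    · rw [hc, ht2, hq, hue, ho]; module
    · rw [hc, ht3, hm, hve, ho]; module

/-- The osculating curvature of three points, in terms of their mutual chords. -/
theorem oscCurvature_spec (hK : 0 ≤ K) {p q m : ModelPlane K} (hpq : p ≠ q) (hqm : q ≠ m)
    (hmp : m ≠ p) : 0 ≤ oscCurvature K p q m ∧
      CircumEq (‖p.coords - q.coords‖ ^ 2) (‖q.coords - m.coords‖ ^ 2)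
        (‖m.coords - p.coords‖ ^ 2) (K + oscCurvature K p q m ^ 2) := by
  obtain ⟨κ, c, hc, ⟨r, hr⟩, ⟨s, hs⟩, ⟨t, ht⟩⟩ := exists_isKappaCircle_through hK hpq hqm hmp
  have hκ := hc.nonneg
  have h1 := hc.circumEq hK r s t
  rw [hr, hs, ht] at h1
  have key : {κ : ℝ | ∃ p' q' m' : ModelPlane K,
      dist p' q' = dist p q ∧ dist q' m' = dist q m ∧ dist m' p' = dist m p ∧
      ∃ c : ℝ → ModelPlane K, IsKappaCircle K κ c ∧ p' ∈ range c ∧ q' ∈ range c ∧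
        m' ∈ range c} = {κ} := by
    ext κ'
    constructor
    · rintro ⟨p', q', m', d1, d2, d3, c', hc', ⟨r', rfl⟩, ⟨s', rfl⟩, ⟨t', rfl⟩⟩
      have h2 := hc'.circumEq hK r' s' t'
      rw [norm_coords_sub_eq_of_dist_eq hK d1, norm_coords_sub_eq_of_dist_eq hK d2,
        norm_coords_sub_eq_of_dist_eq hK d3] at h2
      have h3 := norm_coords_sub_pos hpq
      have h4 := norm_coords_sub_pos hqm
      have h5 := norm_coords_sub_pos hmp
      have h6 := h1.trans h2.symm
      have h7 := mul_right_cancel₀ (by positivity) h6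
      exact ((sq_eq_sq₀ hκ hc'.nonneg).1 (by linarith)).symm
    · rintro rfl
      exact ⟨p, q, m, rfl, rfl, rfl, c, hc, ⟨r, hr⟩, ⟨s, hs⟩, ⟨t, ht⟩⟩
  rw [oscCurvature, key, csInf_singleton]
  exact ⟨hκ, h1⟩

theorem oscCurvature_nonneg {X : Type*} [MetricSpace X] (p q m : X) : 0 ≤ oscCurvature K p q m := by
  apply Real.sInf_nonneg
  rintro κ ⟨p', q', m', -, -, -, c, hc, -⟩
  exact hc.nonneg

/-! ### Arcs of circles -/

theorem arcChordValue_nonneg (ℓ r : ℝ) : 0 ≤ arcChordValue K ℓ r := by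
  apply Real.sInf_nonneg
  rintro κ ⟨c, hc, -⟩
  exact hc.nonneg

/-- In space a `κ`-circle is a circle of radius `1 / √(K + κ²)`, or a line if this is infinite.
Overlap and chord depend on `K` and `κ` through this radius alone. -/
theorem IsKappaCircle.arc (hK : 0 ≤ K) {c : ℝ → ModelPlane K} (h : IsKappaCircle K κ c) {ℓ : ℝ}
    (hℓ : 0 < ℓ) : (InjOn c (Ico 0 ℓ) ↔ √(K + κ ^ 2) * ℓ ≤ 2 * Real.pi) ∧
      (√(K + κ ^ 2) * ℓ ≤ 2 * Real.pi →
        ‖(c 0).coords - (c ℓ).coords‖ = ℓ * Real.sinc (√(K + κ ^ 2) * ℓ / 2)) := by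
  rcases h.chord hK with ⟨R, hR, e, hc⟩ | ⟨rfl, rfl, hc⟩
  · have hs : √(K + κ ^ 2) = R⁻¹ := by rw [← e, Real.sqrt_sq (by positivity)]
    rw [hs, inv_mul_eq_div, div_le_iff₀ hR]
    constructor
    · constructor
      · intro hi
        by_contra! hlt
        have h1 := hc 0 (2 * Real.pi * R)
        have h2 : (0 - 2 * Real.pi * R) / (2 * R) = -Real.pi := by field_simp; ring
        rw [h2, Real.sin_neg, Real.sin_pi, neg_zero, zero_pow two_ne_zero, mul_zero] at h1
        have h3 := norm_eq_zero.1 (pow_eq_zero_iff two_ne_zero |>.1 h1)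
        have h4 := hi ⟨le_rfl, hℓ⟩ ⟨by positivity, hlt⟩ (coords_injective (sub_eq_zero.1 h3))
        have : 0 < 2 * Real.pi * R := by positivity
        linarith
      · intro hle
        have key : ∀ s ∈ Ico 0 ℓ, ∀ t ∈ Ico 0 ℓ, s < t → c s ≠ c t := by
          intro s hs t ht hst heq
          have h1 := hc t s
          rw [heq, sub_self, norm_zero] at h1
          have h2 : 0 < Real.sin ((t - s) / (2 * R)) := by
            apply Real.sin_pos_of_pos_of_lt_pi
            · have := sub_pos.2 hst; positivity
            · rw [div_lt_iff₀ (by positivity)]; linarith [hs.1, ht.2]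
          have : 0 < 4 * R ^ 2 * Real.sin ((t - s) / (2 * R)) ^ 2 := by positivity
          linarith
        intro s hs t ht heq
        rcases lt_trichotomy s t with h | h | h
        · exact absurd heq (key s hs t ht h)
        · exact h
        · exact absurd heq.symm (key t ht s hs h)
    · intro hle
      have h0 : 0 ≤ Real.sin (ℓ / R / 2) := by
        apply Real.sin_nonneg_of_nonneg_of_le_pi (by positivity)
        rw [div_div, div_le_iff₀ (by positivity)]; linarith
      have h1 : ℓ * Real.sinc (ℓ / R / 2) = 2 * R * Real.sin (ℓ / R / 2) := by
        rw [← Real.mul_sinc]; field_simp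
      rw [h1, ← sq_eq_sq₀ (norm_nonneg _) (by positivity), norm_sub_rev, norm_sub_rev, hc,
        zero_sub, neg_div, Real.sin_neg, div_div]
      rw [mul_comm R 2]; ring
  · have h0 : √(0 + (0 : ℝ) ^ 2) = 0 := by simp
    rw [h0]
    refine ⟨⟨fun _ => by simp [Real.pi_pos.le], fun _ => ?_⟩, fun _ => ?_⟩
    · intro s _ t _ hst
      have := hc s t
      rw [hst, sub_self, norm_zero] at this
      exact sub_eq_zero.1 (abs_eq_zero.1 this.symm)
    · rw [hc]; simp [abs_of_pos hℓ]

/-- The arc/chord curvature is determined by the equation for the chord. -/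
theorem arcChordValue_eq (hK : 0 ≤ K) (hκ : 0 ≤ κ) {ℓ : ℝ} (hℓ : 0 < ℓ)
    (h : √(K + κ ^ 2) * ℓ ≤ 2 * Real.pi) {x y : ModelPlane K}
    (hxy : ‖x.coords - y.coords‖ = ℓ * Real.sinc (√(K + κ ^ 2) * ℓ / 2)) :
    arcChordValue K ℓ (dist x y) = κ := by
  have key : {κ : ℝ | ∃ c : ℝ → ModelPlane K, IsKappaCircle K κ c ∧ InjOn c (Ico 0 ℓ) ∧
    dist (c 0) (c ℓ) = dist x y} = {κ} := by
    ext κ'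
    constructor
    · rintro ⟨c, hc, hi, hd⟩
      obtain ⟨h1, h2⟩ := hc.arc hK hℓ
      have h3 := h1.1 hi
      have h4 := h2 h3
      rw [norm_coords_sub_eq_of_dist_eq hK hd, hxy] at h4
      have h5 := mul_left_cancel₀ hℓ.ne' h4
      have h6 := Real.strictAntiOn_sinc.injOn
        (x₁ := √(K + κ ^ 2) * ℓ / 2) ⟨by positivity, by linarith⟩ ⟨by positivity, by linarith⟩ h5
      have h7 : √(K + κ ^ 2) = √(K + κ' ^ 2) := by
        have : √(K + κ ^ 2) * ℓ = √(K + κ' ^ 2) * ℓ := by linarith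
        exact mul_right_cancel₀ hℓ.ne' this
      have h8 := (Real.sqrt_inj (by positivity) (by positivity)).1 h7
      exact ((sq_eq_sq₀ hκ hc.nonneg).1 (by linarith)).symm
    · rintro rfl
      obtain ⟨c, hc⟩ := exists_isKappaCircle (κ := κ') hK hκ
      obtain ⟨h1, h2⟩ := hc.arc hK hℓ
      exact ⟨c, hc, h1.2 h, dist_eq_of_norm_coords_sub_eq hK ((h2 h).trans hxy.symm)⟩
  rw [arcChordValue, key, csInf_singleton]

/-- The intermediate value theorem for `sinc` between `√K ℓ / 2`, the case of a geodesic, and `π`,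
the case of a full circle. -/
theorem exists_arcChord (hK : 0 ≤ K) {ℓ d : ℝ} (hℓ : 0 < ℓ) (hd : 0 ≤ d) (h : √K * ℓ ≤ 2 * Real.pi)
    (hdl : d ≤ ℓ * Real.sinc (√K * ℓ / 2)) :
    ∃ κ, 0 ≤ κ ∧ √(K + κ ^ 2) * ℓ ≤ 2 * Real.pi ∧
      d = ℓ * Real.sinc (√(K + κ ^ 2) * ℓ / 2) := by
  have h1 : √K * ℓ / 2 ≤ Real.pi := by linarith
  have h2 := intermediate_value_Icc' h1 Real.continuous_sinc.continuousOn
  have h3 : d / ℓ ∈ Icc (Real.sinc Real.pi) (Real.sinc (√K * ℓ / 2)) := by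
    rw [Real.sinc_pi]
    exact ⟨by positivity, by rw [div_le_iff₀ hℓ]; linarith⟩
  obtain ⟨x, hx, hxd⟩ := h2 h3
  have hβ : √K ≤ 2 * x / ℓ := by rw [le_div_iff₀ hℓ]; linarith [hx.1]
  have hβ2 : K ≤ (2 * x / ℓ) ^ 2 := by
    calc K = √K ^ 2 := (Real.sq_sqrt hK).symm
      _ ≤ _ := by gcongr
  have hx0 : 0 ≤ x := le_trans (by positivity) hx.1
  have e : √(K + √((2 * x / ℓ) ^ 2 - K) ^ 2) = 2 * x / ℓ := by
    rw [Real.sq_sqrt (by linarith), add_sub_cancel, Real.sqrt_sq (by positivity)]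
  refine ⟨√((2 * x / ℓ) ^ 2 - K), Real.sqrt_nonneg _, ?_, ?_⟩
  · rw [e, div_mul_cancel₀ _ hℓ.ne']; linarith [hx.2]
  · have : 2 * x / ℓ * ℓ / 2 = x := by field_simp
    rw [e, this, hxd]; field_simp

/-- The chord of an arc that satisfies the condition for comparison. -/
theorem norm_coords_sub_le_sinc (hK : 0 ≤ K) {ℓ : ℝ} {x y : ModelPlane K}
    (hxy : dist x y ≤ ℓ) (h : 0 < K → ℓ + dist x y ≤ 2 * Real.pi / √K) :
    √K * ℓ ≤ 2 * Real.pi ∧ ‖x.coords - y.coords‖ ≤ ℓ * Real.sinc (√K * ℓ / 2) := by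
  rcases hK.eq_or_lt with rfl | hK'
  · refine ⟨by simp [Real.pi_pos.le], ?_⟩
    simpa using (norm_coords_sub_le_dist le_rfl x y).trans hxy
  · have hs := Real.sqrt_pos.2 hK'
    have h1 := h hK'
    rw [le_div_iff₀ hs] at h1
    have h0 : 0 ≤ √K * dist x y := by positivity
    refine ⟨by linarith, ?_⟩
    have e : ∀ a : ℝ, √K / 2 * (a * Real.sinc (√K * a / 2)) = Real.sin (√K * a / 2) := by
      intro a; rw [← Real.mul_sinc]; ring
    rw [norm_coords_sub hK]
    refine le_of_mul_le_mul_left ?_ (show 0 < √K / 2 by positivity)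
    rw [e, e]
    have h2 : √K * dist x y ≤ √K * ℓ := by gcongr
    -- Beyond `π / 2` the sine decreases. The perimeter condition says `√K d / 2 ≤ π - √K ℓ / 2`, so
    -- the comparison is made after reflection in `π / 2`.
    rcases le_total (√K * ℓ / 2) (Real.pi / 2) with h3 | h3
    · exact Real.sin_le_sin_of_le_of_le_pi_div_two (by linarith [Real.pi_pos]) h3 (by linarith)
    · rw [← Real.sin_pi_sub (√K * ℓ / 2)]
      exact Real.sin_le_sin_of_le_of_le_pi_div_two (by linarith [Real.pi_pos]) (by linarith)
        (by linarith)

/-- For fixed length the chord of a non-overlapping `κ`-arc strictly decreases in `κ`. The perimeter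
condition ensures that a `κ`-arc with the given chord exists at all. -/
theorem le_arcChordValue (hK : 0 ≤ K) {ℓ : ℝ} (hℓ : 0 < ℓ) {x y : ModelPlane K}
    (hxy : dist x y ≤ ℓ) (h : 0 < K → ℓ + dist x y ≤ 2 * Real.pi / √K)
    (h1 : √(K + κ ^ 2) * ℓ ≤ 2 * Real.pi)
    (h2 : ‖x.coords - y.coords‖ ≤ ℓ * Real.sinc (√(K + κ ^ 2) * ℓ / 2)) :
    κ ≤ arcChordValue K ℓ (dist x y) := by
  obtain ⟨h3, h4⟩ := norm_coords_sub_le_sinc hK hxy h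
  obtain ⟨κ', hκ', h5, h6⟩ := exists_arcChord hK hℓ (norm_nonneg _) h3 h4
  rw [arcChordValue_eq hK hκ' hℓ h5 h6]
  rw [h6] at h2
  by_contra! hlt
  have h7 : √(K + κ' ^ 2) < √(K + κ ^ 2) := Real.sqrt_lt_sqrt (by positivity) (by gcongr)
  have h8 := Real.strictAntiOn_sinc (a := √(K + κ' ^ 2) * ℓ / 2) (b := √(K + κ ^ 2) * ℓ / 2)
    ⟨by positivity, by linarith⟩ ⟨by positivity, by linarith⟩ (by gcongr)
  have := le_of_mul_le_mul_left h2 hℓ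
  linarith

end

section

open ModelPlane

/-! ### Circumradii of triangles in a convex curve -/

variable {K κ : ℝ} {G p : ℝ → ℝ}

theorem PolarFrame.K_mul_inner_curve (F : PolarFrame K) (hG : ConvexRadial K G) (hK : K ≠ 0)
    (t : ℝ) : K * ⟪F.curve G t, F.curve G t⟫ = 1 := by
  have ht := radW_pos (hG.pos_add t)
  have ht2 := radW_sq (hG.pos_add t)
  rcases F.origin with ⟨h, -⟩ | ⟨-, hc, h⟩
  · exact absurd h hK
  simp only [PolarFrame.curve, hc, zero_add, inner_add_left, inner_add_right, real_inner_smul_left,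
    real_inner_smul_right, F.inner_e_e, F.inner_e_O, F.inner_O_e, sub_self, Real.cos_zero]
  field_simp
  linear_combination G t ^ 2 * h - ht2

theorem PolarFrame.inner_curve_normal (F : PolarFrame K) (hG : ConvexRadial K G) (hK : K ≠ 0)
    (t q : ℝ) : ⟪F.curve G t, F.normal t (G t) q⟫ = 0 := by
  have ht := radW_pos (hG.pos_add t)
  rcases F.origin with ⟨h, -⟩ | ⟨-, hc, h⟩
  · exact absurd h hK
  simp only [PolarFrame.curve, PolarFrame.normal, hc, zero_add, inner_add_left, inner_sub_right,
    real_inner_smul_left, real_inner_smul_right, F.inner_e_e, F.inner_e_O, F.inner_O_e,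
    F.inner_e_e', F.inner_O_e', sub_self, Real.cos_zero, Real.sin_zero]
  field_simp
  linear_combination G t * h

/-- Every point of the curve is touched by a ball of radius `1 / √(K + κ²)` that contains the
curve. -/
theorem PolarFrame.exists_ball (F : PolarFrame K) (hG : ConvexRadial K G) (hκ : 0 < κ)
    (hp : CurvatureGE K G p κ) (t : ℝ) : ∃ w : E3, (K + κ ^ 2) * ‖w‖ ^ 2 = 1 ∧
      ∀ u, ‖F.curve G u - F.curve G t‖ ^ 2 ≤ 2 * ⟪F.curve G u - F.curve G t, w⟫ := by
  have hK := hG.nonneg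
  have hl : 0 < K + κ ^ 2 := by positivity
  have hz := radZ_pos (p := p t) (hG.pos_add t)
  have hnn := F.inner_normal_normal (t := t) (p := p t) (hG.pos_add t)
  set n := F.normal t (G t) (p t) with hn
  set z := radZ K (G t) (p t) with hz'
  -- A unit-speed `κ`-circle with this inner normal has acceleration `κ n / z - K γ` in space.
  -- Multiplied by the squared radius `1 / (K + κ²)` it points from the curve to the centre of that
  -- circle, which serves as the centre of the ball.
  refine ⟨(K + κ ^ 2)⁻¹ • ((κ * z⁻¹) • n - K • F.curve G t), ?_, fun u => ?_⟩
  · have h1 : K * ⟪F.curve G t, n⟫ = 0 := by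
      rcases eq_or_ne K 0 with h | h
      · simp [h]
      · rw [F.inner_curve_normal hG h, mul_zero]
    have h2 : K * (K * ⟪F.curve G t, F.curve G t⟫) = K := by
      rcases eq_or_ne K 0 with h | h
      · simp [h]
      · rw [F.K_mul_inner_curve hG h, mul_one]
    have h3 : ‖(κ * z⁻¹) • n - K • F.curve G t‖ ^ 2 = K + κ ^ 2 := by
      rw [← real_inner_self_eq_norm_sq]
      simp only [inner_sub_left, inner_sub_right, real_inner_smul_left, real_inner_smul_right]
      rw [hnn, real_inner_comm (F.curve G t) n]
      field_simp
      linear_combination z * h2 - 2 * κ * h1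
    rw [norm_smul, mul_pow, h3, Real.norm_eq_abs, sq_abs]
    field_simp
  · have h1 := F.excess_nonneg hG hκ hp (hp.slope t) u
    rw [PolarFrame.excess, PolarFrame.chordSq, sub_nonneg] at h1
    have h2 := F.inner_sub_normal' hG t (p t) u
    rw [← hn, ← hz'] at h2
    have h3 : K * ⟪F.curve G u - F.curve G t, F.curve G t⟫ =
        -(K / 2 * ‖F.curve G u - F.curve G t‖ ^ 2) := by
      rcases eq_or_ne K 0 with h | h
      · simp [h]
      · have a1 := F.K_mul_inner_curve hG h t
        have a2 := F.K_mul_inner_curve hG h u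
        rw [← real_inner_self_eq_norm_sq]
        simp only [inner_sub_left, inner_sub_right]
        rw [real_inner_comm (F.curve G u) (F.curve G t)]
        linear_combination (a2 - a1) / 2
    rw [real_inner_smul_right, inner_sub_right, real_inner_smul_right, real_inner_smul_right, h3, h2]
    rw [← mul_assoc, ← div_eq_mul_inv, ← div_eq_mul_inv, ← sub_nonneg]
    have : 2 / (K + κ ^ 2) * (κ / z * (norComp K G t (p t) u * z) -
        -(K / 2 * ‖F.curve G u - F.curve G t‖ ^ 2)) - ‖F.curve G u - F.curve G t‖ ^ 2 =
        2 * κ / (K + κ ^ 2) *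
          (norComp K G t (p t) u - κ / 2 * ‖F.curve G u - F.curve G t‖ ^ 2) := by
      field_simp
      ring
    rw [this]
    have := sub_nonneg.2 h1
    positivity

/-- The circumradius of a triangle with longest side opposite to the vertex at the origin, in a
ball with the origin on its boundary. -/
theorem circumEq_le_of_ball {u v w : E3} {l : ℝ} (hl : 0 ≤ l) (hw : l * ‖w‖ ^ 2 = 1)
    (hu : ‖u‖ ^ 2 ≤ 2 * ⟪u, w⟫) (hv : ‖v‖ ^ 2 ≤ 2 * ⟪v, w⟫) (h1 : ‖u‖ ≤ ‖u - v‖)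
    (h2 : ‖v‖ ≤ ‖u - v‖) :
    l * (‖u‖ ^ 2 * ‖v‖ ^ 2 * ‖u - v‖ ^ 2) ≤
      4 * ‖u‖ ^ 2 * ‖v‖ ^ 2 - (‖u‖ ^ 2 + ‖v‖ ^ 2 - ‖u - v‖ ^ 2) ^ 2 := by
  have e := norm_sub_sq_real u v
  have h1' : ‖u‖ ^ 2 ≤ ‖u - v‖ ^ 2 := by gcongr
  have h2' : ‖v‖ ^ 2 ≤ ‖u - v‖ ^ 2 := by gcongr
  have hU : ‖u‖ ^ 2 = ⟪u, u⟫ := (real_inner_self_eq_norm_sq u).symm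
  have hV : ‖v‖ ^ 2 = ⟪v, v⟫ := (real_inner_self_eq_norm_sq v).symm
  set U := ‖u‖ ^ 2 with hUd
  set V := ‖v‖ ^ 2 with hVd
  set S := ‖u - v‖ ^ 2 with hSd
  have hU0 : 0 ≤ U := sq_nonneg _
  have hV0 : 0 ≤ V := sq_nonneg _
  have hS0 : 0 ≤ S := sq_nonneg _
  set i := ⟪u, v⟫ with hi
  have hP : 0 ≤ V * (U - i) := mul_nonneg hV0 (by linarith)
  have hQ : 0 ≤ U * (V - i) := mul_nonneg hU0 (by linarith)
  -- A multiple of the circumcentre of `0, u, v`. Since the side opposite the origin is longest,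
  -- both coefficients are nonnegative, so the two hypotheses on the ball can be added with these
  -- weights; Cauchy–Schwarz for `o` and `w` gives the rest.
  set o := (V * (U - i)) • u + (U * (V - i)) • v with ho
  have ho1 : U * V * S ≤ 2 * ⟪o, w⟫ := by
    rw [ho, inner_add_left, real_inner_smul_left, real_inner_smul_left]
    have a1 := mul_le_mul_of_nonneg_left hu hP
    have a2 := mul_le_mul_of_nonneg_left hv hQ
    calc U * V * S = V * (U - i) * U + U * (V - i) * V := by rw [e]; ring
      _ ≤ _ := by linarith
  have ho2 : ‖o‖ ^ 2 = (U * V - i ^ 2) * (U * V * S) := by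
    rw [← real_inner_self_eq_norm_sq, ho]
    simp only [inner_add_left, inner_add_right, real_inner_smul_left, real_inner_smul_right]
    rw [← hU, ← hV, real_inner_comm u v, ← hi, e]
    ring
  have ho3 : ⟪o, w⟫ ^ 2 ≤ ‖o‖ ^ 2 * ‖w‖ ^ 2 := by
    rw [← mul_pow]
    exact sq_le_sq' (by linarith [neg_le_of_abs_le (abs_real_inner_le_norm o w)])
      (real_inner_le_norm o w)
  have hM0 : 0 ≤ U * V * S := by positivity
  rcases hM0.eq_or_lt with hM | hM
  · rw [← hM, mul_zero]
    have : (U + V - S) = 2 * i := by rw [e]; ring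
    rw [this]
    have := abs_le.1 (abs_real_inner_le_norm u v)
    have := sq_le_sq' this.1 this.2
    rw [mul_pow] at this
    nlinarith
  · have h5 : (U * V * S) ^ 2 ≤ 4 * (‖o‖ ^ 2 * ‖w‖ ^ 2) := by
      have := pow_le_pow_left₀ hM0 ho1 2
      linarith
    have h6 : l * (U * V * S) ^ 2 ≤ 4 * (U * V - i ^ 2) * (U * V * S) := by
      calc l * (U * V * S) ^ 2 ≤ l * (4 * (‖o‖ ^ 2 * ‖w‖ ^ 2)) := by gcongr
        _ = _ := by rw [ho2]; linear_combination 4 * ((U * V - i ^ 2) * (U * V * S)) * hw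
    have h7 : l * (U * V * S) ≤ 4 * (U * V - i ^ 2) := by
      refine le_of_mul_le_mul_right ?_ hM
      linarith
    have : (U + V - S) = 2 * i := by rw [e]; ring
    rw [this]
    linarith

/-- The circumradius of a triangle, if at each vertex there is a ball that contains it. -/
theorem circumEq_le_of_balls {x y z : E3} {l : ℝ} (hl : 0 ≤ l)
    (hx : ∃ w : E3, l * ‖w‖ ^ 2 = 1 ∧ ‖y - x‖ ^ 2 ≤ 2 * ⟪y - x, w⟫ ∧ ‖z - x‖ ^ 2 ≤ 2 * ⟪z - x, w⟫)
    (hy : ∃ w : E3, l * ‖w‖ ^ 2 = 1 ∧ ‖z - y‖ ^ 2 ≤ 2 * ⟪z - y, w⟫ ∧ ‖x - y‖ ^ 2 ≤ 2 * ⟪x - y, w⟫)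
    (hz : ∃ w : E3, l * ‖w‖ ^ 2 = 1 ∧ ‖x - z‖ ^ 2 ≤ 2 * ⟪x - z, w⟫ ∧
      ‖y - z‖ ^ 2 ≤ 2 * ⟪y - z, w⟫) :
    l * (‖x - y‖ ^ 2 * ‖y - z‖ ^ 2 * ‖z - x‖ ^ 2) ≤
      4 * ‖x - y‖ ^ 2 * ‖y - z‖ ^ 2 - (‖x - y‖ ^ 2 + ‖y - z‖ ^ 2 - ‖z - x‖ ^ 2) ^ 2 := by
  have key : ∀ x y z : E3, (∃ w : E3, l * ‖w‖ ^ 2 = 1 ∧ ‖y - x‖ ^ 2 ≤ 2 * ⟪y - x, w⟫ ∧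
      ‖z - x‖ ^ 2 ≤ 2 * ⟪z - x, w⟫) → ‖x - y‖ ≤ ‖y - z‖ → ‖z - x‖ ≤ ‖y - z‖ →
      l * (‖x - y‖ ^ 2 * ‖y - z‖ ^ 2 * ‖z - x‖ ^ 2) ≤
      4 * ‖x - y‖ ^ 2 * ‖y - z‖ ^ 2 - (‖x - y‖ ^ 2 + ‖y - z‖ ^ 2 - ‖z - x‖ ^ 2) ^ 2 := by
    rintro x y z ⟨w, hw, h1, h2⟩ h3 h4
    have e : y - x - (z - x) = y - z := by abel
    have := circumEq_le_of_ball hl hw h1 h2 (by rwa [e, norm_sub_rev]) (by rwa [e])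
    rw [e, norm_sub_rev y x] at this
    linarith
  rcases le_total ‖x - y‖ ‖y - z‖ with h1 | h1
  · rcases le_total ‖z - x‖ ‖y - z‖ with h2 | h2
    · exact key x y z hx h1 h2
    · have := key y z x hy h2 (h1.trans h2)
      linarith
  · rcases le_total ‖z - x‖ ‖x - y‖ with h2 | h2
    · have := key z x y hz h2 h1
      linarith
    · have := key y z x hy (h1.trans h2) h2
      linarith

/-- The osculating curvature of three points of a curve of curvature at least `κ`. -/
theorem PolarFrame.le_oscCurvature (F : PolarFrame K) (hG : ConvexRadial K G) (hκ : 0 < κ)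
    (hp : CurvatureGE K G p κ) {x y z : ModelPlane K} (hxy : x ≠ y) (hyz : y ≠ z) (hzx : z ≠ x)
    (hx : x.coords ∈ range (F.curve G)) (hy : y.coords ∈ range (F.curve G))
    (hz : z.coords ∈ range (F.curve G)) : κ ≤ oscCurvature K x y z := by
  have hK := hG.nonneg
  obtain ⟨r, hr⟩ := hx
  obtain ⟨s, hs⟩ := hy
  obtain ⟨t, ht⟩ := hz
  obtain ⟨wr, hwr, hwr'⟩ := F.exists_ball hG hκ hp r
  obtain ⟨ws, hws, hws'⟩ := F.exists_ball hG hκ hp s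
  obtain ⟨wt, hwt, hwt'⟩ := F.exists_ball hG hκ hp t
  have h1 := circumEq_le_of_balls (x := F.curve G r) (y := F.curve G s) (z := F.curve G t)
    (by positivity) ⟨wr, hwr, hwr' s, hwr' t⟩ ⟨ws, hws, hws' t, hws' r⟩ ⟨wt, hwt, hwt' r, hwt' s⟩
  obtain ⟨h2, h3⟩ := oscCurvature_spec hK hxy hyz hzx
  rw [hr, hs, ht, ← h3] at h1
  have h4 := norm_coords_sub_pos hxy
  have h5 := norm_coords_sub_pos hyz
  have h6 := norm_coords_sub_pos hzx
  have h7 := le_of_mul_le_mul_right h1 (by positivity)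
  exact (sq_le_sq₀ hκ.le h2).1 (by linarith)

end

section

open ModelPlane

/-! ### Arc length -/

variable {K κ : ℝ} {G p : ℝ → ℝ}

/-- The speed of a curve with radial coordinate `g` and slope `p`. -/
noncomputable def radSpeed (K g p : ℝ) : ℝ := radZ K g p / radW K g ^ 2

theorem radSpeed_pos {g p : ℝ} (h : 0 < K + g ^ 2) : 0 < radSpeed K g p :=
  div_pos (radZ_pos h) (pow_pos (radW_pos h) 2)

theorem PolarFrame.norm_velocity (F : PolarFrame K) {t g p : ℝ} (h : 0 < K + g ^ 2) :
    ‖F.velocity t g p‖ = radSpeed K g p := by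
  have hw := radW_pos h
  have hz := radZ_pos (p := p) h
  have h1 := F.inner_tangent_tangent (t := t) (p := p) h
  rw [real_inner_self_eq_norm_sq, ← mul_pow] at h1
  have h2 := (sq_eq_sq₀ (norm_nonneg _) (by positivity)).1 h1
  rw [PolarFrame.velocity, norm_smul, h2, radSpeed, norm_inv, norm_pow, Real.norm_eq_abs,
    abs_of_pos hw]
  field_simp

theorem exists_radSpeed_bounds (hG : ConvexRadial K G) (hp : ∀ t, IsSlope G t (p t)) :
    ∃ c C, 0 < c ∧ ∀ t, radSpeed K (G t) (p t) ∈ Icc c C := by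
  obtain ⟨m, M, B, w, hb⟩ := hG.exists_bounds
  have hw := hb.w_pos
  have hK := hG.nonneg
  have hB := hb.B_pos
  refine ⟨1 / √(K + B ^ 2), √(K + B ^ 2 + B ^ 2) / w ^ 2, by positivity, fun t => ?_⟩
  have hG2 : G t ^ 2 ≤ B ^ 2 := sq_le_sq' (abs_le.1 (hb.abs_le t)).1 (abs_le.1 (hb.abs_le t)).2
  have hp2 : p t ^ 2 ≤ B ^ 2 := sq_le_sq' (hb.slope t _ (hp t)).1 (hb.slope t _ (hp t)).2
  have hW := radW_pos (hG.pos_add t)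
  have hWw := hb.w_le _ (hb.mem t)
  have hZ := radW_le_radZ (K := K) (g := G t) (p := p t)
  have hWB : radW K (G t) ≤ √(K + B ^ 2) := Real.sqrt_le_sqrt (by linarith)
  have hZB : radZ K (G t) (p t) ≤ √(K + B ^ 2 + B ^ 2) := Real.sqrt_le_sqrt (by linarith)
  constructor
  · calc 1 / √(K + B ^ 2) ≤ 1 / radW K (G t) := by gcongr
      _ = radW K (G t) / radW K (G t) ^ 2 := by field_simp
      _ ≤ _ := by unfold radSpeed; gcongr
  · unfold radSpeed
    gcongr

theorem measurable_slope (hG : ConvexRadial K G) (hp : ∀ t, IsSlope G t (p t)) : Measurable p := by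
  obtain ⟨B, -, hB, -⟩ := hG.exists_bound
  have hm : Monotone (fun t => p t + 2 * B * t) := by
    intro s t hst
    have := IsSlope.le_add_of_le hB hp hst
    simp only
    linarith
  have : p = fun t => (p t + 2 * B * t) - 2 * B * t := by funext t; ring
  rw [this]
  exact hm.measurable.sub (by fun_prop)

/-- The arc length of a curve as an integral. -/
noncomputable def lengthIntegral (K : ℝ) (G p : ℝ → ℝ) (t : ℝ) : ℝ :=
  ∫ s in (0 : ℝ)..t, radSpeed K (G s) (p s)

theorem measurable_radSpeed (hG : ConvexRadial K G) (hp : ∀ t, IsSlope G t (p t)) :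
    Measurable fun t => radSpeed K (G t) (p t) := by
  have h1 := measurable_slope hG hp
  have h2 := hG.continuous.measurable
  have h3 : Measurable fun t => radZ K (G t) (p t) :=
    continuous_radZ.measurable.comp (h2.prodMk h1)
  have h4 : Measurable fun t => radW K (G t) := continuous_radW.measurable.comp h2
  exact h3.div (h4.pow_const 2)

theorem intervalIntegrable_radSpeed (hG : ConvexRadial K G) (hp : ∀ t, IsSlope G t (p t))
    (a b : ℝ) : IntervalIntegrable (fun t => radSpeed K (G t) (p t)) volume a b := by
  obtain ⟨c, C, hc, hC⟩ := exists_radSpeed_bounds hG hp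
  refine (intervalIntegrable_const (c := C)).mono_fun
    (measurable_radSpeed hG hp).aestronglyMeasurable (Eventually.of_forall fun t => ?_)
  simp only [Real.norm_eq_abs]
  rw [abs_of_nonneg (hc.le.trans (hC t).1)]
  exact (hC t).2.trans (le_abs_self C)

theorem lengthIntegral_sub (hG : ConvexRadial K G) (hp : ∀ t, IsSlope G t (p t)) (a b : ℝ) :
    lengthIntegral K G p b - lengthIntegral K G p a = ∫ s in a..b, radSpeed K (G s) (p s) :=
  intervalIntegral.integral_interval_sub_left (intervalIntegrable_radSpeed hG hp _ _)
    (intervalIntegrable_radSpeed hG hp _ _)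

theorem exists_lengthIntegral_bounds (hG : ConvexRadial K G) (hp : ∀ t, IsSlope G t (p t)) :
    ∃ c C, 0 < c ∧ 0 < C ∧ ∀ a b, a ≤ b →
      lengthIntegral K G p b - lengthIntegral K G p a ∈ Icc (c * (b - a)) (C * (b - a)) := by
  obtain ⟨c, C, hc, hC⟩ := exists_radSpeed_bounds hG hp
  refine ⟨c, C, hc, hc.trans_le ((hC 0).1.trans (hC 0).2), fun a b hab => ?_⟩
  rw [lengthIntegral_sub hG hp]
  constructor
  · have := intervalIntegral.integral_mono_on hab intervalIntegrable_const
      (intervalIntegrable_radSpeed hG hp a b) fun t _ => (hC t).1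
    simpa [mul_comm] using this
  · have := intervalIntegral.integral_mono_on hab (intervalIntegrable_radSpeed hG hp a b)
      intervalIntegrable_const fun t _ => (hC t).2
    simpa [mul_comm] using this

theorem continuousAt_radSpeed (hG : ConvexRadial K G) {t : ℝ} (hc : ContinuousAt p t) :
    ContinuousAt (fun t => radSpeed K (G t) (p t)) t := by
  have h3 : ContinuousAt (fun t => radZ K (G t) (p t)) t :=
    continuous_radZ.continuousAt.comp (f := fun t => (G t, p t)) (hG.continuous.continuousAt.prodMk hc)
  have h4 : ContinuousAt (fun t => radW K (G t)) t :=
    (continuous_radW.comp hG.continuous).continuousAt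
  exact h3.div (h4.pow 2) (pow_pos (radW_pos (hG.pos_add t)) 2).ne'

theorem hasDerivAt_lengthIntegral (hG : ConvexRadial K G) (hp : ∀ t, IsSlope G t (p t)) {t : ℝ}
    (hc : ContinuousAt p t) :
    HasDerivAt (lengthIntegral K G p) (radSpeed K (G t) (p t)) t :=
  intervalIntegral.integral_hasDerivAt_right (intervalIntegrable_radSpeed hG hp _ _)
    ⟨univ, univ_mem, (measurable_radSpeed hG hp).aestronglyMeasurable⟩
    (continuousAt_radSpeed hG hc)

theorem ModelPlane.dist_le (hK : 0 ≤ K) (x y : ModelPlane K) :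
    dist x y ≤ Real.pi / 2 * ‖x.coords - y.coords‖ := by
  rcases hK.eq_or_lt with rfl | hK'
  · have h := norm_coords_sub le_rfl x y
    simp only [Real.sqrt_zero, zero_mul, zero_div, Real.sinc_zero, mul_one] at h
    rw [h]
    have := Real.pi_gt_three
    have : 0 ≤ dist x y := dist_nonneg
    nlinarith
  · have hs := Real.sqrt_pos.2 hK'
    have h1 := Real.mul_le_sin (x := √K * dist x y / 2) (by positivity)
      (by linarith [sqrt_mul_dist_le_pi hK x y])
    have e : Real.sin (√K * dist x y / 2) = √K / 2 * ‖x.coords - y.coords‖ := by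
      rw [norm_coords_sub hK, ← Real.mul_sinc]; ring
    rw [e] at h1
    have hπ := Real.pi_pos
    have h2 : √K / 2 * dist x y ≤ √K / 2 * (Real.pi / 2 * ‖x.coords - y.coords‖) := by
      calc √K / 2 * dist x y = Real.pi / 2 * (2 / Real.pi * (√K * dist x y / 2)) := by
            field_simp
        _ ≤ Real.pi / 2 * (√K / 2 * ‖x.coords - y.coords‖) := by gcongr
        _ = _ := by ring
    exact le_of_mul_le_mul_left h2 (by positivity)

/-- The metric derivative of a differentiable curve. -/
theorem tendsto_dist_div (hK : 0 ≤ K) {Γ : ℝ → ModelPlane K} {V : E3} {t : ℝ}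
    (h : HasDerivAt (fun s => (Γ s).coords) V t) :
    Tendsto (fun y => dist (Γ t) (Γ y) / |y - t|) (𝓝[≠] t) (𝓝 ‖V‖) := by
  have h1 : Tendsto (fun y => ‖(Γ t).coords - (Γ y).coords‖ / |y - t|) (𝓝[≠] t) (𝓝 ‖V‖) := by
    have := (hasDerivAt_iff_tendsto_slope.1 h).norm
    refine this.congr fun y => ?_
    rw [slope_def_module, norm_smul, norm_inv, Real.norm_eq_abs, norm_sub_rev, inv_mul_eq_div]
  have h2 : Tendsto (fun y => dist (Γ t) (Γ y)) (𝓝 t) (𝓝 0) := by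
    have h3 : Tendsto (fun y => Real.pi / 2 * ‖(Γ t).coords - (Γ y).coords‖) (𝓝 t) (𝓝 0) := by
      have h4 : ContinuousAt (fun y => Real.pi / 2 * ‖(Γ t).coords - (Γ y).coords‖) t :=
        (continuousAt_const.sub h.continuousAt).norm.const_mul _
      have := h4.tendsto
      simpa using this
    exact squeeze_zero (fun _ => dist_nonneg) (fun y => ModelPlane.dist_le hK _ _) h3
  have h3 : Tendsto (fun y => Real.sinc (√K * dist (Γ t) (Γ y) / 2)) (𝓝[≠] t) (𝓝 1) := by
    have h4 : Tendsto (fun y => √K * dist (Γ t) (Γ y) / 2) (𝓝 t) (𝓝 (√K * 0 / 2)) :=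
      (h2.const_mul _).div_const 2
    have := (Real.continuous_sinc.tendsto _).comp h4
    simp only [mul_zero, zero_div, Real.sinc_zero] at this
    exact this.mono_left nhdsWithin_le_nhds
  have h4 := h1.div h3 one_ne_zero
  rw [div_one] at h4
  refine h4.congr' ?_
  filter_upwards [h3.eventually_ne one_ne_zero] with y hy
  rw [Pi.div_apply, norm_coords_sub hK, div_right_comm, mul_div_cancel_right₀ _ hy]

theorem PolarFrame.exists_lipschitz_dist (F : PolarFrame K) (hG : ConvexRadial K G)
    {Γ : ℝ → ModelPlane K} (hΓ : ∀ t, (Γ t).coords = F.curve G t) (a b : ℝ) :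
    ∃ L : NNReal, LipschitzOnWith L Γ (Icc a b) := by
  obtain ⟨L, hL0, hL⟩ := F.exists_lipschitz_curve hG a b
  refine ⟨(Real.pi / 2 * L).toNNReal, LipschitzOnWith.of_dist_le_mul fun x hx y hy => ?_⟩
  rw [Real.coe_toNNReal _ (by positivity)]
  refine (ModelPlane.dist_le hG.nonneg _ _).trans ?_
  rw [hΓ, hΓ, mul_assoc, Real.dist_eq]
  gcongr
  exact hL x hx y hy

/-- The distance from `Γ a` grows at most at the metric speed, which almost everywhere equals the
norm of the velocity in space. -/
theorem PolarFrame.dist_le_lengthIntegral (F : PolarFrame K) (hG : ConvexRadial K G)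
    (hp : ∀ t, IsSlope G t (p t)) {Γ : ℝ → ModelPlane K} (hΓ : ∀ t, (Γ t).coords = F.curve G t)
    {a b : ℝ} (hab : a ≤ b) :
    dist (Γ a) (Γ b) ≤ lengthIntegral K G p b - lengthIntegral K G p a := by
  obtain ⟨L, hL⟩ := F.exists_lipschitz_dist hG hΓ a b
  obtain ⟨c, C, hc, hC0, hC⟩ := exists_lengthIntegral_bounds hG hp
  have hcoe : (fun s => (Γ s).coords) = F.curve G := funext hΓ
  have hd : LipschitzOnWith L (fun v => dist (Γ a) (Γ v)) (Icc a b) := by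
    refine LipschitzOnWith.of_dist_le_mul fun x hx y hy => ?_
    rw [Real.dist_eq]
    rw [dist_comm (Γ a), dist_comm (Γ a)]
    refine (abs_dist_sub_le _ _ _).trans ?_
    exact hL.dist_le_mul x hx y hy
  have := le_of_oneSidedLipschitz_of_ae_deriv_nonpos
    (f := fun v => dist (Γ a) (Γ v) - lengthIntegral K G p v) (C := L) hab ?_ ?_
  · simp only [dist_self] at this
    linarith
  · intro x hx y hy hxy
    have h1 := hd.dist_le_mul y hy x hx
    rw [Real.dist_eq, Real.dist_eq, abs_of_nonneg (sub_nonneg.2 hxy)] at h1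
    have h2 := (hC x y hxy).1
    have h3 := mul_nonneg hc.le (sub_nonneg.2 hxy)
    have h4 := (le_abs_self _).trans h1
    linarith
  · filter_upwards [hG.ae_differentiableAt_slope hp, hd.ae_differentiableWithinAt_of_mem_real]
      with v hv hdv hm
    have hdv := ((hdv ⟨hm.1.le, hm.2.le⟩).differentiableAt (Icc_mem_nhds hm.1 hm.2)).hasDerivAt
    refine ⟨_, hdv.fun_sub (hasDerivAt_lengthIntegral hG hp hv.continuousAt), ?_⟩
    have hγ := F.hasDerivAt_curve hG (hG.hasDerivAt hp hv.continuousAt)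
    rw [← hcoe] at hγ
    have h1 := tendsto_dist_div hG.nonneg hγ
    rw [F.norm_velocity (hG.pos_add v)] at h1
    have h2 := hasDerivAt_iff_tendsto_slope.1 hdv
    refine sub_nonpos.2 (le_of_tendsto_of_tendsto h2 h1 ?_)
    filter_upwards [self_mem_nhdsWithin] with y hy
    calc _ ≤ |slope (fun v => dist (Γ a) (Γ v)) v y| := le_abs_self _
      _ = |dist (Γ a) (Γ y) - dist (Γ a) (Γ v)| / |y - v| := by
        rw [slope_def_field, abs_div]
      _ ≤ _ := by
        gcongr
        rw [dist_comm (Γ v), dist_comm (Γ a), dist_comm (Γ a)]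
        exact abs_dist_sub_le _ _ _

theorem eVariationOn_le_ofReal {X : Type*} [PseudoMetricSpace X] {f : ℝ → X} {I : ℝ → ℝ} {a b : ℝ}
    (hab : a ≤ b) (hI : MonotoneOn I (Icc a b))
    (h : ∀ x ∈ Icc a b, ∀ y ∈ Icc a b, x ≤ y → dist (f x) (f y) ≤ I y - I x) :
    eVariationOn f (Icc a b) ≤ ENNReal.ofReal (I b - I a) := by
  have h1 : eVariationOn f (Icc a b) ≤ eVariationOn I (Icc a b) := by
    refine iSup_mono fun q => Finset.sum_le_sum fun i _ => ?_
    have hm : q.2.1 i ≤ q.2.1 (i + 1) := q.2.2.1 (Nat.le_succ i)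
    have m1 := q.2.2.2 i
    have m2 := q.2.2.2 (i + 1)
    rw [edist_dist, edist_dist, dist_comm, Real.dist_eq,
      abs_of_nonneg (sub_nonneg.2 (hI m1 m2 hm))]
    exact ENNReal.ofReal_le_ofReal (h _ m1 _ m2 hm)
  refine h1.trans ?_
  have := hI.eVariationOn_eq (left_mem_Icc.2 hab) (right_mem_Icc.2 hab)
  rw [inter_self] at this
  exact this.le

/-- For the upper bound, every chord of a subdivision is at most the integral over its interval. For
the lower bound, the variation `T` is monotone and its derivative is almost everywhere at least the
speed; a singular part of `T` would only enlarge it, while the integral is Lipschitz. -/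
theorem PolarFrame.eVariationOn_eq (F : PolarFrame K) (hG : ConvexRadial K G)
    (hp : ∀ t, IsSlope G t (p t)) {Γ : ℝ → ModelPlane K} (hΓ : ∀ t, (Γ t).coords = F.curve G t)
    {a b : ℝ} (hab : a ≤ b) : eVariationOn Γ (Icc a b) =
      ENNReal.ofReal (lengthIntegral K G p b - lengthIntegral K G p a) := by
  obtain ⟨c, C, hc, hC0, hC⟩ := exists_lengthIntegral_bounds hG hp
  have hcoe : (fun s => (Γ s).coords) = F.curve G := funext hΓ
  have hmono : Monotone (lengthIntegral K G p) := by
    intro x y hxy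
    have := (hC x y hxy).1
    have := mul_nonneg hc.le (sub_nonneg.2 hxy)
    linarith
  have hle : ∀ x y, x ≤ y → eVariationOn Γ (Icc x y) ≤
      ENNReal.ofReal (lengthIntegral K G p y - lengthIntegral K G p x) := fun x y hxy =>
    eVariationOn_le_ofReal hxy (hmono.monotoneOn _)
      fun s _ t _ hst => F.dist_le_lengthIntegral hG hp hΓ hst
  have hfin : ∀ x y, x ≤ y → eVariationOn Γ (Icc x y) ≠ ⊤ := fun x y hxy =>
    ((hle x y hxy).trans_lt ENNReal.ofReal_lt_top).ne
  refine le_antisymm (hle a b hab) ?_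
  rw [← ENNReal.ofReal_toReal (hfin a b hab)]
  refine ENNReal.ofReal_le_ofReal ?_
  set T : ℝ → ℝ := fun v => variationOnFromTo Γ univ a v with hT
  have hlb : LocallyBoundedVariationOn Γ univ := by
    intro x y _ _
    rw [univ_inter]
    rcases le_total x y with h | h
    · exact hfin x y h
    · rcases h.eq_or_lt with rfl | h
      · exact hfin _ _ le_rfl
      · rw [Icc_eq_empty (not_le.2 h)]
        simp [BoundedVariationOn]
  have hTm : Monotone T := by
    have := variationOnFromTo.monotoneOn hlb (mem_univ a)
    exact monotoneOn_univ.1 this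
  have hTd : ∀ x y, x ≤ y → dist (Γ x) (Γ y) ≤ T y - T x := by
    intro x y hxy
    have h1 := variationOnFromTo.add hlb (mem_univ a) (mem_univ x) (mem_univ y)
    have h2 : dist (Γ x) (Γ y) ≤ variationOnFromTo Γ univ x y := by
      rw [variationOnFromTo.eq_of_le _ _ hxy, univ_inter, dist_edist]
      exact ENNReal.toReal_mono (hfin x y hxy)
        (eVariationOn.edist_le _ (left_mem_Icc.2 hxy) (right_mem_Icc.2 hxy))
    simp only [hT]
    linarith
  have := le_of_oneSidedLipschitz_of_ae_deriv_nonpos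
    (f := fun v => lengthIntegral K G p v - T v) (C := C) hab ?_ ?_
  · simp only [hT, variationOnFromTo.self] at this
    rw [variationOnFromTo.eq_of_le _ _ hab, univ_inter] at this
    linarith
  · intro x _ y _ hxy
    have h2 := (hC x y hxy).2
    have := hTm hxy
    linarith
  · filter_upwards [hG.ae_differentiableAt_slope hp, hTm.ae_differentiableAt] with v hv hdv _
    have hdv := hdv.hasDerivAt
    refine ⟨_, (hasDerivAt_lengthIntegral hG hp hv.continuousAt).fun_sub hdv, ?_⟩
    have hγ := F.hasDerivAt_curve hG (hG.hasDerivAt hp hv.continuousAt)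
    rw [← hcoe] at hγ
    have h1 := tendsto_dist_div hG.nonneg hγ
    rw [F.norm_velocity (hG.pos_add v)] at h1
    have h2 := hasDerivAt_iff_tendsto_slope.1 hdv
    refine sub_nonpos.2 (le_of_tendsto_of_tendsto h1 h2 ?_)
    filter_upwards [self_mem_nhdsWithin] with y hy
    rw [slope_def_field]
    rcases lt_or_gt_of_ne hy with h | h
    · rw [abs_of_neg (sub_neg.2 h), ← neg_sub (T v), neg_div, ← div_neg]
      have : 0 < -(y - v) := by linarith
      gcongr
      rw [dist_comm]
      exact hTd _ _ h.le
    · rw [abs_of_pos (sub_pos.2 h)]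
      have := sub_pos.2 h
      gcongr
      exact hTd _ _ (le_of_lt h)

theorem PolarFrame.arcLength_eq (F : PolarFrame K) (hG : ConvexRadial K G)
    (hp : ∀ t, IsSlope G t (p t)) {Γ : ℝ → ModelPlane K} (hΓ : ∀ t, (Γ t).coords = F.curve G t)
    {a b : ℝ} (hab : a ≤ b) :
    arcLength Γ a b = lengthIntegral K G p b - lengthIntegral K G p a := by
  obtain ⟨c, C, hc, hC0, hC⟩ := exists_lengthIntegral_bounds hG hp
  rw [arcLength, F.eVariationOn_eq hG hp hΓ hab, ENNReal.toReal_ofReal]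
  exact (mul_nonneg hc.le (sub_nonneg.2 hab)).trans (hC a b hab).1

end

section

open ModelPlane

/-! ### Chords of arcs -/

variable {K κ : ℝ} {G p : ℝ → ℝ}

/-- The derivative of the length of a chord. -/
theorem PolarFrame.deriv_chord_sq_le (F : PolarFrame K) (hG : ConvexRadial K G) (hκ : 0 < κ)
    (hp : CurvatureGE K G p κ) {a v d : ℝ} (hv : ContinuousAt p v)
    (hd : HasDerivAt (fun v => ‖F.curve G a - F.curve G v‖) d v) :
    d ^ 2 ≤ (1 - (K + κ ^ 2) * ‖F.curve G a - F.curve G v‖ ^ 2 / 4)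
      * radSpeed K (G v) (p v) ^ 2 := by
  have hX := F.chordSq_le' hG hκ hp v a
  have hs := radSpeed_pos (p := p v) (hG.pos_add v)
  rw [PolarFrame.chordSq] at hX
  rcases (norm_nonneg (F.curve G a - F.curve G v)).eq_or_lt with h0 | h0
  -- A norm has a minimum where it vanishes, so its derivative, if it exists there, is zero.
  · have : d = 0 := by
      refine IsLocalMin.hasDerivAt_eq_zero (Eventually.of_forall fun y => ?_) hd
      rw [← h0]; exact norm_nonneg _
    rw [this, ← h0]
    simp only [ne_eq, OfNat.ofNat_ne_zero, not_false_eq_true, zero_pow, mul_zero, zero_div,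
      sub_zero, one_mul]
    positivity
  · have h1 := F.hasDerivAt_chordSq hG (hG.hasDerivAt hp.slope hv) a
    have h2 := (hd.fun_pow 2).unique h1
    have h3 := F.excess_nonneg hG hκ hp (hp.slope v) a
    have h4 := F.chordSq_eq hG v (p v) a
    rw [PolarFrame.excess] at h3
    rw [PolarFrame.chordSq] at h3 h4
    set g := ‖F.curve G a - F.curve G v‖ with hg
    have hw := radW_pos (hG.pos_add v)
    have h5 : g * d = -tanComp K G v (p v) a * radSpeed K (G v) (p v) := by
      rw [radSpeed]
      simp only [Nat.cast_ofNat, Nat.add_one_sub_one, pow_one] at h2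
      linear_combination h2 / 2
    have h6 : κ / 2 * g ^ 2 ≤ norComp K G v (p v) a := by linarith
    have h7 : (κ / 2 * g ^ 2) ^ 2 ≤ norComp K G v (p v) a ^ 2 := by gcongr
    -- The touching disc forces a normal component of at least `κ g² / 2`; Pythagoras leaves this
    -- much for the tangential component, which governs the derivative of the chord.
    have h8 : tanComp K G v (p v) a ^ 2 ≤ g ^ 2 * (1 - (K + κ ^ 2) * g ^ 2 / 4) := by
      nlinarith
    have h9 : g ^ 2 * d ^ 2 ≤ g ^ 2 * ((1 - (K + κ ^ 2) * g ^ 2 / 4)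
        * radSpeed K (G v) (p v) ^ 2) := by
      rw [← mul_pow, h5, mul_pow, neg_sq, ← mul_assoc]
      gcongr
    exact le_of_mul_le_mul_left h9 (by positivity)

/-- With `β = √(K + κ²)` and chord `g`, the inequality `|g'| ≤ √(1 - (β g / 2)²) · speed` says that
`arcsin (β g / 2)` grows at most like `β / 2` times the length. The factor `c < 1` keeps the
argument where `arcsin` is smooth; it is removed afterwards by `c → 1`. -/
theorem PolarFrame.arcsin_chord_le (F : PolarFrame K) (hG : ConvexRadial K G) (hκ : 0 < κ)
    (hp : CurvatureGE K G p κ) {a b c : ℝ} (hab : a ≤ b) (hc0 : 0 < c) (hc1 : c < 1) :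
    Real.arcsin (c * (√(K + κ ^ 2) / 2 * ‖F.curve G a - F.curve G b‖)) ≤
      √(K + κ ^ 2) / 2 * (lengthIntegral K G p b - lengthIntegral K G p a) := by
  have hK := hG.nonneg
  have hl : 0 < K + κ ^ 2 := by positivity
  have hβ2 := Real.sq_sqrt hl.le
  set β := √(K + κ ^ 2) with hβ
  have hβ0 : 0 < β := Real.sqrt_pos.2 hl
  set g := fun v => ‖F.curve G a - F.curve G v‖ with hg
  have hg0 : ∀ v, 0 ≤ g v := fun v => norm_nonneg _
  have hg1 : ∀ v, β / 2 * g v ≤ 1 := by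
    intro v
    have := F.chordSq_le' hG hκ hp v a
    rw [PolarFrame.chordSq] at this
    rw [← sq_le_one_iff₀ (by have := hg0 v; positivity)]
    rw [mul_pow, div_pow, hβ2]
    simp only [hg]
    linarith
  obtain ⟨L, hL0, hL⟩ := F.exists_lipschitz_curve hG a b
  have hgL : LipschitzOnWith L.toNNReal g (Icc a b) := by
    refine LipschitzOnWith.of_dist_le_mul fun x hx y hy => ?_
    rw [Real.dist_eq, Real.dist_eq, Real.coe_toNNReal _ hL0]
    refine (abs_norm_sub_norm_le _ _).trans ?_
    rw [sub_sub_sub_cancel_left, norm_sub_rev]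
    exact hL x hx y hy
  obtain ⟨c', C, hc', hC0, hC⟩ := exists_lengthIntegral_bounds hG hp.slope
  have hφ : ContDiffOn ℝ 1 (fun r : ℝ => Real.arcsin (c * (β / 2 * r))) (Icc 0 (2 / β)) := by
    intro r hr
    refine ContDiffAt.contDiffWithinAt ?_
    have h1 : β / 2 * r ≤ 1 := by
      calc β / 2 * r ≤ β / 2 * (2 / β) := by gcongr; exact hr.2
        _ = 1 := by field_simp
    have h2 : 0 ≤ c * (β / 2 * r) := by have := hr.1; positivity
    have h3 : c * (β / 2 * r) < 1 := by nlinarith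
    have h4 : ContDiffAt ℝ 1 Real.arcsin (c * (β / 2 * r)) :=
      Real.contDiffAt_arcsin (by linarith) h3.ne
    have h5 : ContDiffAt ℝ 1 (fun r : ℝ => c * (β / 2 * r)) r := by fun_prop
    exact ContDiffAt.comp (g := Real.arcsin) r h4 h5
  obtain ⟨M, hM⟩ := hφ.exists_lipschitzOnWith one_ne_zero (convex_Icc _ _) isCompact_Icc
  have hmem : ∀ v, g v ∈ Icc 0 (2 / β) := fun v => ⟨hg0 v, by
    rw [le_div_iff₀ hβ0]; linarith [hg1 v]⟩
  have := le_of_oneSidedLipschitz_of_ae_deriv_nonpos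
    (f := fun v => Real.arcsin (c * (β / 2 * g v)) - β / 2 * lengthIntegral K G p v)
    (C := M * L) hab ?_ ?_
  · have e : g a = 0 := by simp [hg]
    simp only [e, mul_zero, Real.arcsin_zero] at this
    linarith
  · intro x hx y hy hxy
    have h1 := hM.dist_le_mul _ (hmem y) _ (hmem x)
    have h2 := hgL.dist_le_mul y hy x hx
    rw [Real.dist_eq, Real.dist_eq, Real.coe_toNNReal _ hL0, abs_of_nonneg (sub_nonneg.2 hxy)]
      at h2
    rw [Real.dist_eq, Real.dist_eq] at h1
    have h3 := (le_abs_self _).trans h1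
    have h4 : (M : ℝ) * |g y - g x| ≤ M * (L * (y - x)) := by gcongr
    have h5 : 0 ≤ lengthIntegral K G p y - lengthIntegral K G p x :=
      (mul_nonneg hc'.le (sub_nonneg.2 hxy)).trans (hC x y hxy).1
    have h6 : 0 ≤ β / 2 * (lengthIntegral K G p y - lengthIntegral K G p x) := by positivity
    linarith
  · filter_upwards [hG.ae_differentiableAt_slope hp.slope,
      hgL.ae_differentiableWithinAt_of_mem_real] with v hv hdv hm
    have hd := ((hdv ⟨hm.1.le, hm.2.le⟩).differentiableAt (Icc_mem_nhds hm.1 hm.2)).hasDerivAt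
    set d := deriv g v
    have hs := radSpeed_pos (p := p v) (hG.pos_add v)
    have h1 := F.deriv_chord_sq_le hG hκ hp hv.continuousAt hd
    set ρ := β / 2 * g v with hρ
    have hρ0 : 0 ≤ ρ := by have := hg0 v; positivity
    have hρ1 : ρ ≤ 1 := hg1 v
    have hcρ : c * ρ < 1 := by nlinarith
    have hcρ0 : 0 ≤ c * ρ := by positivity
    have hpos : 0 < 1 - (c * ρ) ^ 2 := by nlinarith
    have hder := (Real.hasDerivAt_arcsin (x := c * ρ) (by linarith) hcρ.ne).comp v
      ((hd.const_mul (β / 2)).const_mul c)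
    refine ⟨_, hder.fun_sub ((hasDerivAt_lengthIntegral hG hp.slope hv.continuousAt).const_mul _),
      ?_⟩
    have hq := Real.sqrt_pos.2 hpos
    have h2 : c * d ≤ √(1 - (c * ρ) ^ 2) * radSpeed K (G v) (p v) := by
      refine le_of_sq_le_sq ?_ (by positivity)
      rw [mul_pow, mul_pow, Real.sq_sqrt hpos.le]
      have e : 1 - (K + κ ^ 2) * g v ^ 2 / 4 = 1 - ρ ^ 2 := by
        rw [hρ, mul_pow, div_pow, hβ2]; ring
      have h1' : d ^ 2 ≤ (1 - ρ ^ 2) * radSpeed K (G v) (p v) ^ 2 := by rw [← e]; exact h1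
      have hs2 : 0 ≤ radSpeed K (G v) (p v) ^ 2 := by positivity
      calc c ^ 2 * d ^ 2 ≤ c ^ 2 * ((1 - ρ ^ 2) * radSpeed K (G v) (p v) ^ 2) := by gcongr
        _ = c ^ 2 * (1 - ρ ^ 2) * radSpeed K (G v) (p v) ^ 2 := by ring
        _ ≤ _ := by
          gcongr
          have h7 : c ^ 2 ≤ 1 := by nlinarith
          have h8 := mul_pow c ρ 2
          linarith
    have h3 : 1 / √(1 - (c * ρ) ^ 2) * (c * (β / 2 * d)) ≤ β / 2 * radSpeed K (G v) (p v) := by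
      rw [one_div, inv_mul_le_iff₀ hq]
      calc c * (β / 2 * d) = β / 2 * (c * d) := by ring
        _ ≤ β / 2 * (√(1 - (c * ρ) ^ 2) * radSpeed K (G v) (p v)) := by gcongr
        _ = _ := by ring
    exact sub_nonpos.2 h3

theorem mul_sinc_eq {β ℓ : ℝ} (hβ : 0 < β) :
    ℓ * Real.sinc (β * ℓ / 2) = 2 / β * Real.sin (β * ℓ / 2) := by
  rw [← Real.mul_sinc]; field_simp

/-- The chord of a short arc is at most that of an arc of a circle. -/
theorem PolarFrame.chord_le_of_le_pi (F : PolarFrame K) (hG : ConvexRadial K G) (hκ : 0 < κ)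
    (hp : CurvatureGE K G p κ) {a b ℓ : ℝ} (hab : a ≤ b)
    (hℓ : lengthIntegral K G p b - lengthIntegral K G p a = ℓ) (h : √(K + κ ^ 2) * ℓ ≤ Real.pi) :
    ‖F.curve G a - F.curve G b‖ ≤ ℓ * Real.sinc (√(K + κ ^ 2) * ℓ / 2) := by
  have hK := hG.nonneg
  have hβ0 : 0 < √(K + κ ^ 2) := Real.sqrt_pos.2 (by positivity)
  obtain ⟨c', C, hc', -, hC⟩ := exists_lengthIntegral_bounds hG hp.slope
  have hℓ0 : 0 ≤ ℓ := hℓ ▸ (mul_nonneg hc'.le (sub_nonneg.2 hab)).trans (hC a b hab).1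
  have key : ∀ c ∈ Ioo (0 : ℝ) 1, c * (√(K + κ ^ 2) / 2 * ‖F.curve G a - F.curve G b‖) ≤
      Real.sin (√(K + κ ^ 2) * ℓ / 2) := by
    intro c hc
    have h1 := F.arcsin_chord_le hG hκ hp hab hc.1 hc.2
    rw [hℓ] at h1
    have h0 : 0 ≤ √(K + κ ^ 2) * ℓ := by positivity
    rw [div_mul_eq_mul_div _ _ ℓ] at h1
    have h2 : √(K + κ ^ 2) / 2 * ‖F.curve G a - F.curve G b‖ ≤ 1 := by
      have := F.chordSq_le' hG hκ hp b a
      rw [PolarFrame.chordSq] at this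
      rw [← sq_le_one_iff₀ (by positivity), mul_pow, div_pow, Real.sq_sqrt (by positivity)]
      linarith
    have h3 : 0 ≤ √(K + κ ^ 2) / 2 * ‖F.curve G a - F.curve G b‖ := by positivity
    have h4 := mul_nonneg hc.1.le h3
    have h5 := mul_le_mul hc.2.le h2 h3 zero_le_one
    exact (Real.arcsin_le_iff_le_sin ⟨by linarith, by linarith⟩
      ⟨by linarith [Real.pi_pos], by linarith⟩).1 h1
  have h2 : √(K + κ ^ 2) / 2 * ‖F.curve G a - F.curve G b‖ ≤ Real.sin (√(K + κ ^ 2) * ℓ / 2) := by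
    have hcl : (1 : ℝ) ∈ closure (Ioo (0 : ℝ) 1) := by
      rw [closure_Ioo zero_ne_one]; exact ⟨zero_le_one, le_rfl⟩
    have := le_on_closure key (by fun_prop) (by fun_prop) hcl
    rwa [one_mul] at this
  rw [mul_sinc_eq hβ0, div_mul_eq_mul_div, le_div_iff₀ hβ0]
  linarith

theorem lengthIntegral_add_period (hG : ConvexRadial K G) (hp : ∀ t, IsSlope G t (p t))
    (hper : Function.Periodic p (2 * Real.pi)) (a : ℝ) :
    lengthIntegral K G p (a + 2 * Real.pi) - lengthIntegral K G p a =
      lengthIntegral K G p (2 * Real.pi) := by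
  have h : Function.Periodic (fun t => radSpeed K (G t) (p t)) (2 * Real.pi) := by
    intro t
    simp only [hG.periodic t, hper t]
  rw [lengthIntegral_sub hG hp, h.intervalIntegral_add_eq a 0, zero_add, lengthIntegral]

/-- If `β ℓ ≥ π`, the complementary arc has the same chord and, by the bound on the total length,
satisfies `β ℓ' ≤ 2π - β ℓ ≤ π`. The short case then applies, and `sin` is symmetric about `π / 2`.
-/
theorem PolarFrame.chord_le (F : PolarFrame K) (hG : ConvexRadial K G) (hκ : 0 < κ)
    (hp : CurvatureGE K G p κ) (hper : Function.Periodic p (2 * Real.pi))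
    (hL : √(K + κ ^ 2) * lengthIntegral K G p (2 * Real.pi) ≤ 2 * Real.pi) {a b ℓ : ℝ}
    (hab : a ≤ b) (hba : b ≤ a + 2 * Real.pi)
    (hℓ : lengthIntegral K G p b - lengthIntegral K G p a = ℓ) :
    √(K + κ ^ 2) * ℓ ≤ 2 * Real.pi ∧
      ‖F.curve G a - F.curve G b‖ ≤ ℓ * Real.sinc (√(K + κ ^ 2) * ℓ / 2) := by
  have hK := hG.nonneg
  have hβ0 : 0 < √(K + κ ^ 2) := Real.sqrt_pos.2 (by positivity)
  obtain ⟨c', C, hc', -, hC⟩ := exists_lengthIntegral_bounds hG hp.slope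
  have h1 := lengthIntegral_add_period hG hp.slope hper a
  have h2 : 0 ≤ lengthIntegral K G p (a + 2 * Real.pi) - lengthIntegral K G p b :=
    (mul_nonneg hc'.le (sub_nonneg.2 hba)).trans (hC _ _ hba).1
  set β := √(K + κ ^ 2) with hβ
  have h3 : β * ℓ ≤ 2 * Real.pi := by
    refine le_trans ?_ hL
    gcongr
    linarith
  refine ⟨h3, ?_⟩
  rcases le_total (β * ℓ) Real.pi with h | h
  · exact F.chord_le_of_le_pi hG hκ hp hab hℓ h
  · set ℓ' := lengthIntegral K G p (a + 2 * Real.pi) - lengthIntegral K G p b with hℓ'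
    have h4 : β * ℓ' ≤ 2 * Real.pi - β * ℓ := by
      have : β * ℓ' = β * lengthIntegral K G p (2 * Real.pi) - β * ℓ := by
        rw [← h1, ← hℓ, hℓ']; ring
      linarith
    have h5 := F.chord_le_of_le_pi hG hκ hp hba rfl (by rw [← hβ, ← hℓ']; linarith)
    have h6 : F.curve G (a + 2 * Real.pi) = F.curve G a := by
      simpa using F.curve_add_two_pi_mul hG a 1
    rw [h6, norm_sub_rev, ← hβ, ← hℓ'] at h5
    refine h5.trans ?_
    rw [mul_sinc_eq hβ0, mul_sinc_eq hβ0]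
    gcongr
    rw [← Real.sin_pi_sub (β * ℓ / 2)]
    have h0 : 0 ≤ β * ℓ' := by positivity
    exact Real.sin_le_sin_of_le_of_le_pi_div_two (by linarith [Real.pi_pos]) (by linarith)
      (by linarith)

/-! ### The length of a convex curve -/

/-- The support condition does not involve `K`. A positive radial function on the sphere is also one
in the plane, which corresponds to central projection. -/
theorem ConvexRadial.of_pos (hG : ConvexRadial K G) (h : ∀ t, 0 < G t) : ConvexRadial 0 G where
  nonneg := le_rfl
  periodic := hG.periodic
  pos _ := h
  bdd := hG.bdd
  slope := hG.slope

/-- Since `Ψ` increases with the slope, a rise of `p` works in favour of the claim. Replacing `p y`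
by `min (p x) (p y)` leaves only the fall, which is linear in `y - x`. -/
theorem ConvexRadial.exists_oneSidedLipschitz (hG : ConvexRadial 0 G)
    (hp : ∀ t, IsSlope G t (p t)) {Ψ : ℝ → ℝ → ℝ}
    (hΨ : ∀ g q, 0 < g → ContDiffAt ℝ 1 (fun x : ℝ × ℝ × ℝ => Ψ x.2.1 x.2.2) (0, g, q))
    (hm : ∀ t, Monotone (Ψ (G t))) :
    ∃ C, ∀ x y, x ≤ y → Ψ (G x) (p x) - Ψ (G y) (p y) ≤ C * (y - x) := by
  obtain ⟨m, M, B, w, hb⟩ := hG.exists_bounds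
  have hB := hb.B_pos
  have hpm : ∀ v, p v ∈ Icc (-B) B := fun v => hb.slope v _ (hp v)
  have hc : ContDiffOn ℝ 1 (fun x : ℝ × ℝ => Ψ x.1 x.2) ((Icc m M ∩ Ici 0) ×ˢ Icc (-B) B) := by
    intro x hx
    have h1 := hb.pos _ hx.1.1
    have h2 : x.1 ≠ 0 := by rintro h; rw [h] at h1; simp at h1
    have h3 : ContDiffAt ℝ 1 (fun x : ℝ × ℝ => ((0 : ℝ), x.1, x.2)) x := by fun_prop
    exact (ContDiffAt.comp x (hΨ x.1 x.2 (lt_of_le_of_ne hx.1.2 h2.symm)) h3).contDiffWithinAt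
  obtain ⟨L, hL⟩ := hc.exists_lipschitzOnWith one_ne_zero
    (((convex_Icc _ _).inter (convex_Ici _)).prod (convex_Icc _ _))
    ((isCompact_Icc.inter_right isClosed_Ici).prod isCompact_Icc)
  have hGm : ∀ v, G v ∈ Icc m M ∩ Ici 0 := fun v => ⟨hb.mem v, (hG.pos rfl v).le⟩
  refine ⟨L * (4 * B), fun x y hxy => ?_⟩
  have hxy0 := sub_nonneg.2 hxy
  have h1 : Ψ (G y) (min (p x) (p y)) ≤ Ψ (G y) (p y) := hm y (min_le_right _ _)
  have hmin : min (p x) (p y) ∈ Icc (-B) B :=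
    ⟨le_min (hpm x).1 (hpm y).1, (min_le_left _ _).trans (hpm x).2⟩
  have h2 := hL.dist_le_mul (G x, p x) ⟨hGm x, hpm x⟩ (G y, min (p x) (p y)) ⟨hGm y, hmin⟩
  have h3 := (le_abs_self _).trans h2
  have h4 : |G x - G y| ≤ 2 * B * (y - x) := by
    have := hb.lip y x
    rwa [abs_sub_comm x, abs_of_nonneg hxy0] at this
  have h5 : |p x - min (p x) (p y)| ≤ 2 * B * (y - x) := by
    rw [abs_of_nonneg (sub_nonneg.2 (min_le_left _ _))]
    rcases le_total (p x) (p y) with h | h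
    · rw [min_eq_left h, sub_self]; positivity
    · rw [min_eq_right h]
      linarith [IsSlope.le_add_of_le hb.abs_le hp hxy]
  have h6 : dist (G x, p x) (G y, min (p x) (p y)) ≤ 4 * B * (y - x) := by
    rw [Prod.dist_eq, Real.dist_eq, Real.dist_eq]
    have : 0 ≤ 2 * B * (y - x) := by positivity
    exact max_le (by linarith) (by linarith)
  have h7 : (L : ℝ) * dist (G x, p x) (G y, min (p x) (p y)) ≤ L * (4 * B * (y - x)) := by gcongr
  linarith

/-- The derivative of the slope is bounded from below. -/
theorem IsSlope.neg_le_deriv (hp : ∀ t, IsSlope G t (p t)) {t d : ℝ} (hd : HasDerivAt p d t) :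
    -G t ≤ d := by
  have hc : HasDerivAt (fun u => Real.cos (u - t)) (-Real.sin (t - t) * 1) t :=
    (Real.hasDerivAt_cos _).comp t ((hasDerivAt_id t).sub_const t)
  have hs : HasDerivAt (fun u => Real.sin (u - t)) (Real.cos (t - t) * 1) t :=
    (Real.hasDerivAt_sin _).comp t ((hasDerivAt_id t).sub_const t)
  have h1 := (hc.const_mul (p t)).fun_sub (hs.const_mul (G t))
  simp only [sub_self, Real.sin_zero, Real.cos_zero, neg_zero, zero_mul, mul_zero, one_mul,
    mul_one, zero_sub] at h1
  have h2 := (hasDerivAt_iff_tendsto_slope.1 h1).mono_left (nhdsGT_le_nhdsNE t)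
  have h3 := (hasDerivAt_iff_tendsto_slope.1 hd).mono_left (nhdsGT_le_nhdsNE t)
  refine le_of_tendsto_of_tendsto h2 h3 ?_
  have hI : Ioo t (t + 1) ∈ 𝓝[>] t := Ioo_mem_nhdsGT (by linarith)
  filter_upwards [hI] with u hu
  rw [slope_def_field, slope_def_field]
  have h0 : 0 < u - t := sub_pos.2 hu.1
  refine div_le_div_of_nonneg_right ?_ h0.le
  simp only [sub_self, Real.cos_zero, Real.sin_zero, mul_one, mul_zero, sub_zero]
  refine sub_le_sub_right ?_ _
  have a1 := hp t u
  have a2 := hp u t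
  rw [← neg_sub u t, Real.cos_neg, Real.sin_neg] at a2
  have hsin : 0 < Real.sin (u - t) :=
    Real.sin_pos_of_pos_of_lt_pi h0 (by linarith [Real.pi_gt_three, hu.2])
  have hcos : 0 < Real.cos (u - t) :=
    Real.cos_pos_of_mem_Ioo ⟨by linarith [Real.pi_pos], by linarith [Real.pi_gt_three, hu.2]⟩
  -- Eliminating `G u` from the two support inequalities gives `p u ≥ p t cos (u - t) - G t sin (u -
  -- t)`, whose right side has derivative `-G t` at `t`.
  have a3 := mul_le_mul_of_nonneg_right a1 hcos.le
  refine le_of_mul_le_mul_right ?_ hsin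
  have e : G t * (Real.sin (u - t) ^ 2 + Real.cos (u - t) ^ 2) = G t := by
    rw [Real.sin_sq_add_cos_sq, mul_one]
  linarith

/-- A plane curve of curvature at least `κ` has length at most `2π / κ`. -/
theorem lengthIntegral_le_of_zero (hG : ConvexRadial 0 G) (hκ : 0 < κ)
    (hp : CurvatureGE 0 G p κ) (hper : Function.Periodic p (2 * Real.pi)) :
    κ * lengthIntegral 0 G p (2 * Real.pi) ≤ 2 * Real.pi := by
  obtain ⟨C, hC⟩ := hG.exists_oneSidedLipschitz hp.slope (Ψ := fun g q => Real.arctan (q / g))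
    (fun g q hg => by
      have : ContDiffAt ℝ 1 (fun x : ℝ × ℝ × ℝ => x.2.2 / x.2.1) (0, g, q) :=
        ContDiffAt.div (by fun_prop) (by fun_prop) hg.ne'
      exact this.arctan)
    (fun t q q' h => Real.arctan_strictMono.monotone
      (div_le_div_of_nonneg_right h (hG.pos rfl t).le))
  obtain ⟨c', C', hc', -, hC'⟩ := exists_lengthIntegral_bounds hG hp.slope
  -- Up to a constant, `v + arctan (p / G)` is the direction of the tangent. It turns at least `κ`
  -- times as fast as the length grows, and by `2π` over one period.
  have := le_of_oneSidedLipschitz_of_ae_deriv_nonpos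
    (f := fun v => κ * lengthIntegral 0 G p v - v - Real.arctan (p v / G v))
    (C := κ * C' + C) Real.two_pi_pos.le ?_ ?_
  · have e1 : lengthIntegral 0 G p 0 = 0 := by simp [lengthIntegral]
    have e2 : G (2 * Real.pi) = G 0 := by simpa using hG.periodic 0
    have e3 : p (2 * Real.pi) = p 0 := by simpa using hper 0
    simp only [e1, e2, e3] at this
    linarith
  · intro x _ y _ hxy
    have h1 := hC x y hxy
    have h2 := mul_le_mul_of_nonneg_left (hC' x y hxy).2 hκ.le
    linarith
  · filter_upwards [hp.ae_le, hG.ae_differentiableAt_slope hp.slope] with v hk hv _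
    have hd := hv.hasDerivAt
    have hGv := hG.pos rfl v
    have h1 := (hd.fun_div (hG.hasDerivAt hp.slope hv.continuousAt) hGv.ne').arctan
    refine ⟨_, (((hasDerivAt_lengthIntegral hG hp.slope hv.continuousAt).const_mul κ).fun_sub
      (hasDerivAt_id v)).fun_sub h1, ?_⟩
    have hk := hk _ hd
    have hz := radZ_pos (p := p v) (hG.pos_add v)
    have hz2 := radZ_sq (p := p v) (hG.pos_add v)
    rw [radW_zero hGv] at hk
    rw [radSpeed, radW_zero hGv]
    set d := deriv p v
    set z := radZ 0 (G v) (p v)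
    have e : κ * (z / G v ^ 2) - 1 - 1 / (1 + (p v / G v) ^ 2) *
        ((d * G v - p v * p v) / G v ^ 2) =
        -(((G v + d) * G v ^ 3 - κ * z ^ 3) / (G v ^ 2 * z ^ 2)) := by
      have hz3 : z ^ 3 = z * (0 + G v ^ 2 + p v ^ 2) := by rw [← hz2]; ring
      rw [hz2, hz3]
      field_simp
      ring
    rw [e, neg_nonpos]
    have := sub_nonneg.2 hk
    positivity

theorem hasDerivAt_radZ (hG : ConvexRadial K G) (hp : ∀ t, IsSlope G t (p t)) {t d : ℝ}
    (hd : HasDerivAt p d t) : HasDerivAt (fun s => radZ K (G s) (p s))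
      (p t * (G t + d) / radZ K (G t) (p t)) t := by
  have hGd := hG.hasDerivAt hp hd.continuousAt
  have h3 : HasDerivAt (fun s => K + G s ^ 2 + p s ^ 2) (2 * G t * p t + 2 * p t * d) t := by
    simpa using ((hGd.fun_pow 2).const_add K).fun_add (hd.fun_pow 2)
  have hne : K + G t ^ 2 + p t ^ 2 ≠ 0 := by have := hG.pos_add t; positivity
  refine (h3.sqrt hne).congr_deriv ?_
  rw [radZ]; ring

/-- The correction term of the length comparison on the sphere. Its derivative in the slope has the
sign of `R - 1 / Z`, which is nonnegative for `R = 1 / √(K + κ²)` as soon as `κ ≤ G`; so upward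
jumps of the slope do no harm. -/
theorem hasDerivAt_calibration {R g q : ℝ} (hK : 0 < K) (hg : 0 < g) :
    HasDerivAt (fun q => R * Real.arctan (q / g) - Real.arctan (√K * q / (g * radZ K g q)) / √K)
      (g * (R - 1 / radZ K g q) / (g ^ 2 + q ^ 2)) q := by
  have hpos : 0 < K + g ^ 2 := by positivity
  have hs := Real.sqrt_pos.2 hK
  have hs2 := Real.sq_sqrt hK.le
  have hz := radZ_pos (p := q) hpos
  have hz2 := radZ_sq (p := q) hpos
  have h2 : HasDerivAt (fun q => radZ K g q) (q / radZ K g q) q := by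
    have h3 : HasDerivAt (fun q => K + g ^ 2 + q ^ 2) (2 * q) q := by
      simpa using ((hasDerivAt_id q).fun_pow 2).const_add (K + g ^ 2)
    refine (h3.sqrt (by positivity)).congr_deriv ?_
    rw [radZ]; ring
  have h4 := (((hasDerivAt_id q).const_mul √K).fun_div (h2.const_mul g) (by positivity)).arctan
  have h5 := (((hasDerivAt_id q).div_const g).arctan.const_mul R).fun_sub (h4.div_const √K)
  refine h5.congr_deriv ?_
  simp only [id]
  set z := radZ K g q
  have e1 : 1 + (√K * q / (g * z)) ^ 2 = (K + g ^ 2) * (g ^ 2 + q ^ 2) / (g ^ 2 * z ^ 2) := by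
    field_simp
    rw [hs2, hz2]; ring
  have e2 : 1 + (q / g) ^ 2 = (g ^ 2 + q ^ 2) / g ^ 2 := by field_simp
  have h6 : 0 < g ^ 2 + q ^ 2 := by positivity
  rw [e1, e2]
  field_simp
  linear_combination (-1 : ℝ) * hz2

/-- A curve on the sphere in a disc about a point inside the curve is not longer than the boundary
of the disc. -/
theorem lengthIntegral_le_of_le (hK : 0 < K) (hG : ConvexRadial K G) (hκ : 0 < κ)
    (hp : ∀ t, IsSlope G t (p t)) (hper : Function.Periodic p (2 * Real.pi))
    (hle : ∀ t, κ ≤ G t) :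
    √(K + κ ^ 2) * lengthIntegral K G p (2 * Real.pi) ≤ 2 * Real.pi := by
  have hl : 0 < K + κ ^ 2 := by positivity
  have hβ0 : 0 < √(K + κ ^ 2) := Real.sqrt_pos.2 hl
  have hs := Real.sqrt_pos.2 hK
  have hs2 := Real.sq_sqrt hK.le
  set R := (√(K + κ ^ 2))⁻¹ with hR
  have hR0 : 0 < R := inv_pos.2 hβ0
  have hGpos : ∀ t, 0 < G t := fun t => hκ.trans_le (hle t)
  have hRZ : ∀ t q, 0 ≤ R - 1 / radZ K (G t) q := by
    intro t q
    rw [sub_nonneg, hR, one_div]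
    apply inv_anti₀ hβ0
    refine Real.sqrt_le_sqrt ?_
    have : κ ^ 2 ≤ G t ^ 2 := by have := hle t; gcongr
    nlinarith [sq_nonneg q]
  have hG0 := hG.of_pos hGpos
  obtain ⟨C, hC⟩ := hG0.exists_oneSidedLipschitz hp
    (Ψ := fun g q => R * Real.arctan (q / g) - Real.arctan (√K * q / (g * radZ K g q)) / √K)
    (fun g q hg => by
      have hpos : 0 < K + g ^ 2 := by positivity
      have h1 : ContDiffAt ℝ 1 (fun x : ℝ × ℝ × ℝ => x.2.2 / x.2.1) (0, g, q) :=
        ContDiffAt.div (by fun_prop) (by fun_prop) hg.ne'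
      have h2 : ContDiffAt ℝ 1 (fun x : ℝ × ℝ × ℝ => √K * x.2.2 / (x.2.1 * radZ K x.2.1 x.2.2))
          (0, g, q) := by
        have hz : ContDiffAt ℝ 1 (fun x : ℝ × ℝ × ℝ => radZ K x.2.1 x.2.2) (0, g, q) :=
          contDiffAt_radZ (x := (0, g, q)) hpos
        have hz0 := radZ_pos (p := q) hpos
        have hg1 : ContDiffAt ℝ 1 (fun x : ℝ × ℝ × ℝ => x.2.1) (0, g, q) := by fun_prop
        exact ContDiffAt.div (by fun_prop) (hg1.mul hz) (by positivity)
      exact (contDiffAt_const.mul h1.arctan).sub (h2.arctan.div_const _))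
    (fun t => by
      apply monotone_of_hasDerivAt_nonneg (fun q => hasDerivAt_calibration hK (hGpos t))
      intro q
      have := hRZ t q
      have := hGpos t
      exact div_nonneg (by positivity) (by positivity))
  obtain ⟨c', C', hc', -, hC'⟩ := exists_lengthIntegral_bounds hG hp
  -- The derivative of this function is `-(G + p') G (R - 1 / Z) / (G² + p²)`, nonpositive because
  -- `G + p' ≥ 0` by convexity and `R ≥ 1 / Z`. The correction term is periodic, so over one turn
  -- only length at most `2π R` remains.
  have := le_of_oneSidedLipschitz_of_ae_deriv_nonpos
    (f := fun v => lengthIntegral K G p v - R * v - (R * Real.arctan (p v / G v) -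
      Real.arctan (√K * p v / (G v * radZ K (G v) (p v))) / √K))
    (C := C' + C) Real.two_pi_pos.le ?_ ?_
  · have e1 : lengthIntegral K G p 0 = 0 := by simp [lengthIntegral]
    have e2 : G (2 * Real.pi) = G 0 := by simpa using hG.periodic 0
    have e3 : p (2 * Real.pi) = p 0 := by simpa using hper 0
    simp only [e1, e2, e3] at this
    have h2 : lengthIntegral K G p (2 * Real.pi) ≤ R * (2 * Real.pi) := by linarith
    rw [hR, inv_mul_eq_div, le_div_iff₀ hβ0] at h2
    linarith
  · intro x _ y _ hxy
    have h1 := hC x y hxy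
    have h2 := (hC' x y hxy).2
    have h3 : 0 ≤ R * (y - x) := mul_nonneg hR0.le (sub_nonneg.2 hxy)
    linarith
  · filter_upwards [hG.ae_differentiableAt_slope hp] with v hv _
    have hd := hv.hasDerivAt
    have hGv := hGpos v
    have hpos := hG.pos_add v
    have hz := radZ_pos (p := p v) hpos
    have hz2 := radZ_sq (p := p v) hpos
    have hw := radW_pos hpos
    have hw2 := radW_sq hpos
    have hGd := hG.hasDerivAt hp hv.continuousAt
    have h1 := (hd.fun_div hGd hGv.ne').arctan.const_mul R
    have h2 := ((hd.const_mul √K).fun_div (hGd.fun_mul (hasDerivAt_radZ hG hp hd))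
      (by positivity)).arctan.div_const √K
    refine ⟨_, ((hasDerivAt_lengthIntegral hG hp hv.continuousAt).fun_sub
      ((hasDerivAt_id v).const_mul R)).fun_sub (h1.fun_sub h2), ?_⟩
    have hRz := hRZ v (p v)
    have hdG := IsSlope.neg_le_deriv hp hd
    rw [radSpeed]
    set d := deriv p v
    set z := radZ K (G v) (p v)
    have h6 : 0 < G v ^ 2 + p v ^ 2 := by positivity
    have e1 : 1 + (√K * p v / (G v * z)) ^ 2 =
        radW K (G v) ^ 2 * (G v ^ 2 + p v ^ 2) / (G v ^ 2 * z ^ 2) := by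
      field_simp
      rw [hs2, hz2, hw2]; ring
    have e2 : 1 + (p v / G v) ^ 2 = (G v ^ 2 + p v ^ 2) / G v ^ 2 := by field_simp
    have e : z / radW K (G v) ^ 2 - R * 1 - (R * (1 / (1 + (p v / G v) ^ 2) *
        ((d * G v - p v * p v) / G v ^ 2)) - 1 / (1 + (√K * p v / (G v * z)) ^ 2) *
        ((√K * d * (G v * z) - √K * p v * (p v * z + G v * (p v * (G v + d) / z))) /
          (G v * z) ^ 2) / √K) =
        -((d + G v) * G v * (R - 1 / z) / (G v ^ 2 + p v ^ 2)) := by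
      rw [e1, e2, hw2]
      have hz2' : K = z ^ 2 - G v ^ 2 - p v ^ 2 := by linarith
      field_simp
      rw [hz2']
      ring
    rw [e, neg_nonpos]
    have : 0 ≤ d + G v := by linarith
    positivity

end

section

open ModelPlane

/-! ### Second order expansion of curves -/

section Expansion

variable {γ V : ℝ → E3} {A : E3} {t₀ : ℝ}

/-- A curve whose velocity is differentiable at one point has a second order expansion there. -/
theorem exists_second_order (hV : HasDerivAt V A t₀) (hγ : ∀ᵐ v, HasDerivAt γ (V v) v)
    (hL : ∃ L, LipschitzOnWith L γ (Icc (t₀ - 1) (t₀ + 1))) {ε : ℝ} (hε : 0 < ε) :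
    ∃ η > 0, ∀ s t r, s ≤ t → |s - t₀| ≤ r → |t - t₀| ≤ r → r < η →
      ‖γ t - γ s - (t - s) • (V t₀ + ((s + t) / 2 - t₀) • A)‖ ≤ ε * r * (t - s) := by
  obtain ⟨L, hL⟩ := hL
  have h1 := (hasDerivAt_iff_isLittleO.1 hV).def hε
  obtain ⟨η, hη, hball⟩ := Metric.eventually_nhds_iff.1 h1
  refine ⟨min η 1, by positivity, fun s t r hst hs ht hr => ?_⟩
  set h : ℝ → E3 := fun v => γ v - (v - t₀) • V t₀ - ((v - t₀) ^ 2 / 2) • A with hh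
  have e : γ t - γ s - (t - s) • (V t₀ + ((s + t) / 2 - t₀) • A) = h t - h s := by
    simp only [hh]
    module
  rw [e]
  set w := h t - h s with hw
  have hs' := abs_le.1 hs
  have ht' := abs_le.1 ht
  have hr1 : r < 1 := hr.trans_le (min_le_right _ _)
  have hrη : r < η := hr.trans_le (min_le_left _ _)
  -- Pairing with the increment `w` itself reduces the mean value inequality for vectors to the
  -- scalar one.
  have hr0 : 0 ≤ r := (abs_nonneg _).trans hs
  have key := sub_le_mul_of_ae_deriv_le (f := fun v => ⟪h v, w⟫)
    (C := (L + ‖V t₀‖ + 2 * ‖A‖) * ‖w‖) (M := ε * r * ‖w‖) hst ?_ ?_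
  · have e2 : ⟪h t, w⟫ - ⟪h s, w⟫ = ‖w‖ * ‖w‖ := by
      rw [← inner_sub_left, ← hw, real_inner_self_eq_norm_mul_norm]
    simp only [e2] at key
    rcases (norm_nonneg w).eq_or_lt with h0 | h0
    · rw [← h0]
      have := sub_nonneg.2 hst
      positivity
    · refine le_of_mul_le_mul_right ?_ h0
      linarith
  · intro x hx y hy hxy
    rw [← inner_sub_left]
    refine (real_inner_le_norm _ _).trans ?_
    rw [mul_right_comm]
    gcongr
    have hxI : x ∈ Icc (t₀ - 1) (t₀ + 1) := ⟨by linarith [hx.1], by linarith [hx.2]⟩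
    have hyI : y ∈ Icc (t₀ - 1) (t₀ + 1) := ⟨by linarith [hy.1], by linarith [hy.2]⟩
    have a1 := hL.dist_le_mul y hyI x hxI
    rw [dist_eq_norm, Real.dist_eq, abs_of_nonneg (sub_nonneg.2 hxy)] at a1
    have e3 : h y - h x = γ y - γ x - (y - x) • V t₀ - ((y - x) * ((x + y) / 2 - t₀)) • A := by
      simp only [hh]
      module
    have a2 : |(x + y) / 2 - t₀| ≤ 2 := abs_le.2 ⟨by linarith [hxI.1, hyI.1],
      by linarith [hxI.2, hyI.2]⟩
    have hyx := sub_nonneg.2 hxy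
    rw [e3]
    calc _ ≤ ‖γ y - γ x‖ + ‖(y - x) • V t₀‖ + ‖((y - x) * ((x + y) / 2 - t₀)) • A‖ :=
          (norm_sub_le _ _).trans (add_le_add_left (norm_sub_le _ _) _)
      _ = ‖γ y - γ x‖ + (y - x) * ‖V t₀‖ + (y - x) * |(x + y) / 2 - t₀| * ‖A‖ := by
        rw [norm_smul, norm_smul, norm_mul, Real.norm_eq_abs, Real.norm_eq_abs, abs_of_nonneg hyx]
      _ ≤ L * (y - x) + (y - x) * ‖V t₀‖ + (y - x) * 2 * ‖A‖ := by gcongr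
      _ = _ := by ring
  · filter_upwards [hγ] with v hv hm
    have h2 : HasDerivAt h (V v - V t₀ - (v - t₀) • A) v := by
      have b1 : HasDerivAt (fun v : ℝ => (v - t₀) • V t₀) (V t₀) v := by
        simpa using ((hasDerivAt_id v).sub_const t₀).smul_const (V t₀)
      have b2 : HasDerivAt (fun v : ℝ => ((v - t₀) ^ 2 / 2) • A) ((v - t₀) • A) v := by
        have := ((((hasDerivAt_id v).sub_const t₀).fun_pow 2).div_const 2).smul_const A
        simpa using this
      exact (hv.fun_sub b1).fun_sub b2
    have h3 := h2.inner ℝ (hasDerivAt_const v w)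
    refine ⟨_, h3, ?_⟩
    rw [inner_zero_right, zero_add]
    refine (real_inner_le_norm _ _).trans ?_
    gcongr
    have hvr : |v - t₀| ≤ r := abs_le.2 ⟨by linarith [hm.1], by linarith [hm.2]⟩
    have h4 := hball (y := v) (by rw [Real.dist_eq]; linarith)
    rw [Real.norm_eq_abs] at h4
    exact h4.trans (by gcongr)

/-- Pairs of parameters on both sides of a point. -/
def straddling (t₀ : ℝ) : Filter (ℝ × ℝ) :=
  𝓝 (t₀, t₀) ⊓ 𝓟 {x : ℝ × ℝ | x.1 < x.2 ∧ x.1 ≤ t₀ ∧ t₀ ≤ x.2}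

theorem eventually_straddling {t₀ : ℝ} {P : ℝ → ℝ → Prop} (η : ℝ) (hη : 0 < η)
    (h : ∀ s t, s < t → s ≤ t₀ → t₀ ≤ t → t - s < η → P s t) :
    ∀ᶠ x in straddling t₀, P x.1 x.2 := by
  rw [straddling, eventually_inf_principal]
  have h1 : ∀ᶠ x : ℝ × ℝ in 𝓝 (t₀, t₀), x.2 - x.1 < η := by
    have : ContinuousAt (fun x : ℝ × ℝ => x.2 - x.1) (t₀, t₀) := by fun_prop
    exact this.eventually_lt continuousAt_const (by simpa using hη)
  filter_upwards [h1] with x hx hx2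
  exact h _ _ hx2.1 hx2.2.1 hx2.2.2 hx

/-- A secant is the linearised velocity at the midpoint, up to `o(t - s)`, uniformly over intervals
containing `t₀`. -/
theorem tendsto_secant (hV : HasDerivAt V A t₀) (hγ : ∀ᵐ v, HasDerivAt γ (V v) v)
    (hL : ∃ L, LipschitzOnWith L γ (Icc (t₀ - 1) (t₀ + 1))) :
    Tendsto (fun x : ℝ × ℝ => (x.2 - x.1)⁻¹ • ((x.2 - x.1)⁻¹ • (γ x.2 - γ x.1) -
      (V t₀ + ((x.1 + x.2) / 2 - t₀) • A))) (straddling t₀) (𝓝 0) := by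
  rw [Metric.tendsto_nhds]
  intro ε hε
  obtain ⟨η, hη, h⟩ := exists_second_order hV hγ hL (half_pos hε)
  refine eventually_straddling (P := fun s t => dist ((t - s)⁻¹ • ((t - s)⁻¹ • (γ t - γ s) -
    (V t₀ + ((s + t) / 2 - t₀) • A))) 0 < ε) η hη fun s t hst hs ht hη' => ?_
  have hst0 : 0 < t - s := sub_pos.2 hst
  have h1 := h s t (t - s) hst.le (by rw [abs_of_nonpos (by linarith)]; linarith)
    (by rw [abs_of_nonneg (by linarith)]; linarith) hη'
  have e : (t - s)⁻¹ • ((t - s)⁻¹ • (γ t - γ s) - (V t₀ + ((s + t) / 2 - t₀) • A)) =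
      ((t - s)⁻¹ * (t - s)⁻¹) • (γ t - γ s - (t - s) • (V t₀ + ((s + t) / 2 - t₀) • A)) := by
    have e1 : (t - s)⁻¹ = ((t - s)⁻¹ * (t - s)⁻¹) * (t - s) := by field_simp
    rw [smul_sub, smul_smul, smul_sub _ (γ t - γ s), smul_smul, ← e1]
  rw [dist_zero_right, e, norm_smul, Real.norm_eq_abs, abs_of_pos (by positivity)]
  calc _ ≤ (t - s)⁻¹ * (t - s)⁻¹ * (ε / 2 * (t - s) * (t - s)) := by gcongr
    _ = ε / 2 := by field_simp
    _ < ε := by linarith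

theorem tendsto_secant' (hV : HasDerivAt V A t₀) (hγ : ∀ᵐ v, HasDerivAt γ (V v) v)
    (hL : ∃ L, LipschitzOnWith L γ (Icc (t₀ - 1) (t₀ + 1))) :
    Tendsto (fun x : ℝ × ℝ => (x.2 - x.1)⁻¹ • (γ x.2 - γ x.1)) (straddling t₀) (𝓝 (V t₀)) := by
  have hle : straddling t₀ ≤ 𝓝 (t₀, t₀) := inf_le_left
  have h1 : Tendsto (fun x : ℝ × ℝ => x.2 - x.1) (straddling t₀) (𝓝 0) := by
    have : ContinuousAt (fun x : ℝ × ℝ => x.2 - x.1) (t₀, t₀) := by fun_prop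
    simpa using this.tendsto.mono_left hle
  have h2 := h1.smul (tendsto_secant hV hγ hL)
  have h3 : Tendsto (fun x : ℝ × ℝ => V t₀ + ((x.1 + x.2) / 2 - t₀) • A) (straddling t₀)
      (𝓝 (V t₀)) := by
    have : ContinuousAt (fun x : ℝ × ℝ => V t₀ + ((x.1 + x.2) / 2 - t₀) • A) (t₀, t₀) := by
      fun_prop
    have h4 := this.tendsto.mono_left hle
    simpa using h4
  have h5 := h2.add h3
  rw [smul_zero, zero_add] at h5
  refine h5.congr' ?_
  refine eventually_straddling (P := fun s t => (t - s) • ((t - s)⁻¹ • ((t - s)⁻¹ • (γ t - γ s) -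
    (V t₀ + ((s + t) / 2 - t₀) • A))) + (V t₀ + ((s + t) / 2 - t₀) • A) =
      (t - s)⁻¹ • (γ t - γ s)) 1 one_pos fun s t hst _ _ _ => ?_
  have hst0 : t - s ≠ 0 := (sub_pos.2 hst).ne'
  rw [smul_smul, mul_inv_cancel₀ hst0, one_smul, sub_add_cancel]

/-- The Gram determinant of two vectors. -/
noncomputable def gram (x y : E3) : ℝ := ⟪x, x⟫ * ⟪y, y⟫ - ⟪x, y⟫ ^ 2

theorem gram_smul_smul (a b : ℝ) (x y : E3) : gram (a • x) (b • y) = a ^ 2 * b ^ 2 * gram x y := by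
  simp only [gram, real_inner_smul_left, real_inner_smul_right]
  ring

theorem gram_sub_left (x y : E3) : gram (x - y) y = gram x y := by
  simp only [gram, inner_sub_left, inner_sub_right]
  rw [real_inner_comm x y]
  ring

theorem gram_comm (x y : E3) : gram x y = gram y x := by
  simp only [gram]
  rw [real_inner_comm x y]
  ring

theorem continuous_gram : Continuous fun x : E3 × E3 => gram x.1 x.2 := by
  unfold gram; fun_prop

/-- Heron's formula: both sides are sixteen times the squared area of the triangle `0, u, v`. -/
theorem norm_sub_sq_gram (u v : E3) :
    4 * ‖u‖ ^ 2 * ‖v‖ ^ 2 - (‖u‖ ^ 2 + ‖v‖ ^ 2 - ‖v - u‖ ^ 2) ^ 2 = 4 * gram u v := by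
  rw [norm_sub_sq_real, gram, real_inner_self_eq_norm_sq, real_inner_self_eq_norm_sq,
    real_inner_comm]
  ring

theorem oppositeSides_le_straddling (t₀ : ℝ) : oppositeSides t₀ ≤ straddling t₀ := by
  rw [straddling, le_inf_iff, nhds_prod_eq, oppositeSides, le_principal_iff]
  refine ⟨Filter.prod_mono nhdsWithin_le_nhds nhdsWithin_le_nhds, ?_⟩
  filter_upwards [prod_mem_prod (self_mem_nhdsWithin (a := t₀) (s := Iio t₀))
    (self_mem_nhdsWithin (a := t₀) (s := Ioi t₀))] with x hx
  exact ⟨lt_trans hx.1 hx.2, le_of_lt hx.1, le_of_lt hx.2⟩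

theorem tendsto_fst_straddling (t₀ : ℝ) :
    Tendsto (fun x : ℝ × ℝ => (x.1, t₀)) (oppositeSides t₀) (straddling t₀) := by
  rw [straddling, tendsto_inf, tendsto_principal]
  refine ⟨?_, ?_⟩
  · have : ContinuousAt (fun x : ℝ × ℝ => (x.1, t₀)) (t₀, t₀) := by fun_prop
    exact this.tendsto.mono_left ((oppositeSides_le_straddling t₀).trans inf_le_left)
  · filter_upwards [prod_mem_prod (self_mem_nhdsWithin (a := t₀) (s := Iio t₀))
      (self_mem_nhdsWithin (a := t₀) (s := Ioi t₀))] with x hx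
    exact ⟨hx.1, le_of_lt hx.1, le_rfl⟩

theorem tendsto_snd_straddling (t₀ : ℝ) :
    Tendsto (fun x : ℝ × ℝ => (t₀, x.2)) (oppositeSides t₀) (straddling t₀) := by
  rw [straddling, tendsto_inf, tendsto_principal]
  refine ⟨?_, ?_⟩
  · have : ContinuousAt (fun x : ℝ × ℝ => (t₀, x.2)) (t₀, t₀) := by fun_prop
    exact this.tendsto.mono_left ((oppositeSides_le_straddling t₀).trans inf_le_left)
  · filter_upwards [prod_mem_prod (self_mem_nhdsWithin (a := t₀) (s := Iio t₀))
      (self_mem_nhdsWithin (a := t₀) (s := Ioi t₀))] with x hx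
    exact ⟨hx.2, le_rfl, le_of_lt hx.2⟩

/-- The limit of the curvatures of the circles through three points of a curve. -/
theorem tendsto_menger (hV : HasDerivAt V A t₀) (hγ : ∀ᵐ v, HasDerivAt γ (V v) v)
    (hL : ∃ L, LipschitzOnWith L γ (Icc (t₀ - 1) (t₀ + 1))) (hV0 : V t₀ ≠ 0) :
    Tendsto (fun x : ℝ × ℝ => 4 * gram (γ x.1 - γ t₀) (γ x.2 - γ t₀) /
      (‖γ x.1 - γ t₀‖ ^ 2 * ‖γ t₀ - γ x.2‖ ^ 2 * ‖γ x.2 - γ x.1‖ ^ 2)) (oppositeSides t₀)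
      (𝓝 (gram A (V t₀) / ‖V t₀‖ ^ 6)) := by
  have hop := oppositeSides_le_straddling t₀
  have h1 := tendsto_fst_straddling t₀
  have h2 := tendsto_snd_straddling t₀
  have a1 := (tendsto_secant' hV hγ hL).comp h1
  have a2 := (tendsto_secant' hV hγ hL).comp h2
  have a3 := (tendsto_secant' hV hγ hL).mono_left hop
  have b1 := (tendsto_secant hV hγ hL).comp h1
  have b2 := (tendsto_secant hV hγ hL).comp h2
  simp only [Function.comp_def] at a1 a2 b1 b2
  -- the difference of the two secants
  have hD : Tendsto (fun x : ℝ × ℝ => (x.2 - x.1)⁻¹ • ((x.2 - t₀)⁻¹ • (γ x.2 - γ t₀) -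
      (t₀ - x.1)⁻¹ • (γ t₀ - γ x.1))) (oppositeSides t₀) (𝓝 ((1 / 2 : ℝ) • A)) := by
    have c1 : Tendsto (fun x : ℝ × ℝ => ((x.2 - t₀) / (x.2 - x.1)) • ((x.2 - t₀)⁻¹ •
        ((x.2 - t₀)⁻¹ • (γ x.2 - γ t₀) - (V t₀ + ((t₀ + x.2) / 2 - t₀) • A))))
        (oppositeSides t₀) (𝓝 0) := by
      refine squeeze_zero_norm' ?_ (by simpa using b2.norm)
      filter_upwards [hop (eventually_straddling (P := fun s t => |(t - t₀) / (t - s)| ≤ 1) 1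
        one_pos fun s t h3 h4 h5 _ => by
          rw [abs_of_nonneg (div_nonneg (by linarith) (by linarith)), div_le_one (by linarith)]
          linarith)] with x hx
      rw [norm_smul, Real.norm_eq_abs]
      exact mul_le_of_le_one_left (norm_nonneg _) hx
    have c2 : Tendsto (fun x : ℝ × ℝ => ((t₀ - x.1) / (x.2 - x.1)) • ((t₀ - x.1)⁻¹ •
        ((t₀ - x.1)⁻¹ • (γ t₀ - γ x.1) - (V t₀ + ((x.1 + t₀) / 2 - t₀) • A))))
        (oppositeSides t₀) (𝓝 0) := by
      refine squeeze_zero_norm' ?_ (by simpa using b1.norm)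
      filter_upwards [hop (eventually_straddling (P := fun s t => |(t₀ - s) / (t - s)| ≤ 1) 1
        one_pos fun s t h3 h4 h5 _ => by
          rw [abs_of_nonneg (div_nonneg (by linarith) (by linarith)), div_le_one (by linarith)]
          linarith)] with x hx
      rw [norm_smul, Real.norm_eq_abs]
      exact mul_le_of_le_one_left (norm_nonneg _) hx
    have c3 := (c1.sub c2).add (tendsto_const_nhds (x := (1 / 2 : ℝ) • A))
    rw [sub_zero, zero_add] at c3
    refine c3.congr' ?_
    filter_upwards [prod_mem_prod (self_mem_nhdsWithin (a := t₀) (s := Iio t₀))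
        (self_mem_nhdsWithin (a := t₀) (s := Ioi t₀))] with x hx
    have d1 : x.2 - t₀ ≠ 0 := (sub_pos.2 hx.2).ne'
    have d2 : t₀ - x.1 ≠ 0 := (sub_pos.2 hx.1).ne'
    have d3 : x.2 - x.1 ≠ 0 := (sub_pos.2 (lt_trans hx.1 hx.2)).ne'
    rw [smul_smul, smul_smul, div_mul_eq_mul_div, div_mul_eq_mul_div, mul_inv_cancel₀ d1,
      mul_inv_cancel₀ d2, one_div]
    have d4 : (x.2 - x.1)⁻¹ * ((t₀ + x.2) / 2 - t₀ - ((x.1 + t₀) / 2 - t₀)) = 1 / 2 := by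
      field_simp; ring
    rw [← d4]
    module
  -- The two secants become parallel, so their Gram determinant degenerates. A shear replaces one of
  -- them by the difference without changing the determinant, and the rescaled difference tends to
  -- `A / 2`.
  have hlim := ((continuous_gram.tendsto _).comp (hD.prodMk_nhds a1)).const_mul 4 |>.div
    (((a1.norm.pow 2).mul (a2.norm.pow 2)).mul (a3.norm.pow 2))
    (by have := norm_pos_iff.2 hV0; positivity)
  have e1 : 4 * gram ((1 / 2 : ℝ) • A) (V t₀) / (‖V t₀‖ ^ 2 * ‖V t₀‖ ^ 2 * ‖V t₀‖ ^ 2) =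
      gram A (V t₀) / ‖V t₀‖ ^ 6 := by
    have := gram_smul_smul (1 / 2) 1 A (V t₀)
    rw [one_smul] at this
    rw [this]
    ring
  simp only [e1] at hlim
  refine hlim.congr' ?_
  filter_upwards [prod_mem_prod (self_mem_nhdsWithin (a := t₀) (s := Iio t₀))
      (self_mem_nhdsWithin (a := t₀) (s := Ioi t₀))] with x hx
  have d1 : x.2 - t₀ ≠ 0 := (sub_pos.2 hx.2).ne'
  have d2 : t₀ - x.1 ≠ 0 := (sub_pos.2 hx.1).ne'
  have d3 : x.2 - x.1 ≠ 0 := (sub_pos.2 (lt_trans hx.1 hx.2)).ne'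
  simp only [Pi.div_apply, Function.comp_apply]
  set u := (t₀ - x.1)⁻¹ • (γ t₀ - γ x.1) with hu
  set v := (x.2 - t₀)⁻¹ • (γ x.2 - γ t₀) with hv
  have e2 : γ x.1 - γ t₀ = (-(t₀ - x.1)) • u := by
    rw [hu, smul_smul, neg_mul, mul_inv_cancel₀ d2]; module
  have e3 : γ x.2 - γ t₀ = (x.2 - t₀) • v := by
    rw [hv, smul_smul, mul_inv_cancel₀ d1, one_smul]
  have e4 : gram ((x.2 - x.1)⁻¹ • (v - u)) u = ((x.2 - x.1)⁻¹) ^ 2 * gram u v := by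
    have := gram_smul_smul (x.2 - x.1)⁻¹ 1 (v - u) u
    rw [one_smul] at this
    rw [this, gram_sub_left, gram_comm v u]
    ring
  have e5 : ‖(x.2 - x.1)⁻¹ • (γ x.2 - γ x.1)‖ ^ 2 = ((x.2 - x.1)⁻¹) ^ 2 * ‖γ x.2 - γ x.1‖ ^ 2 := by
    rw [norm_smul, mul_pow, Real.norm_eq_abs, sq_abs]
  clear_value u v
  rw [e4, e5, norm_sub_rev (γ t₀) (γ x.2), e2, e3, gram_smul_smul, norm_smul, norm_smul,
    Real.norm_eq_abs, Real.norm_eq_abs, mul_pow, mul_pow, sq_abs, sq_abs]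
  generalize gram u v = gu
  generalize ‖u‖ = nu
  generalize ‖v‖ = nv
  generalize ‖γ x.2 - γ x.1‖ = nw
  field_simp

end Expansion

end

section

open ModelPlane

/-! ### The third order defect between length and chord -/

section ArcChord

variable {γ V : ℝ → E3} {A : E3} {t₀ : ℝ}

/-- Pairs of parameters on both sides of a point and a third parameter between them. -/
def straddlingBetween (t₀ : ℝ) : Filter (ℝ × ℝ × ℝ) :=
  𝓝 (t₀, t₀, t₀) ⊓ 𝓟 {x : ℝ × ℝ × ℝ | x.1 < x.2.1 ∧ x.1 ≤ t₀ ∧ t₀ ≤ x.2.1 ∧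
    x.1 ≤ x.2.2 ∧ x.2.2 ≤ x.2.1}

theorem tendsto_straddlingBetween (t₀ : ℝ) :
    Tendsto (fun x : ℝ × ℝ × ℝ => (x.1, x.2.1)) (straddlingBetween t₀) (straddling t₀) := by
  rw [straddling, tendsto_inf, tendsto_principal]
  refine ⟨?_, ?_⟩
  · have : ContinuousAt (fun x : ℝ × ℝ × ℝ => (x.1, x.2.1)) (t₀, t₀, t₀) := by fun_prop
    exact this.tendsto.mono_left inf_le_left
  · filter_upwards [mem_inf_of_right (mem_principal_self _)] with x hx
    exact ⟨hx.1, hx.2.1, hx.2.2.1⟩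

/-- Rationalising a difference of nearly equal quantities exhibits the defect as quadratic in the
deviation of `v` from the direction of `w`. -/
theorem norm_sub_inner_eq {v w : E3} (hw : w ≠ 0) (h : 0 < ‖v‖ * ‖w‖ + ⟪v, w⟫) :
    ‖v‖ - ⟪v, ‖w‖⁻¹ • w⟫ = gram v w / (‖w‖ * (‖v‖ * ‖w‖ + ⟪v, w⟫)) := by
  have h1 := norm_pos_iff.2 hw
  rw [real_inner_smul_right, gram, real_inner_self_eq_norm_sq, real_inner_self_eq_norm_sq,
    eq_div_iff (by positivity)]
  field_simp
  ring

/-- The speed minus its component along the chord is the rate at which length outgrows the chord.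
The velocity deviates from the secant by about `A` times the distance to the midpoint, so this rate
is quadratic in that distance. -/
theorem tendsto_speed_defect (hV : HasDerivAt V A t₀) (hγ : ∀ᵐ v, HasDerivAt γ (V v) v)
    (hL : ∃ L, LipschitzOnWith L γ (Icc (t₀ - 1) (t₀ + 1))) (hV0 : V t₀ ≠ 0) :
    Tendsto (fun x : ℝ × ℝ × ℝ =>
      (‖V x.2.2‖ - ⟪V x.2.2, ‖γ x.2.1 - γ x.1‖⁻¹ • (γ x.2.1 - γ x.1)⟫) / (x.2.1 - x.1) ^ 2 -
        ((x.2.2 - (x.1 + x.2.1) / 2) / (x.2.1 - x.1)) ^ 2 * (gram A (V t₀) / (2 * ‖V t₀‖ ^ 3)))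
      (straddlingBetween t₀) (𝓝 0) := by
  -- The relative position of the third parameter has no limit, but it is bounded; along an
  -- ultrafilter it converges to some `θ`, and the two terms then have the same limit.
  rw [tendsto_iff_ultrafilter]
  intro g hg
  have hgs := (tendsto_straddlingBetween t₀).mono_left hg
  have hmem : ∀ᶠ x in (g : Filter (ℝ × ℝ × ℝ)), x.1 < x.2.1 ∧ x.1 ≤ t₀ ∧ t₀ ≤ x.2.1 ∧
      x.1 ≤ x.2.2 ∧ x.2.2 ≤ x.2.1 := hg (mem_inf_of_right (mem_principal_self _))
  obtain ⟨θ, -, hθ⟩ := (isCompact_Icc (a := (-1 : ℝ)) (b := 1)).ultrafilter_le_nhds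
    (g.map fun x => (x.2.2 - (x.1 + x.2.1) / 2) / (x.2.1 - x.1)) (by
      rw [le_principal_iff, Ultrafilter.mem_coe, Ultrafilter.mem_map]
      filter_upwards [hmem] with x hx
      have : 0 < x.2.1 - x.1 := by linarith [hx.1]
      constructor
      · rw [le_div_iff₀ this]; linarith [hx.2.2.2.1]
      · rw [div_le_iff₀ this]; linarith [hx.2.2.2.2])
  replace hθ : Tendsto (fun x : ℝ × ℝ × ℝ => (x.2.2 - (x.1 + x.2.1) / 2) / (x.2.1 - x.1)) g (𝓝 θ) :=
    hθ
  have a1 := (tendsto_secant' hV hγ hL).comp hgs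
  have b1 := (tendsto_secant hV hγ hL).comp hgs
  have hv : Tendsto (fun x : ℝ × ℝ × ℝ => x.2.2) g (𝓝 t₀) := by
    have : ContinuousAt (fun x : ℝ × ℝ × ℝ => x.2.2) (t₀, t₀, t₀) := by fun_prop
    exact this.tendsto.mono_left (hg.trans inf_le_left)
  have a2 : Tendsto (fun x : ℝ × ℝ × ℝ => V x.2.2) g (𝓝 (V t₀)) := hV.continuousAt.tendsto.comp hv
  have b2 : Tendsto (fun x : ℝ × ℝ × ℝ =>
      (x.2.1 - x.1)⁻¹ • (V x.2.2 - V t₀ - (x.2.2 - t₀) • A)) g (𝓝 0) := by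
    have c1 := (hasDerivAt_iff_isLittleO.1 hV).comp_tendsto hv
    have c2 : (fun x : ℝ × ℝ × ℝ => x.2.2 - t₀) =O[g] fun x => x.2.1 - x.1 := by
      refine Asymptotics.IsBigO.of_bound 1 ?_
      filter_upwards [hmem] with x hx
      rw [one_mul, Real.norm_eq_abs, Real.norm_eq_abs, abs_of_pos (a := x.2.1 - x.1)
        (by linarith [hx.1])]
      exact abs_le.2 ⟨by linarith [hx.2.2.1, hx.2.2.2.1], by linarith [hx.2.1, hx.2.2.2.2]⟩
    exact (c1.trans_isBigO c2).tendsto_inv_smul_nhds_zero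
  have hD := (b2.sub b1).add (hθ.smul_const A)
  rw [sub_zero, zero_add] at hD
  simp only [Function.comp_def] at a1 b1 hD
  have hden : Tendsto (fun x : ℝ × ℝ × ℝ => ‖V x.2.2‖ * ‖(x.2.1 - x.1)⁻¹ • (γ x.2.1 - γ x.1)‖ +
      ⟪V x.2.2, (x.2.1 - x.1)⁻¹ • (γ x.2.1 - γ x.1)⟫) g (𝓝 (‖V t₀‖ * ‖V t₀‖ + ⟪V t₀, V t₀⟫)) :=
    (a2.norm.mul a1.norm).add (a2.inner a1)
  have hnum := (continuous_gram.tendsto _).comp (hD.prodMk_nhds a1)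
  have hn0 := norm_pos_iff.2 hV0
  have hpos : 0 < ‖V t₀‖ * ‖V t₀‖ + ⟪V t₀, V t₀⟫ := by
    rw [real_inner_self_eq_norm_sq]; positivity
  have hq := (hnum.div (a1.norm.mul hden) (by positivity)).sub ((hθ.pow 2).mul_const
    (gram A (V t₀) / (2 * ‖V t₀‖ ^ 3)))
  have e1 : gram (θ • A) (V t₀) / (‖V t₀‖ * (‖V t₀‖ * ‖V t₀‖ + ⟪V t₀, V t₀⟫)) -
      θ ^ 2 * (gram A (V t₀) / (2 * ‖V t₀‖ ^ 3)) = 0 := by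
    have := gram_smul_smul θ 1 A (V t₀)
    rw [one_smul] at this
    rw [this, real_inner_self_eq_norm_sq]
    field_simp
    ring
  simp only [e1] at hq
  refine hq.congr' ?_
  filter_upwards [hmem, hden.eventually_const_lt hpos, a1.norm.eventually_const_lt hn0] with x hx hd hn
  have hδ : 0 < x.2.1 - x.1 := by linarith [hx.1]
  simp only [Pi.div_apply, Function.comp_apply]
  congr 1
  have hw := norm_pos_iff.1 hn
  have e2 := norm_sub_inner_eq hw hd
  have e3 : ‖(x.2.1 - x.1)⁻¹ • (γ x.2.1 - γ x.1)‖⁻¹ • ((x.2.1 - x.1)⁻¹ • (γ x.2.1 - γ x.1)) =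
      ‖γ x.2.1 - γ x.1‖⁻¹ • (γ x.2.1 - γ x.1) := by
    rw [norm_smul, smul_smul, mul_inv, norm_inv, Real.norm_eq_abs, abs_of_pos hδ, inv_inv,
      mul_right_comm, mul_inv_cancel₀ hδ.ne', one_mul]
  rw [e3] at e2
  rw [e2]
  have e4 : (x.2.1 - x.1)⁻¹ • (V x.2.2 - V t₀ - (x.2.2 - t₀) • A) -
      (x.2.1 - x.1)⁻¹ • ((x.2.1 - x.1)⁻¹ • (γ x.2.1 - γ x.1) -
        (V t₀ + ((x.1 + x.2.1) / 2 - t₀) • A)) +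
      ((x.2.2 - (x.1 + x.2.1) / 2) / (x.2.1 - x.1)) • A =
      (x.2.1 - x.1)⁻¹ • (V x.2.2 - (x.2.1 - x.1)⁻¹ • (γ x.2.1 - γ x.1)) := by
    rw [div_eq_inv_mul]
    module
  rw [e4]
  generalize (x.2.1 - x.1)⁻¹ • (γ x.2.1 - γ x.1) = w
  have := gram_smul_smul (x.2.1 - x.1)⁻¹ 1 (V x.2.2 - w) w
  rw [one_smul] at this
  rw [this, gram_sub_left]
  field_simp

/-- Integration of a derivative which is nearly quadratic. -/
theorem abs_sub_sub_cube_le {f f' : ℝ → ℝ} {s t c C ε : ℝ} (hst : s ≤ t) (h1 : t - s ≤ 1)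
    (hC : ∀ x ∈ Icc s t, ∀ y ∈ Icc s t, x ≤ y → |f y - f x| ≤ C * (y - x))
    (hd : ∀ᵐ v, v ∈ Ioo s t → HasDerivAt f (f' v) v)
    (hb : ∀ v, s ≤ v → v ≤ t → |f' v - (v - (s + t) / 2) ^ 2 * c| ≤ ε) :
    |f t - f s - c * (t - s) ^ 3 / 12| ≤ ε * (t - s) := by
  set m := (s + t) / 2 with hm
  -- An antiderivative of the quadratic model; since `m` is the midpoint, its increment is `c (t -
  -- s)³ / 12`.
  set g : ℝ → ℝ := fun v => f v - c * (v - m) ^ 3 / 3 with hg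
  have egt : g t - g s = f t - f s - c * (t - s) ^ 3 / 12 := by
    simp only [hg, hm]
    ring
  have hgd : ∀ᵐ v, v ∈ Ioo s t → HasDerivAt g (f' v - (v - m) ^ 2 * c) v := by
    filter_upwards [hd] with v h3 hv
    have h4 : HasDerivAt (fun v : ℝ => c * (v - m) ^ 3 / 3) ((v - m) ^ 2 * c) v := by
      have := ((((hasDerivAt_id v).sub_const m).fun_pow 3).const_mul c).div_const 3
      refine this.congr_deriv ?_
      simp
      ring
    exact (h3 hv).fun_sub h4
  have hgL : ∀ x ∈ Icc s t, ∀ y ∈ Icc s t, x ≤ y → |g y - g x| ≤ (C + |c|) * (y - x) := by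
    intro x hx y hy hxy
    have e2 : g y - g x = (f y - f x) - c * ((y - x) *
        (((y - m) ^ 2 + (y - m) * (x - m) + (x - m) ^ 2) / 3)) := by
      simp only [hg]; ring
    have hyx := sub_nonneg.2 hxy
    have i1 := hC x hx y hy hxy
    have i3 : |c * ((y - x) * (((y - m) ^ 2 + (y - m) * (x - m) + (x - m) ^ 2) / 3))| ≤
        |c| * (y - x) := by
      rw [abs_mul, abs_mul, abs_of_nonneg hyx]
      have j1 : |y - m| ≤ 1 := abs_le.2 ⟨by linarith [hy.1], by linarith [hy.2]⟩
      have j2 : |x - m| ≤ 1 := abs_le.2 ⟨by linarith [hx.1], by linarith [hx.2]⟩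
      have j3 : |((y - m) ^ 2 + (y - m) * (x - m) + (x - m) ^ 2) / 3| ≤ 1 := by
        generalize y - m = a at j1
        generalize x - m = b at j2
        have k1 := sq_le_one_iff_abs_le_one a |>.2 j1
        have k2 := sq_le_one_iff_abs_le_one b |>.2 j2
        rw [abs_of_nonneg (by nlinarith [sq_nonneg (a + b)])]
        nlinarith [sq_nonneg (a - b)]
      gcongr
      exact mul_le_of_le_one_right hyx j3
    rw [e2]
    have i4 := abs_sub (f y - f x) (c * ((y - x) * (((y - m) ^ 2 + (y - m) * (x - m) +
      (x - m) ^ 2) / 3)))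
    linarith
  rw [← egt, abs_le]
  have up := sub_le_mul_of_ae_deriv_le (f := g) (C := C + |c|) (M := ε) hst
    (fun x hx y hy hxy => (le_abs_self _).trans (hgL x hx y hy hxy)) (by
      filter_upwards [hgd] with v hv hm
      exact ⟨_, hv hm, (abs_le.1 (hb v hm.1.le hm.2.le)).2⟩)
  have lo := sub_le_mul_of_ae_deriv_le (f := fun v => -g v) (C := C + |c|) (M := ε) hst
    (fun x hx y hy hxy => by
      have := (neg_le_abs (g y - g x)).trans (hgL x hx y hy hxy)
      linarith) (by
      filter_upwards [hgd] with v hv hm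
      refine ⟨_, (hv hm).neg, ?_⟩
      have := (abs_le.1 (hb v hm.1.le hm.2.le)).1
      linarith)
  exact ⟨by linarith, by linarith⟩

/-- The difference between the length of a short arc and its chord. -/
theorem tendsto_length_sub_chord (hV : HasDerivAt V A t₀) (hγ : ∀ᵐ v, HasDerivAt γ (V v) v)
    (hL : ∃ L, LipschitzOnWith L γ (Icc (t₀ - 1) (t₀ + 1))) (hV0 : V t₀ ≠ 0) {S : ℝ → ℝ}
    (hS : ∀ᵐ v, HasDerivAt S ‖V v‖ v) {C : ℝ} (hC : ∀ x y, x ≤ y → |S y - S x| ≤ C * (y - x)) :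
    Tendsto (fun x : ℝ × ℝ => (S x.2 - S x.1 - ‖γ x.2 - γ x.1‖) / (x.2 - x.1) ^ 3) (straddling t₀)
      (𝓝 (gram A (V t₀) / (24 * ‖V t₀‖ ^ 3))) := by
  rw [Metric.tendsto_nhds]
  intro ε hε
  have h1 := Metric.tendsto_nhds.1 (tendsto_speed_defect hV hγ hL hV0) (ε / 2) (half_pos hε)
  rw [straddlingBetween, eventually_inf_principal] at h1
  obtain ⟨η, hη, h1⟩ := Metric.eventually_nhds_iff.1 h1
  obtain ⟨L, hL'⟩ := hL
  refine eventually_straddling (P := fun s t => dist ((S t - S s - ‖γ t - γ s‖) / (t - s) ^ 3)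
    (gram A (V t₀) / (24 * ‖V t₀‖ ^ 3)) < ε) (min η 1) (by positivity) fun s t hst hs ht hδ => ?_
  have hδη := hδ.trans_le (min_le_left _ _)
  have hδ1 := hδ.trans_le (min_le_right _ _)
  set c := gram A (V t₀) / (2 * ‖V t₀‖ ^ 3) with hc
  set w := γ t - γ s with hw
  set e := ‖w‖⁻¹ • w with he
  have hpos : 0 < t - s := sub_pos.2 hst
  have hbound : ∀ v, s ≤ v → v ≤ t →
      |‖V v‖ - ⟪V v, e⟫ - (v - (s + t) / 2) ^ 2 * c| ≤ ε / 2 * (t - s) ^ 2 := by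
    intro v hsv hvt
    have h2 := h1 (y := (s, t, v)) (by
      rw [Prod.dist_eq, Prod.dist_eq, max_lt_iff, max_lt_iff]
      refine ⟨?_, ?_, ?_⟩ <;> rw [Real.dist_eq, abs_lt] <;> constructor <;> dsimp only <;> linarith)
      ⟨hst, hs, ht, hsv, hvt⟩
    rw [dist_zero_right, Real.norm_eq_abs] at h2
    have e1 : (‖V v‖ - ⟪V v, e⟫) / (t - s) ^ 2 - ((v - (s + t) / 2) / (t - s)) ^ 2 * c =
        (‖V v‖ - ⟪V v, e⟫ - (v - (s + t) / 2) ^ 2 * c) / (t - s) ^ 2 := by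
      field_simp
    rw [e1, abs_div, abs_of_pos (a := (t - s) ^ 2) (by positivity)] at h2
    exact ((div_lt_iff₀ (by positivity)).1 h2).le
  -- Thus length minus chord is the increment of the single function `S - ⟪γ, e⟫` with `e` fixed.
  -- The identity also holds for `w = 0`, where `0⁻¹ = 0` makes `e` zero.
  have hlen : ‖w‖ = ⟪w, e⟫ := by
    rw [he, real_inner_smul_right, real_inner_self_eq_norm_mul_norm]
    rcases (norm_nonneg w).eq_or_lt with h0 | h0
    · simp [← h0]
    · field_simp
  have hen : ‖e‖ ≤ 1 := by
    rw [he, norm_smul, norm_inv, norm_norm]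
    exact inv_mul_le_one
  have key := abs_sub_sub_cube_le (f := fun v => S v - ⟪γ v, e⟫) (f' := fun v => ‖V v‖ - ⟪V v, e⟫)
    (C := C + L) hst.le hδ1.le ?_ ?_ hbound
  · have e5 : gram A (V t₀) / (24 * ‖V t₀‖ ^ 3) = c / 12 := by rw [hc]; ring
    have e6 : (S t - S s - ‖w‖) / (t - s) ^ 3 - c / 12 =
        (S t - ⟪γ t, e⟫ - (S s - ⟪γ s, e⟫) - c * (t - s) ^ 3 / 12) / (t - s) ^ 3 := by
      rw [hlen, hw, inner_sub_left]; field_simp; ring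
    rw [e5, Real.dist_eq, e6, abs_div, abs_of_pos (a := (t - s) ^ 3) (by positivity),
      div_lt_iff₀ (by positivity)]
    have h3 : 0 < ε * (t - s) ^ 3 := by positivity
    linarith
  · intro x hx y hy hxy
    have i1 := hC x y hxy
    have i2 : |⟪γ y - γ x, e⟫| ≤ L * (y - x) := by
      have := hL'.dist_le_mul y ⟨by linarith [hy.1], by linarith [hy.2]⟩ x
        ⟨by linarith [hx.1], by linarith [hx.2]⟩
      rw [dist_eq_norm, Real.dist_eq, abs_of_nonneg (sub_nonneg.2 hxy)] at this
      exact (abs_real_inner_le_norm _ _).trans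
        ((mul_le_of_le_one_right (norm_nonneg _) hen).trans this)
    rw [inner_sub_left] at i2
    have i5 := abs_sub (S y - S x) (⟪γ y, e⟫ - ⟪γ x, e⟫)
    have e7 : S y - ⟪γ y, e⟫ - (S x - ⟪γ x, e⟫) = S y - S x - (⟪γ y, e⟫ - ⟪γ x, e⟫) := by ring
    simp only [e7]
    linarith
  · filter_upwards [hγ, hS] with v h2 h3 _
    exact h3.fun_sub (by simpa using h2.inner ℝ (hasDerivAt_const v e))

theorem tendsto_length_div (hV : HasDerivAt V A t₀) (hγ : ∀ᵐ v, HasDerivAt γ (V v) v)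
    (hL : ∃ L, LipschitzOnWith L γ (Icc (t₀ - 1) (t₀ + 1))) (hV0 : V t₀ ≠ 0) {S : ℝ → ℝ}
    (hS : ∀ᵐ v, HasDerivAt S ‖V v‖ v) {C : ℝ} (hC : ∀ x y, x ≤ y → |S y - S x| ≤ C * (y - x)) :
    Tendsto (fun x : ℝ × ℝ => (S x.2 - S x.1) / (x.2 - x.1)) (straddling t₀) (𝓝 ‖V t₀‖) := by
  have h1 := tendsto_length_sub_chord hV hγ hL hV0 hS hC
  have h2 := (tendsto_secant' hV hγ hL).norm
  have h3 : Tendsto (fun x : ℝ × ℝ => x.2 - x.1) (straddling t₀) (𝓝 0) := by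
    have : ContinuousAt (fun x : ℝ × ℝ => x.2 - x.1) (t₀, t₀) := by fun_prop
    have h4 : Tendsto _ (straddling t₀) _ := this.tendsto.mono_left inf_le_left
    simpa using h4
  have h4 := (h1.mul (h3.pow 2)).add h2
  simp only [ne_eq, OfNat.ofNat_ne_zero, not_false_eq_true, zero_pow, mul_zero, zero_add] at h4
  refine h4.congr' ?_
  refine eventually_straddling (P := fun s t => (S t - S s - ‖γ t - γ s‖) / (t - s) ^ 3 * (t - s) ^ 2
    + ‖(t - s)⁻¹ • (γ t - γ s)‖ = (S t - S s) / (t - s)) 1 one_pos fun s t hst _ _ _ => ?_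
  have hst0 : 0 < t - s := sub_pos.2 hst
  rw [norm_smul, norm_inv, Real.norm_eq_abs, abs_of_pos hst0]
  field_simp
  ring

theorem tendsto_length_sub_chord_div (hV : HasDerivAt V A t₀) (hγ : ∀ᵐ v, HasDerivAt γ (V v) v)
    (hL : ∃ L, LipschitzOnWith L γ (Icc (t₀ - 1) (t₀ + 1))) (hV0 : V t₀ ≠ 0) {S : ℝ → ℝ}
    (hS : ∀ᵐ v, HasDerivAt S ‖V v‖ v) {C : ℝ} (hC : ∀ x y, x ≤ y → |S y - S x| ≤ C * (y - x)) :
    Tendsto (fun x : ℝ × ℝ => (S x.2 - S x.1 - ‖γ x.2 - γ x.1‖) / (S x.2 - S x.1) ^ 3)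
      (straddling t₀) (𝓝 (gram A (V t₀) / ‖V t₀‖ ^ 6 / 24)) := by
  have hn0 := norm_pos_iff.2 hV0
  have h1 := (tendsto_length_sub_chord hV hγ hL hV0 hS hC).div
    ((tendsto_length_div hV hγ hL hV0 hS hC).pow 3) (by positivity)
  have e : gram A (V t₀) / (24 * ‖V t₀‖ ^ 3) / ‖V t₀‖ ^ 3 = gram A (V t₀) / ‖V t₀‖ ^ 6 / 24 := by
    field_simp
  rw [e] at h1
  refine h1.congr' ?_
  refine eventually_straddling (P := fun s t => (S t - S s - ‖γ t - γ s‖) / (t - s) ^ 3 /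
    ((S t - S s) / (t - s)) ^ 3 = (S t - S s - ‖γ t - γ s‖) / (S t - S s) ^ 3) 1 one_pos
    fun s t hst _ _ _ => ?_
  have hst0 : t - s ≠ 0 := (sub_pos.2 hst).ne'
  rw [div_pow, div_div_div_cancel_right₀ (pow_ne_zero 3 hst0)]

end ArcChord

/-! ### Arc/chord values of short arcs -/

variable {K κ : ℝ}

theorem arcChordValue_le (hK : 0 ≤ K) (hκ : 0 ≤ κ) {ℓ : ℝ} (hℓ : 0 < ℓ) {x y : ModelPlane K}
    (hxy : dist x y ≤ ℓ) (h : 0 < K → ℓ + dist x y ≤ 2 * Real.pi / √K)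
    (h2 : ℓ * Real.sinc (√(K + κ ^ 2) * ℓ / 2) ≤ ‖x.coords - y.coords‖) :
    arcChordValue K ℓ (dist x y) ≤ κ := by
  obtain ⟨h3, h4⟩ := norm_coords_sub_le_sinc hK hxy h
  obtain ⟨κ', hκ', h5, h6⟩ := exists_arcChord hK hℓ (norm_nonneg _) h3 h4
  rw [arcChordValue_eq hK hκ' hℓ h5 h6]
  rw [h6] at h2
  by_contra! hlt
  have h7 : √(K + κ ^ 2) < √(K + κ' ^ 2) := Real.sqrt_lt_sqrt (by positivity) (by gcongr)
  have h9 : √(K + κ ^ 2) * ℓ < √(K + κ' ^ 2) * ℓ := by gcongr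
  have h8 := Real.strictAntiOn_sinc (a := √(K + κ ^ 2) * ℓ / 2) (b := √(K + κ' ^ 2) * ℓ / 2)
    ⟨by positivity, by linarith⟩ ⟨by positivity, by linarith⟩ (by gcongr)
  have := le_of_mul_le_mul_left h2 hℓ
  linarith

/-- The model case: a circle of radius `1 / b` in space has defect `b² ℓ³ / 24` to leading order,
with `b² = K + κ²` for a `κ`-arc. -/
theorem tendsto_one_sub_sinc_div {b : ℝ} (hb : 0 ≤ b) {ι : Type*} {l : Filter ι} {ℓ : ι → ℝ}
    (hℓ : ∀ᶠ i in l, 0 < ℓ i) (hℓ0 : Tendsto ℓ l (𝓝 0)) :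
    Tendsto (fun i => (ℓ i - ℓ i * Real.sinc (b * ℓ i / 2)) / ℓ i ^ 3) l (𝓝 (b ^ 2 / 24)) := by
  have h0 : Tendsto (fun i => b * ℓ i / 2) l (𝓝 0) := by
    simpa using (hℓ0.const_mul b).div_const 2
  have h1 : Tendsto (fun i => b ^ 4 / 16 * ℓ i ^ 2) l (𝓝 0) := by
    simpa using (hℓ0.pow 2).const_mul (b ^ 4 / 16)
  rw [tendsto_iff_dist_tendsto_zero]
  refine squeeze_zero' (Eventually.of_forall fun _ => dist_nonneg) ?_ h1
  filter_upwards [hℓ, h0.eventually_lt_const one_pos] with i hi h2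
  have h3 := Real.abs_sinc_sub_le (x := b * ℓ i / 2) (by positivity) h2.le
  have e : (ℓ i - ℓ i * Real.sinc (b * ℓ i / 2)) / ℓ i ^ 3 - b ^ 2 / 24 =
      -((Real.sinc (b * ℓ i / 2) - (1 - (b * ℓ i / 2) ^ 2 / 6)) / ℓ i ^ 2) := by
    field_simp
    ring
  rw [Real.dist_eq, e, abs_neg, abs_div, abs_of_pos (a := ℓ i ^ 2) (by positivity),
    div_le_iff₀ (by positivity)]
  calc _ ≤ _ := h3
    _ = _ := by ring

/-- The arc/chord values of short arcs converge when the arcs differ from their chords by the right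
amount. -/
theorem tendsto_arcChordValue (hK : 0 ≤ K) {ι : Type*} {l : Filter ι} {x y : ι → ModelPlane K}
    {ℓ : ι → ℝ} (hℓ : ∀ᶠ i in l, 0 < ℓ i) (hℓ0 : Tendsto ℓ l (𝓝 0))
    (hle : ∀ᶠ i in l, dist (x i) (y i) ≤ ℓ i) {k : ℝ} (hk : 0 ≤ k)
    (h : Tendsto (fun i => (ℓ i - ‖(x i).coords - (y i).coords‖) / ℓ i ^ 3) l
      (𝓝 ((K + k ^ 2) / 24))) :
    Tendsto (fun i => arcChordValue K (ℓ i) (dist (x i) (y i))) l (𝓝 k) := by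
  have hper : ∀ᶠ i in l, 0 < K → ℓ i + dist (x i) (y i) ≤ 2 * Real.pi / √K := by
    by_cases hK' : 0 < K
    · have hs := Real.sqrt_pos.2 hK'
      have h1 : 0 < Real.pi / √K := div_pos Real.pi_pos hs
      filter_upwards [hle, hℓ0.eventually_lt_const h1] with i h2 h3 _
      rw [mul_div_assoc]
      linarith
    · exact Eventually.of_forall fun i hi => absurd hi hK'
  rw [tendsto_order]
  constructor
  · intro a ha
    rcases lt_or_ge a 0 with h0 | h0
    · exact Eventually.of_forall fun i => h0.trans_le (arcChordValue_nonneg _ _)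
    -- A `k'`-arc with `k' < k` has a smaller limiting defect. Eventually its chord is longer than
    -- the given one, so the value is at least `k' > a`; the upper bound is symmetric.
    obtain ⟨k', hk1, hk2⟩ := exists_between ha
    have hk' : 0 ≤ k' := h0.trans hk1.le
    have h1 := tendsto_one_sub_sinc_div (b := √(K + k' ^ 2)) (Real.sqrt_nonneg _) hℓ hℓ0
    rw [Real.sq_sqrt (by positivity)] at h1
    have h2 := h1.eventually_lt h (by gcongr)
    have h3 : Tendsto (fun i => √(K + k' ^ 2) * ℓ i) l (𝓝 0) := by
      simpa using hℓ0.const_mul (√(K + k' ^ 2))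
    filter_upwards [h2, h3.eventually_lt_const (by positivity : (0 : ℝ) < 2 * Real.pi), hℓ, hle,
      hper] with i i1 i2 i3 i4 i5
    refine hk1.trans_le (le_arcChordValue hK i3 i4 i5 i2.le ?_)
    rw [div_lt_div_iff_of_pos_right (by positivity)] at i1
    linarith
  · intro a ha
    obtain ⟨k', hk1, hk2⟩ := exists_between ha
    have hk' : 0 ≤ k' := hk.trans hk1.le
    have h1 := tendsto_one_sub_sinc_div (b := √(K + k' ^ 2)) (Real.sqrt_nonneg _) hℓ hℓ0
    rw [Real.sq_sqrt (by positivity)] at h1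
    have h2 := h.eventually_lt h1 (by gcongr)
    filter_upwards [h2, hℓ, hle, hper] with i i1 i3 i4 i5
    refine (arcChordValue_le hK hk' i3 i4 i5 ?_).trans_lt hk2
    rw [div_lt_div_iff_of_pos_right (by positivity)] at i1
    linarith

end

/-! ### Geodesic curvature in polar coordinates and the two local limits -/

section

open ModelPlane

variable {K κ : ℝ} {G p : ℝ → ℝ}

/-- The geodesic curvature of a curve at a point with radial coordinate `g` and slope `p`, if `d`
is the derivative of the slope. -/
noncomputable def radCurvature (K g p d : ℝ) : ℝ := (g + d) * radW K g ^ 3 / radZ K g p ^ 3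

theorem radCurvature_nonneg {g p d : ℝ} (h : 0 < K + g ^ 2) (hd : -g ≤ d) :
    0 ≤ radCurvature K g p d :=
  div_nonneg (mul_nonneg (by linarith) (pow_pos (radW_pos h) 3).le) (pow_pos (radZ_pos h) 3).le

/-- Allows the velocity to be replaced by the polynomial tangent vector: a change of length
contributes only a tangential term to the derivative. -/
theorem gram_smul_add_smul (a b : ℝ) (x y : E3) :
    gram (a • x + b • y) (a • y) = a ^ 4 * gram x y := by
  simp only [gram, inner_add_left, inner_add_right, real_inner_smul_left, real_inner_smul_right]
  rw [real_inner_comm x y]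
  ring

theorem PolarFrame.hasDerivAt_tangent (F : PolarFrame K) {t d : ℝ} (hG : HasDerivAt G (p t) t)
    (hp : HasDerivAt p d t) (h : ∀ s, 0 < K + G s ^ 2) :
    HasDerivAt (fun s => F.tangent s (G s) (p s))
      ((G t * p t) • F.e' t - (radZ K (G t) (p t) ^ 2 + d * G t) • F.e t + (d * K) • F.O) t := by
  have e0 : (fun s => F.tangent s (G s) (p s)) =
      fun s => (K + G s ^ 2) • F.e' s - p s • (G s • F.e s - K • F.O) := by
    funext s
    rw [PolarFrame.tangent, radW_sq (h s)]
  rw [e0]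
  have h1 := ((hG.fun_pow 2).const_add K).fun_smul (F.hasDerivAt_e' t)
  have h2 := hp.fun_smul ((hG.fun_smul (F.hasDerivAt_e t)).sub_const (K • F.O))
  refine (h1.fun_sub h2).congr_deriv ?_
  rw [radZ_sq (h t)]
  simp only [Nat.cast_ofNat, Nat.add_one_sub_one, pow_one]
  module

theorem PolarFrame.gram_tangent (F : PolarFrame K) {t g p d : ℝ} (h : 0 < K + g ^ 2) :
    gram ((g * p) • F.e' t - (radZ K g p ^ 2 + d * g) • F.e t + (d * K) • F.O) (F.tangent t g p) =
      K * radZ K g p ^ 6 + (g + d) ^ 2 * radW K g ^ 6 := by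
  have hz : radZ K g p ^ 6 = (K + g ^ 2 + p ^ 2) ^ 3 := by rw [← radZ_sq h]; ring
  have hw : radW K g ^ 6 = (K + g ^ 2) ^ 3 := by rw [← radW_sq h]; ring
  have hB : ⟪(g * p) • F.e' t - (radZ K g p ^ 2 + d * g) • F.e t + (d * K) • F.O,
      (g * p) • F.e' t - (radZ K g p ^ 2 + d * g) • F.e t + (d * K) • F.O⟫ =
      (g * p) ^ 2 + (K + g ^ 2 + p ^ 2 + d * g) ^ 2 + d ^ 2 * K := by
    rw [radZ_sq h]
    simp only [inner_add_left, inner_add_right, inner_sub_left, inner_sub_right,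
      real_inner_smul_left, real_inner_smul_right, inner_e_e, inner_e'_e', inner_e_e', inner_e'_e,
      inner_e_O, inner_e'_O, inner_O_e, inner_O_e', sub_self, Real.cos_zero, Real.sin_zero]
    linear_combination d ^ 2 * F.K_mul_K_mul_inner
  have hBT : ⟪(g * p) • F.e' t - (radZ K g p ^ 2 + d * g) • F.e t + (d * K) • F.O,
      F.tangent t g p⟫ =
      g * p * (K + g ^ 2) + p * g * (K + g ^ 2 + p ^ 2 + d * g) + d * p * K := by
    rw [PolarFrame.tangent, radZ_sq h, radW_sq h]
    simp only [inner_add_left, inner_add_right, inner_sub_left, inner_sub_right,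
      real_inner_smul_left, real_inner_smul_right, inner_e_e, inner_e'_e', inner_e_e', inner_e'_e,
      inner_e_O, inner_e'_O, inner_O_e, inner_O_e', sub_self, Real.cos_zero, Real.sin_zero]
    linear_combination d * p * F.K_mul_K_mul_inner
  rw [gram, hB, hBT, F.inner_tangent_tangent h, hz, hw, radZ_sq h, radW_sq h]
  ring

/-- The squared curvature of a curve in space is `K`, from the surface, plus the squared geodesic
curvature. -/
theorem PolarFrame.exists_hasDerivAt_velocity (F : PolarFrame K) (hG : ConvexRadial K G)
    (hp : ∀ t, IsSlope G t (p t)) {t d : ℝ} (hd : HasDerivAt p d t) :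
    ∃ A, HasDerivAt (fun s => F.velocity s (G s) (p s)) A t ∧
      gram A (F.velocity t (G t) (p t)) / ‖F.velocity t (G t) (p t)‖ ^ 6 =
        K + radCurvature K (G t) (p t) d ^ 2 := by
  have hG' := hG.hasDerivAt hp hd.continuousAt
  have h0 := hG.pos_add t
  have hw := radW_pos h0
  have hz := radZ_pos (p := p t) h0
  have h1 := F.hasDerivAt_tangent hG' hd hG.pos_add
  have h2 := ((hasDerivAt_radW h0 hG').fun_pow 3).fun_inv (pow_pos hw 3).ne'
  refine ⟨_, h2.fun_smul h1, ?_⟩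
  rw [F.norm_velocity h0, PolarFrame.velocity, gram_smul_add_smul, F.gram_tangent h0, radSpeed,
    radCurvature]
  field_simp

section Limits

variable (F : PolarFrame K) {Γ : ℝ → ModelPlane K}

theorem PolarFrame.velocity_ne_zero {t g p : ℝ} (h : 0 < K + g ^ 2) : F.velocity t g p ≠ 0 := by
  rw [← norm_pos_iff, F.norm_velocity h]
  exact radSpeed_pos h

theorem PolarFrame.ae_hasDerivAt_curve (hG : ConvexRadial K G) (hp : ∀ t, IsSlope G t (p t)) :
    ∀ᵐ v, HasDerivAt (F.curve G) (F.velocity v (G v) (p v)) v := by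
  filter_upwards [hG.ae_differentiableAt_slope hp] with v hv
  exact F.hasDerivAt_curve hG (hG.hasDerivAt hp hv.continuousAt)

theorem PolarFrame.exists_lipschitzOnWith_curve (hG : ConvexRadial K G) (s t : ℝ) :
    ∃ L, LipschitzOnWith L (F.curve G) (Icc s t) := by
  obtain ⟨L, hL0, hL⟩ := F.exists_lipschitz_curve hG s t
  refine ⟨L.toNNReal, LipschitzOnWith.of_dist_le_mul fun x hx y hy => ?_⟩
  rw [Real.coe_toNNReal _ hL0, dist_eq_norm, Real.dist_eq]
  exact hL x hx y hy

/-- The osculating curvature at a point where the slope is differentiable. -/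
theorem PolarFrame.tendsto_oscCurvature (hG : ConvexRadial K G) (hp : ∀ t, IsSlope G t (p t))
    (hΓ : ∀ t, (Γ t).coords = F.curve G t) {t d : ℝ} (hd : HasDerivAt p d t) :
    Tendsto (fun x : ℝ × ℝ => oscCurvature K (Γ x.1) (Γ t) (Γ x.2)) (oppositeSides t)
      (𝓝 (radCurvature K (G t) (p t) d)) := by
  obtain ⟨A, hA, hk⟩ := F.exists_hasDerivAt_velocity hG hp hd
  have hγ := F.ae_hasDerivAt_curve hG hp
  have hL := F.exists_lipschitzOnWith_curve hG (t - 1) (t + 1)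
  have h0 := F.velocity_ne_zero (t := t) (p := p t) (hG.pos_add t)
  have h1 := tendsto_menger hA hγ hL h0
  rw [hk] at h1
  have hne : ∀ᶠ x : ℝ × ℝ in straddling t, Γ x.1 ≠ Γ x.2 := by
    filter_upwards [(tendsto_secant' hA hγ hL).norm.eventually_const_lt (norm_pos_iff.2 h0)]
      with x hx h
    rw [← hΓ, ← hΓ, h, sub_self, smul_zero, norm_zero] at hx
    exact lt_irrefl _ hx
  have h2 : Tendsto (fun x : ℝ × ℝ => K + oscCurvature K (Γ x.1) (Γ t) (Γ x.2) ^ 2)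
      (oppositeSides t) (𝓝 (K + radCurvature K (G t) (p t) d ^ 2)) := by
    refine h1.congr' ?_
    filter_upwards [(tendsto_fst_straddling t).eventually hne,
      (tendsto_snd_straddling t).eventually hne, oppositeSides_le_straddling t hne] with x n1 n2 n3
    have h3 := (oscCurvature_spec hG.nonneg n1 n2 n3.symm).2
    have p1 := norm_coords_sub_pos n1
    have p2 := norm_coords_sub_pos n2
    have p3 := norm_coords_sub_pos n3.symm
    rw [CircumEq] at h3
    rw [← norm_sub_sq_gram, ← hΓ, ← hΓ, ← hΓ, norm_sub_rev (Γ x.2).coords (Γ t).coords,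
      sub_sub_sub_cancel_right, eq_comm, eq_div_iff (by positivity), h3]
  have h3 := (h2.sub_const K).sqrt
  simp only [add_sub_cancel_left] at h3
  rw [Real.sqrt_sq (radCurvature_nonneg (hG.pos_add t) (IsSlope.neg_le_deriv hp hd))] at h3
  refine h3.congr fun x => ?_
  exact Real.sqrt_sq (oscCurvature_nonneg _ _ _)

/-- The arc/chord curvature at a point where the slope is differentiable. -/
theorem PolarFrame.tendsto_arcChordCurvature (hG : ConvexRadial K G)
    (hp : ∀ t, IsSlope G t (p t)) (hΓ : ∀ t, (Γ t).coords = F.curve G t) {t d : ℝ}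
    (hd : HasDerivAt p d t) :
    Tendsto (fun x : ℝ × ℝ => arcChordCurvature K Γ x.1 x.2) (straddling t)
      (𝓝 (radCurvature K (G t) (p t) d)) := by
  obtain ⟨A, hA, hk⟩ := F.exists_hasDerivAt_velocity hG hp hd
  have hγ := F.ae_hasDerivAt_curve hG hp
  have hL := F.exists_lipschitzOnWith_curve hG (t - 1) (t + 1)
  have h0 := F.velocity_ne_zero (t := t) (p := p t) (hG.pos_add t)
  obtain ⟨c, C, hc, hC0, hC⟩ := exists_lengthIntegral_bounds hG hp
  have hS : ∀ᵐ v, HasDerivAt (lengthIntegral K G p) ‖F.velocity v (G v) (p v)‖ v := by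
    filter_upwards [hG.ae_differentiableAt_slope hp] with v hv
    rw [F.norm_velocity (hG.pos_add v)]
    exact hasDerivAt_lengthIntegral hG hp hv.continuousAt
  have h1 := tendsto_length_sub_chord_div hA hγ hL h0 hS (C := C) fun x y hxy => by
    have h2 := hC x y hxy
    rw [abs_of_nonneg ((mul_nonneg hc.le (sub_nonneg.2 hxy)).trans h2.1)]
    exact h2.2
  rw [hk] at h1
  have hlt : ∀ᶠ x in straddling t, x.1 < x.2 :=
    eventually_straddling (P := fun s t => s < t) 1 one_pos fun _ _ h _ _ _ => h
  have key := tendsto_arcChordValue hG.nonneg (l := straddling t) (x := fun x => Γ x.1)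
    (y := fun x => Γ x.2) (ℓ := fun x => lengthIntegral K G p x.2 - lengthIntegral K G p x.1) ?_ ?_ ?_
    (radCurvature_nonneg (p := p t) (hG.pos_add t) (IsSlope.neg_le_deriv hp hd)) ?_
  · refine key.congr' ?_
    filter_upwards [hlt] with x hx
    rw [arcChordCurvature, F.arcLength_eq hG hp hΓ hx.le]
  · filter_upwards [hlt] with x hx
    exact (mul_pos hc (sub_pos.2 hx)).trans_le (hC _ _ hx.le).1
  · have h2 : ContinuousAt (lengthIntegral K G p) t :=
      (hasDerivAt_lengthIntegral hG hp hd.continuousAt).continuousAt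
    have h3 : ContinuousAt (fun x : ℝ × ℝ => lengthIntegral K G p x.2 - lengthIntegral K G p x.1)
        (t, t) :=
      (ContinuousAt.comp (f := Prod.snd) (x := (t, t)) h2 continuousAt_snd).sub
        (ContinuousAt.comp (f := Prod.fst) (x := (t, t)) h2 continuousAt_fst)
    have h4 : Tendsto _ (straddling t) _ := h3.tendsto.mono_left inf_le_left
    simpa using h4
  · filter_upwards [hlt] with x hx
    exact F.dist_le_lengthIntegral hG hp hΓ hx.le
  · refine h1.congr fun x => ?_
    rw [hΓ, hΓ, norm_sub_rev]

end Limits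

end

section

open ModelPlane

variable {K κ : ℝ} {G p : ℝ → ℝ}

/-! ### Open convex cones as epigraphs -/

/-- An open convex cone whose intersection with the vertical axis is the open upper half-axis. -/
structure EpiCone (C : Set ((ℝ × ℝ) × ℝ)) : Prop where
  isOpen : IsOpen C
  add : ∀ x ∈ C, ∀ y ∈ C, x + y ∈ C
  smul : ∀ c : ℝ, 0 < c → ∀ x ∈ C, c • x ∈ C
  axis : ∀ l : ℝ, ((0, l) : (ℝ × ℝ) × ℝ) ∈ C ↔ 0 < l

/-- The function whose strict epigraph is a given set. -/
noncomputable def epiFun (C : Set ((ℝ × ℝ) × ℝ)) (x : ℝ × ℝ) : ℝ := sInf {l : ℝ | (x, l) ∈ C}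

namespace EpiCone

variable {C : Set ((ℝ × ℝ) × ℝ)}

theorem nonempty (hC : EpiCone C) (x : ℝ × ℝ) : {l : ℝ | (x, l) ∈ C}.Nonempty := by
  have h0 : ((0 : ℝ) • x, (1 : ℝ)) ∈ C := by rw [zero_smul]; exact (hC.axis 1).2 one_pos
  have h1 : ∀ᶠ ε in 𝓝 (0 : ℝ), (ε • x, (1 : ℝ)) ∈ C := by
    have : ContinuousAt (fun ε : ℝ => (ε • x, (1 : ℝ))) 0 := by fun_prop
    exact this.eventually (hC.isOpen.mem_nhds h0)
  obtain ⟨δ, hδ, h⟩ := Metric.eventually_nhds_iff.1 h1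
  have h2 := hC.smul (δ / 2)⁻¹ (by positivity) _ (h (y := δ / 2) (by
    rw [Real.dist_eq, sub_zero, abs_of_pos (by positivity)]; linarith))
  refine ⟨(δ / 2)⁻¹, ?_⟩
  rw [Prod.smul_mk, smul_smul, inv_mul_cancel₀ (by positivity), one_smul, smul_eq_mul, mul_one] at h2
  exact h2

theorem bddBelow (hC : EpiCone C) (x : ℝ × ℝ) : BddBelow {l : ℝ | (x, l) ∈ C} := by
  obtain ⟨m, hm⟩ := hC.nonempty (-x)
  refine ⟨-m, fun l hl => ?_⟩
  have h := hC.add _ hl _ hm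
  rw [Prod.mk_add_mk, add_neg_cancel, hC.axis] at h
  linarith

theorem mem_iff (hC : EpiCone C) (x : ℝ × ℝ) (l : ℝ) : (x, l) ∈ C ↔ epiFun C x < l := by
  constructor
  · intro h
    have h1 : ∀ᶠ m in 𝓝 l, (x, m) ∈ C := by
      have : ContinuousAt (fun m : ℝ => (x, m)) l := by fun_prop
      exact this.eventually (hC.isOpen.mem_nhds h)
    obtain ⟨m, hm, hml⟩ := ((h1.filter_mono nhdsWithin_le_nhds).and
      (self_mem_nhdsWithin (a := l) (s := Iio l))).exists
    exact (csInf_le (hC.bddBelow x) hm).trans_lt hml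
  · intro h
    obtain ⟨m, hm, hml⟩ := exists_lt_of_csInf_lt (hC.nonempty x) h
    have h1 := hC.add _ hm _ ((hC.axis (l - m)).2 (by linarith))
    rw [Prod.mk_add_mk, add_zero, add_sub_cancel] at h1
    exact h1

theorem epiFun_add_le (hC : EpiCone C) (x y : ℝ × ℝ) : epiFun C (x + y) ≤ epiFun C x + epiFun C y := by
  refine le_of_forall_pos_le_add fun ε hε => ?_
  have h1 := (hC.mem_iff x (epiFun C x + ε / 2)).2 (by linarith)
  have h2 := (hC.mem_iff y (epiFun C y + ε / 2)).2 (by linarith)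
  have h3 := hC.add _ h1 _ h2
  rw [Prod.mk_add_mk, hC.mem_iff] at h3
  linarith

theorem epiFun_smul (hC : EpiCone C) {c : ℝ} (hc : 0 < c) (x : ℝ × ℝ) : epiFun C (c • x) = c * epiFun C x := by
  refine eq_of_forall_gt_iff fun l => ?_
  rw [← hC.mem_iff, ← lt_div_iff₀' hc, ← hC.mem_iff]
  constructor
  · intro h
    have := hC.smul c⁻¹ (by positivity) _ h
    rwa [Prod.smul_mk, smul_smul, inv_mul_cancel₀ hc.ne', one_smul, smul_eq_mul,
      inv_mul_eq_div] at this
  · intro h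
    have := hC.smul c hc _ h
    rwa [Prod.smul_mk, smul_eq_mul, mul_div_cancel₀ _ hc.ne'] at this

theorem epiFun_zero (hC : EpiCone C) : epiFun C 0 = 0 :=
  eq_of_forall_gt_iff fun l => by rw [← hC.mem_iff, hC.axis]

theorem neg_epiFun_neg_le (hC : EpiCone C) (x : ℝ × ℝ) : -epiFun C (-x) ≤ epiFun C x := by
  have := hC.epiFun_add_le x (-x)
  rw [add_neg_cancel, hC.epiFun_zero] at this
  linarith

/-- Hahn–Banach with prescribed value at `e`. On the unit circle a linear functional is a
trigonometric function, and this one is the support of the radial function at `e`. -/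
theorem exists_linear (hC : EpiCone C) (e : ℝ × ℝ) (he : e ≠ 0) :
    ∃ g : ℝ × ℝ →ₗ[ℝ] ℝ, g e = epiFun C e ∧ ∀ x, g x ≤ epiFun C x := by
  obtain ⟨g, hg, hle⟩ := exists_extension_of_le_sublinear
    (LinearPMap.mkSpanSingleton (σ := RingHom.id ℝ) e (epiFun C e) he) (epiFun C)
    (fun c hc x => hC.epiFun_smul hc x) hC.epiFun_add_le (by
      rintro ⟨x, hx⟩
      obtain ⟨c, rfl⟩ := Submodule.mem_span_singleton.1 hx
      refine (LinearPMap.mkSpanSingleton'_apply (σ := RingHom.id ℝ) e (epiFun C e) _ c hx).trans_le ?_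
      simp only [RingHom.id_apply, smul_eq_mul]
      rcases lt_trichotomy c 0 with h | rfl | h
      · have h1 := hC.neg_epiFun_neg_le (c • e)
        rw [← neg_smul, hC.epiFun_smul (by linarith)] at h1
        linarith
      · simp [hC.epiFun_zero]
      · rw [hC.epiFun_smul h])
  refine ⟨g, ?_, hle⟩
  have := hg ⟨e, Submodule.mem_span_singleton_self e⟩
  rw [LinearPMap.mkSpanSingleton_apply] at this
  exact this

theorem exists_abs_le (hC : EpiCone C) : ∃ B, ∀ x : ℝ × ℝ, epiFun C x ≤ B * (|x.1| + |x.2|) := by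
  have key : ∀ (e : ℝ × ℝ) (c : ℝ), epiFun C (c • e) ≤ |c| * (|epiFun C e| + |epiFun C (-e)|) := by
    intro e c
    rcases lt_trichotomy c 0 with h | rfl | h
    · have h1 := hC.epiFun_smul (neg_pos.2 h) (-e)
      rw [neg_smul_neg] at h1
      rw [h1, abs_of_neg h]
      have := abs_nonneg (epiFun C e)
      have := le_abs_self (epiFun C (-e))
      exact mul_le_mul_of_nonneg_left (by linarith) (by linarith)
    · simp [hC.epiFun_zero]
    · rw [hC.epiFun_smul h, abs_of_pos h]
      have := le_abs_self (epiFun C e)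
      have := abs_nonneg (epiFun C (-e))
      exact mul_le_mul_of_nonneg_left (by linarith) h.le
  refine ⟨(|epiFun C (1, 0)| + |epiFun C (-(1, 0))|) + (|epiFun C (0, 1)| + |epiFun C (-(0, 1))|),
    fun x => ?_⟩
  have e : x = x.1 • ((1, 0) : ℝ × ℝ) + x.2 • ((0, 1) : ℝ × ℝ) := by ext <;> simp
  have h1 := key (1, 0) x.1
  have h2 := key (0, 1) x.2
  have h3 := hC.epiFun_add_le (x.1 • ((1, 0) : ℝ × ℝ)) (x.2 • ((0, 1) : ℝ × ℝ))
  rw [← e] at h3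
  have a1 := abs_nonneg x.1
  have a2 := abs_nonneg x.2
  have hA : 0 ≤ |epiFun C (1, 0)| + |epiFun C (-(1, 0))| := by positivity
  have hB : 0 ≤ |epiFun C (0, 1)| + |epiFun C (-(0, 1))| := by positivity
  generalize |epiFun C (1, 0)| + |epiFun C (-(1, 0))| = A at *
  generalize |epiFun C (0, 1)| + |epiFun C (-(0, 1))| = B at *
  nlinarith [mul_nonneg hA a2, mul_nonneg hB a1]

theorem continuous_epiFun (hC : EpiCone C) : Continuous (epiFun C) := by
  obtain ⟨B, hB⟩ := hC.exists_abs_le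
  have key : ∀ x y, |epiFun C x - epiFun C y| ≤ B * (|x.1 - y.1| + |x.2 - y.2|) := by
    intro x y
    have h1 := hC.epiFun_add_le (x - y) y
    have h2 := hC.epiFun_add_le (y - x) x
    have h3 := hB (x - y)
    have h4 := hB (y - x)
    rw [sub_add_cancel] at h1 h2
    rw [Prod.fst_sub, Prod.snd_sub] at h3 h4
    rw [abs_sub_comm y.1, abs_sub_comm y.2] at h4
    rw [abs_le]
    constructor <;> linarith
  rw [continuous_iff_continuousAt]
  intro y
  have h1 : Continuous fun x : ℝ × ℝ => B * (|x.1 - y.1| + |x.2 - y.2|) := by fun_prop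
  have h2 := h1.tendsto y
  simp only [sub_self, abs_zero, add_zero, mul_zero] at h2
  rw [ContinuousAt, tendsto_iff_dist_tendsto_zero]
  exact squeeze_zero (fun _ => dist_nonneg) (fun x => by rw [Real.dist_eq]; exact key x y) h2

/-- The radial function of an open convex cone has slopes. -/
theorem exists_isSlope (t : ℝ) (hC : EpiCone C) :
    ∃ p, IsSlope (fun t => epiFun C (Real.cos t, Real.sin t)) t p := by
  obtain ⟨g, hg, hle⟩ := hC.exists_linear (Real.cos t, Real.sin t) (by
    intro h
    have := Real.cos_sq_add_sin_sq t
    simp only [Prod.mk_eq_zero] at h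
    rw [h.1, h.2] at this
    norm_num at this)
  refine ⟨g (-Real.sin t, Real.cos t), fun u => ?_⟩
  have e : ((Real.cos u, Real.sin u) : ℝ × ℝ) = Real.cos (u - t) • (Real.cos t, Real.sin t) +
      Real.sin (u - t) • (-Real.sin t, Real.cos t) := by
    have h1 : u = (u - t) + t := by ring
    ext
    · simp only [Prod.fst_add, Prod.smul_fst, smul_eq_mul]
      conv_lhs => rw [h1, Real.cos_add]
      ring
    · simp only [Prod.snd_add, Prod.smul_snd, smul_eq_mul]
      conv_lhs => rw [h1, Real.sin_add]
      ring
  have h := hle (Real.cos u, Real.sin u)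
  have h2 := congrArg g e
  rw [map_add, map_smul, map_smul, hg, smul_eq_mul, smul_eq_mul] at h2
  rw [h2] at h
  linarith

end EpiCone

end

section

open ModelPlane

variable {K κ : ℝ} {G p : ℝ → ℝ}

/-! ### Geodesically convex sets in the model plane -/

theorem ModelPlane.dist_eq_angle (hK : 0 < K) (x y : ModelPlane K) :
    √K * dist x y = InnerProductGeometry.angle x.coords y.coords := by
  have hs := Real.sqrt_pos.2 hK
  rw [ModelPlane.dist_def, if_neg hK.ne']
  field_simp

theorem ModelPlane.coords_ne_zero (hK : 0 < K) (x : ModelPlane K) : x.coords ≠ 0 := by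
  have hs := Real.sqrt_pos.2 hK
  rw [← norm_pos_iff, norm_coords hK.ne']
  positivity

theorem ModelPlane.exists_coords_eq_smul (hK : 0 < K) {v : E3} (hv : v ≠ 0) :
    ∃ x : ModelPlane K, v = (‖v‖ * √K) • x.coords := by
  have hs := Real.sqrt_pos.2 hK
  have hn := norm_pos_iff.2 hv
  obtain ⟨x, hx⟩ := ModelPlane.exists_coords_eq (K := K) (x := (‖v‖ * √K)⁻¹ • v) (by
    rw [if_neg hK.ne', norm_smul, norm_inv, Real.norm_eq_abs, abs_of_pos (by positivity)]
    field_simp)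
  refine ⟨x, ?_⟩
  rw [hx, smul_smul, mul_inv_cancel₀ (by positivity), one_smul]

theorem IsOpen.exists_forall_coords (hK : 0 ≤ K) {Ω : Set (ModelPlane K)} (hΩ : IsOpen Ω)
    {x : ModelPlane K} (hx : x ∈ Ω) :
    ∃ δ > 0, ∀ y : ModelPlane K, ‖y.coords - x.coords‖ < δ → y ∈ Ω := by
  obtain ⟨ε, hε, h⟩ := Metric.isOpen_iff.1 hΩ x hx
  have hpi := Real.pi_pos
  refine ⟨ε / Real.pi, by positivity, fun y hy => h ?_⟩
  rw [Metric.mem_ball]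
  have h1 := ModelPlane.dist_le hK y x
  rw [lt_div_iff₀ hpi] at hy
  have := norm_nonneg (y.coords - x.coords)
  nlinarith

theorem ModelPlane.continuous_coords (hK : 0 ≤ K) : Continuous (coords (K := K)) :=
  LipschitzWith.continuous (K := 1) <| LipschitzWith.of_dist_le_mul fun x y => by
    rw [dist_eq_norm, NNReal.coe_one, one_mul]
    exact norm_coords_sub_le_dist hK x y

/-- Convexity is stated through abstract shortest paths. Equality in the triangle inequality forces
such a path in the plane to be the straight segment. -/
theorem IsGeodesicallyConvex.mem_of_zero {Ω : Set (ModelPlane 0)} (hΩ : IsGeodesicallyConvex Ω)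
    {x y z : ModelPlane 0} (hx : x ∈ Ω) (hy : y ∈ Ω) {r : ℝ} (hr : r ∈ Icc (0 : ℝ) 1)
    (hz : z.coords = AffineMap.lineMap x.coords y.coords r) : z ∈ Ω := by
  have hd : ∀ u v : ModelPlane 0, dist u v = dist u.coords v.coords := fun u v => by
    rw [ModelPlane.dist_def, if_pos rfl, dist_eq_norm]
  obtain ⟨g, h0, h1, hiso, hmem⟩ := hΩ x hx y hy
  have hd0 : 0 ≤ dist x y := dist_nonneg
  have hrI : r * dist x y ∈ Icc 0 (dist x y) :=
    ⟨mul_nonneg hr.1 hd0, mul_le_of_le_one_left hd0 hr.2⟩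
  have hm := hmem _ hrI
  have e1 := hiso 0 ⟨le_rfl, hd0⟩ _ hrI
  have e2 := hiso _ hrI _ ⟨hd0, le_rfl⟩
  rw [h0, zero_sub, abs_neg, abs_of_nonneg hrI.1] at e1
  rw [h1, abs_of_nonpos (by linarith [hrI.2]), neg_sub] at e2
  generalize g (r * dist x y) = w at *
  rw [hd, hd] at e1 e2
  have h2 := eq_lineMap_of_dist_eq_mul_of_dist_eq_mul e1 (by rw [e2]; ring)
  rw [← hz] at h2
  rwa [← coords_injective h2]

/-- The point `w` of the given shortest path at the distance of `z` from `x` also lies in the cone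
of `x` and `y`, by the equality case for angles; antipodes are excluded. Having the same inner
products with `x` and `y` as `z`, it equals `z`. -/
theorem IsGeodesicallyConvex.mem_of_pos (hK : 0 < K) {Ω : Set (ModelPlane K)}
    (hΩ : IsGeodesicallyConvex Ω) {x y z : ModelPlane K} (hx : x ∈ Ω) (hy : y ∈ Ω)
    (hxy : InnerProductGeometry.angle x.coords y.coords ≠ Real.pi) {a b r : ℝ} (ha : 0 ≤ a)
    (hb : 0 ≤ b) (hr : 0 < r) (hz : r • z.coords = a • x.coords + b • y.coords) : z ∈ Ω := by
  have hs := Real.sqrt_pos.2 hK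
  obtain ⟨g, h0, h1, hiso, hmem⟩ := hΩ x hx y hy
  have hz' : z.coords = (a / r) • x.coords + (b / r) • y.coords := by
    rw [div_eq_inv_mul, div_eq_inv_mul, mul_smul, mul_smul, ← smul_add, ← hz, smul_smul,
      inv_mul_cancel₀ hr.ne', one_smul]
  have hzs : z.coords ∈ Submodule.span NNReal {x.coords, y.coords} :=
    Submodule.mem_span_pair.2 ⟨⟨a / r, by positivity⟩, ⟨b / r, by positivity⟩, hz'.symm⟩
  have hza := (InnerProductGeometry.angle_eq_angle_add_angle_iff (coords_ne_zero hK z)).2 (Or.inr hzs)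
  rw [← dist_eq_angle hK, ← dist_eq_angle hK, ← dist_eq_angle hK, ← mul_add] at hza
  have hza' := mul_left_cancel₀ hs.ne' hza
  have d1 : 0 ≤ dist x z := dist_nonneg
  have d2 : 0 ≤ dist z y := dist_nonneg
  have hI : dist x z ∈ Icc 0 (dist x y) := ⟨d1, by linarith⟩
  have hm := hmem _ hI
  set w := g (dist x z) with hw
  have e1 := hiso 0 ⟨le_rfl, d1.trans hI.2⟩ _ hI
  have e2 := hiso _ hI _ ⟨d1.trans hI.2, le_rfl⟩
  rw [h0, zero_sub, abs_neg, abs_of_nonneg d1, ← hw] at e1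
  rw [h1, abs_of_nonpos (by linarith [hI.2]), neg_sub, ← hw] at e2
  have e3 : dist w y = dist z y := by linarith
  have hwa : InnerProductGeometry.angle x.coords y.coords =
      InnerProductGeometry.angle x.coords w.coords + InnerProductGeometry.angle w.coords y.coords := by
    rw [← dist_eq_angle hK, ← dist_eq_angle hK, ← dist_eq_angle hK, e1, e3, hza, mul_add]
  have hws := ((InnerProductGeometry.angle_eq_angle_add_angle_iff (coords_ne_zero hK w)).1
    hwa).resolve_left hxy
  obtain ⟨c, d, hcd⟩ := Submodule.mem_span_pair.1 hws
  have hcd' : w.coords = (c : ℝ) • x.coords + (d : ℝ) • y.coords := hcd.symm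
  have i1 : ⟪x.coords, w.coords⟫ = ⟪x.coords, z.coords⟫ := by
    rw [← InnerProductGeometry.cos_angle_mul_norm_mul_norm,
      ← InnerProductGeometry.cos_angle_mul_norm_mul_norm, ← dist_eq_angle hK, ← dist_eq_angle hK, e1,
      norm_coords hK.ne', norm_coords hK.ne', norm_coords hK.ne']
  have i2 : ⟪w.coords, y.coords⟫ = ⟪z.coords, y.coords⟫ := by
    rw [← InnerProductGeometry.cos_angle_mul_norm_mul_norm,
      ← InnerProductGeometry.cos_angle_mul_norm_mul_norm, ← dist_eq_angle hK, ← dist_eq_angle hK, e3,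
      norm_coords hK.ne', norm_coords hK.ne', norm_coords hK.ne']
  have h3 : w.coords - z.coords = (c - a / r) • x.coords + (d - b / r) • y.coords := by
    rw [hcd', hz']; module
  have h4 : ⟪w.coords - z.coords, w.coords - z.coords⟫ = 0 := by
    nth_rewrite 1 [h3]
    rw [inner_add_left, real_inner_smul_left, real_inner_smul_left, inner_sub_right, inner_sub_right,
      i1, real_inner_comm w.coords y.coords, real_inner_comm z.coords y.coords, i2]
    ring
  have h5 := coords_injective (sub_eq_zero.1 (inner_self_eq_zero.1 h4))
  rwa [← h5]

theorem ModelPlane.eq_or_eq_neg_of_smul (hK : 0 < K) {x y : ModelPlane K} {c : ℝ}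
    (h : x.coords = c • y.coords) : x.coords = y.coords ∨ x.coords = -y.coords := by
  have hs := Real.sqrt_pos.2 hK
  have h1 := congrArg norm h
  rw [norm_smul, norm_coords hK.ne', norm_coords hK.ne', Real.norm_eq_abs] at h1
  have h2 : |c| = 1 := by
    have h0 : 1 / √K ≠ 0 := by positivity
    field_simp at h1
    exact h1.symm
  rcases (abs_eq zero_le_one).1 h2 with rfl | rfl
  · left; rw [h, one_smul]
  · right; rw [h, neg_one_smul]

theorem ModelPlane.eq_neg_of_angle_eq_pi (hK : 0 < K) {x y : ModelPlane K}
    (h : InnerProductGeometry.angle x.coords y.coords = Real.pi) : y.coords = -x.coords := by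
  obtain ⟨h0, r, hr, h1⟩ := InnerProductGeometry.angle_eq_pi_iff.1 h
  rcases eq_or_eq_neg_of_smul hK h1 with h2 | h2
  · rw [h2, InnerProductGeometry.angle_self h0] at h
    exact absurd h Real.pi_pos.ne
  · exact h2

/-- A convex region with nonempty boundary does not contain antipodal points. -/
theorem IsGeodesicallyConvex.angle_ne_pi (hK : 0 < K) {Ω : Set (ModelPlane K)}
    (hΩ : IsGeodesicallyConvex Ω) (ho : IsOpen Ω) (hf : (frontier Ω).Nonempty) {x y : ModelPlane K}
    (hx : x ∈ Ω) (hy : y ∈ Ω) : InnerProductGeometry.angle x.coords y.coords ≠ Real.pi := by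
  intro h
  have hyx := eq_neg_of_angle_eq_pi hK h
  have hs := Real.sqrt_pos.2 hK
  suffices Ω = univ by rw [this, frontier_univ] at hf; exact hf.ne_empty rfl
  refine eq_univ_of_forall fun w => ?_
  by_cases hw1 : w.coords = x.coords
  · rwa [coords_injective hw1]
  by_cases hw2 : w.coords = -x.coords
  · rw [← hyx] at hw2; rwa [coords_injective hw2]
  -- Move `x` slightly towards an arbitrary third point `w`, to `q` in `Ω`. Then `q` and `y = -x`
  -- are not antipodal and `w` lies on the arc between them, so `w` is in `Ω`.
  obtain ⟨δ, hδ, hb⟩ := ho.exists_forall_coords hK.le hx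
  have hnz : ∀ ε : ℝ, x.coords + ε • w.coords ≠ 0 := by
    intro ε h0
    have h1 : x.coords = (-ε) • w.coords := by
      rw [neg_smul]; exact eq_neg_of_add_eq_zero_left h0
    rcases eq_or_eq_neg_of_smul hK h1 with h2 | h2
    · exact hw1 h2.symm
    · exact hw2 (by rw [h2, neg_neg])
  have hc : ContinuousAt (fun ε : ℝ => (‖x.coords + ε • w.coords‖ * √K)⁻¹ •
      (x.coords + ε • w.coords)) 0 := by
    have hc1 : ContinuousAt (fun ε : ℝ => x.coords + ε • w.coords) 0 := by fun_prop
    refine ContinuousAt.smul (ContinuousAt.inv₀ (hc1.norm.mul continuousAt_const) ?_) hc1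
    exact (mul_pos (norm_pos_iff.2 (hnz 0)) hs).ne'
  have h0 : (‖x.coords + (0 : ℝ) • w.coords‖ * √K)⁻¹ • (x.coords + (0 : ℝ) • w.coords) = x.coords := by
    rw [zero_smul, add_zero, norm_coords hK.ne', one_div, inv_mul_cancel₀ hs.ne', inv_one, one_smul]
  obtain ⟨η, hη, hball⟩ := Metric.continuousAt_iff.1 hc δ hδ
  have h1 := hball (x := η / 2) (by
    rw [Real.dist_eq, sub_zero, abs_of_pos (by positivity)]; linarith)
  rw [h0, dist_eq_norm] at h1
  obtain ⟨q, hq⟩ := exists_coords_eq_smul hK (hnz (η / 2))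
  set ρ := ‖x.coords + (η / 2) • w.coords‖ * √K with hρ
  have hρ0 : 0 < ρ := mul_pos (norm_pos_iff.2 (hnz _)) hs
  have hq' : q.coords = ρ⁻¹ • (x.coords + (η / 2) • w.coords) := by
    rw [hq, smul_smul, inv_mul_cancel₀ hρ0.ne', one_smul]
  have hqΩ : q ∈ Ω := hb q (by rw [hq']; exact h1)
  refine hΩ.mem_of_pos hK hqΩ hy (fun h2 => ?_) hρ0.le zero_le_one (half_pos hη) (z := w) ?_
  · have h3 := eq_neg_of_angle_eq_pi hK h2
    rw [hyx, neg_inj] at h3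
    rw [← h3] at hq
    have h4 : w.coords = ((η / 2)⁻¹ * (ρ - 1)) • x.coords := by
      rw [mul_smul, sub_smul, one_smul, ← hq, add_sub_cancel_left, smul_smul,
        inv_mul_cancel₀ (by positivity), one_smul]
    rcases eq_or_eq_neg_of_smul hK h4 with h5 | h5
    · exact hw1 h5
    · exact hw2 h5
  · rw [← hq, hyx]; module

end

section

open ModelPlane

variable {K κ : ℝ} {G p : ℝ → ℝ}

/-! ### Homogeneous coordinates -/

/-- Homogeneous coordinates on the model plane, adapted to a frame. -/
structure IsPolarCoords (F : PolarFrame K) (o : ModelPlane K) (Λ : ModelPlane K → (ℝ × ℝ) × ℝ) :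
    Prop where
  coords : ∀ x, x.coords = F.c + ((Λ x).1.1 • F.a + (Λ x).1.2 • F.b + (Λ x).2 • F.O)
  norm : ∀ x, K * ((Λ x).1.1 ^ 2 + (Λ x).1.2 ^ 2) + (Λ x).2 ^ 2 = 1
  zero : K = 0 → ∀ x, (Λ x).2 = 1
  surj : ∀ ξ η l, K * (ξ ^ 2 + η ^ 2) + l ^ 2 = 1 → (K = 0 → l = 1) → ∃ x, Λ x = ((ξ, η), l)
  cont : Continuous Λ
  origin : Λ o = ((0, 0), 1)

theorem exists_isPolarCoords_of_zero (o : ModelPlane 0) :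
    ∃ (F : PolarFrame 0) (Λ : ModelPlane 0 → (ℝ × ℝ) × ℝ), IsPolarCoords F o Λ := by
  have h2 : ∀ x : ModelPlane 0, x.coords 2 = 0 := fun x => by
    have := x.2
    rw [if_pos rfl] at this
    exact this
  refine ⟨⟨o.coords, 0, EuclideanSpace.single 0 1, EuclideanSpace.single 1 1, by simp, by simp,
    by rw [EuclideanSpace.inner_single_left]; simp, by simp, by simp, Or.inl ⟨rfl, rfl⟩⟩,
    fun x => ((x.coords 0 - o.coords 0, x.coords 1 - o.coords 1), 1), ⟨?_, ?_, ?_, ?_, ?_, ?_⟩⟩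
  · intro x
    ext i
    fin_cases i <;> simp [h2]
  · intro x; simp
  · intro _ x; rfl
  · intro ξ η l _ hl
    obtain ⟨x, hx⟩ := ModelPlane.exists_coords_eq (K := 0)
      (x := o.coords + (EuclideanSpace.single 0 ξ + EuclideanSpace.single 1 η)) (by
        rw [if_pos rfl]; simp [h2])
    refine ⟨x, ?_⟩
    simp [hx, hl]
  · have := ModelPlane.continuous_coords (le_refl (0 : ℝ))
    fun_prop
  · simp

theorem exists_isPolarCoords_of_pos (hK : 0 < K) (o : ModelPlane K) :
    ∃ (F : PolarFrame K) (Λ : ModelPlane K → (ℝ × ℝ) × ℝ), IsPolarCoords F o Λ := by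
  have hs := Real.sqrt_pos.2 hK
  have hs2 := Real.sq_sqrt hK.le
  have hoo := K_mul_inner_self hK o
  have hoo' : K * ‖o.coords‖ ^ 2 = 1 := by rw [← real_inner_self_eq_norm_sq, hoo]
  -- The unit vector towards `o` becomes the last member of an orthonormal basis; the other two span
  -- the tangent plane at `o`.
  have hv : Orthonormal ℝ (({2} : Set (Fin 3)).domRestrict fun _ => √K • o.coords) := by
    constructor
    · rintro ⟨i, hi⟩
      rw [Set.domRestrict_apply, norm_smul, norm_coords hK.ne', Real.norm_eq_abs, abs_of_pos hs]
      field_simp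
    · rintro ⟨i, hi⟩ ⟨j, hj⟩ hij
      exact absurd (Subtype.ext ((mem_singleton_iff.1 hi).trans (mem_singleton_iff.1 hj).symm)) hij
  obtain ⟨B, hB⟩ := hv.exists_orthonormalBasis_extension_of_card_eq (by simp)
  have hB2 := hB 2 (mem_singleton 2)
  have hO : o.coords = (√K)⁻¹ • B 2 := by
    rw [hB2, smul_smul, inv_mul_cancel₀ hs.ne', one_smul]
  have hin : ∀ i j, ⟪B i, B j⟫ = if i = j then (1 : ℝ) else 0 := fun i j =>
    (orthonormal_iff_ite.1 B.orthonormal) i j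
  have hOB : ∀ j, ⟪o.coords, B j⟫ = (√K)⁻¹ * if (2 : Fin 3) = j then (1 : ℝ) else 0 := fun j => by
    rw [hO, real_inner_smul_left, hin]
  have hexp : ∀ x : E3, x = ⟪x, B 0⟫ • B 0 + ⟪x, B 1⟫ • B 1 + (K * ⟪x, o.coords⟫) • o.coords := by
    intro x
    have := B.sum_repr' x
    rw [Fin.sum_univ_three] at this
    conv_lhs => rw [← this]
    rw [hO, real_inner_smul_right, smul_smul, real_inner_comm x (B 0), real_inner_comm x (B 1),
      real_inner_comm x (B 2)]
    congr 2
    rw [show K * ((√K)⁻¹ * ⟪x, B 2⟫) * (√K)⁻¹ = K / √K ^ 2 * ⟪x, B 2⟫ by field_simp, hs2,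
      div_self hK.ne', one_mul]
  refine ⟨⟨0, o.coords, B 0, B 1, by simp [hin], by simp [hin], by simp [hin], by simp [hOB],
    by simp [hOB], Or.inr ⟨hK.ne', rfl, hoo⟩⟩,
    fun x => ((⟪x.coords, B 0⟫, ⟪x.coords, B 1⟫), K * ⟪x.coords, o.coords⟫), ⟨?_, ?_, ?_, ?_, ?_, ?_⟩⟩
  · intro x
    rw [zero_add]
    exact hexp _
  · intro x
    have h1 := K_mul_inner_self hK x
    have h2 := congrArg (fun y => ⟪x.coords, y⟫) (hexp x.coords)
    simp only [inner_add_right, real_inner_smul_right] at h2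
    rw [h2] at h1
    simp only
    linarith
  · intro h; exact absurd h hK.ne'
  · intro ξ η l h _
    have hne : ∀ i j : Fin 3, i ≠ j → ⟪B i, B j⟫ = (0 : ℝ) := fun i j hij => by rw [hin, if_neg hij]
    have hBO : ∀ j, ⟪B j, o.coords⟫ = (√K)⁻¹ * if (2 : Fin 3) = j then (1 : ℝ) else 0 := fun j => by
      rw [real_inner_comm, hOB]
    obtain ⟨x, hx⟩ := ModelPlane.exists_coords_eq (K := K)
      (x := ξ • B 0 + η • B 1 + l • o.coords) (by
        rw [if_neg hK.ne', eq_div_iff hs.ne', ← sq_eq_sq₀ (by positivity) zero_le_one, mul_pow, hs2,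
          ← real_inner_self_eq_norm_sq]
        simp only [inner_add_left, inner_add_right, real_inner_smul_left, real_inner_smul_right, hin,
          hBO, hOB]
        simp
        linear_combination h + l ^ 2 * hoo')
    refine ⟨x, ?_⟩
    simp only [hx, inner_add_left, real_inner_smul_left, hin, hBO, hOB]
    simp
    linear_combination l * hoo'
  · have := ModelPlane.continuous_coords hK.le
    fun_prop
  · simp [hOB, hoo']

theorem exists_isPolarCoords (hK : 0 ≤ K) (o : ModelPlane K) :
    ∃ (F : PolarFrame K) (Λ : ModelPlane K → (ℝ × ℝ) × ℝ), IsPolarCoords F o Λ := by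
  rcases hK.eq_or_lt with rfl | h
  · exact exists_isPolarCoords_of_zero o
  · exact exists_isPolarCoords_of_pos h o

namespace IsPolarCoords

variable {F : PolarFrame K} {o : ModelPlane K} {Λ : ModelPlane K → (ℝ × ℝ) × ℝ}

/-- The quadratic form of the homogeneous coordinates. -/
noncomputable def form (K : ℝ) (v : (ℝ × ℝ) × ℝ) : ℝ := K * (v.1.1 ^ 2 + v.1.2 ^ 2) + v.2 ^ 2

theorem form_smul (s : ℝ) (v : (ℝ × ℝ) × ℝ) : form K (s • v) = s ^ 2 * form K v := by
  simp only [form, Prod.smul_fst, Prod.smul_snd, smul_eq_mul]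
  ring

/-- The point of `ℝ³` with given homogeneous coordinates. -/
noncomputable def lin (F : PolarFrame K) (v : (ℝ × ℝ) × ℝ) : E3 :=
  v.1.1 • F.a + v.1.2 • F.b + v.2 • F.O

theorem lin_smul (s : ℝ) (v : (ℝ × ℝ) × ℝ) : lin F (s • v) = s • lin F v := by
  simp only [lin, Prod.smul_fst, Prod.smul_snd, smul_eq_mul]
  module

theorem lin_add (v w : (ℝ × ℝ) × ℝ) : lin F (v + w) = lin F v + lin F w := by
  simp only [lin, Prod.fst_add, Prod.snd_add]
  module

theorem coords' (h : IsPolarCoords F o Λ) (x : ModelPlane K) : x.coords = F.c + lin F (Λ x) :=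
  h.coords x

theorem injective (h : IsPolarCoords F o Λ) : Function.Injective Λ := fun x y hxy =>
  coords_injective (by rw [h.coords', h.coords', hxy])

theorem exists_smul_eq (h : IsPolarCoords F o Λ) {v : (ℝ × ℝ) × ℝ} (hv : 0 < form K v)
    (h0 : K = 0 → 0 < v.2) : ∃ x, v = √(form K v) • Λ x := by
  have hs := Real.sqrt_pos.2 hv
  obtain ⟨x, hx⟩ := h.surj ((√(form K v))⁻¹ * v.1.1) ((√(form K v))⁻¹ * v.1.2)
    ((√(form K v))⁻¹ * v.2) (by
      have := form_smul (K := K) (√(form K v))⁻¹ v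
      rw [inv_pow, Real.sq_sqrt hv.le, inv_mul_cancel₀ hv.ne'] at this
      simpa [form] using this) (fun hK => by
      have : form K v = v.2 ^ 2 := by rw [form, hK]; ring
      rw [this, Real.sqrt_sq (h0 hK).le, inv_mul_cancel₀ (h0 hK).ne'])
  refine ⟨x, ?_⟩
  rw [hx]
  ext <;> simp [mul_inv_cancel_left₀ hs.ne']

/-- The cone over a subset of the model plane. -/
def cone (Λ : ModelPlane K → (ℝ × ℝ) × ℝ) (Ω : Set (ModelPlane K)) : Set ((ℝ × ℝ) × ℝ) :=
  {v | ∃ s : ℝ, 0 < s ∧ ∃ x ∈ Ω, v = s • Λ x}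

theorem isOpen_cone (h : IsPolarCoords F o Λ) (hK : 0 ≤ K) {Ω : Set (ModelPlane K)}
    (hΩ : IsOpen Ω) : IsOpen (cone Λ Ω) := by
  rw [isOpen_iff_mem_nhds]
  rintro _ ⟨s, hs, x, hx, rfl⟩
  obtain ⟨δ, hδ, hb⟩ := hΩ.exists_forall_coords hK hx
  have hx1 : form K (Λ x) = 1 := h.norm x
  have hf : form K (s • Λ x) = s ^ 2 := by rw [form_smul, hx1, mul_one]
  have hcf : Continuous (form K) := by unfold form; fun_prop
  have hcl : Continuous (lin F) := by unfold lin; fun_prop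
  have e1 : ∀ᶠ v in 𝓝 (s • Λ x), 0 < form K v :=
    hcf.continuousAt.eventually_const_lt (by rw [hf]; positivity)
  have e2 : ∀ᶠ v : (ℝ × ℝ) × ℝ in 𝓝 (s • Λ x), K = 0 → 0 < v.2 := by
    by_cases hK0 : K = 0
    · have : ContinuousAt (fun v : (ℝ × ℝ) × ℝ => v.2) (s • Λ x) := by fun_prop
      filter_upwards [this.eventually_const_lt (u := 0) (by
        dsimp only
        rw [Prod.smul_snd, h.zero hK0, smul_eq_mul, mul_one]; exact hs)] with v hv _
      exact hv
    · exact Eventually.of_forall fun v hv => absurd hv hK0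
  have hd : ContinuousAt (fun v => ‖F.c + (√(form K v))⁻¹ • lin F v - x.coords‖) (s • Λ x) := by
    have h1 : ContinuousAt (fun v => (√(form K v))⁻¹) (s • Λ x) := by
      refine ContinuousAt.inv₀ hcf.continuousAt.sqrt ?_
      rw [hf, Real.sqrt_sq (le_of_lt hs)]
      exact hs.ne'
    exact ((continuousAt_const.add (h1.smul hcl.continuousAt)).sub continuousAt_const).norm
  have e3 := hd.eventually_lt_const (u := δ) (by
    dsimp only
    rw [hf, Real.sqrt_sq (le_of_lt hs), lin_smul, smul_smul, inv_mul_cancel₀ hs.ne', one_smul,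
      ← h.coords', sub_self, norm_zero]
    exact hδ)
  filter_upwards [e1, e2, e3] with v h1 h2 h3
  obtain ⟨y, hy⟩ := h.exists_smul_eq h1 h2
  refine ⟨_, Real.sqrt_pos.2 h1, y, hb y ?_, hy⟩
  have hy2 : lin F (Λ y) = (√(form K v))⁻¹ • lin F v := by
    conv_rhs => rw [hy, lin_smul, ← hy]
    rw [smul_smul, inv_mul_cancel₀ (Real.sqrt_pos.2 h1).ne', one_smul]
  rw [h.coords' y, hy2]
  exact h3

theorem smul_mem_cone {Ω : Set (ModelPlane K)} {c : ℝ} (hc : 0 < c) {v : (ℝ × ℝ) × ℝ}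
    (hv : v ∈ cone Λ Ω) : c • v ∈ cone Λ Ω := by
  obtain ⟨s, hs, x, hx, rfl⟩ := hv
  exact ⟨c * s, mul_pos hc hs, x, hx, smul_smul _ _ _⟩

theorem mem_cone_iff (h : IsPolarCoords F o Λ) {Ω : Set (ModelPlane K)} {x : ModelPlane K} :
    Λ x ∈ cone Λ Ω ↔ x ∈ Ω := by
  constructor
  · rintro ⟨s, hs, y, hy, hxy⟩
    have h1 : form K (Λ x) = 1 := h.norm x
    have h2 : form K (Λ y) = 1 := h.norm y
    rw [hxy, form_smul, h2, mul_one] at h1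
    have h3 : s = 1 := (pow_eq_one_iff_of_nonneg (le_of_lt hs) two_ne_zero).1 h1
    rw [h3, one_smul] at hxy
    rwa [h.injective hxy]
  · intro hx
    exact ⟨1, one_pos, x, hx, (one_smul _ _).symm⟩

/-- A sum of two vectors of the cone lies over a point of the geodesic between the two base points.
On the sphere the sum is nonzero because the region contains no antipodal points. -/
theorem add_mem_cone (h : IsPolarCoords F o Λ) (hK : 0 ≤ K) {Ω : Set (ModelPlane K)}
    (hΩ : IsOpen Ω) (hc : IsGeodesicallyConvex Ω) (hf : (frontier Ω).Nonempty)
    {v w : (ℝ × ℝ) × ℝ} (hv : v ∈ cone Λ Ω) (hw : w ∈ cone Λ Ω) : v + w ∈ cone Λ Ω := by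
  obtain ⟨s, hs, x, hx, rfl⟩ := hv
  obtain ⟨t, ht, y, hy, rfl⟩ := hw
  have hs' : 0 < s := hs
  have ht' : 0 < t := ht
  rcases hK.eq_or_lt with rfl | hK'
  · have h2 : (s • Λ x + t • Λ y).2 = s + t := by
      simp [h.zero rfl]
    have hq : form 0 (s • Λ x + t • Λ y) = (s + t) ^ 2 := by rw [form, h2]; ring
    obtain ⟨z, hz⟩ := h.exists_smul_eq (v := s • Λ x + t • Λ y) (by rw [hq]; positivity)
      (fun _ => by rw [h2]; positivity)
    rw [hq, Real.sqrt_sq (by positivity)] at hz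
    refine ⟨s + t, by positivity, z, hc.mem_of_zero hx hy (r := t / (s + t))
      ⟨by positivity, (div_le_one (by positivity)).2 (by linarith)⟩ ?_, hz⟩
    have h3 := congrArg (lin F) hz
    rw [lin_add, lin_smul, lin_smul, lin_smul] at h3
    have h4 : lin F (Λ z) = (s + t)⁻¹ • (s • lin F (Λ x) + t • lin F (Λ y)) := by
      rw [h3, smul_smul, inv_mul_cancel₀ (by positivity), one_smul]
    rw [h.coords' z, h.coords' x, h.coords' y, h4, AffineMap.lineMap_apply_module]
    have h5 : s / (s + t) = 1 - t / (s + t) := by field_simp; ring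
    rw [smul_add, smul_smul, smul_smul, ← h5, inv_mul_eq_div, inv_mul_eq_div]
    have h6 : F.c = (s / (s + t) + t / (s + t)) • F.c := by
      rw [h5, sub_add_cancel, one_smul]
    nth_rewrite 1 [h6]
    module
  · have hc0 : F.c = 0 := by
      rcases F.origin with ⟨h0, -⟩ | ⟨-, h0, -⟩
      · exact absurd h0 hK'.ne'
      · exact h0
    have hxc : ∀ x, x.coords = lin F (Λ x) := fun x => by rw [h.coords', hc0, zero_add]
    have hπ := hc.angle_ne_pi hK' hΩ hf hx hy
    have hq : 0 < form K (s • Λ x + t • Λ y) := by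
      by_contra hneg
      have h0 : form K (s • Λ x + t • Λ y) = 0 :=
        le_antisymm (not_lt.1 hneg) (by unfold form; positivity)
      have h1 : lin F (s • Λ x + t • Λ y) = 0 := by
        generalize s • Λ x + t • Λ y = v at h0
        rw [form] at h0
        have a1 := sq_nonneg v.1.1
        have a2 := sq_nonneg v.1.2
        have a3 := sq_nonneg v.2
        have a4 : K * (v.1.1 ^ 2 + v.1.2 ^ 2) = 0 := by
          have : 0 ≤ K * (v.1.1 ^ 2 + v.1.2 ^ 2) := by positivity
          linarith
        have a5 := (mul_eq_zero.1 a4).resolve_left hK'.ne'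
        have b1 : v.1.1 = 0 := pow_eq_zero_iff two_ne_zero |>.1 (by linarith)
        have b2 : v.1.2 = 0 := pow_eq_zero_iff two_ne_zero |>.1 (by linarith)
        have b3 : v.2 = 0 := pow_eq_zero_iff two_ne_zero |>.1 (by linarith)
        simp [lin, b1, b2, b3]
      rw [lin_add, lin_smul, lin_smul, ← hxc, ← hxc] at h1
      refine hπ (InnerProductGeometry.angle_eq_pi_iff.2 ⟨coords_ne_zero hK' x, -(s / t),
        by rw [neg_lt_zero]; positivity, ?_⟩)
      have h2 : t • y.coords = -(s • x.coords) := eq_neg_of_add_eq_zero_right h1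
      have h3 : y.coords = t⁻¹ • (t • y.coords) := by
        rw [smul_smul, inv_mul_cancel₀ ht'.ne', one_smul]
      rw [h3, h2, div_eq_inv_mul]
      module
    obtain ⟨z, hz⟩ := h.exists_smul_eq hq (fun h0 => absurd h0 hK'.ne')
    refine ⟨_, Real.sqrt_pos.2 hq, z, hc.mem_of_pos hK' hx hy hπ hs'.le ht'.le
      (Real.sqrt_pos.2 hq) ?_, hz⟩
    have h3 := congrArg (lin F) hz
    rw [lin_add, lin_smul, lin_smul, lin_smul, ← hxc, ← hxc, ← hxc] at h3
    exact h3.symm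

/-- The cone misses the lower half-axis because the antipode of `o` is not in the region; in the
plane the last coordinate is always positive. -/
theorem epiCone (h : IsPolarCoords F o Λ) (hK : 0 ≤ K) {Ω : Set (ModelPlane K)}
    (hΩ : IsOpen Ω) (hc : IsGeodesicallyConvex Ω) (hf : (frontier Ω).Nonempty) (ho : o ∈ Ω) :
    EpiCone (cone Λ Ω) where
  isOpen := h.isOpen_cone hK hΩ
  add _ hv _ hw := h.add_mem_cone hK hΩ hc hf hv hw
  smul _ hc _ hv := smul_mem_cone hc hv
  axis l := by
    constructor
    · rintro ⟨s, hs, x, hx, hsx⟩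
      have hs' : 0 < s := hs
      have h1 := congrArg (fun v => v.1.1) hsx
      have h2 := congrArg (fun v => v.1.2) hsx
      have h3 := congrArg (fun v => v.2) hsx
      simp only [Prod.smul_fst, Prod.smul_snd, smul_eq_mul, Prod.fst_zero, Prod.snd_zero] at h1 h2 h3
      have e1 := (mul_eq_zero.1 h1.symm).resolve_left hs'.ne'
      have e2 := (mul_eq_zero.1 h2.symm).resolve_left hs'.ne'
      have e3 := h.norm x
      rw [e1, e2] at e3
      have e4 : (Λ x).2 = 1 ∨ (Λ x).2 = -1 := sq_eq_one_iff.1 (by linarith)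
      rcases e4 with e4 | e4
      · rw [h3, e4, mul_one]; exact hs'
      · rcases hK.eq_or_lt with hK0 | hK'
        · rw [h.zero hK0.symm] at e4; norm_num at e4
        · exfalso
          have hc0 : F.c = 0 := by
            rcases F.origin with ⟨h0, -⟩ | ⟨-, h0, -⟩
            · exact absurd h0 hK'.ne'
            · exact h0
          have e5 : x.coords = -o.coords := by
            rw [h.coords x, h.coords o, h.origin, e1, e2, e4, hc0]
            module
          refine hc.angle_ne_pi hK' hΩ hf ho hx ?_
          rw [e5, InnerProductGeometry.angle_self_neg_of_nonzero (coords_ne_zero hK' o)]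
    · intro hl
      exact ⟨l, hl, o, ho, by rw [h.origin]; ext <;> simp⟩

/-- Boundary points of a convex region lie on the graph of the gauge of its cone. -/
theorem epiFun_eq_of_mem_frontier (h : IsPolarCoords F o Λ) {Ω : Set (ModelPlane K)}
    (hΩ : IsOpen Ω) (hC : EpiCone (cone Λ Ω)) {x : ModelPlane K} (hx : x ∈ frontier Ω) :
    epiFun (cone Λ Ω) (Λ x).1 = (Λ x).2 := by
  have hiff : ∀ y, y ∈ Ω ↔ epiFun (cone Λ Ω) (Λ y).1 < (Λ y).2 := fun y => by
    rw [← h.mem_cone_iff, ← hC.mem_iff]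
  refine le_antisymm ?_ ?_
  · have h1 : IsClosed {y | epiFun (cone Λ Ω) (Λ y).1 ≤ (Λ y).2} :=
      isClosed_le (hC.continuous_epiFun.comp h.cont.fst) h.cont.snd
    exact closure_minimal (fun y hy => ((hiff y).1 hy).le) h1 (frontier_subset_closure hx)
  · rw [hΩ.frontier_eq] at hx
    exact not_lt.1 fun h1 => hx.2 ((hiff x).2 h1)

theorem fst_ne_zero_of_mem_frontier (h : IsPolarCoords F o Λ) {Ω : Set (ModelPlane K)}
    (hΩ : IsOpen Ω) (hC : EpiCone (cone Λ Ω)) {x : ModelPlane K} (hx : x ∈ frontier Ω) :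
    (Λ x).1 ≠ 0 := by
  intro h0
  have h1 := h.epiFun_eq_of_mem_frontier hΩ hC hx
  have h2 := h.norm x
  rw [h0, hC.epiFun_zero] at h1
  rw [h0, ← h1] at h2
  norm_num at h2

end IsPolarCoords

end

section

open ModelPlane

variable {K κ : ℝ} {G p : ℝ → ℝ}

/-! ### Lifts of angles -/

theorem exists_continuous_arg {z : ℝ → ℂ} (hz : Continuous z) (h0 : ∀ t, z t ≠ 0) :
    ∃ φ : ℝ → ℝ, Continuous φ ∧ ∀ t, (φ t : Real.Angle) = ((z t).arg : Real.Angle) := by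
  have hc : Continuous fun t => ((z t).arg : Real.Angle) := by
    rw [continuous_iff_continuousAt]
    intro t
    exact (Complex.continuousAt_arg_coe_angle (h0 t)).comp hz.continuousAt
  have hcov : IsCoveringMap (fun x : ℝ => (x : Real.Angle)) :=
    AddCircle.isCoveringMap_coe (2 * Real.pi)
  obtain ⟨φ, ⟨-, hφ⟩, -⟩ := hcov.existsUnique_continuousMap_lifts ⟨_, hc⟩ 0 (z 0).arg rfl
  exact ⟨φ, φ.continuous, fun t => congrFun hφ t⟩

theorem exists_int_forall_eq {g : ℝ → ℝ} (hg : Continuous g) (h : ∀ t, ∃ n : ℤ, g t = n) :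
    ∃ n : ℤ, ∀ t, g t = n := by
  choose n hn using h
  have h1 : Continuous fun t => ((n t : ℤ) : ℝ) := by simpa only [← hn] using hg
  have h2 : Continuous n := Int.isClosedEmbedding_coe_real.isEmbedding.continuous_iff.2 h1
  exact ⟨n 0, fun t => by rw [hn, PreconnectedSpace.constant inferInstance h2 (x := t) (y := 0)]⟩

/-- The angle of a simple closed curve increases or decreases by one turn along the curve. -/
theorem strictMono_or_strictAnti_of_degree {ψ : ℝ → ℝ} (hψ : Continuous ψ)
    (h1 : ∀ s t, ∀ n : ℤ, ψ s = ψ t + n → ∃ m : ℤ, s = t + m)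
    (h2 : ∀ t, ∃ n : ℤ, ψ (t + 1) = ψ t + n) :
    (StrictMono ψ ∧ ∀ t, ψ (t + 1) = ψ t + 1) ∨ (StrictAnti ψ ∧ ∀ t, ψ (t + 1) = ψ t - 1) := by
  obtain ⟨n, hn⟩ := exists_int_forall_eq (g := fun t => ψ (t + 1) - ψ t) (by fun_prop)
    (fun t => by obtain ⟨n, hn⟩ := h2 t; exact ⟨n, by rw [hn]; ring⟩)
  replace hn : ∀ t, ψ (t + 1) = ψ t + n := fun t => by linarith [hn t]
  -- If the degree were zero, `ψ (t + 1/2) - ψ t` would change sign after half a period. A zero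
  -- would give two distinct points of the curve at the same angle.
  have hn0 : n ≠ 0 := by
    rintro rfl
    have e1 := hn 0
    simp only [zero_add, Int.cast_zero, add_zero] at e1
    have hc : Continuous fun t => ψ (t + 1 / 2) - ψ t := by fun_prop
    have hz : ∃ t, ψ (t + 1 / 2) - ψ t = 0 := by
      have e2 : ψ (1 / 2 + 1 / 2) - ψ (1 / 2) = -(ψ (0 + 1 / 2) - ψ 0) := by
        norm_num [e1]
      rcases le_total 0 (ψ (0 + 1 / 2) - ψ 0) with h | h
      · exact mem_range_of_exists_le_of_exists_ge hc ⟨1 / 2, by rw [e2]; linarith⟩ ⟨0, h⟩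
      · exact mem_range_of_exists_le_of_exists_ge hc ⟨0, h⟩ ⟨1 / 2, by rw [e2]; linarith⟩
    obtain ⟨t, ht⟩ := hz
    obtain ⟨m, hm⟩ := h1 (t + 1 / 2) t 0 (by push_cast; linarith)
    have h3 : (2 * m : ℤ) = 1 := by
      have : (2 * m : ℝ) = 1 := by linarith
      exact_mod_cast this
    omega
  have hnat : ∀ (m : ℕ) t, ψ (t + m) = ψ t + m * n := by
    intro m
    induction m with
    | zero => intro t; simp
    | succ m ih =>
      intro t
      have := hn (t + m)
      rw [ih] at this
      push_cast
      rw [← add_assoc, this]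
      ring
  have hint : ∀ (m : ℤ) t, ψ (t + m) = ψ t + m * n := by
    intro m t
    obtain ⟨k, rfl | rfl⟩ := m.eq_nat_or_neg
    · exact_mod_cast hnat k t
    · have := hnat k (t + ((-(k : ℤ) : ℤ) : ℝ))
      push_cast at this ⊢
      rw [neg_add_cancel_right] at this
      linarith
  have hinj : Function.Injective ψ := by
    intro s t hst
    obtain ⟨m, rfl⟩ := h1 s t 0 (by simpa using hst)
    rw [hint] at hst
    have h3 : ((m * n : ℤ) : ℝ) = 0 := by push_cast; linarith
    have h4 := (mul_eq_zero.1 (Int.cast_eq_zero.1 h3)).resolve_right hn0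
    rw [h4]; simp
  have hsmall : ∀ s ∈ Icc (0 : ℝ) 1, ∀ k : ℤ, ψ s = ψ 0 + k → s = 0 ∨ s = 1 := by
    intro s hs k hk
    obtain ⟨m, hm⟩ := h1 s 0 k hk
    rw [zero_add] at hm
    have i1 : (0 : ℤ) ≤ m := by exact_mod_cast hm ▸ hs.1
    have i2 : m ≤ 1 := by exact_mod_cast hm ▸ hs.2
    have : m = 0 ∨ m = 1 := by omega
    rcases this with rfl | rfl
    · left; simpa using hm
    · right; simpa using hm
  have e0 := hn 0
  rw [zero_add] at e0
  rcases hψ.strictMono_of_inj hinj with hm | hm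
  · left
    have hpos : 0 < n := by
      have : (0 : ℝ) < n := by have := hm zero_lt_one; linarith
      exact_mod_cast this
    -- With more than one turn, the angle `ψ 0 + 1` would be attained strictly inside one period, at
    -- a point different from the initial one.
    have : n = 1 := by
      by_contra hne
      have h3 : (2 : ℝ) ≤ n := by exact_mod_cast (by omega : (2 : ℤ) ≤ n)
      obtain ⟨s, hs, hs2⟩ := intermediate_value_Icc (zero_le_one' ℝ) hψ.continuousOn
        (show ψ 0 + 1 ∈ Icc (ψ 0) (ψ 1) from ⟨by linarith, by linarith⟩)
      rcases hsmall s hs 1 (by rw [hs2]; simp) with rfl | rfl <;> linarith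
    refine ⟨hm, fun t => by rw [hn, this, Int.cast_one]⟩
  · right
    have hneg : n < 0 := by
      have : (n : ℝ) < 0 := by have := hm zero_lt_one; linarith
      exact_mod_cast this
    have : n = -1 := by
      by_contra hne
      have h3 : (n : ℝ) ≤ -2 := by exact_mod_cast (by omega : n ≤ (-2 : ℤ))
      obtain ⟨s, hs, hs2⟩ := intermediate_value_Icc' (zero_le_one' ℝ) hψ.continuousOn
        (show ψ 0 - 1 ∈ Icc (ψ 1) (ψ 0) from ⟨by linarith, by linarith⟩)
      rcases hsmall s hs (-1) (by rw [hs2]; simp; ring) with rfl | rfl <;> linarith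
    refine ⟨hm, fun t => by rw [hn, this]; simp; ring⟩

theorem surjective_of_add_one {φ : ℝ → ℝ} {c : ℝ} (hc : 0 < c) (hφ : Continuous φ)
    (h : ∀ t, φ (t + 1) = φ t + c) : Function.Surjective φ := by
  have hnat : ∀ (m : ℕ) t, φ (t + m) = φ t + m * c := by
    intro m
    induction m with
    | zero => intro t; simp
    | succ m ih =>
      intro t
      have := h (t + m)
      rw [ih] at this
      push_cast
      rw [← add_assoc, this]
      ring
  intro x
  obtain ⟨m, hm⟩ := exists_nat_ge (|x - φ 0| / c)
  rw [div_le_iff₀ hc] at hm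
  have h1 := hnat m 0
  have h2 := hnat m (-m)
  rw [zero_add] at h1
  rw [neg_add_cancel] at h2
  have h3 := abs_le.1 hm
  exact mem_range_of_exists_le_of_exists_ge hφ ⟨-m, by linarith⟩ ⟨m, by linarith⟩

/-! ### Closed convex curves in polar coordinates -/

/-- A closed convex curve in polar coordinates. -/
structure PolarRepresentation (σ : ℝ → ModelPlane K) (F : PolarFrame K) (G φ : ℝ → ℝ) : Prop where
  radial : ConvexRadial K G
  strictMono : StrictMono φ
  continuous : Continuous φ
  add_one : ∀ t, φ (t + 1) = φ t + 2 * Real.pi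
  coords : ∀ t, (σ t).coords = F.curve G (φ t)

theorem IsClosedConvexCurve.exists_int {σ : ℝ → ModelPlane K} (hσ : IsClosedConvexCurve σ) {s t : ℝ}
    (h : σ s = σ t) : ∃ m : ℤ, s = t + m := by
  have h1 : σ (Int.fract s) = σ (Int.fract t) := by
    have e : ∀ s, σ (Int.fract s) = σ s := fun s => by
      have := hσ.periodic.sub_int_mul_eq (x := s) ⌊s⌋
      rw [mul_one] at this
      rw [← this, Int.fract]
    rw [e, e, h]
  have h2 := hσ.simple ⟨Int.fract_nonneg s, Int.fract_lt_one s⟩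
    ⟨Int.fract_nonneg t, Int.fract_lt_one t⟩ h1
  refine ⟨⌊s⌋ - ⌊t⌋, ?_⟩
  have h3 := Int.fract_add_floor s
  have h4 := Int.fract_add_floor t
  push_cast
  linarith

theorem PolarFrame.curve_congr_angle (F : PolarFrame K) (hG : Function.Periodic G (2 * Real.pi))
    {s t : ℝ} (h : (s : Real.Angle) = t) : F.curve G s = F.curve G t := by
  obtain ⟨k, hk⟩ := Real.Angle.angle_eq_iff_two_pi_dvd_sub.1 h
  have e1 : G s = G t := by
    have := hG.sub_int_mul_eq (x := s) k
    rw [← this]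
    congr 1
    linarith
  have e2 := Real.Angle.cos_eq_iff_coe_eq_or_eq_neg.2 (Or.inl h)
  have e3 : Real.sin s = Real.sin t := by rw [← Real.Angle.sin_coe, h, Real.Angle.sin_coe]
  rw [PolarFrame.curve, PolarFrame.curve, PolarFrame.e, PolarFrame.e, e1, e2, e3]

/-- Every closed convex curve can be written in polar coordinates around every point of a convex
region bounded by it. -/
theorem IsClosedConvexCurve.exists_polarRepresentation (hK : 0 ≤ K) {σ : ℝ → ModelPlane K}
    (hσ : IsClosedConvexCurve σ) {Ω : Set (ModelPlane K)} (hΩ : IsOpen Ω)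
    (hc : IsGeodesicallyConvex Ω) (hf : frontier Ω = range σ) {o : ModelPlane K} (ho : o ∈ Ω) :
    ∃ (F : PolarFrame K) (G φ : ℝ → ℝ), PolarRepresentation σ F G φ ∧ o.coords = F.c + F.O ∧
      (K ≠ 0 → ∀ x : ModelPlane K,
        (∀ t q, IsSlope G t q → 0 < ⟪x.coords, F.normal t (G t) q⟫) → x ∈ Ω) := by
  obtain ⟨F, Λ, h⟩ := exists_isPolarCoords hK o
  have hC := h.epiCone hK hΩ hc (by rw [hf]; exact range_nonempty σ) ho
  have hmem : ∀ t, σ t ∈ frontier Ω := fun t => by rw [hf]; exact mem_range_self t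
  set C := IsPolarCoords.cone Λ Ω with hCdef
  set z : ℝ → ℂ := fun t => ⟨(Λ (σ t)).1.1, (Λ (σ t)).1.2⟩ with hz
  have hΛ : Continuous fun t => Λ (σ t) := h.cont.comp hσ.continuous
  have hzc : Continuous z := by
    have e : z = fun t => Complex.equivRealProdCLM.symm (Λ (σ t)).1 := by
      funext t
      rfl
    rw [e]
    exact Complex.equivRealProdCLM.symm.continuous.comp hΛ.fst
  have hz0 : ∀ t, z t ≠ 0 := fun t h0 => h.fst_ne_zero_of_mem_frontier hΩ hC (hmem t) <| by
    have h1 := congrArg Complex.re h0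
    have h2 := congrArg Complex.im h0
    exact Prod.ext h1 h2
  obtain ⟨φ, hφ, hφz⟩ := exists_continuous_arg hzc hz0
  set G : ℝ → ℝ := fun t => epiFun C (Real.cos t, Real.sin t) with hG
  have hGper : Function.Periodic G (2 * Real.pi) := fun t => by
    simp only [hG, Real.cos_add_two_pi, Real.sin_add_two_pi]
  have hre : ∀ t, (Λ (σ t)).1.1 = ‖z t‖ * Real.cos (φ t) := fun t => by
    rw [← Real.Angle.cos_coe, hφz, Real.Angle.cos_coe, Complex.norm_mul_cos_arg]
  have him : ∀ t, (Λ (σ t)).1.2 = ‖z t‖ * Real.sin (φ t) := fun t => by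
    rw [← Real.Angle.sin_coe, hφz, Real.Angle.sin_coe, Complex.norm_mul_sin_arg]
  have hl : ∀ t, (Λ (σ t)).2 = ‖z t‖ * G (φ t) := fun t => by
    rw [← h.epiFun_eq_of_mem_frontier hΩ hC (hmem t), hG, ← hC.epiFun_smul (norm_pos_iff.2 (hz0 t))]
    congr 1
    exact Prod.ext (hre t) (him t)
  have hnorm : ∀ t, ‖z t‖ ^ 2 * (K + G (φ t) ^ 2) = 1 := fun t => by
    have := h.norm (σ t)
    rw [hre, him, hl] at this
    linear_combination this - K * ‖z t‖ ^ 2 * Real.cos_sq_add_sin_sq (φ t)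
  have hr : ∀ t, ‖z t‖ = (radW K (G (φ t)))⁻¹ := fun t => by
    have h1 := norm_pos_iff.2 (hz0 t)
    have h2 : 0 < K + G (φ t) ^ 2 := by
      by_contra hneg
      have := hnorm t
      nlinarith [mul_nonneg (sq_nonneg ‖z t‖) (by linarith : 0 ≤ -(K + G (φ t) ^ 2))]
    have h3 := radW_pos h2
    have h4 := hnorm t
    rw [← radW_sq h2, ← mul_pow] at h4
    exact eq_inv_of_mul_eq_one_left ((pow_eq_one_iff_of_nonneg (by positivity) two_ne_zero).1 h4)
  have hcoords : ∀ t, (σ t).coords = F.curve G (φ t) := fun t => by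
    rw [h.coords, hre, him, hl, hr, PolarFrame.curve, PolarFrame.e]
    module
  have hdeg := strictMono_or_strictAnti_of_degree (ψ := fun t => φ t / (2 * Real.pi)) (by fun_prop)
    (fun s t n hn => hσ.exists_int (coords_injective (by
      rw [hcoords, hcoords]
      refine F.curve_congr_angle hGper (Real.Angle.angle_eq_iff_two_pi_dvd_sub.2 ⟨n, ?_⟩)
      have := Real.pi_pos
      field_simp at hn
      linarith)))
    (fun t => by
      have e : z (t + 1) = z t := by simp only [hz, hσ.periodic t]
      have e2 : (φ (t + 1) : Real.Angle) = φ t := by rw [hφz, hφz, e]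
      obtain ⟨k, hk⟩ := Real.Angle.angle_eq_iff_two_pi_dvd_sub.1 e2
      refine ⟨k, ?_⟩
      have := Real.pi_pos
      field_simp
      linarith)
  -- In the plane positivity of `G` is read off at points of the curve, so every angle has to be
  -- attained.
  have hradial : Function.Surjective φ → ConvexRadial K G := fun hsurj => by
    obtain ⟨B, hB⟩ := hC.exists_abs_le
    refine ⟨hK, hGper, fun hK0 t => ?_, ⟨|B| * (1 + 1), fun t => ?_⟩, fun t => EpiCone.exists_isSlope t hC⟩
    · obtain ⟨s, rfl⟩ := hsurj t
      have h1 := hl s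
      rw [h.zero hK0] at h1
      exact (pos_iff_pos_of_mul_pos (by rw [← h1]; exact one_pos)).1 (norm_pos_iff.2 (hz0 s))
    · refine (hB _).trans ((mul_le_mul_of_nonneg_right (le_abs_self B) (by positivity)).trans ?_)
      exact mul_le_mul_of_nonneg_left (add_le_add (Real.abs_cos_le_one t) (Real.abs_sin_le_one t))
        (abs_nonneg B)
  have hpi := Real.pi_pos
  have ho' : o.coords = F.c + F.O := by
    rw [h.coords o, h.origin]
    module
  -- Being above the gauge is checked with a single supporting half-space, the one at the angle of
  -- `x` itself. If `x` is on the axis then `w = 0` and any angle serves.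
  have hhalf : K ≠ 0 → ∀ x : ModelPlane K,
      (∀ t q, IsSlope G t q → 0 < ⟪x.coords, F.normal t (G t) q⟫) → x ∈ Ω := fun hK0 x hx => by
    rw [← h.mem_cone_iff, ← hCdef]
    change ((Λ x).1, (Λ x).2) ∈ C
    rw [hC.mem_iff]
    set w : ℂ := ⟨(Λ x).1.1, (Λ x).1.2⟩ with hw
    obtain ⟨q, hq⟩ := EpiCone.exists_isSlope w.arg hC
    have h1 := hx w.arg q hq
    have h2 : ⟪x.coords, F.normal w.arg (G w.arg) q⟫ = (Λ x).2 - ‖w‖ * G w.arg := by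
      rcases F.origin with ⟨h3, -⟩ | ⟨-, h3, h4⟩
      · exact absurd h3 hK0
      have e1 : (Λ x).1.1 = ‖w‖ * Real.cos w.arg := (Complex.norm_mul_cos_arg w).symm
      have e2 : (Λ x).1.2 = ‖w‖ * Real.sin w.arg := (Complex.norm_mul_sin_arg w).symm
      rw [h.coords, h3, e1, e2]
      have e3 : (0 : E3) + ((‖w‖ * Real.cos w.arg) • F.a + (‖w‖ * Real.sin w.arg) • F.b +
          (Λ x).2 • F.O) = ‖w‖ • F.e w.arg + (Λ x).2 • F.O := by
        rw [PolarFrame.e]; module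
      rw [e3]
      simp only [PolarFrame.normal, inner_add_left, inner_sub_right, real_inner_smul_left,
        real_inner_smul_right, F.inner_e_e, F.inner_e_O, F.inner_O_e, F.inner_e_e', F.inner_O_e',
        sub_self, Real.cos_zero, Real.sin_zero]
      linear_combination (Λ x).2 * h4
    rw [h2, sub_pos] at h1
    refine lt_of_eq_of_lt ?_ h1
    rcases (norm_nonneg w).eq_or_lt with h0 | h0
    · have h3 := norm_eq_zero.1 h0.symm
      have h4 : (Λ x).1 = 0 := Prod.ext (congrArg Complex.re h3) (congrArg Complex.im h3)
      rw [h4, hC.epiFun_zero, ← h0, zero_mul]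
    · simp only [hG]
      rw [← hC.epiFun_smul h0]
      congr 1
      exact Prod.ext (Complex.norm_mul_cos_arg w).symm (Complex.norm_mul_sin_arg w).symm
  rcases hdeg with ⟨hm, h1⟩ | ⟨hm, h1⟩
  · have h2 : ∀ t, φ (t + 1) = φ t + 2 * Real.pi := fun t => by
      have := h1 t
      field_simp at this
      linarith
    exact ⟨F, G, φ, ⟨hradial (surjective_of_add_one (by positivity) hφ h2),
      fun s t hst => (div_lt_div_iff_of_pos_right (by positivity)).1 (hm hst), hφ, h2, hcoords⟩, ho', hhalf⟩
  · have h2 : ∀ t, -φ (t + 1) = -φ t + 2 * Real.pi := fun t => by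
      have := h1 t
      field_simp at this
      linarith
    have hsurj := surjective_of_add_one (φ := fun t => -φ t) (by positivity) hφ.neg h2
    have hr' := hradial fun x => by
      obtain ⟨t, ht⟩ := hsurj (-x)
      exact ⟨t, neg_injective ht⟩
    refine ⟨F.reflect, fun t => G (-t), fun t => -φ t, ⟨hr'.reflect, fun s t hst =>
      neg_lt_neg ((div_lt_div_iff_of_pos_right (by positivity)).1 (hm hst)), hφ.neg, h2, fun t => ?_⟩, ho',
      fun hK0 x hx => hhalf hK0 x fun t q hq => ?_⟩
    · rw [F.reflect_curve, neg_neg, hcoords]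
    · have h3 := hx (-t) (-q) hq.reflect
      have h4 : F.reflect.normal (-t) (G t) (-q) = F.normal t (G t) q := by
        simp [PolarFrame.normal, PolarFrame.reflect, PolarFrame.e, PolarFrame.e']
      simp only [neg_neg] at h3
      rwa [h4] at h3

end

section

open ModelPlane

variable {K κ : ℝ} {G p : ℝ → ℝ}

/-! ### The length of a curve of large curvature -/

theorem PolarFrame.le_inner_normal (F : PolarFrame K) (hG : ConvexRadial K G) (hκ : 0 < κ)
    (hp : CurvatureGE K G p κ) {t q : ℝ} (hq : IsSlope G t q) (u : ℝ) :
    κ / 2 * radZ K (G t) q * ‖F.curve G u - F.curve G t‖ ^ 2 ≤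
      ⟪F.curve G u - F.curve G t, F.normal t (G t) q⟫ := by
  have h1 := F.excess_nonneg hG hκ hp hq u
  rw [PolarFrame.excess, PolarFrame.chordSq, sub_nonneg] at h1
  rw [F.inner_sub_normal' hG t q u]
  have hz := radZ_pos (p := q) (hG.pos_add t)
  nlinarith

/-- The points of minimal norm of a closed convex hull. -/
theorem exists_mem_closure_convexHull_forall_le {S : Set E3} (hS : S.Nonempty) :
    ∃ z ∈ closure (convexHull ℝ S), ∀ x ∈ closure (convexHull ℝ S), ‖z‖ ^ 2 ≤ ⟪x, z⟫ := by
  have hc : Convex ℝ (closure (convexHull ℝ S)) := (convex_convexHull ℝ S).closure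
  obtain ⟨z, hz, h⟩ := exists_norm_eq_iInf_of_complete_convex
    (hS.convexHull (𝕜 := ℝ)).closure isClosed_closure.isComplete hc 0
  refine ⟨z, hz, fun x hx => ?_⟩
  have := (norm_eq_iInf_iff_real_inner_le_zero hc hz).1 h x hx
  rw [zero_sub, inner_neg_left, inner_sub_right, real_inner_self_eq_norm_sq, real_inner_comm] at this
  linarith

theorem closure_convexHull_subset {S T : Set E3} (h : S ⊆ T) (hT : Convex ℝ T) (hT' : IsClosed T) :
    closure (convexHull ℝ S) ⊆ T :=
  closure_minimal (convexHull_min h hT) hT'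

theorem convex_setOf_le_inner (z : E3) (c : ℝ) : Convex ℝ {x : E3 | c ≤ ⟪x, z⟫} := by
  intro x hx y hy a b ha hb hab
  rw [mem_ofPred_eq] at *
  rw [inner_add_left, real_inner_smul_left, real_inner_smul_left]
  calc c = a * c + b * c := by rw [← add_mul, hab, one_mul]
    _ ≤ _ := by gcongr

theorem isClosed_setOf_le_inner (z : E3) (c : ℝ) : IsClosed {x : E3 | c ≤ ⟪x, z⟫} :=
  isClosed_le continuous_const (by fun_prop)

/-- The curve lies in a closed half-space at positive distance from the centre of the sphere. -/
theorem PolarFrame.exists_le_inner (F : PolarFrame K) (hG : ConvexRadial K G) (hK : 0 < K)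
    (hκ : 0 < κ) (hp : CurvatureGE K G p κ) :
    ∃ c : E3, c ≠ 0 ∧ ∀ u, κ / √(K * (K + κ ^ 2)) * ‖c‖ ≤ ⟪F.curve G u, c⟫ := by
  obtain ⟨w, hw, h⟩ := F.exists_ball hG hκ hp 0
  have hl : 0 < K + κ ^ 2 := by positivity
  set m := κ / √(K * (K + κ ^ 2)) with hm
  have hm0 : 0 < m := by positivity
  have hm2 : m ^ 2 = 1 / K - 1 / (K + κ ^ 2) := by
    rw [hm, div_pow, Real.sq_sqrt (by positivity)]
    field_simp
    ring
  have hw2 : ‖w‖ ^ 2 = 1 / (K + κ ^ 2) := by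
    rw [eq_div_iff hl.ne']; linarith
  -- The intersection of the sphere with the touching ball is a cap. Expanding the squared distance
  -- to the centre `γ(0) + w` of the ball gives the half-space containing it, and `m² + |c|² ≥ 2 m
  -- |c|` gives its distance from the origin.
  have key : ∀ u, (m ^ 2 + ‖F.curve G 0 + w‖ ^ 2) / 2 ≤ ⟪F.curve G u, F.curve G 0 + w⟫ := by
    intro u
    have h1 : ‖F.curve G u - (F.curve G 0 + w)‖ ^ 2 ≤ ‖w‖ ^ 2 := by
      rw [← sub_sub, norm_sub_sq_real]
      linarith [h u]
    rw [norm_sub_sq_real] at h1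
    have h2 : ‖F.curve G u‖ ^ 2 = 1 / K := by
      rw [eq_div_iff hK.ne', ← real_inner_self_eq_norm_sq, mul_comm, F.K_mul_inner_curve hG hK.ne']
    rw [h2, hw2] at h1
    rw [hm2]
    linarith
  refine ⟨F.curve G 0 + w, fun h0 => ?_, fun u => le_trans ?_ (key u)⟩
  · have := key 0
    rw [h0, inner_zero_right, norm_zero] at this
    nlinarith
  · nlinarith [sq_nonneg (m - ‖F.curve G 0 + w‖)]

/-- On the sphere, there is a point of the region from which the whole curve is seen within the
right distance. -/
theorem exists_polarRepresentation_le (hK : 0 < K) (hκ : 0 < κ) {σ : ℝ → ModelPlane K}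
    (hσ : IsClosedConvexCurve σ) {Ω : Set (ModelPlane K)} (hΩ : IsOpen Ω)
    (hc : IsGeodesicallyConvex Ω) (hf : frontier Ω = range σ) {F : PolarFrame K} {φ : ℝ → ℝ}
    (hr : PolarRepresentation σ F G φ) (hp : CurvatureGE K G p κ)
    (hhalf : ∀ x : ModelPlane K,
      (∀ t q, IsSlope G t q → 0 < ⟪x.coords, F.normal t (G t) q⟫) → x ∈ Ω) :
    ∃ (F' : PolarFrame K) (G' φ' : ℝ → ℝ), PolarRepresentation σ F' G' φ' ∧ ∀ t, κ ≤ G' t := by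
  have hG := hr.radial
  have hs := Real.sqrt_pos.2 hK
  have hs2 := Real.sq_sqrt hK.le
  have hl : 0 < K + κ ^ 2 := by positivity
  set m := κ / √(K * (K + κ ^ 2)) with hm
  have hm0 : 0 < m := by positivity
  obtain ⟨z, hz, hzle⟩ := exists_mem_closure_convexHull_forall_le (range_nonempty (F.curve G))
  have hsub : range (F.curve G) ⊆ closure (convexHull ℝ (range (F.curve G))) :=
    (subset_convexHull ℝ _).trans subset_closure
  obtain ⟨c, hc0, hcle⟩ := F.exists_le_inner hG hK hκ hp
  have hmz : m ≤ ‖z‖ := by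
    have h1 : m * ‖c‖ ≤ ⟪z, c⟫ := closure_convexHull_subset (T := {x | m * ‖c‖ ≤ ⟪x, c⟫})
      (by rintro _ ⟨u, rfl⟩; exact hcle u) (convex_setOf_le_inner c _) (isClosed_setOf_le_inner c _) hz
    exact le_of_mul_le_mul_right (h1.trans (real_inner_le_norm z c)) (norm_pos_iff.2 hc0)
  have hz0 : z ≠ 0 := norm_pos_iff.1 (hm0.trans_le hmz)
  obtain ⟨o, ho⟩ := exists_coords_eq_smul hK hz0
  set ρ := ‖z‖ * √K with hρ
  have hρ0 : 0 < ρ := mul_pos (norm_pos_iff.2 hz0) hs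
  have hoΩ : o ∈ Ω := by
    refine hhalf o fun t q hq => ?_
    suffices 0 < ⟪z, F.normal t (G t) q⟫ by
      rw [ho, real_inner_smul_left] at this
      exact pos_of_mul_pos_right this hρ0.le
    have hZ := radZ_pos (p := q) (hG.pos_add t)
    have hqn := F.inner_curve_normal hG hK.ne' t q
    -- The inequality known on the curve describes a closed ball, so it extends to the closed convex
    -- hull, in particular to `z`.
    have h1 : κ / 2 * radZ K (G t) q * ‖z - F.curve G t‖ ^ 2 ≤
        ⟪z - F.curve G t, F.normal t (G t) q⟫ := by
      set k := κ / 2 * radZ K (G t) q with hk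
      have hk0 : 0 < k := by positivity
      set n := F.normal t (G t) q with hn
      set y := F.curve G t with hy
      have e : ∀ x : E3, k * ‖x - y‖ ^ 2 ≤ ⟪x - y, n⟫ ↔
          x ∈ Metric.closedBall (y + (2 * k)⁻¹ • n) (‖n‖ / (2 * k)) := fun x => by
        rw [Metric.mem_closedBall, dist_eq_norm, ← sub_sub,
          ← sq_le_sq₀ (norm_nonneg _) (by positivity), norm_sub_sq_real (x - y), norm_smul,
          real_inner_smul_right, norm_inv, Real.norm_eq_abs, abs_of_pos (by positivity : 0 < 2 * k)]
        have e2 : (‖n‖ / (2 * k)) ^ 2 = ((2 * k)⁻¹ * ‖n‖) ^ 2 := by ring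
        rw [e2]
        constructor
        · intro h
          have h2 := mul_le_mul_of_nonneg_left h (inv_nonneg.2 hk0.le)
          rw [inv_mul_cancel_left₀ hk0.ne'] at h2
          have e3 : 2 * ((2 * k)⁻¹ * ⟪x - y, n⟫) = k⁻¹ * ⟪x - y, n⟫ := by field_simp
          linarith
        · intro h
          have e3 : 2 * ((2 * k)⁻¹ * ⟪x - y, n⟫) = k⁻¹ * ⟪x - y, n⟫ := by field_simp
          have h2 : ‖x - y‖ ^ 2 ≤ k⁻¹ * ⟪x - y, n⟫ := by linarith
          have h3 := mul_le_mul_of_nonneg_left h2 hk0.le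
          rwa [mul_inv_cancel_left₀ hk0.ne'] at h3
      rw [e]
      refine closure_convexHull_subset ?_ (convex_closedBall _ _) Metric.isClosed_closedBall hz
      rintro _ ⟨u, rfl⟩
      rw [← e]
      exact F.le_inner_normal hG hκ hp hq u
    rw [inner_sub_left, hqn, sub_zero] at h1
    refine lt_of_lt_of_le ?_ h1
    -- If the nearest point were on the curve it would have norm `1 / √K`; then `⟪x, z⟫ ≥ ‖z‖²` for
    -- all points `x` of the curve would force the curve to be constant.
    have hne : z ≠ F.curve G t := by
      intro hzt
      have hconst : ∀ u, F.curve G u = F.curve G t := fun u => by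
        have h2 := hzle _ (hsub (mem_range_self u))
        have e1 : ‖F.curve G u‖ ^ 2 = 1 / K := by
          rw [eq_div_iff hK.ne', ← real_inner_self_eq_norm_sq, mul_comm,
            F.K_mul_inner_curve hG hK.ne']
        have e2 : ‖z‖ ^ 2 = 1 / K := by
          rw [hzt, eq_div_iff hK.ne', ← real_inner_self_eq_norm_sq, mul_comm,
            F.K_mul_inner_curve hG hK.ne']
        have h3 : ‖F.curve G u - z‖ ^ 2 ≤ 0 := by
          rw [norm_sub_sq_real]
          linarith
        have h4 := norm_eq_zero.1 (pow_eq_zero_iff two_ne_zero |>.1 (le_antisymm h3 (sq_nonneg _)))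
        rw [← hzt]
        exact sub_eq_zero.1 h4
      have h5 : σ (1 / 2) = σ 0 := coords_injective (by rw [hr.coords, hr.coords, hconst, hconst (φ 0)])
      have h6 := hσ.simple ⟨by norm_num, by norm_num⟩ ⟨le_rfl, one_pos⟩ h5
      norm_num at h6
    have := norm_pos_iff.2 (sub_ne_zero.2 hne)
    positivity
  obtain ⟨F', G', φ', hr', ho', -⟩ := hσ.exists_polarRepresentation hK.le hΩ hc hf hoΩ
  refine ⟨F', G', φ', hr', fun t => ?_⟩
  obtain ⟨s, rfl⟩ := surjective_of_add_one (by have := Real.pi_pos; positivity) hr'.continuous hr'.add_one t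
  have h1 := hzle _ (hsub (mem_range_self (φ s)))
  rw [← hr.coords, hr'.coords, ho, real_inner_smul_right, ho'] at h1
  have hW := radW_pos (hr'.radial.pos_add (φ' s))
  have hW2 := radW_sq (hr'.radial.pos_add (φ' s))
  rcases F'.origin with ⟨h0, -⟩ | ⟨-, hc', hO⟩
  · exact absurd h0 hK.ne'
  have h2 : K * ⟪F'.curve G' (φ' s), F'.c + F'.O⟫ = G' (φ' s) / radW K (G' (φ' s)) := by
    simp only [PolarFrame.curve, hc', zero_add, inner_add_left, real_inner_smul_left, F'.inner_e_O]
    field_simp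
    linear_combination G' (φ' s) * hO
  rw [← ho', ← ho, ho'] at h1
  -- The right side is the cosine of the angle at the origin of space between `o` and the point of
  -- the curve. Together with `‖z‖ ≥ m` it is at least `κ / √(K + κ²)`, and `g ↦ g / √(K + g²)`
  -- increases, hence `κ ≤ G'`.
  have h3 : √K * ‖z‖ ≤ G' (φ' s) / radW K (G' (φ' s)) := by
    rw [← h2]
    have h4 : ‖z‖ * (√K * ⟪F'.curve G' (φ' s), F'.c + F'.O⟫) ≥ ‖z‖ * ‖z‖ := by
      rw [hρ] at h1; linarith
    have h5 := le_of_mul_le_mul_left h4 (norm_pos_iff.2 hz0)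
    calc √K * ‖z‖ ≤ √K * (√K * ⟪F'.curve G' (φ' s), F'.c + F'.O⟫) := by gcongr
      _ = √K ^ 2 * ⟪F'.curve G' (φ' s), F'.c + F'.O⟫ := by ring
      _ = _ := by rw [hs2]
  have h4 : κ / √(K + κ ^ 2) ≤ G' (φ' s) / radW K (G' (φ' s)) := by
    refine le_trans (le_of_eq ?_) ((mul_le_mul_of_nonneg_left hmz hs.le).trans h3)
    rw [hm, Real.sqrt_mul hK.le]
    field_simp
  generalize G' (φ' s) = g at *
  have hg : 0 < g := by
    have : 0 < κ / √(K + κ ^ 2) := by positivity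
    exact (div_pos_iff_of_pos_right hW).1 (this.trans_le h4)
  have h5 : (κ / √(K + κ ^ 2)) ^ 2 ≤ (g / radW K g) ^ 2 := by gcongr
  rw [div_pow, div_pow, hW2, Real.sq_sqrt hl.le, div_le_div_iff₀ hl (by positivity)] at h5
  have h6 : κ ^ 2 ≤ g ^ 2 := by
    have : K * κ ^ 2 ≤ K * g ^ 2 := by linarith
    exact le_of_mul_le_mul_left this hK
  exact (sq_le_sq₀ hκ.le hg.le).1 h6

end

section

open ModelPlane

variable {K κ : ℝ} {G p : ℝ → ℝ}

/-! ### Arc length in polar coordinates -/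

theorem ConvexRadial.exists_periodic_slope (hG : ConvexRadial K G) :
    ∃ p : ℝ → ℝ, (∀ t, IsSlope G t (p t)) ∧ Function.Periodic p (2 * Real.pi) := by
  choose q hq using hG.slope
  refine ⟨fun t => q (toIcoMod Real.two_pi_pos 0 t), fun t => ?_, fun t => ?_⟩
  · have hper : ∀ r, Function.Periodic (fun t => IsSlope G t r) (2 * Real.pi) := fun r t => by
      refine propext ⟨fun h => ?_, fun h => h.add_period hG.periodic⟩
      have := h.sub_period hG.periodic
      rwa [add_sub_cancel_right] at this
    have h1 := (hper (q (toIcoMod Real.two_pi_pos 0 t))).sub_zsmul_eq (x := t)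
      (toIcoDiv Real.two_pi_pos 0 t)
    rw [← h1]
    exact hq _
  · simp only [toIcoMod_add_right]

section

variable {σ : ℝ → ModelPlane K} {F : PolarFrame K} {φ : ℝ → ℝ}

theorem PolarRepresentation.surjective (hr : PolarRepresentation σ F G φ) : Function.Surjective φ :=
  surjective_of_add_one Real.two_pi_pos hr.continuous hr.add_one

/-- A curve in polar coordinates, parametrized by the angle. -/
noncomputable def PolarRepresentation.byAngle (hr : PolarRepresentation σ F G φ) (t : ℝ) :
    ModelPlane K :=
  σ ((hr.strictMono.orderIsoOfSurjective φ hr.surjective).symm t)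

theorem PolarRepresentation.byAngle_apply (hr : PolarRepresentation σ F G φ) (t : ℝ) :
    hr.byAngle (φ t) = σ t := by
  rw [PolarRepresentation.byAngle]
  congr 1
  exact (hr.strictMono.orderIsoOfSurjective φ hr.surjective).symm_apply_apply t

theorem PolarRepresentation.coords_byAngle (hr : PolarRepresentation σ F G φ) (t : ℝ) :
    (hr.byAngle t).coords = F.curve G t := by
  obtain ⟨s, rfl⟩ := hr.surjective t
  rw [hr.byAngle_apply, hr.coords]

theorem PolarRepresentation.eVariationOn_byAngle (hr : PolarRepresentation σ F G φ) (a b : ℝ) :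
    eVariationOn σ (Icc a b) = eVariationOn hr.byAngle (Icc (φ a) (φ b)) := by
  have h1 : hr.byAngle ∘ φ = σ := funext hr.byAngle_apply
  have h2 := eVariationOn.comp_eq_of_monotoneOn hr.byAngle (t := Icc a b) φ
    (hr.strictMono.monotone.monotoneOn _)
  rw [h1] at h2
  rw [h2]
  congr 1
  exact (hr.strictMono.orderIsoOfSurjective φ hr.surjective).image_Icc a b

theorem PolarRepresentation.arcChordCurvature_byAngle (hr : PolarRepresentation σ F G φ) (a b : ℝ) :
    arcChordCurvature K hr.byAngle (φ a) (φ b) = arcChordCurvature K σ a b := by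
  rw [arcChordCurvature, arcChordCurvature, arcLength, arcLength, hr.eVariationOn_byAngle,
    hr.byAngle_apply, hr.byAngle_apply]

theorem PolarRepresentation.eVariationOn_eq (hr : PolarRepresentation σ F G φ)
    (hp : ∀ t, IsSlope G t (p t)) {a b : ℝ} (hab : a ≤ b) : eVariationOn σ (Icc a b) =
      ENNReal.ofReal (lengthIntegral K G p (φ b) - lengthIntegral K G p (φ a)) := by
  rw [hr.eVariationOn_byAngle, F.eVariationOn_eq hr.radial hp hr.coords_byAngle
    (hr.strictMono.monotone hab)]

theorem PolarRepresentation.arcLength_eq (hr : PolarRepresentation σ F G φ)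
    (hp : ∀ t, IsSlope G t (p t)) {a b : ℝ} (hab : a ≤ b) :
    arcLength σ a b = lengthIntegral K G p (φ b) - lengthIntegral K G p (φ a) := by
  rw [arcLength, hr.eVariationOn_byAngle, ← arcLength, F.arcLength_eq hr.radial hp hr.coords_byAngle
    (hr.strictMono.monotone hab)]

theorem PolarRepresentation.dist_le_arcLength (hr : PolarRepresentation σ F G φ) {a b : ℝ}
    (hab : a ≤ b) : dist (σ a) (σ b) ≤ arcLength σ a b := by
  obtain ⟨p, hp⟩ := hr.radial.exists_periodic_slope
  rw [hr.arcLength_eq hp.1 hab, ← hr.byAngle_apply, ← hr.byAngle_apply]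
  exact F.dist_le_lengthIntegral hr.radial hp.1 hr.coords_byAngle (hr.strictMono.monotone hab)

theorem PolarRepresentation.arcLength_one (hr : PolarRepresentation σ F G φ)
    (hp : ∀ t, IsSlope G t (p t)) (hper : Function.Periodic p (2 * Real.pi)) :
    arcLength σ 0 1 = lengthIntegral K G p (2 * Real.pi) := by
  have h1 := hr.add_one 0
  rw [zero_add] at h1
  rw [hr.arcLength_eq hp zero_le_one, h1, lengthIntegral_add_period hr.radial hp hper]

/-! ### Null sets -/

/-- The hypothesis makes `I` bi-Lipschitz, so null sets correspond in both directions. It is applied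
to arc length as a function of the angle. -/
theorem volume_image_eq_zero_iff {I : ℝ → ℝ} {c C : ℝ} (hc : 0 < c)
    (hI : ∀ a b, a ≤ b → I b - I a ∈ Icc (c * (b - a)) (C * (b - a))) (S : Set ℝ) :
    volume (I '' S) = 0 ↔ volume S = 0 := by
  have hI' : ∀ a b, c * |a - b| ≤ |I a - I b| ∧ |I a - I b| ≤ C * |a - b| := by
    have key : ∀ a b, a ≤ b → c * |a - b| ≤ |I a - I b| ∧ |I a - I b| ≤ C * |a - b| := by
      intro a b hab
      have h1 := hI a b hab
      have h2 : 0 ≤ I b - I a := (mul_nonneg hc.le (sub_nonneg.2 hab)).trans h1.1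
      rw [abs_of_nonpos (by linarith : a - b ≤ 0), abs_of_nonpos (by linarith : I a - I b ≤ 0),
        neg_sub, neg_sub]
      exact h1
    intro a b
    rcases le_total a b with h | h
    · exact key a b h
    · rw [abs_sub_comm a b, abs_sub_comm (I a)]
      exact key b a h
  have hC : 0 ≤ C := by
    have := hI 0 1 zero_le_one
    have h2 := this.1.trans this.2
    rw [sub_zero, mul_one, mul_one] at h2
    linarith
  rw [← hausdorffMeasure_real]
  constructor
  · intro h
    have hal : AntilipschitzWith (c⁻¹).toNNReal I := AntilipschitzWith.of_le_mul_dist fun x y => by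
      rw [Real.coe_toNNReal _ (by positivity), Real.dist_eq, Real.dist_eq, inv_mul_eq_div,
        le_div_iff₀' hc]
      exact (hI' x y).1
    have h1 := hal.le_hausdorffMeasure_image (d := 1) zero_le_one S
    rw [h, mul_zero] at h1
    exact le_antisymm h1 zero_le
  · intro h
    have hl : LipschitzWith C.toNNReal I := LipschitzWith.of_dist_le_mul fun x y => by
      rw [Real.coe_toNNReal _ hC, Real.dist_eq, Real.dist_eq]
      exact (hI' x y).2
    have h1 := hl.hausdorffMeasure_image_le (d := 1) zero_le_one S
    rw [h, mul_zero] at h1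
    exact le_antisymm h1 zero_le

theorem ae_of_periodic {D : ℝ → Prop} {a c : ℝ} (hc : 0 < c) (hD : ∀ t, D (t + c) ↔ D t)
    (h : ∀ᵐ t, t ∈ Icc a (a + c) → D t) : ∀ᵐ t, D t := by
  have hper : Function.Periodic D c := fun t => propext (hD t)
  have h1 : ∀ᵐ t, ∀ n : ℤ, t - n • c ∈ Icc a (a + c) → D (t - n • c) :=
    ae_all_iff.2 fun n => (measurePreserving_sub_right volume (n • c)).quasiMeasurePreserving.ae h
  filter_upwards [h1] with t ht
  have h2 := toIcoMod_mem_Ico hc a t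
  have h3 := ht (toIcoDiv hc a t) ⟨h2.1, h2.2.le⟩
  rwa [hper.sub_zsmul_eq] at h3

theorem PolarRepresentation.almostEverywhereOnCurve_iff (hr : PolarRepresentation σ F G φ)
    {P D : ℝ → Prop} (hD : ∀ t, D (t + 2 * Real.pi) ↔ D t) (h : ∀ᵐ t, ∀ s, φ s = t → (P s ↔ D t)) :
    AlmostEverywhereOnCurve σ P ↔ ∀ᵐ t, D t := by
  obtain ⟨p, hp, -⟩ := hr.radial.exists_periodic_slope
  obtain ⟨c, C, hc, -, hI⟩ := exists_lengthIntegral_bounds hr.radial hp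
  have e1 : arcLength σ 0 '' {t : ℝ | t ∈ Icc (0 : ℝ) 1 ∧ ¬ P t} =
      (fun t => lengthIntegral K G p t - lengthIntegral K G p (φ 0)) ''
        (φ '' {t : ℝ | t ∈ Icc (0 : ℝ) 1 ∧ ¬ P t}) := by
    rw [image_image]
    exact image_congr fun t ht => hr.arcLength_eq hp ht.1.1
  have h01 : φ 1 = φ 0 + 2 * Real.pi := by rw [← hr.add_one 0, zero_add]
  have e2 : ∀ᵐ t, (¬(t ∈ φ '' {t : ℝ | t ∈ Icc (0 : ℝ) 1 ∧ ¬ P t}) ↔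
      (t ∈ Icc (φ 0) (φ 0 + 2 * Real.pi) → D t)) := by
    filter_upwards [h] with t ht
    obtain ⟨s, rfl⟩ := hr.surjective t
    have hs := ht s rfl
    rw [hr.strictMono.injective.mem_set_image, mem_ofPred_eq, ← hs, ← h01]
    have : s ∈ Icc (0 : ℝ) 1 ↔ φ s ∈ Icc (φ 0) (φ 1) := by
      rw [mem_Icc, mem_Icc, hr.strictMono.le_iff_le, hr.strictMono.le_iff_le]
    rw [← this]
    tauto
  rw [AlmostEverywhereOnCurve, e1, volume_image_eq_zero_iff hc (C := C) (fun a b hab => by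
    have := hI a b hab
    rwa [sub_sub_sub_cancel_right]),
    measure_eq_zero_iff_ae_notMem, eventually_congr e2]
  exact ⟨fun h => ae_of_periodic Real.two_pi_pos hD h, fun h => h.mono fun t ht _ => ht⟩

end

end

section

open ModelPlane

variable {K κ : ℝ} {G p : ℝ → ℝ} {σ : ℝ → ModelPlane K} {F : PolarFrame K} {φ : ℝ → ℝ}

/-! ### Curvatures of closed convex curves -/

theorem radCurvature_ge_iff {g q d : ℝ} (h : 0 < K + g ^ 2) :
    κ ≤ radCurvature K g q d ↔ κ * radZ K g q ^ 3 ≤ (g + d) * radW K g ^ 3 := by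
  rw [radCurvature, le_div_iff₀ (pow_pos (radZ_pos h) 3)]

/-- Almost everywhere bounds on the curvature of a closed convex curve. -/
theorem PolarRepresentation.almostEverywhereOnCurve_iff_curvatureGE
    (hr : PolarRepresentation σ F G φ) (hp : ∀ t, IsSlope G t (p t))
    (hper : Function.Periodic p (2 * Real.pi)) {P : ℝ → Prop}
    (hP : ∀ t d, HasDerivAt p d (φ t) → (P t ↔ κ ≤ radCurvature K (G (φ t)) (p (φ t)) d)) :
    AlmostEverywhereOnCurve σ P ↔ CurvatureGE K G p κ := by
  have hG := hr.radial
  have key : AlmostEverywhereOnCurve σ P ↔ ∀ᵐ t, ∀ d, HasDerivAt p d t →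
      κ * radZ K (G t) (p t) ^ 3 ≤ (G t + d) * radW K (G t) ^ 3 := by
    refine hr.almostEverywhereOnCurve_iff (fun t => ?_) ?_
    · have h1 : ∀ d, HasDerivAt p d (t + 2 * Real.pi) ↔ HasDerivAt p d t := fun d => by
        have h2 : (fun s => p (s + 2 * Real.pi)) = p := funext hper
        constructor
        · intro h
          have h3 := h.comp_add_const t (2 * Real.pi)
          rwa [h2] at h3
        · intro h
          have h3 := HasDerivAt.comp_sub_const (t + 2 * Real.pi) (2 * Real.pi) (f := p) (f' := d)
            (by rwa [add_sub_cancel_right])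
          have h4 : (fun s => p (s - 2 * Real.pi)) = p := funext fun s => hper.sub_eq s
          rwa [h4] at h3
      simp only [h1, hG.periodic t, hper t]
    · filter_upwards [hG.ae_differentiableAt_slope hp] with t ht s hs
      subst hs
      rw [hP s _ ht.hasDerivAt, radCurvature_ge_iff (hG.pos_add _)]
      constructor
      · intro h d hd
        rwa [hd.unique ht.hasDerivAt]
      · intro h
        exact h _ ht.hasDerivAt
  rw [key]
  exact ⟨fun h => ⟨hp, h⟩, fun h => h.ae_le⟩

/-- The speed in the angle is bounded away from zero, so an arc of small length subtends a small
angle. -/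
theorem PolarRepresentation.tendsto_shrinkingArcs (hr : PolarRepresentation σ F G φ) (t : ℝ) :
    Tendsto (Prod.map φ φ) (shrinkingArcs σ t) (straddling (φ t)) := by
  obtain ⟨p, hp, -⟩ := hr.radial.exists_periodic_slope
  obtain ⟨c, C, hc, -, hI⟩ := exists_lengthIntegral_bounds hr.radial hp
  have hmem : ∀ᶠ I : ℝ × ℝ in shrinkingArcs σ t, I.1 < I.2 ∧ I.2 ≤ I.1 + 1 ∧ I.1 ≤ t ∧ t ≤ I.2 :=
    mem_inf_of_right (mem_principal_self _)
  rw [straddling, tendsto_inf, tendsto_principal]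
  constructor
  · rw [Metric.tendsto_nhds]
    intro ε hε
    have h1 : ∀ᶠ I : ℝ × ℝ in shrinkingArcs σ t,
        eVariationOn σ (Icc I.1 I.2) < ENNReal.ofReal (c * ε) :=
      (tendsto_comap.mono_left inf_le_left).eventually_lt_const
        (ENNReal.ofReal_pos.2 (mul_pos hc hε))
    filter_upwards [h1, hmem] with I h2 hI2
    rw [hr.eVariationOn_eq hp hI2.1.le, ENNReal.ofReal_lt_ofReal_iff (mul_pos hc hε)] at h2
    have m1 := hr.strictMono.monotone hI2.1.le
    have m2 := hr.strictMono.monotone hI2.2.2.1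
    have m3 := hr.strictMono.monotone hI2.2.2.2
    have h3 := (hI _ _ m1).1
    have h4 : φ I.2 - φ I.1 < ε := lt_of_mul_lt_mul_left (h3.trans_lt h2) hc.le
    rw [Prod.dist_eq, max_lt_iff, Real.dist_eq, Real.dist_eq, Prod.map_fst, Prod.map_snd, abs_lt,
      abs_lt]
    constructor <;> constructor <;> linarith
  · filter_upwards [hmem] with I hI2
    exact ⟨hr.strictMono hI2.1, hr.strictMono.monotone hI2.2.2.1, hr.strictMono.monotone hI2.2.2.2⟩

/-- Needed to identify lower and upper limits with the limit. The arcs starting at the point itself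
are enough. -/
theorem PolarRepresentation.neBot_shrinkingArcs (hr : PolarRepresentation σ F G φ) (t : ℝ) :
    (shrinkingArcs σ t).NeBot := by
  obtain ⟨p, hp, -⟩ := hr.radial.exists_periodic_slope
  obtain ⟨c, C, hc, -, hI⟩ := exists_lengthIntegral_bounds hr.radial hp
  have h : Tendsto (fun δ => (t, t + δ)) (𝓝[>] (0 : ℝ)) (shrinkingArcs σ t) := by
    have hpos : ∀ᶠ δ in 𝓝[>] (0 : ℝ), δ ∈ Ioo (0 : ℝ) 1 := Ioo_mem_nhdsGT one_pos
    rw [shrinkingArcs, tendsto_inf, tendsto_principal, tendsto_comap_iff]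
    constructor
    · have h1 : Tendsto (fun δ => ENNReal.ofReal (C * (φ (t + δ) - φ t))) (𝓝[>] (0 : ℝ)) (𝓝 0) := by
        have h2 : Continuous fun δ => ENNReal.ofReal (C * (φ (t + δ) - φ t)) := by
          have := hr.continuous
          exact ENNReal.continuous_ofReal.comp (by fun_prop)
        have h3 := h2.tendsto 0
        simp only [add_zero, sub_self, mul_zero, ENNReal.ofReal_zero] at h3
        exact h3.mono_left nhdsWithin_le_nhds
      refine tendsto_of_tendsto_of_tendsto_of_le_of_le' tendsto_const_nhds h1
        (Eventually.of_forall fun _ => zero_le) ?_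
      filter_upwards [hpos] with δ hδ
      simp only [Function.comp_apply]
      rw [hr.eVariationOn_eq hp (by linarith [hδ.1])]
      exact ENNReal.ofReal_le_ofReal (hI _ _ (hr.strictMono.monotone (by linarith [hδ.1]))).2
    · filter_upwards [hpos] with δ hδ
      exact ⟨by linarith [hδ.1], by linarith [hδ.2], le_rfl, by linarith [hδ.1]⟩
  exact h.neBot

theorem PolarRepresentation.tendsto_arcChordCurvature (hr : PolarRepresentation σ F G φ)
    (hp : ∀ t, IsSlope G t (p t)) {t d : ℝ} (hd : HasDerivAt p d (φ t)) :
    Tendsto (fun I : ℝ × ℝ => arcChordCurvature K σ I.1 I.2) (shrinkingArcs σ t)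
      (𝓝 (radCurvature K (G (φ t)) (p (φ t)) d)) := by
  have h1 := (F.tendsto_arcChordCurvature hr.radial hp hr.coords_byAngle hd).comp
    (hr.tendsto_shrinkingArcs t)
  exact h1.congr fun I => hr.arcChordCurvature_byAngle I.1 I.2

theorem PolarRepresentation.tendsto_oppositeSides (hr : PolarRepresentation σ F G φ) (t : ℝ) :
    Tendsto (Prod.map φ φ) (oppositeSides t) (oppositeSides (φ t)) := by
  have hc := hr.continuous.continuousAt (x := t)
  refine Tendsto.prodMap (tendsto_nhdsWithin_iff.2 ⟨hc.mono_left nhdsWithin_le_nhds, ?_⟩)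
    (tendsto_nhdsWithin_iff.2 ⟨hc.mono_left nhdsWithin_le_nhds, ?_⟩)
  · filter_upwards [self_mem_nhdsWithin] with s hs
    exact hr.strictMono hs
  · filter_upwards [self_mem_nhdsWithin] with s hs
    exact hr.strictMono hs

theorem PolarRepresentation.tendsto_oscCurvature (hr : PolarRepresentation σ F G φ)
    (hp : ∀ t, IsSlope G t (p t)) {t d : ℝ} (hd : HasDerivAt p d (φ t)) :
    Tendsto (fun s : ℝ × ℝ => oscCurvature K (σ s.1) (σ t) (σ s.2)) (oppositeSides t)
      (𝓝 (radCurvature K (G (φ t)) (p (φ t)) d)) := by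
  have h1 := (F.tendsto_oscCurvature hr.radial hp hr.coords_byAngle hd).comp
    (hr.tendsto_oppositeSides t)
  refine h1.congr fun s => ?_
  simp only [Function.comp_apply, Prod.map_fst, Prod.map_snd, hr.byAngle_apply]

theorem neBot_oppositeSides (t : ℝ) : (oppositeSides t).NeBot := by
  unfold oppositeSides; infer_instance

theorem PolarRepresentation.arcChordCurvatureGEAt_iff (hr : PolarRepresentation σ F G φ)
    (hp : ∀ t, IsSlope G t (p t)) {t d : ℝ} (hd : HasDerivAt p d (φ t)) :
    ArcChordCurvatureGEAt K σ κ t ↔ κ ≤ radCurvature K (G (φ t)) (p (φ t)) d := by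
  have := hr.neBot_shrinkingArcs t
  have h1 := (continuous_coe_real_ereal.tendsto _).comp (hr.tendsto_arcChordCurvature hp hd)
  have e1 : lowerArcChordCurvature K σ t = _ := h1.liminf_eq
  have e2 : upperArcChordCurvature K σ t = _ := h1.limsup_eq
  rw [ArcChordCurvatureGEAt, e1, e2, EReal.coe_le_coe_iff]
  exact and_iff_right rfl

theorem PolarRepresentation.oscCurvatureGEAt_iff (hr : PolarRepresentation σ F G φ)
    (hp : ∀ t, IsSlope G t (p t)) {t d : ℝ} (hd : HasDerivAt p d (φ t)) :
    OscCurvatureGEAt K σ κ t ↔ κ ≤ radCurvature K (G (φ t)) (p (φ t)) d := by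
  have := neBot_oppositeSides t
  have h1 := (continuous_coe_real_ereal.tendsto _).comp (hr.tendsto_oscCurvature hp hd)
  have e1 : lowerOscCurvature K σ t = _ := h1.liminf_eq
  have e2 : upperOscCurvature K σ t = _ := h1.limsup_eq
  rw [OscCurvatureGEAt, e1, e2, EReal.coe_le_coe_iff]
  exact and_iff_right rfl

theorem PolarRepresentation.curvatureGE_of_forall (hr : PolarRepresentation σ F G φ)
    (hp : ∀ t, IsSlope G t (p t))
    (hP : ∀ t d, HasDerivAt p d (φ t) → κ ≤ radCurvature K (G (φ t)) (p (φ t)) d) :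
    CurvatureGE K G p κ := by
  refine ⟨hp, Eventually.of_forall fun t d hd => ?_⟩
  obtain ⟨s, rfl⟩ := hr.surjective t
  exact (radCurvature_ge_iff (hr.radial.pos_add _)).1 (hP s d hd)

theorem PolarRepresentation.curvatureGE_of_globalArcChordGE (hr : PolarRepresentation σ F G φ)
    (hp : ∀ t, IsSlope G t (p t)) (h : GlobalArcChordGE K σ κ) : CurvatureGE K G p κ := by
  refine hr.curvatureGE_of_forall hp fun t d hd => ?_
  have := hr.neBot_shrinkingArcs t
  refine ge_of_tendsto (hr.tendsto_arcChordCurvature hp hd) ?_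
  have hmem : ∀ᶠ I : ℝ × ℝ in shrinkingArcs σ t, I.1 < I.2 ∧ I.2 ≤ I.1 + 1 ∧ I.1 ≤ t ∧ t ≤ I.2 :=
    mem_inf_of_right (mem_principal_self _)
  have h0 : Tendsto (fun I : ℝ × ℝ => arcLength σ I.1 I.2) (shrinkingArcs σ t) (𝓝 0) :=
    (ENNReal.tendsto_toReal ENNReal.zero_ne_top).comp (tendsto_comap.mono_left inf_le_left)
  -- Length plus chord is at most twice the length, so short arcs satisfy the perimeter condition.
  have hper : ∀ᶠ I : ℝ × ℝ in shrinkingArcs σ t, 0 < K → arcLength σ I.1 I.2 < Real.pi / √K := by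
    by_cases hK : 0 < K
    · filter_upwards [h0.eventually_lt_const (div_pos Real.pi_pos (Real.sqrt_pos.2 hK))] with I hI _
      exact hI
    · exact Eventually.of_forall fun I hI => absurd hI hK
  filter_upwards [hmem, hper] with I h1 h2
  refine h I.1 I.2 h1.1 h1.2.1 fun hK => ?_
  have h3 := h2 hK
  have h4 := hr.dist_le_arcLength h1.1.le
  rw [mul_div_assoc]
  linarith

theorem PolarRepresentation.curvatureGE_of_globalOscGE (hr : PolarRepresentation σ F G φ)
    (hσ : IsClosedConvexCurve σ)
    (hp : ∀ t, IsSlope G t (p t)) (h : GlobalOscGE K σ κ) : CurvatureGE K G p κ := by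
  refine hr.curvatureGE_of_forall hp fun t d hd => ?_
  have := neBot_oppositeSides t
  refine ge_of_tendsto (hr.tendsto_oscCurvature hp hd) ?_
  have hinj : ∀ s s', s < s' → s' < s + 1 → σ s ≠ σ s' := by
    intro s s' h1 h2 h3
    obtain ⟨m, hm⟩ := hσ.exists_int h3
    have h4 : (m : ℝ) < 0 := by linarith
    have h5 : (-1 : ℝ) < m := by linarith
    have h6 : m < 0 := by exact_mod_cast h4
    have h7 : -1 < m := by exact_mod_cast h5
    omega
  have hle : oppositeSides t ≤ 𝓝 (t, t) := (oppositeSides_le_straddling t).trans inf_le_left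
  have hmem : ∀ᶠ s : ℝ × ℝ in oppositeSides t, s.1 < t ∧ t < s.2 ∧ s.2 < s.1 + 1 := by
    have h1 : ∀ᶠ s : ℝ × ℝ in oppositeSides t, s.2 < s.1 + 1 := by
      have : ContinuousAt (fun s : ℝ × ℝ => s.1 + 1) (t, t) := by fun_prop
      exact hle (continuousAt_snd.eventually_lt this (by simp))
    filter_upwards [h1, prod_mem_prod (self_mem_nhdsWithin (a := t) (s := Iio t))
      (self_mem_nhdsWithin (a := t) (s := Ioi t))] with s h2 h3
    exact ⟨h3.1, h3.2, h2⟩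
  have hper : ∀ᶠ s : ℝ × ℝ in oppositeSides t, 0 < K →
      dist (σ s.1) (σ t) + dist (σ t) (σ s.2) + dist (σ s.2) (σ s.1) < 2 * Real.pi / √K := by
    by_cases hK : 0 < K
    · have hc := hσ.continuous
      have h1 : Continuous fun s : ℝ × ℝ =>
        dist (σ s.1) (σ t) + dist (σ t) (σ s.2) + dist (σ s.2) (σ s.1) := by fun_prop
      have h2 := (h1.tendsto (t, t)).mono_left hle
      simp only [dist_self, add_zero] at h2
      filter_upwards [h2.eventually_lt_const
        (div_pos Real.two_pi_pos (Real.sqrt_pos.2 hK))] with s hs _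
      exact hs
    · exact Eventually.of_forall fun I hI => absurd hI hK
  filter_upwards [hmem, hper] with s h1 h2
  exact h _ (mem_range_self _) _ (mem_range_self _) _ (mem_range_self _)
    (hinj _ _ h1.1 (by linarith)) (hinj _ _ h1.2.1 (by linarith))
    (hinj _ _ (h1.1.trans h1.2.1) h1.2.2).symm fun hK => (h2 hK).le

theorem PolarRepresentation.globalOscGE (hr : PolarRepresentation σ F G φ) (hκ : 0 ≤ κ)
    (hp : CurvatureGE K G p κ) : GlobalOscGE K σ κ := by
  rintro _ ⟨r, rfl⟩ _ ⟨s, rfl⟩ _ ⟨t, rfl⟩ h1 h2 h3 -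
  rcases hκ.eq_or_lt with rfl | hκ'
  · exact oscCurvature_nonneg _ _ _
  · exact F.le_oscCurvature hr.radial hκ' hp h1 h2 h3 ⟨_, (hr.coords r).symm⟩ ⟨_, (hr.coords s).symm⟩
      ⟨_, (hr.coords t).symm⟩

theorem PolarRepresentation.globalArcChordGE (hr : PolarRepresentation σ F G φ) (hκ : 0 ≤ κ)
    (hp : CurvatureGE K G p κ) (hper : Function.Periodic p (2 * Real.pi))
    (hL : 0 < κ → √(K + κ ^ 2) * lengthIntegral K G p (2 * Real.pi) ≤ 2 * Real.pi) :
    GlobalArcChordGE K σ κ := by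
  intro a b hab hba h
  rcases hκ.eq_or_lt with rfl | hκ'
  · exact arcChordValue_nonneg _ _
  have h1 : φ b ≤ φ a + 2 * Real.pi := by
    rw [← hr.add_one]; exact hr.strictMono.monotone hba
  have hlen := hr.arcLength_eq hp.slope hab.le
  obtain ⟨h2, h3⟩ := F.chord_le hr.radial hκ' hp hper (hL hκ') (hr.strictMono.monotone hab.le) h1
    hlen.symm
  rw [← hr.coords, ← hr.coords] at h3
  obtain ⟨c, C, hc, -, hI⟩ := exists_lengthIntegral_bounds hr.radial hp.slope
  have hpos : 0 < arcLength σ a b := by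
    rw [hlen]
    exact (mul_pos hc (sub_pos.2 (hr.strictMono hab))).trans_le
      (hI _ _ (hr.strictMono.monotone hab.le)).1
  exact le_arcChordValue hr.radial.nonneg hpos (hr.dist_le_arcLength hab.le) h h2 h3

theorem IsClosedConvexCurve.tfae_curvatureGE (hK : 0 ≤ K) (hσ : IsClosedConvexCurve σ) (hκ : 0 ≤ κ) :
    List.TFAE [
      AlmostEverywhereOnCurve σ (ArcChordCurvatureGEAt K σ κ),
      AlmostEverywhereOnCurve σ (OscCurvatureGEAt K σ κ),
      GlobalArcChordGE K σ κ,
      GlobalOscGE K σ κ] := by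
  obtain ⟨Ω, hΩ, ⟨o, ho⟩, hc, hf⟩ := hσ.bounds
  obtain ⟨F, G, φ, hr, -, hhalf⟩ := hσ.exists_polarRepresentation hK hΩ hc hf ho
  obtain ⟨p, hp, hper⟩ := hr.radial.exists_periodic_slope
  have ha := hr.almostEverywhereOnCurve_iff_curvatureGE hp hper
    (P := ArcChordCurvatureGEAt K σ κ) fun t d hd => hr.arcChordCurvatureGEAt_iff hp hd
  have hb := hr.almostEverywhereOnCurve_iff_curvatureGE hp hper
    (P := OscCurvatureGEAt K σ κ) fun t d hd => hr.oscCurvatureGEAt_iff hp hd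
  have hL : CurvatureGE K G p κ → 0 < κ →
      √(K + κ ^ 2) * lengthIntegral K G p (2 * Real.pi) ≤ 2 * Real.pi := by
    intro hge hκ'
    rcases hK.eq_or_lt with rfl | hK'
    · rw [zero_add, Real.sqrt_sq hκ]
      exact lengthIntegral_le_of_zero hr.radial hκ' hge hper
    · obtain ⟨F', G', φ', hr', hle⟩ := exists_polarRepresentation_le hK' hκ' hσ hΩ hc hf hr hge
        (hhalf hK'.ne')
      obtain ⟨p', hp', hper'⟩ := hr'.radial.exists_periodic_slope
      -- The length of the curve does not depend on the centre, so it may be estimated in the frame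
      -- where the curve lies in the disc of curvature `κ`.
      rw [← hr.arcLength_one hp hper, hr'.arcLength_one hp' hper']
      exact lengthIntegral_le_of_le hK' hr'.radial hκ' hp' hper' hle
  rw [ha, hb]
  tfae_have 1 → 2 := id
  tfae_have 2 → 3 := fun h => hr.globalArcChordGE hκ h hper (hL h)
  tfae_have 3 → 4 := fun h => hr.globalOscGE hκ (hr.curvatureGE_of_globalArcChordGE hp h)
  tfae_have 4 → 1 := fun h => hr.curvatureGE_of_globalOscGE hσ hp h
  tfae_finish

end

theorem mainTheorem7 (K : ℝ) (hK : 0 ≤ K) (σ : ℝ → ModelPlane K) (hσ : IsClosedConvexCurve σ)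
    (κ : ℝ) (hκ : 0 ≤ κ) :
    List.TFAE [
      AlmostEverywhereOnCurve σ (ArcChordCurvatureGEAt K σ κ),
      AlmostEverywhereOnCurve σ (OscCurvatureGEAt K σ κ),
      GlobalArcChordGE K σ κ,
      GlobalOscGE K σ κ] :=
  hσ.tfae_curvatureGE hK hκ
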